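/- **Setting.** Let $K$ be a linearly ordered set of keys, extended by $-\infty$ and $+\infty$. Threads run under sequential consistency: a run is a finite sequence of atomic steps of arbitrarily many threads, interleaved arbitrarily. Nodes have an immutable field $\mathit{key}$, a Boolean $\mathit{rem}$, pointers $\mathit{left},\mathit{right},\mathit{parent},\mathit{succ},\mathit{pred}$, and two reentrant locks $\mathit{treeLock}$, $\mathit{succLock}$. Initially there are two nodes, $\mathit{min}$ (key $-\infty$) and $\mathit{max}=\mathit{root}$ (key $+\infty$), with $\mathit{min}.\mathit{succ}=\mathit{max}$ and $\mathit{max}.\mathit{pred}=\mathit{min}$; all other pointers are null, nothing is marked ($\mathit{rem}=\mathit{false}$), no lock is held. Dereferencing null blocks the thread. An operation keeps every lock it acquires until it terminates or restarts, and then releases all of them. **The (corrected) logical-ordering tree.** * $\mathrm{treeLocate}(k)$: $x,y\leftarrow \mathit{root}$; while $y\ne \mathrm{null}$ and $y.\mathit{key}\neq k$: $x\leftarrow y$ and $y\leftarrow x.\mathit{right}$ if $x.\mathit{key}<k$, else $y\leftarrow x.\mathit{left}$. Return $x$ if $y=\mathrm{null}$, else $y$. * $\mathrm{contains}(k)$: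 $x\leftarrow\mathrm{treeLocate}(k)$; while $x.\mathit{key}>k$: $x\leftarrow x.\mathit{pred}$; while $x.\mathit{key}<k$: $x\leftarrow x.\mathit{succ}$; if $x.\mathit{key}\ne k$ return false; read $x.\mathit{rem}$ and return its negation. * $\mathrm{insert}(k)$ and $\mathrm{delete}(k)$ begin with: $x\leftarrow \mathrm{treeLocate}(k)$; $p\leftarrow x.\mathit{pred}$ if $x.\mathit{key}>k$, else $p\leftarrow x$; lock $p.\mathit{succLock}$; $s\leftarrow p.\mathit{succ}$; if $k\notin(p.\mathit{key},s.\mathit{key}]$ or $p.\mathit{rem}$, restart. * $\mathrm{delete}(k)$ continues: if $s.\mathit{key}\ne k$ return false; lock $s.\mathit{succLock}$; $s.\mathit{rem}\leftarrow \mathrm{true}$; $\mathrm{removeFromTree}(s)$; $y\leftarrow s.\mathit{succ}$; $y.\mathit{pred}\leftarrow p$; $p.\mathit{succ}\leftarrow y$; return true. * $\mathrm{insert}(k)$ continues: if $s.\mathit{key}=k$ return false; create a node $n$ with key $k$; $n.\mathit{succ}\leftarrow s$; $n.\mathit{pred}\leftarrow p$; $p.\mathit{succ}\leftarrow n$; $s.\mathit{pred}\leftarrow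 n$; choose an arbitrary existing node $z$; $n.\mathit{parent}\leftarrow z$; lock $z.\mathit{treeLock}$; if $z.\mathit{key}<k$ then $z.\mathit{right}\leftarrow n$ else $z.\mathit{left}\leftarrow n$; return true. * $\mathrm{removeFromTree}(n)$: lock $n.\mathit{treeLock}$. If $n.\mathit{left}=\mathrm{null}$: $\mathrm{updateChild}(n,n.\mathit{right})$ and return; if $n.\mathit{right}=\mathrm{null}$: $\mathrm{updateChild}(n,n.\mathit{left})$ and return. Otherwise $s'\leftarrow n.\mathit{succ}$; lock $s'.\mathit{treeLock}$; $\mathrm{updateChild}(s',s'.\mathit{right})$; $s'.\mathit{left}\leftarrow n.\mathit{left}$; $s'.\mathit{right}\leftarrow n.\mathit{right}$; set $\mathit{parent}$ of $n.\mathit{left}$ and of $n.\mathit{right}$ to $s'$ (each if non-null); $\mathrm{updateChild}(n,s')$. * $\mathrm{updateChild}(m,c)$: read $q\leftarrow m.\mathit{parent}$ and lock $q.\mathit{treeLock}$; if $m.\mathit{parent}\neq q$, unlock $q$ (unless it was already held) and retry; if $q.\mathit{left}=m$ then $q.\mathit{left}\leftarrow c$ else $q.\mathit{right}\leftarrow c$;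 if $c\ne \mathrm{null}$ then $c.\mathit{parent}\leftarrow q$. * Rotations, by any thread outside its operations at any time, for any key $\kappa$ (including $\pm\infty$) and any $d,e\in\{\mathit{left},\mathit{right}\}$, with $e'$ the side opposite to $e$: $p\leftarrow \mathrm{treeLocate}(\kappa)$; lock $p.\mathit{treeLock}$; stop if $p.\mathit{rem}$; $y\leftarrow p.d$, stop if null, lock $y.\mathit{treeLock}$; $x\leftarrow y.e$, stop if null, lock $x.\mathit{treeLock}$; $p.d\leftarrow x$; $x.\mathit{parent}\leftarrow p$; $c\leftarrow x.e'$; $y.e\leftarrow c$; $c.\mathit{parent}\leftarrow y$ if $c\neq\mathrm{null}$; $x.e'\leftarrow y$; $y.\mathit{parent}\leftarrow x$. All locks are released at the end. **Reachability and traversals.** Locations are pairs $(o,\mathbf f)$ of a node and a field; $\sigma_t$ is the memory state at time $t$; a pointer to $o'$ has the value $(o',\mathit{key})$. * Plain reachability: $\mathrm{SReach}(x)$ holds in $\sigma$ if $x$ is reached from $\mathit{min}$ by following $\mathit{succ}$; a location $(o,\mathbf f)$ is plainly reachable if $o$ is. * $k$-reachability: $\mathrm{SReach}_k(\ell)$ holds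 in $\sigma$ if there are $\ell_0=(\mathit{min},\mathit{key}),\dots,\ell_n=\ell$ with $\mathrm{ext}_k(\ell_i,\sigma(\ell_i),\ell_{i+1})$ for all $i<n$, where $\mathrm{ext}_k$ consists of $((o,\mathit{key}),m,(o,\mathit{succ}))$ with $m<k$ and $((o,\mathit{succ}),(o',\mathit{key}),(o',\mathit{key}))$. Write $\mathrm{SReach}_k(x)$ for $\mathrm{SReach}_k(x,\mathit{key})$. * The relation $\mathrm{ext}$ consists of $((o,\mathit{key}),v,(o,\mathbf f))$ for any $v$ and $((o,\mathbf f),(o',\mathit{key}),(o',\mathit{key}))$, for $\mathbf f\in\{\mathit{left},\mathit{right},\mathit{pred}\}$. * A traversal through an extend relation $E$ is a sequence $(\ell_1,t_1),\dots,(\ell_n,t_n),\ell_{n+1}$ with $t_1\le\dots\le t_n$ and $E(\ell_i,\sigma_{t_i}(\ell_i),\ell_{i+1})$ for all $i\le n$. It is correct with respect to a reachability predicate $R$ and a base time $t_\star\le t_1$ if $R(\ell_1)$ holds in $\sigma_{t_\star}$ and, for every $i=1,\dots,n$, $R(\ell_{i+1})$ holds in $\sigma_u$ for some $u\in[t_\star,t_i]$.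 The abstract set of a state $\sigma$ is $\mathcal A(\sigma)=\{k\in K:\ \exists x.\ \mathrm{SReach}_k(x)\wedge x.\mathit{key}=k\wedge\neg x.\mathit{rem}\}$. **Theorem.** In every run of this algorithm from the initial state: 1. Every traversal through $\mathrm{ext}$ (tree and predecessor links) whose first location is plainly reachable at its base time is correct with respect to plain reachability. 2. For every $k$, every traversal through $\mathrm{ext}_k$ (successor links) whose first location is $k$-reachable at its base time is correct with respect to $k$-reachability. 3. If $\mathrm{SReach}_k(x)$ holds at time $t$, and $x.\mathit{key}=k$ and $x.\mathit{rem}=v$ hold at time $t'\ge t$, then $\mathrm{SReach}_k(x)\wedge x.\mathit{rem}=v$ holds at some time in $[t,t']$. 4. The successor list is sorted: if $\mathrm{SReach}(x)$ and $x.\mathit{succ}=y$, then $x.\mathit{key}<y.\mathit{key}$. Nodes are marked before they are unlinked: if $\mathrm{SReach}(x)$ holds at time $t$ and $\neg x.\mathit{rem}$ at time $t'\ge t$, then $\mathrm{SReach}(x)$ holds at time $t'$. 5. The following assertions hold whenever a thread is at the given point of an operation, where $\mathrm{Past}(P)$ means that $P$ held at some time between the invocation of the operation and now. * In the loop of $\mathrm{treeLocate}$: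 $\mathrm{Past}(\mathrm{SReach}(x))$, and $\mathrm{Past}(\mathrm{SReach}(y))$ if $y\ne\mathrm{null}$. In the first loop of $\mathrm{contains}$: $\mathrm{Past}(\mathrm{SReach}(x))$. In its second loop: $\mathrm{Past}(\mathrm{SReach}_k(x))$. When it returns false because $x.\mathit{key}\neq k$: $\mathrm{Past}(\mathrm{SReach}_k(x))\wedge x.\mathit{key}>k$. Before it reads $x.\mathit{rem}$: $\mathrm{Past}(\mathrm{SReach}_k(x))\wedge x.\mathit{key}=k$. After it has read the value $b$ from $x.\mathit{rem}$: $\mathrm{Past}(\mathrm{SReach}_k(x)\wedge x.\mathit{rem}=b)\wedge x.\mathit{key}=k$. * In $\mathrm{insert}$ and $\mathrm{delete}$ after the check that may restart: $\mathrm{SReach}_k(p)\wedge k\in(p.\mathit{key},s.\mathit{key}]\wedge\neg p.\mathit{rem}\wedge p.\mathit{succ}=s$. * In $\mathrm{delete}$, on returning false: $\mathrm{SReach}_k(s)\wedge s.\mathit{key}>k$; before $s.\mathit{rem}\leftarrow\mathrm{true}$: $\mathrm{SReach}_k(s)\wedge s.\mathit{key}=k\wedge\neg s.\mathit{rem}$;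 before $p.\mathit{succ}\leftarrow y$: $\mathrm{SReach}_k(p)\wedge p.\mathit{succ}=s\wedge s.\mathit{succ}=y\wedge s.\mathit{key}=k\wedge p.\mathit{key}<k<y.\mathit{key}\wedge\neg p.\mathit{rem}\wedge s.\mathit{rem}$. * In $\mathrm{insert}$, on returning false: $\mathrm{SReach}_k(s)\wedge s.\mathit{key}=k\wedge\neg s.\mathit{rem}$; before $p.\mathit{succ}\leftarrow n$: $\mathrm{SReach}_k(p)\wedge\neg p.\mathit{rem}\wedge p.\mathit{succ}=s\wedge k\in(p.\mathit{key},s.\mathit{key})\wedge n.\mathit{key}=k\wedge\neg n.\mathit{rem}\wedge n.\mathit{succ}=s$. 6. Every operation takes effect on the abstract set. If $\mathrm{contains}(k)$ returns true (false), then $k\in\mathcal A(\sigma)$ ($k\notin\mathcal A(\sigma)$) for some state $\sigma$ during the invocation; if $\mathrm{insert}(k)$ ($\mathrm{delete}(k)$) returns false, then $k\in\mathcal A(\sigma)$ ($k\notin\mathcal A(\sigma)$) for some $\sigma$ during the invocation. There is an injective map from the steps $(\sigma_m,\sigma_{m+1})$ with $\mathcal A(\sigma_m)\ne\mathcal A(\sigma_{m+1})$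 to update operations such that the step assigned to $\mathrm{insert}(k)$ ($\mathrm{delete}(k)$) occurs during that invocation, which does not return false, and satisfies $\mathcal A(\sigma_{m+1})=\mathcal A(\sigma_m)\cup\{k\}$ ($\mathcal A(\sigma_{m+1})=\mathcal A(\sigma_m)\setminus\{k\}$); every update that returns true is in its image. 7. The history of invocations and responses is linearizable with respect to the sequential set object, initially empty: all completed operations with their results and some pending operations can be arranged in a legal sequential execution of the set in which an operation that returned before another one was invoked never comes after it. -/

import Mathlib

/-! ## Memory: locations, values, states -/

namespace LOTree

/-- Object identifiers. -/
abbrev Node := ℕ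

abbrev Thread := ℕ

/-- Keys of nodes: the keys of set elements, with `⊥` for `-∞` and `⊤` for `+∞`. -/
abbrev Key (K : Type*) := WithBot (WithTop K)

/-- A key of a set element, as a key of a node. -/
def toKey {K : Type*} (k : K) : Key K := ((k : WithTop K) : WithBot (WithTop K))

inductive PtrField
  | left | right | parent | succ | pred
  deriving DecidableEq

inductive Field
  | key | rem | ptr (f : PtrField)

/-- A memory location is a pair of an object and a field name. -/
abbrev Loc := Node × Field

/-- Values of locations. The pointer `ptr (some o)` is the pointer to the location `(o, key)`, and
`ptr none` is `null`. -/
inductive Val (K : Type*)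
  | key (κ : Key K)
  | flag (b : Bool)
  | ptr (o : Option Node)

/-- The fields of one object, without its two locks. -/
structure NodeRec (K : Type*) where
  key : Key K
  rem : Bool
  ptr : PtrField → Option Node

/-- A memory state. -/
abbrev Mem (K : Type*) := Node → NodeRec K

/-- The state as a map from locations to values. -/
def readLoc {K : Type*} (σ : Mem K) : Loc → Val K
  | (o, .key) => .key (σ o).key
  | (o, .rem) => .flag (σ o).rem
  | (o, .ptr f) => .ptr ((σ o).ptr f)

/-! ## Traversals and their correctness

A run is given by the sequence `σ 0, σ 1, …` of its memory states. -/

/-- `ext ℓ v ℓ'`: after the traversal reads `v` from `ℓ`, it may read `ℓ'` next. -/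
abbrev Extend (K : Type*) := Loc → Val K → Loc → Prop

abbrev ReachPred (K : Type*) := Mem K → Loc → Prop

/-- The predicate `P` held in some state between time `t` and time `t'`, inclusive. -/
def Past {K : Type*} (σ : ℕ → Mem K) (t t' : ℕ) (P : Mem K → Prop) : Prop :=
  ∃ u, t ≤ u ∧ u ≤ t' ∧ P (σ u)

/-- The traversal `(ℓ 0, τ 0), …, (ℓ (n-1), τ (n-1)), ℓ n`: the location `ℓ i` is read at time
`τ i`, reaching `ℓ (i+1)`. -/
def IsTraversal {K : Type*} (σ : ℕ → Mem K) (ext : Extend K) (n : ℕ) (ℓ : ℕ → Loc)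
    (τ : ℕ → ℕ) : Prop :=
  (∀ i, i + 1 < n → τ i ≤ τ (i + 1)) ∧
  ∀ i, i < n → ext (ℓ i) (readLoc (σ (τ i)) (ℓ i)) (ℓ (i + 1))

/-- Every location of the traversal satisfied the reachability predicate at some time between the
base time `tb` and the time at which the traversal reached it. -/
def TraversalCorrect {K : Type*} (σ : ℕ → Mem K) (R : ReachPred K) (tb n : ℕ) (ℓ : ℕ → Loc)
    (τ : ℕ → ℕ) : Prop :=
  R (σ tb) (ℓ 0) ∧ ∀ i, i < n → Past σ tb (τ i) (fun s => R s (ℓ (i + 1)))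

/-- Every traversal through `ext` that takes place between a base time `tb` and time `N`, and whose
first location is reachable at the base time, is correct. -/
def TraversalsCorrect {K : Type*} (σ : ℕ → Mem K) (ext : Extend K) (R : ReachPred K)
    (N : ℕ) : Prop :=
  ∀ (tb n : ℕ) (ℓ : ℕ → Loc) (τ : ℕ → ℕ), tb ≤ N → IsTraversal σ ext n ℓ τ →
    (∀ i, i < n → tb ≤ τ i ∧ τ i ≤ N) → R (σ tb) (ℓ 0) → TraversalCorrect σ R tb n ℓ τ

/-! ## Reachability predicates of the logical-ordering tree -/

/-- The sentinel with key `-∞`. -/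
def minNode : Node := 0

/-- The sentinel with key `+∞`, which is also the root of the tree. -/
def maxNode : Node := 1

/-- The fields followed by the first part of the traversal. -/
def IsTreePredField (f : PtrField) : Prop := f = .left ∨ f = .right ∨ f = .pred

/-- Traversals over tree links and predecessor links. -/
inductive TreePredExt {K : Type*} : Loc → Val K → Loc → Prop
  | field (o : Node) (v : Val K) (f : PtrField) (hf : IsTreePredField f) :
      TreePredExt (o, .key) v (o, .ptr f)
  | follow (o o' : Node) (f : PtrField) (hf : IsTreePredField f) :
      TreePredExt (o, .ptr f) (.ptr (some o')) (o', .key)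

/-- Traversals over successor links searching for `k`. -/
inductive SuccExt {K : Type*} [LinearOrder K] (k : K) : Loc → Val K → Loc → Prop
  | field (o : Node) (m : Key K) (hm : m < toKey k) :
      SuccExt k (o, .key) (.key m) (o, .ptr .succ)
  | follow (o o' : Node) :
      SuccExt k (o, .ptr .succ) (.ptr (some o')) (o', .key)

/-- Steps along the successor list, irrespective of any key. -/
inductive ListExt {K : Type*} : Loc → Val K → Loc → Prop
  | field (o : Node) (v : Val K) : ListExt (o, .key) v (o, .ptr .succ)
  | follow (o o' : Node) : ListExt (o, .ptr .succ) (.ptr (some o')) (o', .key)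

/-- `x` is reachable from the sentinel `-∞` by following successor links. -/
def SReach {K : Type*} (σ : Mem K) (x : Node) : Prop :=
  Relation.ReflTransGen (fun ℓ ℓ' => ListExt ℓ (readLoc σ ℓ) ℓ')
    (minNode, .key) (x, .key)

/-- Plain reachability as a predicate of locations: all fields of a reachable object are
reachable. -/
def SReachLoc {K : Type*} : ReachPred K := fun σ ℓ => SReach σ ℓ.1

/-- `k`-reachability of a location. -/
def KReachLoc {K : Type*} [LinearOrder K] (k : K) : ReachPred K := fun σ ℓ =>
  Relation.ReflTransGen (fun ℓ₁ ℓ₂ => SuccExt k ℓ₁ (readLoc σ ℓ₁) ℓ₂) (minNode, .key) ℓ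

/-- `k`-reachability of an object. -/
def KReach {K : Type*} [LinearOrder K] (σ : Mem K) (k : K) (x : Node) : Prop :=
  KReachLoc k σ (x, .key)

/-- The abstraction function: the set that a memory state represents. -/
def absSet {K : Type*} [LinearOrder K] (σ : Mem K) : Set K :=
  {k | ∃ x, KReach σ k x ∧ (σ x).key = toKey k ∧ (σ x).rem = false}

/-! ## The algorithm

Every step of a thread performs at most one access to a mutable field or to a lock. (The key of a
node never changes after the node has been created; reads of keys are merged into adjacent steps.)
Dereferencing `null` blocks the thread forever. -/

inductive Upd
  | insert | delete

/-- The operations of the set. -/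
inductive SetOp (K : Type*)
  | contains (k : K)
  | update (u : Upd) (k : K)

inductive Side
  | left | right

def Side.fld : Side → PtrField
  | .left => .left
  | .right => .right

def Side.opp : Side → Side
  | .left => .right
  | .right => .left

/-- What `tree-locate` is called for. A rotation `rotate κ d e` locates a node `p` by an
arbitrary key `κ`; it then rotates the child `y` of `p` on side `d` with the child `x` of `y` on
side `e`. -/
inductive Goal (K : Type*)
  | op (o : SetOp K)
  | rotate (κ : Key K) (d e : Side)

def Goal.key {K : Type*} : Goal K → Key K
  | .op (.contains k) => toKey k
  | .op (.update _ k) => toKey k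
  | .rotate κ _ _ => κ

/-- Program points of `updateChild`, with the local variable `p` (its first argument). -/
inductive UCPoint
  /-- read `p ← m.parent` -/
  | readParent
  /-- `lock(p.treeLock)` -/
  | lockParent (p : Node)
  /-- check the precondition `m.parent = p`; `fresh` tells that the lock was not held before -/
  | validate (p : Node) (fresh : Bool)
  /-- `if (p.left = m)` -/
  | test (p : Node)
  /-- `p.left ← c` or `p.right ← c` -/
  | write (p : Node) (d : Side)
  /-- `if (c ≠ null) c.parent ← p` -/
  | setParent (p : Node)

/-- Program points of `removeFromTree(n)`. -/
inductive RmPoint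
  /-- `lock(n.treeLock)` -/
  | lockNode
  /-- `if (n.left = null)` -/
  | testLeft
  /-- `if (n.right = null)` -/
  | testRight
  /-- read the child on side `d`, the only child, before `updateChild(n.parent, n, n.d)` -/
  | oneChild (d : Side)
  /-- `s ← n.succ` -/
  | readSucc
  /-- `lock(s.treeLock)` -/
  | lockSucc (s : Node)
  /-- read `s.right` before `updateChild(s.parent, s, s.right)` -/
  | unlinkSucc (s : Node)
  /-- read `n.d` before `s.d ← n.d` -/
  | copyRead (s : Node) (d : Side)
  /-- `s.d ← v`, where `v` was read from `n.d` -/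
  | copyWrite (s : Node) (d : Side) (v : Option Node)
  /-- read `n.d` before `n.d.parent ← s` -/
  | adoptRead (s : Node) (d : Side)
  /-- `if (v ≠ null) v.parent ← s`, where `v` was read from `n.d` -/
  | adoptWrite (s : Node) (d : Side) (v : Option Node)
  /-- inside `updateChild(m.parent, m, c)`; afterwards `removeFromTree` continues by copying the
  children of `n` to `s` if `after = some s`, and returns if `after = none` -/
  | uc (m : Node) (c : Option Node) (after : Option Node) (at_ : UCPoint)

/-- Program points of a rotation with sides `d`, `e`, after `p` has been located. -/
inductive RotPoint
  | lockP (p : Node)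
  /-- `if (p.rem) return` -/
  | checkP (p : Node)
  /-- `y ← p.d; if (y = null) return` -/
  | readY (p : Node)
  | lockY (p y : Node)
  /-- `x ← y.e; if (x = null) return` -/
  | readX (p y : Node)
  | lockX (p y x : Node)
  /-- `p.d ← x` -/
  | linkX (p y x : Node)
  /-- `x.parent ← p` -/
  | parentX (p y x : Node)
  /-- `c ← x.e'`, where `e'` is the side opposite to `e` -/
  | readC (y x : Node)
  /-- `y.e ← c` -/
  | linkC (y x : Node) (c : Option Node)
  /-- `if (c ≠ null) c.parent ← y` -/
  | parentC (y x : Node) (c : Option Node)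
  /-- `x.e' ← y` -/
  | linkY (y x : Node)
  /-- `y.parent ← x` -/
  | parentY (y x : Node)
  /-- release all locks -/
  | unlock

/-- Program points of a thread, with the values of its local variables. -/
inductive PC (K : Type*)
  /-- outside every operation -/
  | idle
  /-- `tree-locate`: head of the loop `while (y ≠ null ∧ y.key ≠ k)` -/
  | locate (g : Goal K) (x : Node) (y : Option Node)
  /-- `contains`: head of the loop `while (x.key > k) x ← x.pred` -/
  | walkPred (k : K) (x : Node)
  /-- `contains`: head of the loop `while (x.key < k) x ← x.succ` -/
  | walkSucc (k : K) (x : Node)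
  /-- `contains`: `return false` because `x.key ≠ k` -/
  | missing (k : K) (x : Node)
  /-- `contains`: `if (x.rem)` -/
  | readRem (k : K) (x : Node)
  /-- `contains`: return after `b` was read from `x.rem` -/
  | gotRem (k : K) (x : Node) (b : Bool)
  /-- updates: `p ← (x.key > k ? x.pred : x)` -/
  | choosePred (u : Upd) (k : K) (x : Node)
  /-- updates: `lock(p.succLock)` -/
  | lockPred (u : Upd) (k : K) (p : Node)
  /-- updates: `s ← p.succ` -/
  | readSucc (u : Upd) (k : K) (p : Node)
  /-- updates: `if (k ∉ (p.key, s.key] ∨ p.rem) restart` -/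
  | check (u : Upd) (k : K) (p s : Node)
  /-- updates: release all locks and restart -/
  | restart (u : Upd) (k : K)
  /-- updates: the check succeeded; next, compare `s.key` with `k` -/
  | inRange (u : Upd) (k : K) (p s : Node)
  /-- updates: `return false` -/
  | failed (u : Upd) (k : K) (p s : Node)
  /-- `delete`: `lock(s.succLock)` -/
  | delLock (k : K) (p s : Node)
  /-- `delete`: `s.rem ← true` -/
  | delMark (k : K) (p s : Node)
  /-- `delete`: inside `removeFromTree(s)` -/
  | delTree (k : K) (p s : Node) (at_ : RmPoint)
  /-- `delete`: `y ← s.succ` -/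
  | delRead (k : K) (p s : Node)
  /-- `delete`: `y.pred ← p` -/
  | delPred (k : K) (p s y : Node)
  /-- `delete`: `p.succ ← y` -/
  | delSucc (k : K) (p s y : Node)
  /-- `insert`: `n ← new N(k)` -/
  | insNew (k : K) (p s : Node)
  /-- `insert`: `n.succ ← s` -/
  | insNewSucc (k : K) (p s n : Node)
  /-- `insert`: `n.pred ← p` -/
  | insNewPred (k : K) (p s n : Node)
  /-- `insert`: `p.succ ← n` -/
  | insSucc (k : K) (p s n : Node)
  /-- `insert`: `s.pred ← n` -/
  | insPred (k : K) (p s n : Node)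
  /-- `insert`: `z ← chooseParent(p, s, n)` -/
  | insChoose (k : K) (p s n : Node)
  /-- `insert`: `n.parent ← z` -/
  | insParent (k : K) (n z : Node)
  /-- `insert`: `lock(z.treeLock)` -/
  | insLock (k : K) (n z : Node)
  /-- `insert`: `if (z.key < k) z.right ← n else z.left ← n` -/
  | insChild (k : K) (n z : Node)
  /-- updates: release all locks before returning `b` -/
  | unlock (b : Bool)
  /-- updates: return `b` -/
  | done (b : Bool)
  /-- inside a rotation -/
  | rot (d e : Side) (at_ : RotPoint)

/-- The memory shared by the threads. The node identifiers below `next` have been allocated. A lock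
is free (`none`) or held by a thread. -/
structure Shared (K : Type*) where
  mem : Mem K
  next : ℕ
  succLock : Node → Option Thread
  treeLock : Node → Option Thread

def setPtr {K : Type*} (h : Shared K) (o : Node) (f : PtrField) (v : Option Node) : Shared K :=
  { h with
    mem := Function.update h.mem o { h.mem o with ptr := Function.update (h.mem o).ptr f v } }

/-- `if (o ≠ null) o.f ← v` -/
def setPtrIf {K : Type*} (h : Shared K) (o : Option Node) (f : PtrField) (v : Option Node) :
    Shared K :=
  match o with
  | none => h
  | some o => setPtr h o f v

def setRem {K : Type*} (h : Shared K) (o : Node) (b : Bool) : Shared K :=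
  { h with mem := Function.update h.mem o { h.mem o with rem := b } }

/-- A node that is not marked and all of whose links are `null`. -/
def blankNode {K : Type*} (κ : Key K) : NodeRec K := ⟨κ, false, fun _ => none⟩

/-- `new N(k)`; the new node is `h.next`. -/
def alloc {K : Type*} (h : Shared K) (κ : Key K) : Shared K :=
  { h with mem := Function.update h.mem h.next (blankNode κ), next := h.next + 1 }

/-- Locks are reentrant: a thread can acquire a lock that is free or that it holds. -/
def CanLock (L : Node → Option Thread) (o : Node) (t : Thread) : Prop :=
  L o = none ∨ L o = some t

def lockSuccOf {K : Type*} (h : Shared K) (o : Node) (t : Thread) : Shared K :=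
  { h with succLock := Function.update h.succLock o (some t) }

def lockTreeOf {K : Type*} (h : Shared K) (o : Node) (t : Thread) : Shared K :=
  { h with treeLock := Function.update h.treeLock o (some t) }

def unlockTreeOf {K : Type*} (h : Shared K) (o : Node) : Shared K :=
  { h with treeLock := Function.update h.treeLock o none }

/-- Release all locks that `t` holds. -/
def releaseAll {K : Type*} (h : Shared K) (t : Thread) : Shared K :=
  { h with
    succLock := fun o => if h.succLock o = some t then none else h.succLock o
    treeLock := fun o => if h.treeLock o = some t then none else h.treeLock o }

/-- The program point at which `removeFromTree` continues after `updateChild`; `none` if it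
returns. -/
def afterUC : Option Node → Option RmPoint
  | none => none
  | some s => some (.copyRead s .left)

/-- Steps of `updateChild(m.parent, m, c)`, performed by thread `t` that holds the `treeLock` of
`m`. The first argument `p` is read from `m.parent`, and if the precondition `m.parent = p` fails
once `p` is locked, then `p` is unlocked and the argument is read again. A step to `none` is the
return. -/
inductive UCStep {K : Type*} (t : Thread) (m : Node) (c : Option Node) :
    Shared K → UCPoint → Shared K → Option UCPoint → Prop
  | readParent (h : Shared K) (p : Node) (hp : (h.mem m).ptr .parent = some p) :
      UCStep t m c h .readParent h (some (.lockParent p))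
  | lockFresh (h : Shared K) (p : Node) (hl : h.treeLock p = none) :
      UCStep t m c h (.lockParent p) (lockTreeOf h p t) (some (.validate p true))
  | lockHeld (h : Shared K) (p : Node) (hl : h.treeLock p = some t) :
      UCStep t m c h (.lockParent p) h (some (.validate p false))
  | valid (h : Shared K) (p : Node) (b : Bool) (hp : (h.mem m).ptr .parent = some p) :
      UCStep t m c h (.validate p b) h (some (.test p))
  | invalid (h : Shared K) (p : Node) (b : Bool) (hp : (h.mem m).ptr .parent ≠ some p) :
      UCStep t m c h (.validate p b) (if b then unlockTreeOf h p else h) (some .readParent)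
  | testLeft (h : Shared K) (p : Node) (hp : (h.mem p).ptr .left = some m) :
      UCStep t m c h (.test p) h (some (.write p .left))
  | testRight (h : Shared K) (p : Node) (hp : (h.mem p).ptr .left ≠ some m) :
      UCStep t m c h (.test p) h (some (.write p .right))
  | write (h : Shared K) (p : Node) (d : Side) :
      UCStep t m c h (.write p d) (setPtr h p d.fld c) (some (.setParent p))
  | setParent (h : Shared K) (p : Node) :
      UCStep t m c h (.setParent p) (setPtrIf h c .parent (some p)) none

/-- Steps of `removeFromTree(n)`, performed by thread `t`. A step to `none` is the return. -/
inductive RmStep {K : Type*} (t : Thread) (n : Node) :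
    Shared K → RmPoint → Shared K → Option RmPoint → Prop
  | lockNode (h : Shared K) (hl : CanLock h.treeLock n t) :
      RmStep t n h .lockNode (lockTreeOf h n t) (some .testLeft)
  | leftNull (h : Shared K) (hc : (h.mem n).ptr .left = none) :
      RmStep t n h .testLeft h (some (.oneChild .right))
  | leftSome (h : Shared K) (hc : (h.mem n).ptr .left ≠ none) :
      RmStep t n h .testLeft h (some .testRight)
  | rightNull (h : Shared K) (hc : (h.mem n).ptr .right = none) :
      RmStep t n h .testRight h (some (.oneChild .left))
  | rightSome (h : Shared K) (hc : (h.mem n).ptr .right ≠ none) :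
      RmStep t n h .testRight h (some .readSucc)
  | oneChild (h : Shared K) (d : Side) :
      RmStep t n h (.oneChild d) h (some (.uc n ((h.mem n).ptr d.fld) none .readParent))
  | readSucc (h : Shared K) (s : Node) (hs : (h.mem n).ptr .succ = some s) :
      RmStep t n h .readSucc h (some (.lockSucc s))
  | lockSucc (h : Shared K) (s : Node) (hl : CanLock h.treeLock s t) :
      RmStep t n h (.lockSucc s) (lockTreeOf h s t) (some (.unlinkSucc s))
  | unlinkSucc (h : Shared K) (s : Node) :
      RmStep t n h (.unlinkSucc s) h (some (.uc s ((h.mem s).ptr .right) (some s) .readParent))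
  | copyRead (h : Shared K) (s : Node) (d : Side) :
      RmStep t n h (.copyRead s d) h (some (.copyWrite s d ((h.mem n).ptr d.fld)))
  | copyLeft (h : Shared K) (s : Node) (v : Option Node) :
      RmStep t n h (.copyWrite s .left v) (setPtr h s .left v) (some (.copyRead s .right))
  | copyRight (h : Shared K) (s : Node) (v : Option Node) :
      RmStep t n h (.copyWrite s .right v) (setPtr h s .right v) (some (.adoptRead s .left))
  | adoptRead (h : Shared K) (s : Node) (d : Side) :
      RmStep t n h (.adoptRead s d) h (some (.adoptWrite s d ((h.mem n).ptr d.fld)))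
  | adoptLeft (h : Shared K) (s : Node) (v : Option Node) :
      RmStep t n h (.adoptWrite s .left v) (setPtrIf h v .parent (some s))
        (some (.adoptRead s .right))
  | adoptRight (h : Shared K) (s : Node) (v : Option Node) :
      RmStep t n h (.adoptWrite s .right v) (setPtrIf h v .parent (some s))
        (some (.uc n (some s) none .readParent))
  | ucStep (h h' : Shared K) (m : Node) (c after : Option Node) (q q' : UCPoint)
      (hq : UCStep t m c h q h' (some q')) :
      RmStep t n h (.uc m c after q) h' (some (.uc m c after q'))
  | ucReturn (h h' : Shared K) (m : Node) (c after : Option Node) (q : UCPoint)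
      (hq : UCStep t m c h q h' none) :
      RmStep t n h (.uc m c after q) h' (afterUC after)

/-- Steps of a rotation with sides `d`, `e`, performed by thread `t`. A step to `none` is the
return. -/
inductive RotStep {K : Type*} (t : Thread) (d e : Side) :
    Shared K → RotPoint → Shared K → Option RotPoint → Prop
  | lockP (h : Shared K) (p : Node) (hl : CanLock h.treeLock p t) :
      RotStep t d e h (.lockP p) (lockTreeOf h p t) (some (.checkP p))
  | removed (h : Shared K) (p : Node) (hp : (h.mem p).rem = true) :
      RotStep t d e h (.checkP p) h (some .unlock)
  | present (h : Shared K) (p : Node) (hp : (h.mem p).rem = false) :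
      RotStep t d e h (.checkP p) h (some (.readY p))
  | noY (h : Shared K) (p : Node) (hy : (h.mem p).ptr d.fld = none) :
      RotStep t d e h (.readY p) h (some .unlock)
  | readY (h : Shared K) (p y : Node) (hy : (h.mem p).ptr d.fld = some y) :
      RotStep t d e h (.readY p) h (some (.lockY p y))
  | lockY (h : Shared K) (p y : Node) (hl : CanLock h.treeLock y t) :
      RotStep t d e h (.lockY p y) (lockTreeOf h y t) (some (.readX p y))
  | noX (h : Shared K) (p y : Node) (hx : (h.mem y).ptr e.fld = none) :
      RotStep t d e h (.readX p y) h (some .unlock)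
  | readX (h : Shared K) (p y x : Node) (hx : (h.mem y).ptr e.fld = some x) :
      RotStep t d e h (.readX p y) h (some (.lockX p y x))
  | lockX (h : Shared K) (p y x : Node) (hl : CanLock h.treeLock x t) :
      RotStep t d e h (.lockX p y x) (lockTreeOf h x t) (some (.linkX p y x))
  | linkX (h : Shared K) (p y x : Node) :
      RotStep t d e h (.linkX p y x) (setPtr h p d.fld (some x)) (some (.parentX p y x))
  | parentX (h : Shared K) (p y x : Node) :
      RotStep t d e h (.parentX p y x) (setPtr h x .parent (some p)) (some (.readC y x))
  | readC (h : Shared K) (y x : Node) :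
      RotStep t d e h (.readC y x) h (some (.linkC y x ((h.mem x).ptr e.opp.fld)))
  | linkC (h : Shared K) (y x : Node) (c : Option Node) :
      RotStep t d e h (.linkC y x c) (setPtr h y e.fld c) (some (.parentC y x c))
  | parentC (h : Shared K) (y x : Node) (c : Option Node) :
      RotStep t d e h (.parentC y x c) (setPtrIf h c .parent (some y)) (some (.linkY y x))
  | linkY (h : Shared K) (y x : Node) :
      RotStep t d e h (.linkY y x) (setPtr h x e.opp.fld (some y)) (some (.parentY y x))
  | parentY (h : Shared K) (y x : Node) :
      RotStep t d e h (.parentY y x) (setPtr h y .parent (some x)) (some .unlock)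
  | unlock (h : Shared K) :
      RotStep t d e h .unlock (releaseAll h t) none

/-- Events of a run: invocations, responses, and internal steps. -/
inductive Label (K : Type*)
  | call (t : Thread) (o : SetOp K)
  | ret (t : Thread) (b : Bool)
  | internal

/-- Where a thread continues when `tree-locate` returns `x`. -/
def afterLocate {K : Type*} (x : Node) : Goal K → PC K
  | .op (.contains k) => .walkPred k x
  | .op (.update u k) => .choosePred u k x
  | .rotate _ d e => .rot d e (.lockP x)

/-- The side of `z` to which a new node with key `κ` is linked: right if `z.key < κ`. -/
def childSide {K : Type*} [LinearOrder K] (z κ : Key K) : Side :=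
  if z < κ then .right else .left

/-- Steps of thread `t`. -/
inductive TStep {K : Type*} [LinearOrder K] (t : Thread) :
    Shared K → PC K → Label K → Shared K → PC K → Prop
  | call (h : Shared K) (o : SetOp K) :
      TStep t h .idle (.call t o) h (.locate (.op o) maxNode (some maxNode))
  | startRotate (h : Shared K) (κ : Key K) (d e : Side) :
      TStep t h .idle .internal h (.locate (.rotate κ d e) maxNode (some maxNode))
  -- tree-locate
  | locateNull (h : Shared K) (g : Goal K) (x : Node) :
      TStep t h (.locate g x none) .internal h (afterLocate x g)
  | locateFound (h : Shared K) (g : Goal K) (x y : Node) (hk : (h.mem y).key = g.key) :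
      TStep t h (.locate g x (some y)) .internal h (afterLocate y g)
  | locateRight (h : Shared K) (g : Goal K) (x y : Node) (hk : (h.mem y).key < g.key) :
      TStep t h (.locate g x (some y)) .internal h (.locate g y ((h.mem y).ptr .right))
  | locateLeft (h : Shared K) (g : Goal K) (x y : Node) (hk : g.key < (h.mem y).key) :
      TStep t h (.locate g x (some y)) .internal h (.locate g y ((h.mem y).ptr .left))
  -- contains
  | walkPred (h : Shared K) (k : K) (x x' : Node) (hk : toKey k < (h.mem x).key)
      (hx : (h.mem x).ptr .pred = some x') :
      TStep t h (.walkPred k x) .internal h (.walkPred k x')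
  | walkPredEnd (h : Shared K) (k : K) (x : Node) (hk : (h.mem x).key ≤ toKey k) :
      TStep t h (.walkPred k x) .internal h (.walkSucc k x)
  | walkSucc (h : Shared K) (k : K) (x x' : Node) (hk : (h.mem x).key < toKey k)
      (hx : (h.mem x).ptr .succ = some x') :
      TStep t h (.walkSucc k x) .internal h (.walkSucc k x')
  | walkSuccMiss (h : Shared K) (k : K) (x : Node) (hk : toKey k < (h.mem x).key) :
      TStep t h (.walkSucc k x) .internal h (.missing k x)
  | walkSuccHit (h : Shared K) (k : K) (x : Node) (hk : (h.mem x).key = toKey k) :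
      TStep t h (.walkSucc k x) .internal h (.readRem k x)
  | missing (h : Shared K) (k : K) (x : Node) :
      TStep t h (.missing k x) (.ret t false) h .idle
  | readRem (h : Shared K) (k : K) (x : Node) :
      TStep t h (.readRem k x) .internal h (.gotRem k x (h.mem x).rem)
  | gotRem (h : Shared K) (k : K) (x : Node) (b : Bool) :
      TStep t h (.gotRem k x b) (.ret t (!b)) h .idle
  -- common part of insert and delete
  | choosePred (h : Shared K) (u : Upd) (k : K) (x p : Node) (hk : toKey k < (h.mem x).key)
      (hp : (h.mem x).ptr .pred = some p) :
      TStep t h (.choosePred u k x) .internal h (.lockPred u k p)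
  | chooseSelf (h : Shared K) (u : Upd) (k : K) (x : Node) (hk : (h.mem x).key ≤ toKey k) :
      TStep t h (.choosePred u k x) .internal h (.lockPred u k x)
  | lockPred (h : Shared K) (u : Upd) (k : K) (p : Node) (hl : CanLock h.succLock p t) :
      TStep t h (.lockPred u k p) .internal (lockSuccOf h p t) (.readSucc u k p)
  | readSucc (h : Shared K) (u : Upd) (k : K) (p s : Node)
      (hs : (h.mem p).ptr .succ = some s) :
      TStep t h (.readSucc u k p) .internal h (.check u k p s)
  | checkFail (h : Shared K) (u : Upd) (k : K) (p s : Node)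
      (hc : ¬ ((h.mem p).key < toKey k ∧ toKey k ≤ (h.mem s).key) ∨ (h.mem p).rem = true) :
      TStep t h (.check u k p s) .internal h (.restart u k)
  | checkOk (h : Shared K) (u : Upd) (k : K) (p s : Node)
      (hc : ((h.mem p).key < toKey k ∧ toKey k ≤ (h.mem s).key) ∧ (h.mem p).rem = false) :
      TStep t h (.check u k p s) .internal h (.inRange u k p s)
  | restart (h : Shared K) (u : Upd) (k : K) :
      TStep t h (.restart u k) .internal (releaseAll h t)
        (.locate (.op (.update u k)) maxNode (some maxNode))
  -- delete
  | delAbsent (h : Shared K) (k : K) (p s : Node) (hk : (h.mem s).key ≠ toKey k) :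
      TStep t h (.inRange .delete k p s) .internal h (.failed .delete k p s)
  | delPresent (h : Shared K) (k : K) (p s : Node) (hk : (h.mem s).key = toKey k) :
      TStep t h (.inRange .delete k p s) .internal h (.delLock k p s)
  | delLock (h : Shared K) (k : K) (p s : Node) (hl : CanLock h.succLock s t) :
      TStep t h (.delLock k p s) .internal (lockSuccOf h s t) (.delMark k p s)
  | delMark (h : Shared K) (k : K) (p s : Node) :
      TStep t h (.delMark k p s) .internal (setRem h s true) (.delTree k p s .lockNode)
  | delTree (h h' : Shared K) (k : K) (p s : Node) (q q' : RmPoint)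
      (hq : RmStep t s h q h' (some q')) :
      TStep t h (.delTree k p s q) .internal h' (.delTree k p s q')
  | delTreeReturn (h h' : Shared K) (k : K) (p s : Node) (q : RmPoint)
      (hq : RmStep t s h q h' none) :
      TStep t h (.delTree k p s q) .internal h' (.delRead k p s)
  | delRead (h : Shared K) (k : K) (p s y : Node) (hy : (h.mem s).ptr .succ = some y) :
      TStep t h (.delRead k p s) .internal h (.delPred k p s y)
  | delPred (h : Shared K) (k : K) (p s y : Node) :
      TStep t h (.delPred k p s y) .internal (setPtr h y .pred (some p)) (.delSucc k p s y)
  | delSucc (h : Shared K) (k : K) (p s y : Node) :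
      TStep t h (.delSucc k p s y) .internal (setPtr h p .succ (some y)) (.unlock true)
  -- insert
  | insPresent (h : Shared K) (k : K) (p s : Node) (hk : (h.mem s).key = toKey k) :
      TStep t h (.inRange .insert k p s) .internal h (.failed .insert k p s)
  | insAbsent (h : Shared K) (k : K) (p s : Node) (hk : (h.mem s).key ≠ toKey k) :
      TStep t h (.inRange .insert k p s) .internal h (.insNew k p s)
  | insNew (h : Shared K) (k : K) (p s : Node) :
      TStep t h (.insNew k p s) .internal (alloc h (toKey k)) (.insNewSucc k p s h.next)
  | insNewSucc (h : Shared K) (k : K) (p s n : Node) :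
      TStep t h (.insNewSucc k p s n) .internal (setPtr h n .succ (some s)) (.insNewPred k p s n)
  | insNewPred (h : Shared K) (k : K) (p s n : Node) :
      TStep t h (.insNewPred k p s n) .internal (setPtr h n .pred (some p)) (.insSucc k p s n)
  | insSucc (h : Shared K) (k : K) (p s n : Node) :
      TStep t h (.insSucc k p s n) .internal (setPtr h p .succ (some n)) (.insPred k p s n)
  | insPred (h : Shared K) (k : K) (p s n : Node) :
      TStep t h (.insPred k p s n) .internal (setPtr h s .pred (some n)) (.insChoose k p s n)
  -- the result of `chooseParent` is arbitrary
  | insChoose (h : Shared K) (k : K) (p s n z : Node) (hz : z < h.next) :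
      TStep t h (.insChoose k p s n) .internal h (.insParent k n z)
  | insParent (h : Shared K) (k : K) (n z : Node) :
      TStep t h (.insParent k n z) .internal (setPtr h n .parent (some z)) (.insLock k n z)
  | insLock (h : Shared K) (k : K) (n z : Node) (hl : CanLock h.treeLock z t) :
      TStep t h (.insLock k n z) .internal (lockTreeOf h z t) (.insChild k n z)
  | insChild (h : Shared K) (k : K) (n z : Node) :
      TStep t h (.insChild k n z) .internal
        (setPtr h z (childSide (h.mem z).key (toKey k)).fld (some n)) (.unlock true)
  -- end of insert and delete
  | failed (h : Shared K) (u : Upd) (k : K) (p s : Node) :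
      TStep t h (.failed u k p s) .internal h (.unlock false)
  | unlock (h : Shared K) (b : Bool) :
      TStep t h (.unlock b) .internal (releaseAll h t) (.done b)
  | done (h : Shared K) (b : Bool) :
      TStep t h (.done b) (.ret t b) h .idle
  -- rotations
  | rot (h h' : Shared K) (d e : Side) (q q' : RotPoint)
      (hq : RotStep t d e h q h' (some q')) :
      TStep t h (.rot d e q) .internal h' (.rot d e q')
  | rotReturn (h h' : Shared K) (d e : Side) (q : RotPoint)
      (hq : RotStep t d e h q h' none) :
      TStep t h (.rot d e q) .internal h' .idle

structure Config (K : Type*) where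
  shared : Shared K
  pc : Thread → PC K

/-- Initially there are only the two sentinels, linked to each other; no lock is held. -/
def initMem (K : Type*) : Mem K := fun o =>
  if o = minNode then { blankNode ⊥ with ptr := fun f => if f = .succ then some maxNode else none }
  else if o = maxNode then
    { blankNode ⊤ with ptr := fun f => if f = .pred then some minNode else none }
  else blankNode ⊥

def initConfig (K : Type*) : Config K where
  shared := ⟨initMem K, 2, fun _ => none, fun _ => none⟩
  pc := fun _ => .idle

/-- One thread makes one step. -/
def Step {K : Type*} [LinearOrder K] (c : Config K) (l : Label K) (c' : Config K) : Prop :=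
  ∃ (t : Thread) (q : PC K), TStep t c.shared (c.pc t) l c'.shared q ∧
    c'.pc = Function.update c.pc t q

/-- `st 0, …, st N` is a run of the algorithm from the initial state, in which the step from `st i`
to `st (i+1)` has the label `lab i`. -/
def IsRun {K : Type*} [LinearOrder K] (st : ℕ → Config K) (lab : ℕ → Label K) (N : ℕ) : Prop :=
  st 0 = initConfig K ∧ ∀ i, i < N → Step (st i) (lab i) (st (i + 1))

/-! ## Assertions in the code -/

/-- The assertions that annotate the code, where `σ` is the current state and `past P` says that
`P` held at some time between the invocation of the current operation and now. -/
def Assertion {K : Type*} [LinearOrder K] (σ : Mem K) (past : (Mem K → Prop) → Prop) :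
    PC K → Prop
  | .locate _ x y =>
      past (fun s => SReach s x) ∧ ∀ y', y = some y' → past (fun s => SReach s y')
  | .walkPred _ x => past (fun s => SReach s x)
  | .walkSucc k x => past (fun s => KReach s k x)
  | .missing k x => past (fun s => KReach s k x) ∧ toKey k < (σ x).key
  | .readRem k x => past (fun s => KReach s k x) ∧ (σ x).key = toKey k
  | .gotRem k x b => past (fun s => KReach s k x ∧ (s x).rem = b) ∧ (σ x).key = toKey k
  | .inRange _ k p s =>
      KReach σ k p ∧ (σ p).key < toKey k ∧ toKey k ≤ (σ s).key ∧ (σ p).rem = false ∧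
        (σ p).ptr .succ = some s
  | .failed .delete k _ s => KReach σ k s ∧ toKey k < (σ s).key
  | .failed .insert k _ s => KReach σ k s ∧ (σ s).key = toKey k ∧ (σ s).rem = false
  | .delMark k _ s => KReach σ k s ∧ (σ s).key = toKey k ∧ (σ s).rem = false
  | .delSucc k p s y =>
      KReach σ k p ∧ (σ p).ptr .succ = some s ∧ (σ s).ptr .succ = some y ∧
        (σ s).key = toKey k ∧ (σ p).key < toKey k ∧ toKey k < (σ y).key ∧
        (σ p).rem = false ∧ (σ s).rem = true
  | .insSucc k p s n =>
      KReach σ k p ∧ (σ p).rem = false ∧ (σ p).ptr .succ = some s ∧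
        (σ p).key < toKey k ∧ toKey k < (σ s).key ∧
        (σ n).key = toKey k ∧ (σ n).rem = false ∧ (σ n).ptr .succ = some s
  | _ => True

/-- The assertions hold: whenever an operation invoked by thread `t` at step `i` has not returned
before time `m`, the assertion at the program point of `t` at time `m` is true. -/
def AssertionsHold {K : Type*} [LinearOrder K] (st : ℕ → Config K) (lab : ℕ → Label K)
    (N : ℕ) : Prop :=
  ∀ (t : Thread) (o : SetOp K) (i m : ℕ), lab i = .call t o → i < m → m ≤ N →
    (∀ j, i < j → j < m → ∀ b, lab j ≠ .ret t b) →
    Assertion (st m).shared.mem (Past (fun r => (st r).shared.mem) (i + 1) m) ((st m).pc t)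

/-! ## Linearizability -/

/-- The operation invoked at step `i` returns `b` at step `j`. -/
def Returns {K : Type*} (lab : ℕ → Label K) (i j : ℕ) (b : Bool) : Prop :=
  ∃ (t : Thread) (o : SetOp K), lab i = .call t o ∧ i < j ∧ lab j = .ret t b ∧
    ∀ m, i < m → m < j → ∀ b', lab m ≠ .ret t b'

/-- The effect of a successful update on a set. -/
def Upd.apply {K : Type*} (u : Upd) (k : K) (S : Set K) : Set K :=
  match u with
  | .insert => S ∪ {k}
  | .delete => S \ {k}

/-- The set specification: operation `o` in state `S` returns `b` and leads to state `S'`. -/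
def SeqSpec {K : Type*} (S : Set K) (o : SetOp K) (b : Bool) (S' : Set K) : Prop :=
  match o with
  | .contains k => (b = true ↔ k ∈ S) ∧ S' = S
  | .update .insert k => (b = true ↔ k ∉ S) ∧ S' = S ∪ {k}
  | .update .delete k => (b = true ↔ k ∈ S) ∧ S' = S \ {k}

/-- A sequence of operations (given by the steps at which they are invoked) with results is a
sequential execution of the set from state `S`. -/
def SeqLegal {K : Type*} (lab : ℕ → Label K) : Set K → List (ℕ × Bool) → Prop
  | _, [] => True
  | S, (i, b) :: L => ∃ (t : Thread) (o : SetOp K) (S' : Set K),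
      lab i = .call t o ∧ SeqSpec S o b S' ∧ SeqLegal lab S' L

/-- The history of the first `N` steps is linearizable with respect to an initially empty set: all
operations that have returned, with their results, and some of the pending ones, can be arranged in
a legal sequence in which an operation that returned before the invocation of another one does not
come after it. -/
def Linearizable {K : Type*} (lab : ℕ → Label K) (N : ℕ) : Prop :=
  ∃ L : List (ℕ × Bool),
    (L.map Prod.fst).Nodup ∧
    (∀ a ∈ L, a.1 < N) ∧
    (∀ i j b, j < N → Returns lab i j b → (i, b) ∈ L) ∧
    L.Pairwise (fun a a' => ¬ ∃ j b, Returns lab a'.1 j b ∧ j < a.1) ∧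
    SeqLegal lab ∅ L

/-- The step from time `m` to time `m+1` changes the abstract set. -/
def Changes {K : Type*} [LinearOrder K] (σ : ℕ → Mem K) (m : ℕ) : Prop :=
  absSet (σ m) ≠ absSet (σ (m + 1))

/-- The step from time `m` to time `m+1` is a decisive transition of the operation invoked at step
`i`, which is an update that has not returned before that and does not fail. -/
def Decisive {K : Type*} [LinearOrder K] (σ : ℕ → Mem K) (lab : ℕ → Label K) (N i m : ℕ) : Prop :=
  ∃ (t : Thread) (u : Upd) (k : K), lab i = .call t (.update u k) ∧ i < m ∧
    (∀ j b, j < N → Returns lab i j b → m < j ∧ b = true) ∧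
    absSet (σ (m + 1)) = u.apply k (absSet (σ m)) ∧ Changes σ m

/-- Every operation takes effect on the abstract set during its execution. -/
def TakesEffect {K : Type*} [LinearOrder K] (σ : ℕ → Mem K) (lab : ℕ → Label K) (N : ℕ) : Prop :=
  -- contains
  (∀ i j t k b, j < N → lab i = .call t (.contains k) → Returns lab i j b →
    ∃ m, i < m ∧ m ≤ j ∧ (b = true ↔ k ∈ absSet (σ m))) ∧
  -- unsuccessful insert and delete
  (∀ i j t k, j < N → lab i = .call t (.update .insert k) → Returns lab i j false →
    ∃ m, i < m ∧ m ≤ j ∧ k ∈ absSet (σ m)) ∧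
  (∀ i j t k, j < N → lab i = .call t (.update .delete k) → Returns lab i j false →
    ∃ m, i < m ∧ m ≤ j ∧ k ∉ absSet (σ m)) ∧
  -- the transitions that change the set are decisive for pairwise distinct operations, and every
  -- successful insert and delete has one of them
  ∃ D : ℕ → ℕ,
    (∀ m, m < N → Changes σ m → Decisive σ lab N (D m) m) ∧
    (∀ m m', m < N → m' < N → Changes σ m → Changes σ m' → D m = D m' → m = m') ∧
    (∀ i j t u k, j < N → lab i = .call t (.update u k) → Returns lab i j true →
      ∃ m, m < N ∧ Changes σ m ∧ D m = i)

end LOTree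

/-! The nodes carry two structures. The sorted successor list determines the abstract set; the left
and right links only provide a starting point for a search. A badly chosen starting point does no
harm: `contains` repairs it by walking along `pred` and then `succ`, and an update restarts when its
check under the lock fails. What has to be shown is that every node met by a search was in the list
at some time during the search.

The list. `ListInv` is an inductive invariant in rely-guarantee style: besides sortedness it
records, for every thread, what that thread knows at its program point, and `ListAct.rely` says
which part of this other threads cannot destroy. Its main consequence is `ListHist`, valid in every
step: keys never change, marks are never cleared, a node leaves the list only when it is marked,
`succ` changes only at nodes that are in the list after the write, `pred` is redirected only to
nodes of the list, and only nodes of the list become marked.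

The tree. The links need not form a search tree, nor even a tree: an insertion attaches its node
under an arbitrary node and may overwrite a link, and a node may become its own child. What survives
is `TreeInv`: links from nodes of the tree lead to nodes of the tree, where a node belongs to the
tree if it is unmarked or its deleter has not yet unlinked it. The danger is the write that takes a
node out of the tree, since no link to it may remain. This write overwrites one link of the locked
parent, so it must be known that no other link exists: every node is `Settled`, with at most one
incoming link, and that one from its parent, or in `Transit` while a single thread rearranges its
links. Ownership of the lock of the parent of `m` is the right to change the links and the parent of
`m` (`TreeGuar`). A node that has left the tree but not the list keeps its children in the tree,
because its deleter retains the relevant locks (`KeepChildren`). Together these give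
`TreeInv.reach_link`: tree and predecessor links of nodes of the list lead to nodes of the list; and
`TStep.link_reach`: a newly written tree link leads to a node that is in the list at that moment.

Traversals. Let `x` be in the list at time `i`, and let a link of `x` have value `y` at a later time
`j`. By induction on `j`, `y` was in the list in between: either the link already had this value one
step earlier, or the last step wrote it and its target was in the list (`IsRun.past_link`). For
`succ` the argument is dual: the written node is itself in the list, and sortedness yields
`k`-reachability (`IsRun.past_succ`). For marks, a node that becomes marked is in the list before
and after the step (`IsRun.past_rem`). No traversal has to be analysed as a whole.

Linearizability. Only two steps change the abstract set, marking in `delete` and linking in `insert`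
(`ListAct.absSet_eq`, `TStep.absSet_effect`), and an update executes such a step at most once,
exactly if it does not fail (`IsRun.opState`). Every other result was correct in some state during
the invocation, by the assertions. Ordering operations by these times gives the sequential execution
(`TakesEffect.linearizable`). -/

set_option linter.unusedSectionVars false

namespace LOTree

variable {K : Type*}

/-! ## Memory updates -/

section Memory

@[simp] theorem setPtr_ptr (h : Shared K) (o : Node) (f : PtrField) (v : Option Node) (x : Node)
    (g : PtrField) :
    ((setPtr h o f v).mem x).ptr g = if x = o ∧ g = f then v else (h.mem x).ptr g := by
  by_cases hx : x = o
  · subst hx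
    by_cases hg : g = f <;> simp [setPtr, hg]
  · simp [setPtr, hx]

@[simp] theorem setPtr_key (h : Shared K) (o : Node) (f : PtrField) (v : Option Node) (x : Node) :
    ((setPtr h o f v).mem x).key = (h.mem x).key := by
  by_cases hx : x = o
  · subst hx; simp [setPtr]
  · simp [setPtr, hx]

@[simp] theorem setPtr_rem (h : Shared K) (o : Node) (f : PtrField) (v : Option Node) (x : Node) :
    ((setPtr h o f v).mem x).rem = (h.mem x).rem := by
  by_cases hx : x = o
  · subst hx; simp [setPtr]
  · simp [setPtr, hx]

@[simp] theorem setPtr_next (h : Shared K) (o : Node) (f : PtrField) (v : Option Node) :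
    (setPtr h o f v).next = h.next := rfl

@[simp] theorem setPtr_succLock (h : Shared K) (o : Node) (f : PtrField) (v : Option Node) :
    (setPtr h o f v).succLock = h.succLock := rfl

@[simp] theorem setRem_ptr (h : Shared K) (o : Node) (b : Bool) (x : Node) :
    ((setRem h o b).mem x).ptr = (h.mem x).ptr := by
  by_cases hx : x = o
  · subst hx; simp [setRem]
  · simp [setRem, hx]

@[simp] theorem setRem_key (h : Shared K) (o : Node) (b : Bool) (x : Node) :
    ((setRem h o b).mem x).key = (h.mem x).key := by
  by_cases hx : x = o
  · subst hx; simp [setRem]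
  · simp [setRem, hx]

@[simp] theorem setRem_rem (h : Shared K) (o : Node) (b : Bool) (x : Node) :
    ((setRem h o b).mem x).rem = if x = o then b else (h.mem x).rem := by
  by_cases hx : x = o
  · subst hx; simp [setRem]
  · simp [setRem, hx]

@[simp] theorem setRem_next (h : Shared K) (o : Node) (b : Bool) :
    (setRem h o b).next = h.next := rfl

@[simp] theorem setRem_succLock (h : Shared K) (o : Node) (b : Bool) :
    (setRem h o b).succLock = h.succLock := rfl

theorem alloc_mem (h : Shared K) (κ : Key K) (x : Node) :
    (alloc h κ).mem x = if x = h.next then blankNode κ else h.mem x := by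
  by_cases hx : x = h.next
  · subst hx; simp [alloc]
  · simp [alloc, hx]

@[simp] theorem alloc_next (h : Shared K) (κ : Key K) : (alloc h κ).next = h.next + 1 := rfl

@[simp] theorem alloc_succLock (h : Shared K) (κ : Key K) :
    (alloc h κ).succLock = h.succLock := rfl

@[simp] theorem lockSuccOf_succLock (h : Shared K) (o : Node) (t : Thread) (x : Node) :
    (lockSuccOf h o t).succLock x = if x = o then some t else h.succLock x := by
  simp [lockSuccOf, Function.update_apply]

@[simp] theorem lockTreeOf_treeLock (h : Shared K) (o : Node) (t : Thread) (x : Node) :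
    (lockTreeOf h o t).treeLock x = if x = o then some t else h.treeLock x := by
  simp [lockTreeOf, Function.update_apply]

@[simp] theorem unlockTreeOf_treeLock (h : Shared K) (o : Node) (x : Node) :
    (unlockTreeOf h o).treeLock x = if x = o then none else h.treeLock x := by
  simp [unlockTreeOf, Function.update_apply]

@[simp] theorem releaseAll_succLock (h : Shared K) (t : Thread) (x : Node) :
    (releaseAll h t).succLock x = if h.succLock x = some t then none else h.succLock x := rfl

@[simp] theorem releaseAll_treeLock (h : Shared K) (t : Thread) (x : Node) :
    (releaseAll h t).treeLock x = if h.treeLock x = some t then none else h.treeLock x := rfl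

end Memory

/-! ## Reachability along successor links -/

/-- The successor relation of a memory state. -/
def SuccRel (σ : Mem K) (a b : Node) : Prop := (σ a).ptr .succ = some b

/-- Reachability from the sentinel `-∞`, at the level of nodes. -/
def Reach (σ : Mem K) (x : Node) : Prop := Relation.ReflTransGen (SuccRel σ) minNode x

/-- The successor list is sorted. -/
def SortedList [LinearOrder K] (σ : Mem K) : Prop :=
  ∀ x y, Reach σ x → (σ x).ptr .succ = some y → (σ x).key < (σ y).key

theorem reach_min (σ : Mem K) : Reach σ minNode := Relation.ReflTransGen.refl

theorem Reach.succ {σ : Mem K} {x y : Node} (hx : Reach σ x) (h : (σ x).ptr .succ = some y) :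
    Reach σ y := hx.tail h

theorem sReach_iff_reach {σ : Mem K} {x : Node} : SReach σ x ↔ Reach σ x := by
  constructor
  · intro h
    have key : ∀ ℓ : Loc, Relation.ReflTransGen (fun ℓ ℓ' => ListExt ℓ (readLoc σ ℓ) ℓ')
        (minNode, .key) ℓ → Reach σ ℓ.1 := by
      intro ℓ hℓ
      induction hℓ with
      | refl => exact reach_min σ
      | @tail b c _ hbc ih =>
        generalize hv : readLoc σ b = v at hbc
        cases hbc with
        | field o => exact ih
        | follow o o' =>
          simp only [readLoc, Val.ptr.injEq] at hv
          exact ih.succ hv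
    exact key _ h
  · intro h
    induction h with
    | refl => exact Relation.ReflTransGen.refl
    | @tail b c _ hbc ih =>
      refine (ih.tail (ListExt.field b _)).tail ?_
      have : readLoc σ (b, .ptr .succ) = .ptr (some c) := congrArg Val.ptr hbc
      rw [this]
      exact ListExt.follow b c

/-- Each node has at most one successor, so the nodes reached from `minNode` form a chain. With
sortedness this turns comparisons of keys into paths. -/
theorem reach_total {σ : Mem K} {a b : Node} (ha : Reach σ a) (hb : Reach σ b) :
    Relation.ReflTransGen (SuccRel σ) a b ∨ Relation.ReflTransGen (SuccRel σ) b a :=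
  Relation.ReflTransGen.total_of_right_unique
    (fun x y z (h1 : _ = _) (h2 : _ = _) => by rw [h1] at h2; exact Option.some.inj h2) ha hb

section Sorted

variable [LinearOrder K] {σ : Mem K}

theorem SortedList.key_le_of_path (hs : SortedList σ) {a b : Node} (ha : Reach σ a)
    (hab : Relation.ReflTransGen (SuccRel σ) a b) : (σ a).key ≤ (σ b).key := by
  induction hab with
  | refl => exact le_rfl
  | tail h1 h2 ih => exact ih.trans (hs _ _ (ha.trans h1) h2).le

theorem SortedList.key_lt_of_path (hs : SortedList σ) {a b : Node} (ha : Reach σ a)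
    (hab : Relation.ReflTransGen (SuccRel σ) a b) (hne : a ≠ b) : (σ a).key < (σ b).key := by
  rcases Relation.ReflTransGen.cases_head hab with h | ⟨c, hac, hcb⟩
  · exact absurd h hne
  · exact (hs _ _ ha hac).trans_le (hs.key_le_of_path (ha.succ hac) hcb)

theorem SortedList.eq_of_key_eq (hs : SortedList σ) {a b : Node} (ha : Reach σ a)
    (hb : Reach σ b) (h : (σ a).key = (σ b).key) : a = b := by
  by_contra hne
  rcases reach_total ha hb with hp | hp
  · exact (hs.key_lt_of_path ha hp hne).ne h
  · exact (hs.key_lt_of_path hb hp (Ne.symm hne)).ne h.symm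

theorem SortedList.path_of_key_lt (hs : SortedList σ) {a b : Node} (ha : Reach σ a)
    (hb : Reach σ b) (h : (σ a).key < (σ b).key) : Relation.ReflTransGen (SuccRel σ) a b := by
  rcases reach_total ha hb with hp | hp
  · exact hp
  · exact absurd (hs.key_le_of_path hb hp) (not_le.2 h)

/-- A reachable node has at most one reachable predecessor. -/
theorem SortedList.pred_unique (hs : SortedList σ) {a b x : Node} (ha : Reach σ a)
    (hb : Reach σ b) (hax : (σ a).ptr .succ = some x) (hbx : (σ b).ptr .succ = some x) :
    a = b := by
  by_contra hne
  have aux : ∀ a b : Node, Reach σ a → Reach σ b → (σ a).ptr .succ = some x →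
      (σ b).ptr .succ = some x → a ≠ b → Relation.ReflTransGen (SuccRel σ) a b → False := by
    intro a b ha hb hax hbx hne hp
    rcases Relation.ReflTransGen.cases_head hp with h | ⟨c, hac, hcb⟩
    · exact hne h
    · have : c = x := by
        have h1 : (σ a).ptr .succ = some c := hac
        rw [hax] at h1; exact (Option.some.inj h1).symm
      subst this
      -- The path from `a` to `b` passes through `x`, so the key of `x` would be at most that of
      -- `b`, whose successor is `x`.
      exact absurd (hs.key_le_of_path (ha.succ hac) hcb) (not_le.2 (hs _ _ hb hbx))
  rcases reach_total ha hb with hp | hp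
  · exact aux a b ha hb hax hbx hne hp
  · exact aux b a hb ha hbx hax (Ne.symm hne) hp

/-- Steps along the successor list from nodes with keys less than `k`. -/
def KSuccRel (σ : Mem K) (k : K) (a b : Node) : Prop :=
  (σ a).key < toKey k ∧ (σ a).ptr .succ = some b

/-- Two steps between locations, from `key` to `succ` and on to the next `key`, make one step
between nodes. A `succ` location is entered only after its node has passed the test against `k`. -/
theorem kReachLoc_iff {k : K} {ℓ : Loc} : KReachLoc k σ ℓ ↔
    Relation.ReflTransGen (KSuccRel σ k) minNode ℓ.1 ∧
      (ℓ.2 = .key ∨ (ℓ.2 = .ptr .succ ∧ (σ ℓ.1).key < toKey k)) := by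
  constructor
  · intro h
    unfold KReachLoc at h
    induction h with
    | refl => exact ⟨Relation.ReflTransGen.refl, Or.inl rfl⟩
    | @tail b c _ hbc ih =>
      generalize hv : readLoc σ b = v at hbc
      cases hbc with
      | field o m hm =>
        simp only [readLoc, Val.key.injEq] at hv
        exact ⟨ih.1, Or.inr ⟨rfl, by rw [hv]; exact hm⟩⟩
      | follow o o' =>
        simp only [readLoc, Val.ptr.injEq] at hv
        have h2 := ih.2
        simp only [reduceCtorEq, true_and, false_or] at h2
        exact ⟨ih.1.tail ⟨h2, hv⟩, Or.inl rfl⟩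
  · rintro ⟨h1, h2⟩
    have aux : ∀ x, Relation.ReflTransGen (KSuccRel σ k) minNode x →
        KReachLoc k σ (x, .key) := by
      intro x hx
      induction hx with
      | refl => exact Relation.ReflTransGen.refl
      | @tail b c _ hbc ih =>
        refine (ih.tail (SuccExt.field b _ hbc.1)).tail ?_
        have : readLoc σ (b, .ptr .succ) = .ptr (some c) := by simpa [readLoc] using hbc.2
        rw [this]
        exact SuccExt.follow b c
    obtain ⟨x, f⟩ := ℓ
    rcases h2 with h2 | ⟨h2, h3⟩
    · simp only at h2; subst h2; exact aux x h1
    · simp only at h2 h3; subst h2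
      exact (aux x h1).tail (SuccExt.field x _ h3)

theorem reach_of_kSuccRel {k : K} {x : Node}
    (h : Relation.ReflTransGen (KSuccRel σ k) minNode x) : Reach σ x := by
  induction h with
  | refl => exact reach_min σ
  | tail _ h ih => exact ih.succ h.2

theorem KReach.reach {k : K} {x : Node} (h : KReach σ k x) : Reach σ x :=
  reach_of_kSuccRel (kReachLoc_iff.1 h).1

theorem KReach.succ {k : K} {x y : Node} (h : KReach σ k x) (hk : (σ x).key < toKey k)
    (hy : (σ x).ptr .succ = some y) : KReach σ k y :=
  kReachLoc_iff.2 ⟨(kReachLoc_iff.1 h).1.tail ⟨hk, hy⟩, Or.inl rfl⟩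

theorem kReachLoc_succ_iff {k : K} {x : Node} :
    KReachLoc k σ (x, .ptr .succ) ↔ KReach σ k x ∧ (σ x).key < toKey k := by
  unfold KReach
  rw [kReachLoc_iff, kReachLoc_iff]
  simp

/-- All keys before `x` on the list are smaller than that of `x`, so the test against `k` does not
stop the walk earlier. This converts the plain reachability obtained from the tree into
`k`-reachability. -/
theorem SortedList.kReach (hs : SortedList σ) {k : K} {x : Node} (hx : Reach σ x)
    (hk : (σ x).key ≤ toKey k) : KReach σ k x := by
  induction hx with
  | refl => exact Relation.ReflTransGen.refl
  | @tail b c hb hbc ih =>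
    have hlt := (hs b c hb hbc).trans_le hk
    exact (ih hlt.le).succ hlt hbc

/-- The `k`-reachable nodes end at the first node whose key is not below `k`. If `x` is entered from
`c`, then `c` has a key below `k`, so `z` lies after `c` and hence not before `x`. -/
theorem SortedList.key_le_of_kReach (hs : SortedList σ) {k : K} {x z : Node} (hx : KReach σ k x)
    (hz : Reach σ z) (hk : toKey k ≤ (σ z).key) : (σ x).key ≤ (σ z).key := by
  rcases Relation.ReflTransGen.cases_tail (kReachLoc_iff.1 hx).1 with h | ⟨c, hc, hlt, hcx⟩
  · simp only at h; subst h
    exact hs.key_le_of_path (reach_min σ) hz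
  · have hcr : Reach σ c := reach_of_kSuccRel hc
    have hp := hs.path_of_key_lt hcr hz (hlt.trans_le hk)
    rcases Relation.ReflTransGen.cases_head hp with h | ⟨d, hd, hdz⟩
    · subst h; exact absurd hlt (not_lt.2 hk)
    · have : d = x := by
        have h1 : (σ c).ptr .succ = some d := hd
        rw [hcx] at h1; exact (Option.some.inj h1).symm
      subst this
      exact hs.key_le_of_path (hcr.succ hd) hdz

theorem SortedList.mem_absSet (hs : SortedList σ) {k : K} :
    k ∈ absSet σ ↔ ∃ x, Reach σ x ∧ (σ x).key = toKey k ∧ (σ x).rem = false := by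
  constructor
  · rintro ⟨x, h1, h2⟩; exact ⟨x, h1.reach, h2⟩
  · rintro ⟨x, h1, h2, h3⟩; exact ⟨x, hs.kReach h1 h2.le, h2, h3⟩

end Sorted

/-! ## Changes of the successor list -/

/-- Agreement on the old list suffices, because a path of the new state starts at `minNode` and so
never leaves the old list. Writes to nodes outside the list are covered in this way. -/
theorem reach_congr {σ σ' : Mem K}
    (h : ∀ x, Reach σ x → (σ' x).ptr .succ = (σ x).ptr .succ) (x : Node) :
    Reach σ' x ↔ Reach σ x := by
  constructor
  · intro hx
    induction hx with
    | refl => exact reach_min σ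
    | @tail b c _ hbc ih =>
      have hbc : (σ' b).ptr .succ = some c := hbc
      rw [h b ih] at hbc
      exact ih.succ hbc
  · intro hx
    induction hx with
    | refl => exact reach_min σ'
    | @tail b c hb hbc ih =>
      have hbc : (σ b).ptr .succ = some c := hbc
      rw [← h b hb] at hbc
      exact ih.succ hbc

/-- Linking `n` between `p` and its successor `s`. -/
theorem reach_link {σ σ' : Mem K} {p s n : Node} (hp : Reach σ p)
    (hps : (σ p).ptr .succ = some s) (hns : (σ n).ptr .succ = some s) (hnp : n ≠ p)
    (h : ∀ x, (σ' x).ptr .succ = if x = p then some n else (σ x).ptr .succ) (x : Node) :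
    Reach σ' x ↔ Reach σ x ∨ x = n := by
  have hsub : ∀ x, Reach σ x → Reach σ' x := by
    intro x hx
    induction hx with
    | refl => exact reach_min σ'
    | @tail b c hb hbc ih =>
      have hbc : (σ b).ptr .succ = some c := hbc
      by_cases hbp : b = p
      · subst hbp
        have hn : Reach σ' n := ih.succ (by simp [h])
        have : c = s := by rw [hps] at hbc; exact (Option.some.inj hbc).symm
        subst this
        exact hn.succ (by simp [h, hnp, hns])
      · exact ih.succ (by simp [h, hbp, hbc])
  constructor
  · intro hx
    induction hx with
    | refl => exact Or.inl (reach_min σ)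
    | @tail b c _ hbc ih =>
      have hbc : (σ' b).ptr .succ = some c := hbc
      rw [h] at hbc
      by_cases hbp : b = p
      · rw [if_pos hbp] at hbc
        exact Or.inr (Option.some.inj hbc).symm
      · rw [if_neg hbp] at hbc
        rcases ih with hb | hb
        · exact Or.inl (hb.succ hbc)
        · subst hb
          have : c = s := by rw [hns] at hbc; exact (Option.some.inj hbc).symm
          subst this
          exact Or.inl (hp.succ hps)
  · rintro (hx | rfl)
    · exact hsub x hx
    · exact (hsub p hp).succ (by simp [h])

/-- Unlinking `s` between `p` and `y`. -/
theorem reach_unlink [LinearOrder K] {σ σ' : Mem K} {p s y : Node} (hs : SortedList σ)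
    (hp : Reach σ p) (hps : (σ p).ptr .succ = some s) (hsy : (σ s).ptr .succ = some y)
    (hmin : s ≠ minNode)
    (h : ∀ x, (σ' x).ptr .succ = if x = p then some y else (σ x).ptr .succ) (x : Node) :
    Reach σ' x ↔ Reach σ x ∧ x ≠ s := by
  have hsr := hp.succ hps
  have hys : y ≠ s := by
    rintro rfl
    exact lt_irrefl _ (hs _ _ hsr hsy)
  have hpne : p ≠ s := by
    rintro rfl
    exact lt_irrefl _ (hs _ _ hp hps)
  constructor
  · intro hx
    induction hx with
    | refl => exact ⟨reach_min σ, Ne.symm hmin⟩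
    | @tail b c _ hbc ih =>
      have hbc : (σ' b).ptr .succ = some c := hbc
      rw [h] at hbc
      by_cases hbp : b = p
      · rw [if_pos hbp] at hbc
        obtain rfl := Option.some.inj hbc
        exact ⟨hsr.succ hsy, hys⟩
      · rw [if_neg hbp] at hbc
        refine ⟨ih.1.succ hbc, ?_⟩
        rintro rfl
        exact hbp (hs.pred_unique ih.1 hp hbc hps)
  -- When the old path stands at `s`, which is no longer reachable, the induction carries `p`
  -- instead; the next node `y` is then reached directly from `p`.
  · have aux : ∀ x, Reach σ x → (x ≠ s → Reach σ' x) ∧ (x = s → Reach σ' p) := by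
      intro x hx
      induction hx with
      | refl => exact ⟨fun _ => reach_min σ', fun h => absurd h.symm hmin⟩
      | @tail b c hb hbc ih =>
        have hbc : (σ b).ptr .succ = some c := hbc
        constructor
        · intro hc
          by_cases hbs : b = s
          · have h1 := ih.2 hbs
            have : c = y := by rw [hbs, hsy] at hbc; exact (Option.some.inj hbc).symm
            subst this
            exact h1.succ (by simp [h])
          · have h1 := ih.1 hbs
            by_cases hbp : b = p
            · subst hbp
              rw [hps] at hbc
              exact absurd (Option.some.inj hbc).symm hc
            · exact h1.succ (by simp [h, hbp, hbc])
        · rintro rfl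
          have : b = p := hs.pred_unique hb hp hbc hps
          subst this
          exact ih.1 hpne
    rintro ⟨hx, hne⟩
    exact (aux x hx).1 hne

/-! ## Views of program points -/

/-- The node that an insertion has created and not yet linked to the tree. -/
def PC.newNode : PC K → Option Node
  | .insNewSucc _ _ _ n => some n
  | .insNewPred _ _ _ n => some n
  | .insSucc _ _ _ n => some n
  | .insPred _ _ _ n => some n
  | .insChoose _ _ _ n => some n
  | .insParent _ n _ => some n
  | .insLock _ n _ => some n
  | .insChild _ n _ => some n
  | _ => none

/-- The node that an insertion has created and to which no predecessor link points yet. -/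
def PC.hidden : PC K → Option Node
  | .insNewSucc _ _ _ n => some n
  | .insNewPred _ _ _ n => some n
  | .insSucc _ _ _ n => some n
  | .insPred _ _ _ n => some n
  | _ => none

/-- The node that a deletion has marked and not yet unlinked. -/
def PC.deleted : PC K → Option Node
  | .delTree _ _ s _ => some s
  | .delRead _ _ s => some s
  | .delPred _ _ s _ => some s
  | .delSucc _ _ s _ => some s
  | _ => none

/-- A pair of neighbours of the list whose predecessor link is out of date. -/
def PC.predGap : PC K → Option (Node × Node)
  | .insPred _ _ s n => some (n, s)
  | .delSucc _ _ s y => some (s, y)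
  | _ => none

theorem PC.newNode_of_hidden {q : PC K} {n : Node} (h : q.hidden = some n) :
    q.newNode = some n := by
  cases q <;> simp_all [PC.hidden, PC.newNode]

/-! ## Steps as seen by the successor list -/

/-- Two shared states agree on everything that concerns the successor list, except that the thread
`t` may have acquired or released locks. -/
structure ListSame (h h' : Shared K) (t : Thread) : Prop where
  next : h'.next = h.next
  key : ∀ x, (h'.mem x).key = (h.mem x).key
  rem : ∀ x, (h'.mem x).rem = (h.mem x).rem
  succ : ∀ x, (h'.mem x).ptr .succ = (h.mem x).ptr .succ
  pred : ∀ x, (h'.mem x).ptr .pred = (h.mem x).ptr .pred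
  lock : ∀ x t', t' ≠ t → h.succLock x = some t' → h'.succLock x = some t'

theorem ListSame.setPtr (h : Shared K) (t : Thread) (o : Node) (f : PtrField) (v : Option Node)
    (hf : f ≠ .succ) (hf' : f ≠ .pred) : ListSame h (setPtr h o f v) t where
  next := rfl
  key := by simp
  rem := by simp
  succ x := by simp [hf.symm]
  pred x := by simp [hf'.symm]
  lock _ _ _ h := h

theorem ListSame.refl (h : Shared K) (t : Thread) : ListSame h h t :=
  ⟨rfl, fun _ => rfl, fun _ => rfl, fun _ => rfl, fun _ => rfl, fun _ _ _ h => h⟩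

theorem ListSame.setPtrIf (h : Shared K) (t : Thread) (o : Option Node) (f : PtrField)
    (v : Option Node) (hf : f ≠ .succ) (hf' : f ≠ .pred) : ListSame h (setPtrIf h o f v) t := by
  cases o with
  | none => exact .refl h t
  | some o => exact .setPtr h t o f v hf hf'

theorem Side.fld_ne_succ (d : Side) : d.fld ≠ .succ := by cases d <;> decide

theorem Side.fld_ne_pred (d : Side) : d.fld ≠ .pred := by cases d <;> decide

theorem ListSame.lockSuccOf (h : Shared K) (t : Thread) (o : Node)
    (hl : CanLock h.succLock o t) : ListSame h (lockSuccOf h o t) t where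
  next := rfl
  key _ := rfl
  rem _ := rfl
  succ _ := rfl
  pred _ := rfl
  lock x t' ht hx := by
    have : x ≠ o := by
      rintro rfl
      rcases hl with hl | hl <;> rw [hl] at hx <;> simp_all
    simpa [this] using hx

theorem ListSame.lockTreeOf (h : Shared K) (t : Thread) (o : Node) :
    ListSame h (lockTreeOf h o t) t :=
  ⟨rfl, fun _ => rfl, fun _ => rfl, fun _ => rfl, fun _ => rfl, fun _ _ _ h => h⟩

theorem ListSame.unlockTreeOf (h : Shared K) (t : Thread) (o : Node) :
    ListSame h (unlockTreeOf h o) t :=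
  ⟨rfl, fun _ => rfl, fun _ => rfl, fun _ => rfl, fun _ => rfl, fun _ _ _ h => h⟩

theorem ListSame.releaseAll (h : Shared K) (t : Thread) : ListSame h (releaseAll h t) t where
  next := rfl
  key _ := rfl
  rem _ := rfl
  succ _ := rfl
  pred _ := rfl
  lock x t' ht hx := by simp [hx, ht]

theorem UCStep.listSame {t : Thread} {m : Node} {c : Option Node} {h h' : Shared K} {q : UCPoint}
    {q' : Option UCPoint} (hq : UCStep t m c h q h' q') :
    ListSame h h' t ∧ h'.succLock = h.succLock := by
  cases hq with
  | lockFresh p => exact ⟨.lockTreeOf _ _ _, rfl⟩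
  | invalid p b =>
    cases b
    · exact ⟨.refl _ _, rfl⟩
    · exact ⟨.unlockTreeOf _ _ _, rfl⟩
  | write p d => exact ⟨.setPtr _ _ _ _ _ d.fld_ne_succ d.fld_ne_pred, rfl⟩
  | setParent p =>
    refine ⟨.setPtrIf _ _ _ _ _ (by decide) (by decide), ?_⟩
    cases c <;> rfl
  | _ => exact ⟨.refl _ _, rfl⟩

theorem RmStep.listSame {t : Thread} {n : Node} {h h' : Shared K} {q : RmPoint}
    {q' : Option RmPoint} (hq : RmStep t n h q h' q') :
    ListSame h h' t ∧ h'.succLock = h.succLock := by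
  cases hq with
  | lockNode => exact ⟨.lockTreeOf _ _ _, rfl⟩
  | lockSucc => exact ⟨.lockTreeOf _ _ _, rfl⟩
  | copyLeft => exact ⟨.setPtr _ _ _ _ _ (by decide) (by decide), rfl⟩
  | copyRight => exact ⟨.setPtr _ _ _ _ _ (by decide) (by decide), rfl⟩
  | adoptLeft s v =>
    refine ⟨.setPtrIf _ _ _ _ _ (by decide) (by decide), ?_⟩
    cases v <;> rfl
  | adoptRight s v =>
    refine ⟨.setPtrIf _ _ _ _ _ (by decide) (by decide), ?_⟩
    cases v <;> rfl
  | ucStep _ m c after q q' hq => exact hq.listSame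
  | ucReturn _ m c after q hq => exact hq.listSame
  | _ => exact ⟨.refl _ _, rfl⟩

theorem RotStep.listSame {t : Thread} {d e : Side} {h h' : Shared K} {q : RotPoint}
    {q' : Option RotPoint} (hq : RotStep t d e h q h' q') : ListSame h h' t := by
  cases hq with
  | lockP => exact .lockTreeOf _ _ _
  | lockY => exact .lockTreeOf _ _ _
  | lockX => exact .lockTreeOf _ _ _
  | linkX => exact .setPtr _ _ _ _ _ d.fld_ne_succ d.fld_ne_pred
  | parentX => exact .setPtr _ _ _ _ _ (by decide) (by decide)
  | linkC => exact .setPtr _ _ _ _ _ e.fld_ne_succ e.fld_ne_pred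
  | parentC => exact .setPtrIf _ _ _ _ _ (by decide) (by decide)
  | linkY => exact .setPtr _ _ _ _ _ e.opp.fld_ne_succ e.opp.fld_ne_pred
  | parentY => exact .setPtr _ _ _ _ _ (by decide) (by decide)
  | unlock => exact .releaseAll _ _
  | _ => exact .refl _ _

/-- A move between program points that does not concern the successor list. -/
structure PCSilent (q q' : PC K) : Prop where
  -- The directions differ by how the invariants use the views: `Seen`, `NotNew` and `new_inj`
  -- forbid threads from showing a node, so `newNode` and `hidden` may only disappear; `marked` and
  -- `pred_eq` require a thread that accounts for an exception, so `deleted` and `predGap` must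
  -- persist.
  newNode : ∀ n, q'.newNode = some n → q.newNode = some n
  hidden : ∀ n, q'.hidden = some n → q.hidden = some n
  deleted : ∀ n, q.deleted = some n → q'.deleted = some n
  predGap : ∀ e, q.predGap = some e → q'.predGap = some e

/-- The effect of a step of thread `t` on the successor list. -/
inductive ListAct (t : Thread) (h : Shared K) : PC K → Shared K → PC K → Prop
  | silent (q : PC K) (h' : Shared K) (q' : PC K) (hs : ListSame h h' t) (hq : PCSilent q q') :
      ListAct t h q h' q'
  | insNew (k : K) (p s : Node) :
      ListAct t h (.insNew k p s) (alloc h (toKey k)) (.insNewSucc k p s h.next)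
  | insNewSucc (k : K) (p s n : Node) :
      ListAct t h (.insNewSucc k p s n) (setPtr h n .succ (some s)) (.insNewPred k p s n)
  | insNewPred (k : K) (p s n : Node) :
      ListAct t h (.insNewPred k p s n) (setPtr h n .pred (some p)) (.insSucc k p s n)
  | insSucc (k : K) (p s n : Node) :
      ListAct t h (.insSucc k p s n) (setPtr h p .succ (some n)) (.insPred k p s n)
  | insPred (k : K) (p s n : Node) :
      ListAct t h (.insPred k p s n) (setPtr h s .pred (some n)) (.insChoose k p s n)
  | delMark (k : K) (p s : Node) :
      ListAct t h (.delMark k p s) (setRem h s true) (.delTree k p s .lockNode)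
  | delPred (k : K) (p s y : Node) :
      ListAct t h (.delPred k p s y) (setPtr h y .pred (some p)) (.delSucc k p s y)
  | delSucc (k : K) (p s y : Node) :
      ListAct t h (.delSucc k p s y) (setPtr h p .succ (some y)) (.unlock true)

theorem PCSilent.afterLocate (g : Goal K) (x : Node) (y : Option Node) (z : Node) :
    PCSilent (.locate g x y) (afterLocate z g) := by
  rcases g with (k | ⟨u, k⟩) | ⟨κ, d, e⟩ <;> constructor <;>
    simp [LOTree.afterLocate, PC.newNode, PC.hidden, PC.deleted, PC.predGap]

/-- All steps of searches, locks, tree links and rotations collapse to `silent`, so the analysis of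
the list has nine cases instead of one for each statement of the algorithm. -/
theorem TStep.listAct [LinearOrder K] {t : Thread} {h h' : Shared K} {q q' : PC K} {l : Label K}
    (hst : TStep t h q l h' q') : ListAct t h q h' q' := by
  have hps : ∀ {q q' : PC K}, PCSilent q q' → ListAct t h q h q' :=
    fun hq => .silent _ _ _ (.refl _ _) hq
  cases hst with
  | insNew => exact .insNew _ _ _
  | insNewSucc => exact .insNewSucc _ _ _ _
  | insNewPred => exact .insNewPred _ _ _ _
  | insSucc => exact .insSucc _ _ _ _
  | insPred => exact .insPred _ _ _ _
  | delMark => exact .delMark _ _ _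
  | delPred => exact .delPred _ _ _ _
  | delSucc => exact .delSucc _ _ _ _
  | locateNull => exact hps (.afterLocate _ _ _ _)
  | locateFound => exact hps (.afterLocate _ _ _ _)
  | lockPred u k p hl =>
    exact .silent _ _ _ (.lockSuccOf _ _ _ hl)
      (by constructor <;> simp [PC.newNode, PC.hidden, PC.deleted, PC.predGap])
  | delLock k p s hl =>
    exact .silent _ _ _ (.lockSuccOf _ _ _ hl)
      (by constructor <;> simp [PC.newNode, PC.hidden, PC.deleted, PC.predGap])
  | restart =>
    exact .silent _ _ _ (.releaseAll _ _)
      (by constructor <;> simp [PC.newNode, PC.hidden, PC.deleted, PC.predGap])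
  | unlock =>
    exact .silent _ _ _ (.releaseAll _ _)
      (by constructor <;> simp [PC.newNode, PC.hidden, PC.deleted, PC.predGap])
  | delTree _ k p s q q' hq =>
    exact .silent _ _ _ hq.listSame.1
      (by constructor <;> simp [PC.newNode, PC.hidden, PC.deleted, PC.predGap])
  | delTreeReturn _ k p s q hq =>
    exact .silent _ _ _ hq.listSame.1
      (by constructor <;> simp [PC.newNode, PC.hidden, PC.deleted, PC.predGap])
  | rot _ d e q q' hq =>
    exact .silent _ _ _ hq.listSame
      (by constructor <;> simp [PC.newNode, PC.hidden, PC.deleted, PC.predGap])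
  | rotReturn _ d e q hq =>
    exact .silent _ _ _ hq.listSame
      (by constructor <;> simp [PC.newNode, PC.hidden, PC.deleted, PC.predGap])
  | insParent k n z =>
    exact .silent _ _ _ (.setPtr _ _ _ _ _ (by decide) (by decide))
      (by constructor <;> simp [PC.newNode, PC.hidden, PC.deleted, PC.predGap])
  | insLock k n z hl =>
    exact .silent _ _ _ (.lockTreeOf _ _ _)
      (by constructor <;> simp [PC.newNode, PC.hidden, PC.deleted, PC.predGap])
  | insChild k n z =>
    exact .silent _ _ _ (.setPtr _ _ _ _ _ (Side.fld_ne_succ _) (Side.fld_ne_pred _))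
      (by constructor <;> simp [PC.newNode, PC.hidden, PC.deleted, PC.predGap])
  | _ => exact hps (by constructor <;> simp [PC.newNode, PC.hidden, PC.deleted, PC.predGap])

/-! ## The invariant of the successor list -/

/-- `x` is or was in the list. -/
def Known (c : Config K) (x : Node) : Prop :=
  x < c.shared.next ∧ (Reach c.shared.mem x ∨ (c.shared.mem x).rem = true)

/-- `x` is or was in the list, and a predecessor link to it has been set. -/
def Seen (c : Config K) (x : Node) : Prop :=
  Known c x ∧ ∀ t, (c.pc t).hidden ≠ some x

/-- `n` is a new node, not yet linked to the list. -/
structure Fresh (c : Config K) (k : K) (n : Node) : Prop where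
  lt : n < c.shared.next
  not_reach : ¬ Reach c.shared.mem n
  rem : (c.shared.mem n).rem = false
  key : (c.shared.mem n).key = toKey k

/-- What the thread `t` can rely on when other threads make steps. -/
structure ListRely (c c' : Config K) (t : Thread) : Prop where
  next_le : c.shared.next ≤ c'.shared.next
  key : ∀ x, x < c.shared.next → (c'.shared.mem x).key = (c.shared.mem x).key
  seen : ∀ x, Seen c x → Seen c' x
  reach : ∀ x, Reach c.shared.mem x → (c.shared.mem x).rem = false → Reach c'.shared.mem x
  lock : ∀ x, c.shared.succLock x = some t → c'.shared.succLock x = some t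
  succ : ∀ x, Known c x → c.shared.succLock x = some t →
    (c'.shared.mem x).ptr .succ = (c.shared.mem x).ptr .succ
  rem : ∀ x, x < c.shared.next → c.shared.succLock x = some t →
    (c'.shared.mem x).rem = (c.shared.mem x).rem
  -- The field `y.pred` is protected by the lock two places before `y`: it is written by the
  -- insertion of the middle node or by its deletion, and both hold the lock of `p`.
  pred : ∀ p x y, Reach c.shared.mem p → (c.shared.mem p).ptr .succ = some x →
    (c.shared.mem x).ptr .succ = some y → c.shared.succLock p = some t →
    (c'.shared.mem y).ptr .pred = (c.shared.mem y).ptr .pred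
  -- An inserter does not hold the lock of its new node. The successor of that node is stable
  -- nevertheless, since `succ` is written only at `Seen` nodes and at the writer's own new node.
  hidden : ∀ n, n < c.shared.next → (c.pc t).hidden = some n →
    (c'.shared.mem n).ptr .succ = (c.shared.mem n).ptr .succ
  fresh : ∀ n, n < c.shared.next → (c.pc t).hidden = some n → ¬ Reach c.shared.mem n →
    ¬ Reach c'.shared.mem n ∧ (c'.shared.mem n).ptr .pred = (c.shared.mem n).ptr .pred ∧
      (c'.shared.mem n).rem = (c.shared.mem n).rem

theorem Fresh.rely {c c' : Config K} {t : Thread} {k : K} {n : Node}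
    (r : ListRely c c' t) (hn : (c.pc t).hidden = some n) (b : Fresh c k n) : Fresh c' k n where
  lt := b.lt.trans_le r.next_le
  not_reach := (r.fresh _ b.lt hn b.not_reach).1
  rem := by rw [(r.fresh _ b.lt hn b.not_reach).2.2]; exact b.rem
  key := by rw [r.key _ b.lt]; exact b.key

section Inv

variable [LinearOrder K]

/-- The thread `t` holds the lock of the node `p` of the list, `s` is the successor of `p`, and `k`
lies between them. -/
structure Base (c : Config K) (t : Thread) (k : K) (p s : Node) : Prop where
  seen : Seen c p
  reach : Reach c.shared.mem p
  rem : (c.shared.mem p).rem = false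
  key_lt : (c.shared.mem p).key < toKey k
  le_key : toKey k ≤ (c.shared.mem s).key
  succ : (c.shared.mem p).ptr .succ = some s
  lock : c.shared.succLock p = some t

/-- What thread `t` knows about the successor list at program point `q`. -/
def ListThread (c : Config K) (t : Thread) : PC K → Prop
  | .locate _ x y => Seen c x ∧ ∀ y', y = some y' → Seen c y'
  | .choosePred _ _ x => Seen c x
  | .lockPred _ _ p => Seen c p
  | .readSucc _ _ p => Seen c p ∧ c.shared.succLock p = some t
  | .check _ _ p s =>
      Seen c p ∧ c.shared.succLock p = some t ∧ (c.shared.mem p).ptr .succ = some s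
  | .inRange _ k p s => Base c t k p s
  | .failed u k p s => Base c t k p s ∧
      match u with
      | .insert => (c.shared.mem s).key = toKey k
      | .delete => toKey k < (c.shared.mem s).key
  | .delLock k p s => Base c t k p s ∧ (c.shared.mem s).key = toKey k
  | .delMark k p s => Base c t k p s ∧ (c.shared.mem s).key = toKey k ∧
      c.shared.succLock s = some t
  | .delTree k p s _ | .delRead k p s => Base c t k p s ∧ (c.shared.mem s).key = toKey k ∧
      c.shared.succLock s = some t ∧ (c.shared.mem s).rem = true
  | .delPred k p s y => Base c t k p s ∧ (c.shared.mem s).key = toKey k ∧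
      c.shared.succLock s = some t ∧ (c.shared.mem s).rem = true ∧
      (c.shared.mem s).ptr .succ = some y
  | .delSucc k p s y => Base c t k p s ∧ (c.shared.mem s).key = toKey k ∧
      c.shared.succLock s = some t ∧ (c.shared.mem s).rem = true ∧
      (c.shared.mem s).ptr .succ = some y ∧ (c.shared.mem y).ptr .pred = some p
  | .insNew k p s => Base c t k p s ∧ toKey k < (c.shared.mem s).key
  | .insNewSucc k p s n => Base c t k p s ∧ toKey k < (c.shared.mem s).key ∧ Fresh c k n
  | .insNewPred k p s n => Base c t k p s ∧ toKey k < (c.shared.mem s).key ∧ Fresh c k n ∧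
      (c.shared.mem n).ptr .succ = some s
  | .insSucc k p s n => Base c t k p s ∧ toKey k < (c.shared.mem s).key ∧ Fresh c k n ∧
      (c.shared.mem n).ptr .succ = some s ∧ (c.shared.mem n).ptr .pred = some p
  | .insPred k p s n => Base c t k p n ∧ (c.shared.mem n).ptr .succ = some s ∧
      (c.shared.mem s).ptr .pred = some p
  | .insChoose k p _ n => Base c t k p n
  | .insParent k n z => z < c.shared.next ∧ ∃ p, Base c t k p n
  | .insLock k n z => z < c.shared.next ∧ ∃ p, Base c t k p n
  | .insChild k n z => z < c.shared.next ∧ ∃ p, Base c t k p n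
  | _ => True

/-- Two kinds of exceptions are tolerated, each charged to a thread that holds the locks involved: a
predecessor link that is out of date between two writes, and a marked node that is still linked. The
clause `pred_seen` ranges over all nodes, removed ones included, because a search may stand at a
removed node when it follows `pred`. -/
structure ListInv (c : Config K) : Prop where
  key_min : (c.shared.mem minNode).key = ⊥
  key_max : (c.shared.mem maxNode).key = ⊤
  reach_lt : ∀ x, Reach c.shared.mem x → x < c.shared.next
  sorted : SortedList c.shared.mem
  reach_max : Reach c.shared.mem maxNode
  pred_min : (c.shared.mem minNode).ptr .pred = none
  pred_eq : ∀ x y, Reach c.shared.mem x → (c.shared.mem x).ptr .succ = some y →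
    (c.shared.mem y).ptr .pred = some x ∨ ∃ t, (c.pc t).predGap = some (x, y)
  marked : ∀ x, Reach c.shared.mem x → (c.shared.mem x).rem = true →
    ∃ t, (c.pc t).deleted = some x
  pred_seen : ∀ x y, (c.shared.mem x).ptr .pred = some y → Seen c y
  new_inj : ∀ t t' n, (c.pc t).newNode = some n → (c.pc t').newNode = some n → t = t'
  thread : ∀ t, ListThread c t (c.pc t)

theorem Base.reach_succ {c : Config K} {t : Thread} {k : K} {p s : Node} (b : Base c t k p s) :
    Reach c.shared.mem s := b.reach.succ b.succ

theorem Base.rely {c c' : Config K} {t : Thread} {k : K} {p s : Node} (hi : ListInv c)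
    (r : ListRely c c' t) (b : Base c t k p s) : Base c' t k p s where
  seen := r.seen _ b.seen
  reach := r.reach _ b.reach b.rem
  rem := by rw [r.rem _ b.seen.1.1 b.lock]; exact b.rem
  key_lt := by rw [r.key _ b.seen.1.1]; exact b.key_lt
  le_key := by rw [r.key _ (hi.reach_lt _ b.reach_succ)]; exact b.le_key
  succ := by rw [r.succ _ b.seen.1 b.lock]; exact b.succ
  lock := r.lock _ b.lock

/-- Each item of knowledge is either preserved by all steps, such as keys and `Seen`, or concerns a
field protected by a lock that `t` holds, or concerns the new node of `t`. -/
theorem ListThread.rely {c c' : Config K} {t : Thread} (hi : ListInv c)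
    (r : ListRely c c' t) : ListThread c' t (c.pc t) := by
  have h := hi.thread t
  have hb : ∀ {k p s}, Base c t k p s → Base c' t k p s := fun b => b.rely hi r
  have hk : ∀ {k p s}, Base c t k p s → (c'.shared.mem s).key = (c.shared.mem s).key :=
    fun b => r.key _ (hi.reach_lt _ b.reach_succ)
  have hl : ∀ {k p s}, Base c t k p s → s < c.shared.next :=
    fun b => hi.reach_lt _ b.reach_succ
  have hn : ∀ {k p s}, Base c t k p s → Known c s :=
    fun b => ⟨hi.reach_lt _ b.reach_succ, Or.inl b.reach_succ⟩
  generalize hq : c.pc t = q at h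
  cases q with
  | locate g x y => exact ⟨r.seen _ h.1, fun y' hy => r.seen _ (h.2 y' hy)⟩
  | choosePred u k x => exact r.seen _ h
  | lockPred u k x => exact r.seen _ h
  | readSucc u k p => exact ⟨r.seen _ h.1, r.lock _ h.2⟩
  | check u k p s =>
    exact ⟨r.seen _ h.1, r.lock _ h.2.1, by rw [r.succ _ h.1.1 h.2.1]; exact h.2.2⟩
  | inRange u k p s => exact hb h
  | failed u k p s =>
    refine ⟨hb h.1, ?_⟩
    cases u
    · rw [hk h.1]; exact h.2
    · rw [hk h.1]; exact h.2
  | delLock k p s => exact ⟨hb h.1, by rw [hk h.1]; exact h.2⟩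
  | delMark k p s => exact ⟨hb h.1, by rw [hk h.1]; exact h.2.1, r.lock _ h.2.2⟩
  | delTree k p s a =>
    exact ⟨hb h.1, by rw [hk h.1]; exact h.2.1, r.lock _ h.2.2.1,
      by rw [r.rem _ (hl h.1) h.2.2.1]; exact h.2.2.2⟩
  | delRead k p s =>
    exact ⟨hb h.1, by rw [hk h.1]; exact h.2.1, r.lock _ h.2.2.1,
      by rw [r.rem _ (hl h.1) h.2.2.1]; exact h.2.2.2⟩
  | delPred k p s y =>
    exact ⟨hb h.1, by rw [hk h.1]; exact h.2.1, r.lock _ h.2.2.1,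
      by rw [r.rem _ (hl h.1) h.2.2.1]; exact h.2.2.2.1,
      by rw [r.succ _ (hn h.1) h.2.2.1]; exact h.2.2.2.2⟩
  | delSucc k p s y =>
    obtain ⟨b, h1, h2, h3, h4, h5⟩ := h
    exact ⟨hb b, by rw [hk b]; exact h1, r.lock _ h2, by rw [r.rem _ (hl b) h2]; exact h3,
      by rw [r.succ _ (hn b) h2]; exact h4,
      by rw [r.pred _ _ _ b.reach b.succ h4 b.lock]; exact h5⟩
  | insNew k p s => exact ⟨hb h.1, by rw [hk h.1]; exact h.2⟩
  | insNewSucc k p s n =>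
    exact ⟨hb h.1, by rw [hk h.1]; exact h.2.1, h.2.2.rely r (by rw [hq]; rfl)⟩
  | insNewPred k p s n =>
    have hn : (c.pc t).hidden = some n := by rw [hq]; rfl
    exact ⟨hb h.1, by rw [hk h.1]; exact h.2.1, h.2.2.1.rely r hn,
      by rw [r.hidden _ h.2.2.1.lt hn]; exact h.2.2.2⟩
  | insSucc k p s n =>
    have hn : (c.pc t).hidden = some n := by rw [hq]; rfl
    obtain ⟨b, h1, h2, h3, h4⟩ := h
    exact ⟨hb b, by rw [hk b]; exact h1, h2.rely r hn, by rw [r.hidden _ h2.lt hn]; exact h3,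
      by rw [(r.fresh _ h2.lt hn h2.not_reach).2.1]; exact h4⟩
  | insPred k p s n =>
    have hn : (c.pc t).hidden = some n := by rw [hq]; rfl
    exact ⟨hb h.1, by rw [r.hidden _ (hl h.1) hn]; exact h.2.1,
      by rw [r.pred _ _ _ h.1.reach h.1.succ h.2.1 h.1.lock]; exact h.2.2⟩
  | insChoose k p s n => exact hb h
  | insParent k n z => exact ⟨h.1.trans_le r.next_le, h.2.imp fun p b => hb b⟩
  | insLock k n z => exact ⟨h.1.trans_le r.next_le, h.2.imp fun p b => hb b⟩
  | insChild k n z => exact ⟨h.1.trans_le r.next_le, h.2.imp fun p b => hb b⟩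
  | _ => trivial

/-- The new node of an insertion has been allocated. -/
theorem ListInv.newNode_lt {c : Config K} (hi : ListInv c) {t : Thread} {n : Node}
    (hn : (c.pc t).newNode = some n) : n < c.shared.next := by
  have h := hi.thread t
  generalize c.pc t = q at h hn
  cases q <;> simp only [PC.newNode, reduceCtorEq, Option.some.injEq] at hn <;> subst hn
  · exact h.2.2.lt
  · exact h.2.2.1.lt
  · exact h.2.2.1.lt
  · exact hi.reach_lt _ h.1.reach_succ
  · exact hi.reach_lt _ (Base.reach_succ h)
  · obtain ⟨_, p, b⟩ := h; exact hi.reach_lt _ b.reach_succ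
  · obtain ⟨_, p, b⟩ := h; exact hi.reach_lt _ b.reach_succ
  · obtain ⟨_, p, b⟩ := h; exact hi.reach_lt _ b.reach_succ

/-- What a deleting thread knows. -/
theorem ListInv.deleted_base {c : Config K} (hi : ListInv c) {t : Thread} {s : Node}
    (hn : (c.pc t).deleted = some s) : ∃ k p, Base c t k p s ∧ (c.shared.mem s).key = toKey k ∧
      c.shared.succLock s = some t ∧ (c.shared.mem s).rem = true := by
  have h := hi.thread t
  generalize c.pc t = q at h hn
  cases q <;> simp only [PC.deleted, reduceCtorEq, Option.some.injEq] at hn <;> subst hn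
  · exact ⟨_, _, h⟩
  · exact ⟨_, _, h⟩
  · exact ⟨_, _, h.1, h.2.1, h.2.2.1, h.2.2.2.1⟩
  · exact ⟨_, _, h.1, h.2.1, h.2.2.1, h.2.2.2.1⟩

/-- The successor of a node whose lock `t` holds is only deleted by `t`. -/
theorem ListInv.rem_succ {c : Config K} (hi : ListInv c) {t : Thread} {p s : Node}
    (hp : Reach c.shared.mem p) (hs : (c.shared.mem p).ptr .succ = some s)
    (hl : c.shared.succLock p = some t) (ht : (c.pc t).deleted ≠ some s) :
    (c.shared.mem s).rem = false := by
  by_contra hr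
  -- A marked node of the list has a deleter, which holds the lock of its predecessor. Predecessors
  -- are unique, so this is the lock of `p`, and the deleter is `t`.
  obtain ⟨t', ht'⟩ := hi.marked s (hp.succ hs) (by simpa using hr)
  obtain ⟨k, p', b, -⟩ := hi.deleted_base ht'
  have : p' = p := hi.sorted.pred_unique b.reach hp b.succ hs
  subst this
  have : t' = t := by have := b.lock; rw [hl] at this; exact (Option.some.inj this).symm
  subst this
  exact ht ht'

end Inv

/-- What holds for the successor list in every step. -/
structure ListHist (c c' : Config K) : Prop where
  next_le : c.shared.next ≤ c'.shared.next
  key : ∀ x, x < c.shared.next → (c'.shared.mem x).key = (c.shared.mem x).key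
  rem : ∀ x, x < c.shared.next → (c.shared.mem x).rem = true → (c'.shared.mem x).rem = true
  reach : ∀ x, Reach c.shared.mem x → Reach c'.shared.mem x ∨ (c.shared.mem x).rem = true
  -- This clause looks at the state after the step and concerns the written node; `pred` looks at
  -- the state before it and concerns the target. Together with `mark` they are what the induction
  -- over time for traversals consumes.
  succ : ∀ x, Known c x → (c'.shared.mem x).ptr .succ ≠ (c.shared.mem x).ptr .succ →
    Reach c'.shared.mem x
  pred : ∀ x, Known c x → (c'.shared.mem x).ptr .pred ≠ (c.shared.mem x).ptr .pred →
    ∃ m, (c'.shared.mem x).ptr .pred = some m ∧ Reach c.shared.mem m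
  mark : ∀ x, x < c.shared.next → (c.shared.mem x).rem = false →
    (c'.shared.mem x).rem = true → Reach c.shared.mem x

theorem ListHist.known {c c' : Config K} (h : ListHist c c') {x : Node} (hx : Known c x) :
    Known c' x := by
  refine ⟨hx.1.trans_le h.next_le, ?_⟩
  rcases hx.2 with h1 | h1
  · rcases h.reach x h1 with h2 | h2
    · exact Or.inl h2
    · exact Or.inr (h.rem x hx.1 h2)
  · exact Or.inr (h.rem x hx.1 h1)

/-! ### Steps that leave the list unchanged, and threads that do not move -/

section Acts

variable [LinearOrder K] {h h' : Shared K} {pc : Thread → PC K} {t : Thread} {q' : PC K}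

local notation "𝒸" => (Config.mk h pc : Config K)
local notation "𝒸₁" => (Config.mk h' (Function.update pc t q') : Config K)

theorem pc_other {t' : Thread} (ht : t' ≠ t) : Function.update pc t q' t' = pc t' :=
  Function.update_of_ne ht _ _

/-- A node remains seen if the thread that moves does not hide it. -/
theorem ListHist.seen (hh : ListHist 𝒸 𝒸₁) {x : Node} (hx : Seen 𝒸 x)
    (hq : q'.hidden ≠ some x) : Seen 𝒸₁ x := by
  refine ⟨hh.known hx.1, fun t' => ?_⟩
  by_cases ht : t' = t
  · subst ht; simpa using hq
  · simpa [pc_other ht] using hx.2 t'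

theorem ListInv.thread_step (hi : ListInv 𝒸) (hr : ∀ t', t' ≠ t → ListRely 𝒸 𝒸₁ t')
    (ho : ListThread 𝒸₁ t q') (t' : Thread) :
    ListThread 𝒸₁ t' (Function.update pc t q' t') := by
  by_cases ht : t' = t
  · subst ht; simpa using ho
  · simpa [pc_other ht] using ListThread.rely hi (hr t' ht)

theorem ListSame.reach (hs : ListSame h h' t) (x : Node) : Reach h'.mem x ↔ Reach h.mem x :=
  reach_congr (fun x _ => hs.succ x) x

theorem ListSame.hist (hs : ListSame h h' t) : ListHist 𝒸 𝒸₁ where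
  next_le := hs.next.ge
  key x _ := hs.key x
  rem _ _ := by simp only [hs.rem]; exact id
  reach x hx := Or.inl ((hs.reach x).2 hx)
  succ x _ hne := absurd (hs.succ x) hne
  pred x _ hne := absurd (hs.pred x) hne
  mark _ _ h1 h2 := by simp only [hs.rem] at h2; rw [h1] at h2; cases h2

theorem ListSame.seen (hs : ListSame h h' t) (hq : PCSilent (pc t) q') {x : Node}
    (hx : Seen 𝒸 x) : Seen 𝒸₁ x :=
  hs.hist.seen hx (fun he => hx.2 t (hq.hidden x he))

theorem ListSame.rely (hs : ListSame h h' t) (hq : PCSilent (pc t) q') {t' : Thread}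
    (ht : t' ≠ t) : ListRely 𝒸 𝒸₁ t' where
  next_le := hs.next.ge
  key x _ := hs.key x
  seen _ hx := hs.seen hq hx
  reach x hx _ := (hs.reach x).2 hx
  lock x := hs.lock x t' ht
  succ x _ _ := hs.succ x
  rem x _ _ := hs.rem x
  pred _ _ y _ _ _ _ := hs.pred y
  hidden n _ _ := hs.succ n
  fresh n _ _ hn := ⟨fun hn' => hn ((hs.reach n).1 hn'), hs.pred n, hs.rem n⟩

theorem ListSame.base (hs : ListSame h h' t) (hq : PCSilent (pc t) q') {k : K} {p s : Node}
    (b : Base 𝒸 t k p s) (hl : h'.succLock p = some t) : Base 𝒸₁ t k p s where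
  seen := hs.seen hq b.seen
  reach := (hs.reach p).2 b.reach
  rem := (hs.rem p).trans b.rem
  key_lt := by simp only [hs.key]; exact b.key_lt
  le_key := by simp only [hs.key]; exact b.le_key
  succ := (hs.succ p).trans b.succ
  lock := hl

theorem ListInv.silent (hi : ListInv 𝒸) (hs : ListSame h h' t) (hq : PCSilent (pc t) q')
    (ho : ListThread 𝒸₁ t q') : ListInv 𝒸₁ where
  key_min := (hs.key _).trans hi.key_min
  key_max := (hs.key _).trans hi.key_max
  reach_lt x hx := by
    simp only [hs.next]
    exact hi.reach_lt x ((hs.reach x).1 hx)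
  sorted x y hx hy := by
    simp only [hs.key]
    exact hi.sorted x y ((hs.reach x).1 hx) ((hs.succ x).symm.trans hy)
  reach_max := (hs.reach _).2 hi.reach_max
  pred_min := (hs.pred _).trans hi.pred_min
  pred_eq x y hx hy := by
    rcases hi.pred_eq x y ((hs.reach x).1 hx) ((hs.succ x).symm.trans hy) with h1 | ⟨t', h1⟩
    · exact Or.inl ((hs.pred _).trans h1)
    · refine Or.inr ⟨t', ?_⟩
      by_cases ht : t' = t
      · subst ht; simpa using hq.predGap _ h1
      · simpa [pc_other ht] using h1
  marked x hx hr := by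
    obtain ⟨t', h1⟩ := hi.marked x ((hs.reach x).1 hx) ((hs.rem x).symm.trans hr)
    refine ⟨t', ?_⟩
    by_cases ht : t' = t
    · subst ht; simpa using hq.deleted _ h1
    · simpa [pc_other ht] using h1
  pred_seen x y hx := hs.seen hq (hi.pred_seen x y ((hs.pred x).symm.trans hx))
  new_inj := by
    have key : ∀ t' n, (Function.update pc t q' t').newNode = some n →
        (pc t').newNode = some n := by
      intro t' n hn
      by_cases ht : t' = t
      · subst ht; exact hq.newNode n (by simpa using hn)
      · simpa [pc_other ht] using hn
    exact fun t1 t2 n h1 h2 => hi.new_inj t1 t2 n (key _ _ h1) (key _ _ h2)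
  thread := hi.thread_step (fun t' ht => hs.rely hq ht) ho

theorem ListInv.new_inj_of_le (hi : ListInv 𝒸) (hq : ∀ n, q'.newNode = some n → (pc t).newNode = some n) :
    ∀ (t1 t2 : Thread) (n : Node), (Function.update pc t q' t1).newNode = some n →
      (Function.update pc t q' t2).newNode = some n → t1 = t2 := by
  have key : ∀ t' n, (Function.update pc t q' t').newNode = some n →
      (pc t').newNode = some n := by
    intro t' n hn
    by_cases ht : t' = t
    · subst ht; exact hq n (by simpa using hn)
    · simpa [pc_other ht] using hn
  exact fun t1 t2 n h1 h2 => hi.new_inj t1 t2 n (key _ _ h1) (key _ _ h2)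

theorem exists_pc_of_le {α : Type*} {f : PC K → Option α} {e : α}
    (hq : f (pc t) = some e → f q' = some e) (hx : ∃ t', f (pc t') = some e) :
    ∃ t', f (Function.update pc t q' t') = some e := by
  obtain ⟨t', h1⟩ := hx
  refine ⟨t', ?_⟩
  by_cases ht : t' = t
  · subst ht; simpa using hq h1
  · simpa [pc_other ht] using h1

end Acts

/-! ### Insertion -/

section Insert

variable [LinearOrder K] {h : Shared K} {pc : Thread → PC K} {t : Thread} {k : K} {p s n : Node}

local notation "𝒸" => (Config.mk h pc : Config K)

theorem insNew_reach (hi : ListInv 𝒸) (x : Node) :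
    Reach (alloc h (toKey k)).mem x ↔ Reach h.mem x :=
  reach_congr (fun x hx => by
    have : x ≠ h.next := (hi.reach_lt x hx).ne
    simp [alloc_mem, this]) x

theorem insNew_hist (hi : ListInv 𝒸) :
    ListHist 𝒸 ⟨alloc h (toKey k), Function.update pc t (.insNewSucc k p s h.next)⟩ := by
  have hne : ∀ x, x < h.next → x ≠ h.next := fun x hx => hx.ne
  constructor <;> dsimp only
  · simp
  · intro x hx; simp [alloc_mem, hne x hx]
  · intro x hx; simp [alloc_mem, hne x hx]
  · intro x hx; exact Or.inl ((insNew_reach hi x).2 hx)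
  · intro x hx hh; simp [alloc_mem, hne x hx.1] at hh
  · intro x hx hh; simp [alloc_mem, hne x hx.1] at hh
  · intro x hx h1 h2; simp [alloc_mem, hne x hx, h1] at h2

theorem insNew_rely (hi : ListInv 𝒸) {t' : Thread} :
    ListRely 𝒸 ⟨alloc h (toKey k), Function.update pc t (.insNewSucc k p s h.next)⟩ t' := by
  have hh := insNew_hist (k := k) (t := t) (p := p) (s := s) hi
  have hne : ∀ x, x < h.next → x ≠ h.next := fun x hx => hx.ne
  constructor
  · exact hh.next_le
  · exact hh.key
  · intro x hx
    exact hh.seen hx (by simpa [PC.hidden] using (hne x hx.1.1).symm)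
  · intro x hx _; exact (insNew_reach hi x).2 hx
  · intro x hx; exact hx
  · intro x hx _; simp [alloc_mem, hne x hx.1]
  · intro x hx _; simp [alloc_mem, hne x hx]
  · intro p x y hp hx hy _
    have := hne y (hi.reach_lt y ((hp.succ hx).succ hy))
    simp [alloc_mem, this]
  · intro n hn _; simp [alloc_mem, hne n hn]
  · intro n hn _ hr
    exact ⟨fun hr' => hr ((insNew_reach hi n).1 hr'), by simp [alloc_mem, hne n hn],
      by simp [alloc_mem, hne n hn]⟩

theorem insNew_inv (hi : ListInv 𝒸) (hq : pc t = .insNew k p s) :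
    ListInv ⟨alloc h (toKey k), Function.update pc t (.insNewSucc k p s h.next)⟩ := by
  have hh := insNew_hist (k := k) (t := t) (p := p) (s := s) hi
  have hr := fun t' => insNew_rely (k := k) (t := t) (p := p) (s := s) (t' := t') hi
  have hne : ∀ x, x < h.next → x ≠ h.next := fun x hx => hx.ne
  have hmin : minNode < h.next := hi.reach_lt _ (reach_min _)
  have hmax : maxNode < h.next := hi.reach_lt _ hi.reach_max
  have ho := hi.thread t
  dsimp only at ho
  rw [hq] at ho
  have hs : s < h.next := hi.reach_lt s ho.1.reach_succ
  constructor
  · exact (hh.key _ hmin).trans hi.key_min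
  · exact (hh.key _ hmax).trans hi.key_max
  · intro x hx
    exact (hi.reach_lt x ((insNew_reach hi x).1 hx)).trans_le hh.next_le
  · intro x y hx hy
    have hx' := (insNew_reach hi x).1 hx
    simp only [alloc_mem, hne x (hi.reach_lt x hx'), if_false] at hy
    rw [hh.key x (hi.reach_lt x hx'), hh.key y (hi.reach_lt y (hx'.succ hy))]
    exact hi.sorted x y hx' hy
  · exact (insNew_reach hi _).2 hi.reach_max
  · simpa [alloc_mem, hne _ hmin] using hi.pred_min
  · intro x y hx hy
    have hx' := (insNew_reach hi x).1 hx
    simp only [alloc_mem, hne x (hi.reach_lt x hx'), if_false] at hy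
    rcases hi.pred_eq x y hx' hy with h1 | h1
    · left; simpa [alloc_mem, hne y (hi.reach_lt y (hx'.succ hy))] using h1
    · right
      exact exists_pc_of_le (t := t) (pc := pc) (by rw [hq]; simp [PC.predGap]) h1
  · intro x hx hx2
    have hx' := (insNew_reach hi x).1 hx
    simp only [alloc_mem, hne x (hi.reach_lt x hx'), if_false] at hx2
    exact exists_pc_of_le (t := t) (pc := pc) (by rw [hq]; simp [PC.deleted]) (hi.marked x hx' hx2)
  · intro x y hx
    by_cases hxn : x = h.next
    · simp [alloc_mem, hxn, blankNode] at hx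
    · simp only [alloc_mem, hxn, if_false] at hx
      exact (hr t).seen y (hi.pred_seen x y hx)
  -- New nodes of other threads are already allocated, so they differ from `h.next`.
  · have key : ∀ t1 n, t1 ≠ t → (pc t1).newNode = some n → n ≠ h.next :=
      fun t1 n _ h1 => (hi.newNode_lt h1).ne
    intro t1 t2 n h1 h2
    by_cases ht1 : t1 = t <;> by_cases ht2 : t2 = t
    · exact ht1.trans ht2.symm
    · simp only [ht1, Function.update_self, PC.newNode, Option.some.injEq] at h1
      simp only [pc_other ht2] at h2
      exact absurd h1.symm (key t2 n ht2 h2)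
    · simp only [ht2, Function.update_self, PC.newNode, Option.some.injEq] at h2
      simp only [pc_other ht1] at h1
      exact absurd h2.symm (key t1 n ht1 h1)
    · simp only [pc_other ht1] at h1
      simp only [pc_other ht2] at h2
      exact hi.new_inj t1 t2 n h1 h2
  · refine hi.thread_step (fun t' _ => hr t') ?_
    refine ⟨ho.1.rely hi (hr t), ?_, ?_⟩
    · rw [hh.key s hs]; exact ho.2
    · refine ⟨Nat.lt_succ_self _, ?_, ?_, ?_⟩
      · intro hn
        exact lt_irrefl _ (hi.reach_lt _ ((insNew_reach hi _).1 hn))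
      · simp [alloc_mem, blankNode]
      · simp [alloc_mem, blankNode]

/-! Setting the fields of a new node. -/

theorem setNew_reach {f : PtrField} {v : Option Node} (hn : ¬ Reach h.mem n) (x : Node) :
    Reach (setPtr h n f v).mem x ↔ Reach h.mem x :=
  reach_congr (fun x hx => by
    have : x ≠ n := by rintro rfl; exact hn hx
    simp [this]) x

/-- A node that is neither reachable nor marked is not `Known`, so no clause about link changes
applies to it. -/
theorem setNew_hist {f : PtrField} {v : Option Node} {q' : PC K} (hn : ¬ Reach h.mem n)
    (hn' : (h.mem n).rem = false) :
    ListHist 𝒸 ⟨setPtr h n f v, Function.update pc t q'⟩ := by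
  have hne : ∀ x, Known 𝒸 x → x ≠ n := by
    rintro x hx rfl
    rcases hx.2 with h1 | h1
    · exact hn h1
    · simp [hn'] at h1
  constructor <;> dsimp only
  · simp
  · intro x hx; simp
  · intro x hx; simp
  · intro x hx; exact Or.inl ((setNew_reach hn x).2 hx)
  · intro x hx hh; simp [hne x hx] at hh
  · intro x hx hh; simp [hne x hx] at hh
  · intro x hx h1 h2; simp [h1] at h2

theorem setNew_rely {f : PtrField} {v : Option Node} {q' : PC K} (hi : ListInv 𝒸)
    (hn : ¬ Reach h.mem n) (hn' : (h.mem n).rem = false)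
    (hq : (pc t).hidden = some n) (hq' : q'.hidden = some n)
    {t' : Thread} (ht : t' ≠ t) :
    ListRely 𝒸 ⟨setPtr h n f v, Function.update pc t q'⟩ t' := by
  have hh := setNew_hist (pc := pc) (t := t) (f := f) (v := v) (q' := q') hn hn'
  have hne : ∀ x, Reach h.mem x → x ≠ n := by rintro x hx rfl; exact hn hx
  have hnn : ∀ n', (pc t').hidden = some n' → n' ≠ n := by
    rintro n' h1 rfl
    exact ht (hi.new_inj t' t _ (PC.newNode_of_hidden h1) (PC.newNode_of_hidden hq))
  constructor
  · exact hh.next_le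
  · exact hh.key
  · intro x hx
    refine hh.seen hx ?_
    rw [hq']
    exact fun he => hx.2 t (hq.trans he)
  · intro x hx _; exact (setNew_reach hn x).2 hx
  · intro x hx; exact hx
  · intro x hx _
    have : x ≠ n := by
      rintro rfl
      rcases hx.2 with h1 | h1
      · exact hn h1
      · simp [hn'] at h1
    simp [this]
  · intro x hx _; simp
  · intro p x y hp hx hy _
    simp [hne y ((hp.succ hx).succ hy)]
  · intro n' hn h1; simp [hnn n' h1]
  · intro n' _ h1 hr
    exact ⟨fun hr' => hr ((setNew_reach hn n').1 hr'), by simp [hnn n' h1], by simp⟩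

end Insert

/-! ### Preservation of the list invariant by the writes of an insertion -/

section Insert

variable [LinearOrder K] {h : Shared K} {pc : Thread → PC K} {t : Thread} {k : K} {p s n : Node}

local notation "𝒸" => (Config.mk h pc : Config K)

theorem setNew_inv {f : PtrField} {v : Option Node} {q' : PC K} (hi : ListInv 𝒸)
    (hn : ¬ Reach h.mem n) (hn' : (h.mem n).rem = false)
    (hq : (pc t).hidden = some n) (hq' : q'.hidden = some n)
    (hqn : ∀ m, q'.newNode = some m → (pc t).newNode = some m)
    (hqg : ∀ e, (pc t).predGap ≠ some e) (hqd : ∀ e, (pc t).deleted ≠ some e)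
    (hv : ∀ x, f = .pred → v = some x → Seen 𝒸 x)
    (ho : ListThread ⟨setPtr h n f v, Function.update pc t q'⟩ t q') :
    ListInv ⟨setPtr h n f v, Function.update pc t q'⟩ := by
  have hh := setNew_hist (pc := pc) (t := t) (f := f) (v := v) (q' := q') hn hn'
  have hr : ∀ t', t' ≠ t → _ := fun t' ht => setNew_rely (f := f) (v := v) hi hn hn' hq hq' ht
  have hne : ∀ x, Reach h.mem x → x ≠ n := by rintro x hx rfl; exact hn hx
  have hseen : ∀ x, Seen 𝒸 x → Seen ⟨setPtr h n f v, Function.update pc t q'⟩ x := by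
    intro x hx
    refine hh.seen hx ?_
    rw [hq']
    exact fun he => hx.2 t (hq.trans he)
  constructor
  · simpa using hi.key_min
  · simpa using hi.key_max
  · intro x hx
    exact hi.reach_lt x ((setNew_reach hn x).1 hx)
  · intro x y hx hy
    have hx' := (setNew_reach hn x).1 hx
    simp only [setPtr_ptr, hne x hx', false_and, if_false] at hy
    simpa using hi.sorted x y hx' hy
  · exact (setNew_reach hn _).2 hi.reach_max
  · simpa [hne _ (reach_min _)] using hi.pred_min
  · intro x y hx hy
    have hx' := (setNew_reach hn x).1 hx
    simp only [setPtr_ptr, hne x hx', false_and, if_false] at hy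
    rcases hi.pred_eq x y hx' hy with h1 | h1
    · left; simpa [hne y (hx'.succ hy)] using h1
    · right
      exact exists_pc_of_le (t := t) (pc := pc) (fun he => absurd he (hqg _)) h1
  · intro x hx hx2
    have hx' := (setNew_reach hn x).1 hx
    simp only [setPtr_rem] at hx2
    exact exists_pc_of_le (t := t) (pc := pc) (fun he => absurd he (hqd _)) (hi.marked x hx' hx2)
  · intro x y hx
    simp only [setPtr_ptr] at hx
    split_ifs at hx with hc
    · exact hseen y (hv y hc.2.symm hx)
    · exact hseen y (hi.pred_seen x y hx)
  · exact hi.new_inj_of_le hqn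
  · exact hi.thread_step hr ho

theorem Base.setNew {f : PtrField} {v : Option Node} {q' : PC K} {s : Node}
    (b : Base 𝒸 t k p s) (hn : ¬ Reach h.mem n)
    (hn' : (h.mem n).rem = false) (hq : (pc t).hidden = some n) (hq' : q'.hidden = some n) :
    Base ⟨setPtr h n f v, Function.update pc t q'⟩ t k p s where
  seen := by
    refine (setNew_hist hn hn').seen b.seen ?_
    rw [hq']
    exact fun he => b.seen.2 t (hq.trans he)
  reach := (setNew_reach hn p).2 b.reach
  rem := by simpa using b.rem
  key_lt := by simpa using b.key_lt
  le_key := by simpa using b.le_key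
  succ := by
    have : p ≠ n := by rintro rfl; exact hn b.reach
    simpa [this] using b.succ
  lock := b.lock

theorem Fresh.setNew {f : PtrField} {v : Option Node} {q' : PC K}
    (b : Fresh 𝒸 k n) : Fresh ⟨setPtr h n f v, Function.update pc t q'⟩ k n where
  lt := b.lt
  not_reach := fun hx => b.not_reach ((setNew_reach b.not_reach n).1 hx)
  rem := by simpa using b.rem
  key := by simpa using b.key

theorem insNewSucc_inv (hi : ListInv 𝒸) (hq : pc t = .insNewSucc k p s n) :
    ListInv ⟨setPtr h n .succ (some s), Function.update pc t (.insNewPred k p s n)⟩ := by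
  have ho := hi.thread t
  dsimp only at ho
  rw [hq] at ho
  obtain ⟨b, hs, hf⟩ := ho
  have hq0 : (pc t).hidden = some n := by rw [hq]; rfl
  refine setNew_inv hi hf.not_reach hf.rem hq0 rfl ?_ ?_ ?_ (by simp) ?_
  · rw [hq]; exact fun m hm => hm
  · rw [hq]; simp [PC.predGap]
  · rw [hq]; simp [PC.deleted]
  · exact ⟨b.setNew hf.not_reach hf.rem hq0 rfl, by simpa using hs, hf.setNew, by simp⟩

theorem insNewPred_inv (hi : ListInv 𝒸) (hq : pc t = .insNewPred k p s n) :
    ListInv ⟨setPtr h n .pred (some p), Function.update pc t (.insSucc k p s n)⟩ := by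
  have ho := hi.thread t
  dsimp only at ho
  rw [hq] at ho
  obtain ⟨b, hs, hf, hns⟩ := ho
  have hq0 : (pc t).hidden = some n := by rw [hq]; rfl
  refine setNew_inv hi hf.not_reach hf.rem hq0 rfl ?_ ?_ ?_ ?_ ?_
  · rw [hq]; exact fun m hm => hm
  · rw [hq]; simp [PC.predGap]
  · rw [hq]; simp [PC.deleted]
  · rintro x - hx
    obtain rfl := Option.some.inj hx
    exact b.seen
  · exact ⟨b.setNew hf.not_reach hf.rem hq0 rfl, by simpa using hs, hf.setNew,
      by simpa using hns, by simp⟩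

/-! Linking the new node. -/

theorem insSucc_reach (hi : ListInv 𝒸) (hq : pc t = .insSucc k p s n) (x : Node) :
    Reach (setPtr h p .succ (some n)).mem x ↔ Reach h.mem x ∨ x = n := by
  have ho := hi.thread t
  dsimp only at ho
  rw [hq] at ho
  obtain ⟨b, hs, hf, hns, hnp⟩ := ho
  refine reach_link b.reach b.succ hns ?_ ?_ x
  · rintro rfl; exact hf.not_reach b.reach
  · intro x; simp

theorem insSucc_hist (hi : ListInv 𝒸) (hq : pc t = .insSucc k p s n) :
    ListHist 𝒸 ⟨setPtr h p .succ (some n), Function.update pc t (.insPred k p s n)⟩ := by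
  have ho := hi.thread t
  dsimp only at ho
  rw [hq] at ho
  obtain ⟨b, hs, hf, hns, hnp⟩ := ho
  constructor <;> dsimp only
  · simp
  · intro x hx; simp
  · intro x hx; simp
  · intro x hx; exact Or.inl ((insSucc_reach hi hq x).2 (Or.inl hx))
  · intro x hx hh
    by_cases hxp : x = p
    · subst hxp; exact (insSucc_reach hi hq x).2 (Or.inl b.reach)
    · simp [hxp] at hh
  · intro x hx hh; simp at hh
  · intro x hx h1 h2; simp [h1] at h2

theorem insSucc_rely (hi : ListInv 𝒸) (hq : pc t = .insSucc k p s n) {t' : Thread}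
    (ht : t' ≠ t) :
    ListRely 𝒸 ⟨setPtr h p .succ (some n), Function.update pc t (.insPred k p s n)⟩ t' := by
  have hh := insSucc_hist hi hq
  have ho := hi.thread t
  dsimp only at ho
  rw [hq] at ho
  obtain ⟨b, hs, hf, hns, hnp⟩ := ho
  have hq0 : (pc t).hidden = some n := by rw [hq]; rfl
  constructor
  · exact hh.next_le
  · exact hh.key
  · intro x hx
    refine hh.seen hx ?_
    exact fun he => hx.2 t (hq0.trans he)
  · intro x hx _; exact (insSucc_reach hi hq x).2 (Or.inl hx)
  · intro x hx; exact hx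
  · intro x hx hl
    have : x ≠ p := by
      rintro rfl
      exact ht (Option.some.inj (hl.symm.trans b.lock))
    simp [this]
  · intro x hx _; simp
  · intro p x y hp hx hy _; simp
  · intro n' hn h1
    -- The node `p` is `Seen`, so no other thread is still hiding it as its new node.
    have : n' ≠ p := by rintro rfl; exact b.seen.2 t' h1
    simp [this]
  · intro n' _ h1 hr
    refine ⟨fun hr' => ?_, by simp, by simp⟩
    rcases (insSucc_reach hi hq n').1 hr' with h2 | rfl
    · exact hr h2
    · exact ht (hi.new_inj t' t _ (PC.newNode_of_hidden h1) (PC.newNode_of_hidden hq0))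

theorem insSucc_inv (hi : ListInv 𝒸) (hq : pc t = .insSucc k p s n) :
    ListInv ⟨setPtr h p .succ (some n), Function.update pc t (.insPred k p s n)⟩ := by
  have hh := insSucc_hist hi hq
  have hR := insSucc_reach hi hq
  have ho := hi.thread t
  dsimp only at ho
  rw [hq] at ho
  obtain ⟨b, hs, hf, hns, hnp⟩ := ho
  have hq0 : (pc t).hidden = some n := by rw [hq]; rfl
  have hnep : n ≠ p := by rintro rfl; exact hf.not_reach b.reach
  have hseen : ∀ x, Seen 𝒸 x →
      Seen ⟨setPtr h p .succ (some n), Function.update pc t (.insPred k p s n)⟩ x :=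
    fun x hx => hh.seen hx (fun he => hx.2 t (hq0.trans he))
  constructor
  · simpa using hi.key_min
  · simpa using hi.key_max
  · intro x hx
    rcases (hR x).1 hx with h1 | rfl
    · exact hi.reach_lt x h1
    · exact hf.lt
  · intro x y hx hy
    simp only [setPtr_ptr, and_true] at hy
    simp only [setPtr_key]
    split_ifs at hy with hc
    · obtain rfl := Option.some.inj hy
      subst hc
      rw [hf.key]; exact b.key_lt
    · rcases (hR x).1 hx with h1 | rfl
      · exact hi.sorted x y h1 hy
      · rw [hns] at hy
        obtain rfl := Option.some.inj hy
        rw [hf.key]; exact hs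
  · exact (hR _).2 (Or.inl hi.reach_max)
  · simpa using hi.pred_min
  · intro x y hx hy
    simp only [setPtr_ptr, and_true] at hy
    simp only [setPtr_ptr, reduceCtorEq, and_false, if_false]
    split_ifs at hy with hc
    · obtain rfl := Option.some.inj hy
      subst hc
      exact Or.inl hnp
    · rcases (hR x).1 hx with h1 | rfl
      · rcases hi.pred_eq x y h1 hy with h1 | h1
        · exact Or.inl h1
        · right
          exact exists_pc_of_le (t := t) (pc := pc) (by rw [hq]; simp [PC.predGap]) h1
      · rw [hns] at hy
        obtain rfl := Option.some.inj hy
        -- The node `s` still points back to `p`; the pair of `n` and `s` is the gap that `insPred`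
        -- closes.
        exact Or.inr ⟨t, by simp [PC.predGap]⟩
  · intro x hx hx2
    simp only [setPtr_rem] at hx2
    rcases (hR x).1 hx with h1 | rfl
    · exact exists_pc_of_le (t := t) (pc := pc) (by rw [hq]; simp [PC.deleted])
        (hi.marked x h1 hx2)
    · rw [hf.rem] at hx2; cases hx2
  · intro x y hx
    simp only [setPtr_ptr, reduceCtorEq, and_false, if_false] at hx
    exact hseen y (hi.pred_seen x y hx)
  · exact hi.new_inj_of_le (by rw [hq]; exact fun m hm => hm)
  · refine hi.thread_step (fun t' ht => insSucc_rely hi hq ht) ⟨?_, ?_, ?_⟩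
    · exact ⟨hseen _ b.seen, (hR _).2 (Or.inl b.reach), by simpa using b.rem,
        by simpa using b.key_lt, by simpa using hf.key.ge, by simp, b.lock⟩
    · simpa [hnep] using hns
    · simp only [setPtr_ptr, reduceCtorEq, and_false, if_false]
      -- If `s.pred` were out of date, a thread would have the gap between `p` and `s`. A deleter of
      -- `p` would hold the lock of `p`, which `t` holds; an inserter of `p` would still hide `p`,
      -- which is `Seen`.
      have := hi.pred_eq p s b.reach b.succ
      rcases this with h1 | ⟨t', h1⟩
      · exact h1
      · exfalso
        have h2 := hi.thread t'
        dsimp only at h1 h2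
        generalize hq' : pc t' = q at h1 h2
        have hne : t' ≠ t := by
          rintro rfl
          rw [hq] at hq'; subst hq'; simp [PC.predGap] at h1
        cases q <;> simp only [PC.predGap, reduceCtorEq, Option.some.injEq, Prod.mk.injEq] at h1
        · obtain ⟨rfl, rfl⟩ := h1
          have := h2.2.2.1
          exact hne (Option.some.inj (this.symm.trans b.lock))
        · obtain ⟨rfl, rfl⟩ := h1
          exact b.seen.2 t' (by dsimp only; rw [hq']; rfl)

/-! Setting the predecessor of the successor of the new node. -/

theorem setPred_reach {y : Node} {v : Option Node} (x : Node) :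
    Reach (setPtr h y .pred v).mem x ↔ Reach h.mem x :=
  reach_congr (fun x _ => by simp) x

theorem setPred_hist {y x : Node} {q' : PC K} (hx : Reach h.mem x) :
    ListHist 𝒸 ⟨setPtr h y .pred (some x), Function.update pc t q'⟩ := by
  constructor <;> dsimp only
  · simp
  · intro x hx; simp
  · intro x hx; simp
  · intro x hx; exact Or.inl ((setPred_reach x).2 hx)
  · intro x hx hh; simp at hh
  · intro z hz hh
    by_cases hzy : z = y
    · subst hzy; exact ⟨x, by simp, hx⟩
    · simp [hzy] at hh
  · intro x hx h1 h2; simp [h1] at h2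

/-- Shared by `insPred` and `delPred`, which both write `y.pred` while they hold the lock two places
before `y`. A thread relying on the same field would hold the lock of the same node, by uniqueness
of predecessors applied twice. -/
theorem setPred_rely {m y x : Node} {q' : PC K} (hi : ListInv 𝒸) (hx : Reach h.mem x)
    (hp : Reach h.mem p) (hpm : (h.mem p).ptr .succ = some m) (hmy : (h.mem m).ptr .succ = some y)
    (hl : h.succLock p = some t)
    (hqh : ∀ m, q'.hidden = some m → (pc t).hidden = some m) {t' : Thread} (ht : t' ≠ t) :
    ListRely 𝒸 ⟨setPtr h y .pred (some x), Function.update pc t q'⟩ t' := by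
  have hh := setPred_hist (pc := pc) (t := t) (y := y) (q' := q') hx
  constructor
  · exact hh.next_le
  · exact hh.key
  · intro x hx
    exact hh.seen hx (fun he => hx.2 t (hqh x he))
  · intro x hx _; exact (setPred_reach x).2 hx
  · intro x hx; exact hx
  · intro x hx _; simp
  · intro x hx _; simp
  · intro p' m' y' hp' hm' hy' hl'
    by_cases hyy : y' = y
    · subst hyy
      obtain rfl := hi.sorted.pred_unique (hp'.succ hm') (hp.succ hpm) hy' hmy
      obtain rfl := hi.sorted.pred_unique hp' hp hm' hpm
      exact absurd (Option.some.inj (hl'.symm.trans hl)) ht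
    · simp [hyy]
  · intro n' hn h1; simp
  · intro n' _ h1 hr
    refine ⟨fun hr' => hr ((setPred_reach n').1 hr'), ?_, by simp⟩
    have : n' ≠ y := by rintro rfl; exact hr ((hp.succ hpm).succ hmy)
    simp [this]

theorem insPred_inv (hi : ListInv 𝒸) (hq : pc t = .insPred k p s n) :
    ListInv ⟨setPtr h s .pred (some n), Function.update pc t (.insChoose k p s n)⟩ := by
  have ho := hi.thread t
  dsimp only at ho
  rw [hq] at ho
  obtain ⟨b, hns, hsp⟩ := ho
  have hnr := b.reach_succ
  have hh := setPred_hist (pc := pc) (t := t) (y := s) (q' := .insChoose k p s n) hnr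
  have hR := fun x => setPred_reach (h := h) (y := s) (v := some n) x
  have hq0 : (pc t).hidden = some n := by rw [hq]; rfl
  have hseen : ∀ x, Seen 𝒸 x →
      Seen ⟨setPtr h s .pred (some n), Function.update pc t (.insChoose k p s n)⟩ x :=
    fun x hx => hh.seen hx (by simp [PC.hidden])
  have hqh : ∀ m, (PC.insChoose k p s n).hidden = some m → (pc t).hidden = some m := by
    simp [PC.hidden]
  have hsmin : s ≠ minNode := by
    rintro rfl
    have := hi.sorted _ _ hnr hns
    rw [hi.key_min] at this
    exact not_lt_bot this
  constructor
  · simpa using hi.key_min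
  · simpa using hi.key_max
  · intro x hx; exact hi.reach_lt x ((hR x).1 hx)
  · intro x y hx hy
    simp only [setPtr_ptr, reduceCtorEq, and_false, if_false] at hy
    simpa using hi.sorted x y ((hR x).1 hx) hy
  · exact (hR _).2 hi.reach_max
  · simpa [hsmin.symm] using hi.pred_min
  · intro x y hx hy
    replace hx := (hR x).1 hx
    simp only [setPtr_ptr, reduceCtorEq, and_false, if_false] at hy
    by_cases hys : y = s
    · subst hys
      obtain rfl := hi.sorted.pred_unique hx hnr hy hns
      simp
    · simp only [setPtr_ptr, hys, false_and, if_false]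
      rcases hi.pred_eq x y hx hy with h1 | h1
      · exact Or.inl h1
      · right
        refine exists_pc_of_le (t := t) (pc := pc) ?_ h1
        rw [hq]
        simp only [PC.predGap, Option.some.injEq, Prod.mk.injEq]
        exact fun he => absurd he.2.symm hys
  · intro x hx hx2
    simp only [setPtr_rem] at hx2
    exact exists_pc_of_le (t := t) (pc := pc) (by rw [hq]; simp [PC.deleted])
      (hi.marked x ((hR x).1 hx) hx2)
  · intro x y hx
    simp only [setPtr_ptr, and_true] at hx
    split_ifs at hx with hc
    -- The first predecessor link to `n` is written here, and the thread that hid `n`, unique by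
    -- `new_inj`, stops hiding it in the same step. So `n` becomes `Seen`.
    · obtain rfl := Option.some.inj hx
      refine ⟨⟨hi.reach_lt _ hnr, Or.inl ((hR _).2 hnr)⟩, fun t' => ?_⟩
      by_cases ht : t' = t
      · subst ht; simp [PC.hidden]
      · simp only [pc_other ht]
        exact fun he => ht (hi.new_inj t' t n (PC.newNode_of_hidden he) (PC.newNode_of_hidden hq0))
    · exact hseen y (hi.pred_seen x y hx)
  · exact hi.new_inj_of_le (by rw [hq]; exact fun m hm => hm)
  · refine hi.thread_step (fun t' ht => setPred_rely hi hnr b.reach b.succ hns b.lock hqh ht) ?_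
    exact ⟨hseen _ b.seen, (hR _).2 b.reach, by simpa using b.rem,
        by simpa using b.key_lt, by simpa using b.le_key, by simpa using b.succ, b.lock⟩

end Insert

/-! ### Deletion -/

section Delete

variable [LinearOrder K] {h : Shared K} {pc : Thread → PC K} {t : Thread} {k : K} {p s y : Node}

local notation "𝒸" => (Config.mk h pc : Config K)

theorem delPred_inv (hi : ListInv 𝒸) (hq : pc t = .delPred k p s y) :
    ListInv ⟨setPtr h y .pred (some p), Function.update pc t (.delSucc k p s y)⟩ := by
  have ho := hi.thread t
  dsimp only at ho
  rw [hq] at ho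
  obtain ⟨b, hsk, hsl, hsr, hsy⟩ := ho
  have hsR := b.reach_succ
  have hh := setPred_hist (pc := pc) (t := t) (y := y) (q' := .delSucc k p s y) b.reach
  have hR := fun x => setPred_reach (h := h) (y := y) (v := some p) x
  have hqh : ∀ m, (PC.delSucc k p s y).hidden = some m → (pc t).hidden = some m := by
    simp [PC.hidden]
  have hseen : ∀ x, Seen 𝒸 x →
      Seen ⟨setPtr h y .pred (some p), Function.update pc t (.delSucc k p s y)⟩ x :=
    fun x hx => hh.seen hx (by simp [PC.hidden])
  have hymin : y ≠ minNode := by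
    rintro rfl
    have := hi.sorted _ _ hsR hsy
    rw [hi.key_min] at this
    exact not_lt_bot this
  constructor
  · simpa using hi.key_min
  · simpa using hi.key_max
  · intro x hx; exact hi.reach_lt x ((hR x).1 hx)
  · intro x y hx hy
    simp only [setPtr_ptr, reduceCtorEq, and_false, if_false] at hy
    simpa using hi.sorted x y ((hR x).1 hx) hy
  · exact (hR _).2 hi.reach_max
  · simpa [hymin.symm] using hi.pred_min
  · intro x z hx hz
    replace hx := (hR x).1 hx
    simp only [setPtr_ptr, reduceCtorEq, and_false, if_false] at hz
    by_cases hzy : z = y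
    · subst hzy
      obtain rfl := hi.sorted.pred_unique hx hsR hz hsy
      -- The predecessor link now bypasses `s`, which is still in the list; the gap is charged to
      -- `t` until `s` is unlinked.
      exact Or.inr ⟨t, by simp [PC.predGap]⟩
    · simp only [setPtr_ptr, hzy, false_and, if_false]
      rcases hi.pred_eq x z hx hz with h1 | h1
      · exact Or.inl h1
      · exact Or.inr (exists_pc_of_le (t := t) (pc := pc) (by rw [hq]; simp [PC.predGap]) h1)
  · intro x hx hx2
    simp only [setPtr_rem] at hx2
    exact exists_pc_of_le (t := t) (pc := pc) (by rw [hq]; simp [PC.deleted])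
      (hi.marked x ((hR x).1 hx) hx2)
  · intro x z hx
    simp only [setPtr_ptr, and_true] at hx
    split_ifs at hx with hc
    · obtain rfl := Option.some.inj hx
      exact hseen _ b.seen
    · exact hseen z (hi.pred_seen x z hx)
  · exact hi.new_inj_of_le (by rw [hq]; exact fun m hm => hm)
  · refine hi.thread_step
      (fun t' ht => setPred_rely hi b.reach b.reach b.succ hsy b.lock hqh ht) ?_
    exact ⟨⟨hseen _ b.seen, (hR _).2 b.reach, by simpa using b.rem,
        by simpa using b.key_lt, by simpa using b.le_key, by simpa using b.succ, b.lock⟩,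
      by simpa using hsk, hsl, by simpa using hsr, by simpa using hsy, by simp⟩

/-! Marking a node. -/

theorem delMark_reach (x : Node) : Reach (setRem h s true).mem x ↔ Reach h.mem x :=
  reach_congr (fun x _ => by simp) x

theorem delMark_hist (hs : Reach h.mem s) :
    ListHist 𝒸 ⟨setRem h s true, Function.update pc t (.delTree k p s .lockNode)⟩ := by
  constructor <;> dsimp only
  · simp
  · intro x hx; simp
  · intro x hx hr; simp [hr]
  · intro x hx; exact Or.inl ((delMark_reach x).2 hx)
  · intro x hx hh; simp at hh
  · intro z hz hh; simp at hh
  · intro x hx h1 h2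
    by_cases hxs : x = s
    · subst hxs; exact hs
    · simp [h1, hxs] at h2

theorem delMark_rely (hi : ListInv 𝒸) (hq : pc t = .delMark k p s) {t' : Thread} (ht : t' ≠ t) :
    ListRely 𝒸 ⟨setRem h s true, Function.update pc t (.delTree k p s .lockNode)⟩ t' := by
  have ho := hi.thread t
  dsimp only at ho
  rw [hq] at ho
  obtain ⟨b, hsk, hsl⟩ := ho
  have hh := delMark_hist (pc := pc) (t := t) (k := k) (p := p) b.reach_succ
  constructor
  · exact hh.next_le
  · exact hh.key
  · intro x hx
    exact hh.seen hx (by simp [PC.hidden])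
  · intro x hx _; exact (delMark_reach x).2 hx
  · intro x hx; exact hx
  · intro x hx _; simp
  · intro x hx hl
    have : x ≠ s := by rintro rfl; exact ht (Option.some.inj (hl.symm.trans hsl))
    simp [this]
  · intro p x y _ _ _ _; simp
  · intro n' hn h1; simp
  · intro n' _ h1 hr
    refine ⟨fun hr' => hr ((delMark_reach n').1 hr'), by simp, ?_⟩
    have : n' ≠ s := by rintro rfl; exact hr b.reach_succ
    simp [this]

theorem delMark_inv (hi : ListInv 𝒸) (hq : pc t = .delMark k p s) :
    ListInv ⟨setRem h s true, Function.update pc t (.delTree k p s .lockNode)⟩ := by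
  have ho := hi.thread t
  dsimp only at ho
  rw [hq] at ho
  obtain ⟨b, hsk, hsl⟩ := ho
  have hh := delMark_hist (pc := pc) (t := t) (k := k) (p := p) b.reach_succ
  have hR := fun x => delMark_reach (h := h) (s := s) x
  have hseen : ∀ x, Seen 𝒸 x →
      Seen ⟨setRem h s true, Function.update pc t (.delTree k p s .lockNode)⟩ x :=
    fun x hx => hh.seen hx (by simp [PC.hidden])
  have hps : p ≠ s := by
    rintro rfl
    exact lt_irrefl _ (hi.sorted _ _ b.reach b.succ)
  constructor
  · simpa using hi.key_min
  · simpa using hi.key_max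
  · intro x hx; exact hi.reach_lt x ((hR x).1 hx)
  · intro x y hx hy
    simp only [setRem_ptr] at hy
    simpa using hi.sorted x y ((hR x).1 hx) hy
  · exact (hR _).2 hi.reach_max
  · simpa using hi.pred_min
  · intro x z hx hz
    simp only [setRem_ptr] at hz
    rcases hi.pred_eq x z ((hR x).1 hx) hz with h1 | h1
    · left; simpa using h1
    · exact Or.inr (exists_pc_of_le (t := t) (pc := pc) (by rw [hq]; simp [PC.predGap]) h1)
  · intro x hx hx2
    simp only [setRem_rem] at hx2
    by_cases hxs : x = s
    -- The only node that becomes marked is accounted for by its deleter.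
    · subst hxs; exact ⟨t, by simp [PC.deleted]⟩
    · rw [if_neg hxs] at hx2
      exact exists_pc_of_le (t := t) (pc := pc) (by rw [hq]; simp [PC.deleted])
        (hi.marked x ((hR x).1 hx) hx2)
  · intro x z hx
    simp only [setRem_ptr] at hx
    exact hseen z (hi.pred_seen x z hx)
  · exact hi.new_inj_of_le (by rw [hq]; exact fun m hm => hm)
  · refine hi.thread_step (fun t' ht => delMark_rely hi hq ht) ?_
    exact ⟨⟨hseen _ b.seen, (hR _).2 b.reach, by simpa [hps] using b.rem,
        by simpa using b.key_lt, by simpa using b.le_key, by simpa using b.succ, b.lock⟩,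
      by simpa using hsk, hsl, by simp⟩

/-! Unlinking a node. -/

theorem delSucc_reach (hi : ListInv 𝒸) (hq : pc t = .delSucc k p s y) (x : Node) :
    Reach (setPtr h p .succ (some y)).mem x ↔ Reach h.mem x ∧ x ≠ s := by
  have ho := hi.thread t
  dsimp only at ho
  rw [hq] at ho
  obtain ⟨b, hsk, hsl, hsr, hsy, hyp⟩ := ho
  refine reach_unlink hi.sorted b.reach b.succ hsy ?_ (fun x => by simp) x
  -- The key of `s` is a key of a set element, hence not `⊥`.
  rintro rfl
  exact absurd (hsk.symm.trans hi.key_min) (by simp [toKey])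

theorem delSucc_hist (hi : ListInv 𝒸) (hq : pc t = .delSucc k p s y) :
    ListHist 𝒸 ⟨setPtr h p .succ (some y), Function.update pc t (.unlock true)⟩ := by
  have hR := delSucc_reach hi hq
  have ho := hi.thread t
  dsimp only at ho
  rw [hq] at ho
  obtain ⟨b, hsk, hsl, hsr, hsy, hyp⟩ := ho
  have hps : p ≠ s := by
    rintro rfl
    exact lt_irrefl _ (hi.sorted _ _ b.reach b.succ)
  constructor <;> dsimp only
  · simp
  · intro x hx; simp
  · intro x hx; simp
  · intro x hx
    by_cases hxs : x = s
    -- Only `s` leaves the list, and it has been marked before.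
    · subst hxs; exact Or.inr hsr
    · exact Or.inl ((hR x).2 ⟨hx, hxs⟩)
  · intro x hx hh
    by_cases hxp : x = p
    · subst hxp; exact (hR x).2 ⟨b.reach, hps⟩
    · simp [hxp] at hh
  · intro x hx hh; simp at hh
  · intro x hx h1 h2; simp [h1] at h2

theorem delSucc_rely (hi : ListInv 𝒸) (hq : pc t = .delSucc k p s y) {t' : Thread}
    (ht : t' ≠ t) :
    ListRely 𝒸 ⟨setPtr h p .succ (some y), Function.update pc t (.unlock true)⟩ t' := by
  have hh := delSucc_hist hi hq
  have hR := delSucc_reach hi hq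
  have ho := hi.thread t
  dsimp only at ho
  rw [hq] at ho
  obtain ⟨b, hsk, hsl, hsr, hsy, hyp⟩ := ho
  constructor
  · exact hh.next_le
  · exact hh.key
  · intro x hx
    exact hh.seen hx (by simp [PC.hidden])
  · intro x hx hr
    refine (hR x).2 ⟨hx, ?_⟩
    rintro rfl
    exact absurd (hr.symm.trans hsr) (by simp)
  · intro x hx; exact hx
  · intro x hx hl
    have : x ≠ p := by
      rintro rfl
      exact ht (Option.some.inj (hl.symm.trans b.lock))
    simp [this]
  · intro x hx _; simp
  · intro p x y hp hx hy _; simp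
  · intro n' hn h1
    have : n' ≠ p := by rintro rfl; exact b.seen.2 t' h1
    simp [this]
  · intro n' _ h1 hr
    exact ⟨fun hr' => hr ((hR n').1 hr').1, by simp, by simp⟩

theorem delSucc_inv (hi : ListInv 𝒸) (hq : pc t = .delSucc k p s y) :
    ListInv ⟨setPtr h p .succ (some y), Function.update pc t (.unlock true)⟩ := by
  have hh := delSucc_hist hi hq
  have hR := delSucc_reach hi hq
  have ho := hi.thread t
  dsimp only at ho
  rw [hq] at ho
  obtain ⟨b, hsk, hsl, hsr, hsy, hyp⟩ := ho
  constructor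
  · simpa using hi.key_min
  · simpa using hi.key_max
  · intro x hx
    exact hi.reach_lt x ((hR x).1 hx).1
  · intro x z hx hz
    have hx := ((hR x).1 hx).1
    simp only [setPtr_ptr, and_true] at hz
    simp only [setPtr_key]
    split_ifs at hz with hc
    · obtain rfl := Option.some.inj hz
      subst hc
      exact (hi.sorted _ _ b.reach b.succ).trans (hi.sorted _ _ b.reach_succ hsy)
    · exact hi.sorted x z hx hz
  · refine (hR _).2 ⟨hi.reach_max, ?_⟩
    rintro rfl
    refine absurd (hsk.symm.trans hi.key_max) ?_
    simp only [toKey]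
    exact fun he => WithTop.coe_ne_top (WithBot.coe_injective he)
  · simpa using hi.pred_min
  · intro x z hx hz
    obtain ⟨hx, hxs⟩ := (hR x).1 hx
    simp only [setPtr_ptr, and_true] at hz
    simp only [setPtr_ptr, reduceCtorEq, and_false, if_false]
    split_ifs at hz with hc
    · obtain rfl := Option.some.inj hz
      subst hc
      -- The link `y.pred` has already been set to `p`, so the new pair of neighbours is consistent
      -- at once.
      exact Or.inl hyp
    · rcases hi.pred_eq x z hx hz with h1 | h1
      · exact Or.inl h1
      · right
        refine exists_pc_of_le (t := t) (pc := pc) ?_ h1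
        rw [hq]
        simp only [PC.predGap, Option.some.injEq, Prod.mk.injEq]
        exact fun he => absurd he.1.symm hxs
  · intro x hx hx2
    obtain ⟨hx, hxs⟩ := (hR x).1 hx
    simp only [setPtr_rem] at hx2
    refine exists_pc_of_le (t := t) (pc := pc) ?_ (hi.marked x hx hx2)
    rw [hq]
    simp only [PC.deleted, Option.some.injEq]
    exact fun he => absurd he.symm hxs
  · intro x z hx
    simp only [setPtr_ptr, reduceCtorEq, and_false, if_false] at hx
    exact hh.seen (hi.pred_seen x z hx) (by simp [PC.hidden])
  · exact hi.new_inj_of_le (by rw [hq]; exact fun m hm => by simp [PC.newNode] at hm)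
  · exact hi.thread_step (fun t' ht => delSucc_rely hi hq ht) trivial

end Delete

/-! ### All steps -/

section Steps

variable [LinearOrder K] {h h' : Shared K} {pc : Thread → PC K} {t : Thread} {q q' : PC K}

local notation "𝒸" => (Config.mk h pc : Config K)
local notation "𝒸₁" => (Config.mk h' (Function.update pc t q') : Config K)

theorem ListAct.hist (hi : ListInv 𝒸) (hq : pc t = q) (ha : ListAct t h q h' q') :
    ListHist 𝒸 𝒸₁ := by
  have ho := hi.thread t
  dsimp only at ho
  rw [hq] at ho
  cases ha with
  | silent _ _ _ hs _ => exact hs.hist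
  | insNew k p s => exact insNew_hist hi
  | insNewSucc k p s n => exact setNew_hist ho.2.2.not_reach ho.2.2.rem
  | insNewPred k p s n => exact setNew_hist ho.2.2.1.not_reach ho.2.2.1.rem
  | insSucc k p s n => exact insSucc_hist hi hq
  | insPred k p s n => exact setPred_hist ho.1.reach_succ
  | delMark k p s => exact delMark_hist ho.1.reach_succ
  | delPred k p s y => exact setPred_hist ho.1.reach
  | delSucc k p s y => exact delSucc_hist hi hq

theorem ListAct.rely (hi : ListInv 𝒸) (hq : pc t = q) (ha : ListAct t h q h' q') {t' : Thread}
    (ht : t' ≠ t) : ListRely 𝒸 𝒸₁ t' := by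
  have ho := hi.thread t
  dsimp only at ho
  rw [hq] at ho
  cases ha with
  | silent _ _ _ hs hqq => exact hs.rely (by rw [hq]; exact hqq) ht
  | insNew k p s => exact insNew_rely hi
  | insNewSucc k p s n =>
    exact setNew_rely hi ho.2.2.not_reach ho.2.2.rem (by rw [hq]; rfl) rfl ht
  | insNewPred k p s n =>
    exact setNew_rely hi ho.2.2.1.not_reach ho.2.2.1.rem (by rw [hq]; rfl) rfl ht
  | insSucc k p s n => exact insSucc_rely hi hq ht
  | insPred k p s n =>
    exact setPred_rely hi ho.1.reach_succ ho.1.reach ho.1.succ ho.2.1 ho.1.lock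
      (by simp [PC.hidden]) ht
  | delMark k p s => exact delMark_rely hi hq ht
  | delPred k p s y =>
    exact setPred_rely hi ho.1.reach ho.1.reach ho.1.succ ho.2.2.2.2 ho.1.lock
      (by simp [PC.hidden]) ht
  | delSucc k p s y => exact delSucc_rely hi hq ht

theorem listThread_afterLocate {c : Config K} {x : Node} (hx : Seen c x) (g : Goal K) :
    ListThread c t (afterLocate x g) := by
  rcases g with (k | ⟨u, k⟩) | ⟨κ, d, e⟩
  · trivial
  · exact hx
  · trivial

/-- The invariant of the successor list is preserved, provided that tree links lead to nodes that
are or were in the list. -/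
theorem TStep.listInv {l : Label K} (hi : ListInv 𝒸)
    (htree : ∀ x d y, (h.mem x).ptr (Side.fld d) = some y → Seen 𝒸 y)
    (hq : pc t = q) (hst : TStep t h q l h' q') : ListInv 𝒸₁ := by
  have ho := hi.thread t
  dsimp only at ho
  rw [hq] at ho
  -- Every search starts here. The node is never hidden: a hidden node is either not in the list or,
  -- in `insPred`, has a successor with a larger key, which is impossible for the key `⊤`.
  have hmax : Seen 𝒸 maxNode := by
    refine ⟨⟨hi.reach_lt _ hi.reach_max, Or.inl hi.reach_max⟩, fun t' he => ?_⟩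
    have h1 := hi.thread t'
    dsimp only at h1 he
    have hk : (h.mem maxNode).key = ⊤ := hi.key_max
    have hkt : ∀ k : K, (⊤ : Key K) ≠ toKey k := by
      intro k he
      exact WithTop.coe_ne_top (WithBot.coe_injective he.symm)
    generalize pc t' = q1 at h1 he
    cases q1 <;> simp only [PC.hidden, reduceCtorEq, Option.some.injEq] at he <;> subst he
    · exact h1.2.2.not_reach hi.reach_max
    · exact h1.2.2.1.not_reach hi.reach_max
    · exact h1.2.2.1.not_reach hi.reach_max
    · have := hi.sorted _ _ h1.1.reach_succ h1.2.1
      dsimp only at this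
      rw [hk] at this
      exact not_top_lt this
  have ha := hst.listAct
  cases ha with
  | silent _ _ _ hs hqq =>
    have hqq' : PCSilent (pc t) q' := by rw [hq]; exact hqq
    refine hi.silent hs hqq' ?_
    have hsn : ∀ {x}, Seen 𝒸 x → Seen 𝒸₁ x := fun hx => hs.seen hqq' hx
    have hb : ∀ {k : K} {p s : Node}, Base 𝒸 t k p s → h'.succLock p = some t →
      Base 𝒸₁ t k p s := fun b hl => hs.base hqq' b hl
    cases hst with
    | call => exact ⟨hsn hmax, fun y hy => by obtain rfl := Option.some.inj hy; exact hsn hmax⟩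
    | startRotate =>
      exact ⟨hsn hmax, fun y hy => by obtain rfl := Option.some.inj hy; exact hsn hmax⟩
    | restart => exact ⟨hsn hmax, fun y hy => by obtain rfl := Option.some.inj hy; exact hsn hmax⟩
    | locateNull g x => exact listThread_afterLocate (hsn ho.1) g
    | locateFound g x y => exact listThread_afterLocate (hsn (ho.2 y rfl)) g
    | locateRight g x y hk =>
      exact ⟨hsn (ho.2 y rfl), fun z hz => hsn (htree y .right z hz)⟩
    | locateLeft g x y hk =>
      exact ⟨hsn (ho.2 y rfl), fun z hz => hsn (htree y .left z hz)⟩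
    | choosePred u k x p hk hp => exact hsn (hi.pred_seen _ _ hp)
    | chooseSelf u k x hk => exact hsn ho
    | lockPred u k p hl => exact ⟨hsn ho, by simp⟩
    | readSucc u k p s hps =>
      exact ⟨hsn ho.1, ho.2, hps⟩
    | checkOk u k p s hc =>
      refine hb ⟨ho.1, ?_, hc.2, hc.1.1, hc.1.2, ho.2.2, ho.2.1⟩ ho.2.1
      -- A node that was once in the list and is unmarked is still in it; hence the test of `p.rem`
      -- under the lock of `p` suffices.
      rcases ho.1.1.2 with h1 | h1
      · exact h1
      · exact absurd (h1.symm.trans hc.2) (by simp)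
    | delAbsent k p s hk => exact ⟨hb ho ho.lock, lt_of_le_of_ne ho.le_key (Ne.symm hk)⟩
    | delPresent k p s hk => exact ⟨hb ho ho.lock, hk⟩
    | delLock k p s hl =>
      refine ⟨hb ho.1 ?_, ho.2, by simp⟩
      have := ho.1.lock
      dsimp only at this
      simp [this]
    | delTree _ k p s q q' hq =>
      have h1 := hq.listSame.2
      refine ⟨hb ho.1 (by rw [h1]; exact ho.1.lock), (hs.key _).trans ho.2.1, ?_,
        (hs.rem _).trans ho.2.2.2⟩
      rw [h1]; exact ho.2.2.1
    | delTreeReturn _ k p s q hq =>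
      have h1 := hq.listSame.2
      refine ⟨hb ho.1 (by rw [h1]; exact ho.1.lock), (hs.key _).trans ho.2.1, ?_,
        (hs.rem _).trans ho.2.2.2⟩
      rw [h1]; exact ho.2.2.1
    | delRead k p s y hy => exact ⟨hb ho.1 ho.1.lock, ho.2.1, ho.2.2.1, ho.2.2.2, hy⟩
    | insPresent k p s hk => exact ⟨hb ho ho.lock, hk⟩
    | insAbsent k p s hk => exact ⟨hb ho ho.lock, lt_of_le_of_ne ho.le_key (Ne.symm hk)⟩
    | insChoose k p s n z hz => exact ⟨hz, p, hb ho ho.lock⟩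
    | insParent k n z =>
      obtain ⟨hz, p, b⟩ := ho
      exact ⟨hz, p, hb b b.lock⟩
    | insLock k n z hl =>
      obtain ⟨hz, p, b⟩ := ho
      exact ⟨hz, p, hb b b.lock⟩
    -- The pairing of a writing step with `silent` is not excluded by its shape. The knowledge of
    -- `t` is then taken from the lemma about that step.
    | insNew k p s => simpa only [Function.update_self] using (insNew_inv hi hq).thread t
    | insNewSucc k p s n => simpa only [Function.update_self] using (insNewSucc_inv hi hq).thread t
    | insNewPred k p s n => simpa only [Function.update_self] using (insNewPred_inv hi hq).thread t
    | insSucc k p s n => simpa only [Function.update_self] using (insSucc_inv hi hq).thread t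
    | insPred k p s n => simpa only [Function.update_self] using (insPred_inv hi hq).thread t
    | delMark k p s => simpa only [Function.update_self] using (delMark_inv hi hq).thread t
    | delPred k p s y => simpa only [Function.update_self] using (delPred_inv hi hq).thread t
    | delSucc k p s y => simpa only [Function.update_self] using (delSucc_inv hi hq).thread t
    | _ => trivial
  | insNew k p s => exact insNew_inv hi hq
  | insNewSucc k p s n => exact insNewSucc_inv hi hq
  | insNewPred k p s n => exact insNewPred_inv hi hq
  | insSucc k p s n => exact insSucc_inv hi hq
  | insPred k p s n => exact insPred_inv hi hq
  | delMark k p s => exact delMark_inv hi hq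
  | delPred k p s y => exact delPred_inv hi hq
  | delSucc k p s y => exact delSucc_inv hi hq

end Steps

/-! ## The invariant of the tree -/

/-- The node that a thread has locked tentatively in `updateChild`. -/
def PC.freshLock : PC K → Option Node
  | .delTree _ _ _ (.uc _ _ _ (.validate w true)) => some w
  | _ => none

/-- The node that a deletion has marked and not yet unlinked from the tree. -/
def PC.removing : PC K → Option Node
  | .delTree _ _ _ (.uc _ _ none (.setParent _)) => none
  | .delTree _ _ s _ => some s
  | _ => none

/-- Thread `t` holds the tree lock of `w` until the end of its operation. -/
def Own (c : Config K) (t : Thread) (w : Node) : Prop :=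
  c.shared.treeLock w = some t ∧ (c.pc t).freshLock ≠ some w

/-- `x` has not been unlinked from the tree. -/
def InTree (c : Config K) (x : Node) : Prop :=
  (c.shared.mem x).rem = false ∨ ∃ t, (c.pc t).removing = some x

/-- No insertion is about to link `m` to the tree. -/
def NotNew (c : Config K) (m : Node) : Prop := ∀ t, (c.pc t).newNode ≠ some m

/-- A tree link that leads from a node of the tree to `m`. -/
structure TreeEdge (c : Config K) (w : Node) (d : Side) (m : Node) : Prop where
  inTree : InTree c w
  ptr : (c.shared.mem w).ptr d.fld = some m

/-- `m` has at most one incoming link, and it comes from the parent. -/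
def Settled (c : Config K) (m : Node) : Prop :=
  ∀ w d, TreeEdge c w d m → (c.shared.mem m).ptr .parent = some w ∧
    ∀ w' d', TreeEdge c w' d' m → w' = w ∧ d' = d

/-- Apart from links from `n`, `m` has at most one incoming link, and it comes from the parent. -/
def SettledExcept (c : Config K) (n m : Node) : Prop :=
  ∀ w d, TreeEdge c w d m → w ≠ n → (c.shared.mem m).ptr .parent = some w ∧
    ∀ w' d', TreeEdge c w' d' m → w' ≠ n → w' = w ∧ d' = d

/-- The parent of `m` is `v`, which is locked by `t`. -/
structure Par (c : Config K) (t : Thread) (m v : Node) : Prop where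
  lt : m < c.shared.next
  ptr : (c.shared.mem m).ptr .parent = some v
  own : Own c t v

/-- The parent of `m` is locked by `t`. -/
def OwnPar (c : Config K) (t : Thread) (m : Node) : Prop := ∃ v, Par c t m v

/-- The sources of the links to `m` are locked by `t`. -/
def SrcOwned (c : Config K) (t : Thread) (m : Node) : Prop := ∀ w d, TreeEdge c w d m → Own c t w

/-- The children of `n` remain in the tree. -/
structure KeepChildren (c : Config K) (t : Thread) (n : Node) : Prop where
  own : Own c t n
  child : ∀ f m, (c.shared.mem n).ptr (Side.fld f) = some m → m = n ∨ (InTree c m ∧ OwnPar c t m)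

/-- Rotations, from the first write on: the links of `p`, `y` and `x`. -/
structure RotLinks (c : Config K) (t : Thread) (d e : Side) (p y x : Node) : Prop where
  own_p : Own c t p
  own_y : Own c t y
  own_x : Own c t x
  inTree_y : InTree c y
  inTree_x : InTree c x
  seen_y : Seen c y
  new_y : NotNew c y
  new_x : NotNew c x
  ptr_p : (c.shared.mem p).ptr d.fld = some x
  par_y : Par c t y p
  -- Self-loops occur, since an insertion may choose the new node as its own parent. If `y` is its
  -- own child on side `e`, its only incoming link is both this one and the link from `p`.
  loop : x = y → p = y ∧ d = e
  in_x : ∀ w f, TreeEdge c w f x → (w = p ∧ f = d) ∨ (w = y ∧ f = e)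
  in_y : ∀ w f, TreeEdge c w f y → w = p ∧ f = d

/-- Rotations, once `y` has been unlinked. -/
structure RotUnlinked (c : Config K) (t : Thread) (y x : Node) : Prop where
  own_y : Own c t y
  own_x : Own c t x
  inTree_y : InTree c y
  inTree_x : InTree c x
  seen_y : Seen c y
  new_y : NotNew c y
  par_y : OwnPar c t y

/-- What thread `t` knows about the tree at program point `q` of a rotation. -/
def RotThread (c : Config K) (t : Thread) (d e : Side) : RotPoint → Prop
  | .lockP p => p < c.shared.next
  | .checkP p => Own c t p
  | .readY p => Own c t p ∧ InTree c p
  | .lockY p y => Own c t p ∧ InTree c p ∧ (c.shared.mem p).ptr d.fld = some y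
  | .readX p y => Own c t p ∧ InTree c p ∧ (c.shared.mem p).ptr d.fld = some y ∧ Own c t y
  | .lockX p y x => Own c t p ∧ InTree c p ∧ (c.shared.mem p).ptr d.fld = some y ∧ Own c t y ∧
      (c.shared.mem y).ptr e.fld = some x
  | .linkX p y x => Own c t p ∧ InTree c p ∧ (c.shared.mem p).ptr d.fld = some y ∧ Own c t y ∧
      (c.shared.mem y).ptr e.fld = some x ∧ Own c t x
  | .parentX p y x => RotLinks c t d e p y x ∧ Par c t x y
  | .readC y x => ∃ p, RotLinks c t d e p y x ∧ Par c t x p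
  | .linkC y x v => ∃ p, RotLinks c t d e p y x ∧ Par c t x p ∧
      (c.shared.mem x).ptr e.opp.fld = v
  | .parentC y x v => RotUnlinked c t y x ∧ (∀ w f, ¬ TreeEdge c w f y) ∧
      (c.shared.mem x).ptr e.opp.fld = v ∧ ∀ m, v = some m → Par c t m x ∧ NotNew c m ∧
        ∀ w f, TreeEdge c w f m → (w = x ∧ f = e.opp) ∨ (w = y ∧ f = e)
  | .linkY y x => RotUnlinked c t y x ∧ (∀ w f, ¬ TreeEdge c w f y) ∧
      ∀ m, (c.shared.mem x).ptr e.opp.fld = some m → Par c t m y ∧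
        ∀ w f, TreeEdge c w f m → (w = x ∧ f = e.opp) ∨ (w = y ∧ f = e)
  | .parentY y x => RotUnlinked c t y x ∧ (∀ w f, TreeEdge c w f y → w = x ∧ f = e.opp)
  | .unlock => True

/-- What thread `t` knows inside `updateChild(m.parent, m, ·)` before the write. -/
def UCThread (c : Config K) (t : Thread) (m : Node) : UCPoint → Prop
  | .readParent => True
  | .lockParent p => p < c.shared.next
  | .validate p _ => c.shared.treeLock p = some t
  | .test p => Par c t m p
  | .write p d => Par c t m p ∧ (d = .left → (c.shared.mem p).ptr .left = some m) ∧
      (d = .right → (c.shared.mem p).ptr .left ≠ some m)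
  | .setParent _ => False

/-- `removeFromTree(n)` while the children of `n` are copied to `s`. -/
structure Copying (c : Config K) (t : Thread) (n s : Node) : Prop where
  own_n : Own c t n
  own_s : Own c t s
  succ : (c.shared.mem n).ptr .succ = some s
  par_s : OwnPar c t s
  -- A link from `s` to itself is tolerated here, because both links of `s` are about to be
  -- overwritten.
  in_s : ∀ w f, TreeEdge c w f s → w = s
  child : ∀ f m, (c.shared.mem s).ptr (Side.fld f) = some m →
    OwnPar c t m ∧ SettledExcept c s m ∧ SrcOwned c t m

/-- `removeFromTree(n)` while the parents of the children of `n` are set to `s`; at present they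
are `pl` and `pr`. -/
structure Adopting (c : Config K) (t : Thread) (n s pl pr : Node) : Prop where
  own_n : Own c t n
  own_s : Own c t s
  succ : (c.shared.mem n).ptr .succ = some s
  par_s : OwnPar c t s
  in_s : ∀ w f, ¬ TreeEdge c w f s
  same : ∀ f : Side, (c.shared.mem s).ptr f.fld = (c.shared.mem n).ptr f.fld
  left : ∀ m, (c.shared.mem n).ptr .left = some m → Par c t m pl
  right : ∀ m, (c.shared.mem n).ptr .right = some m → Par c t m pr
  child : ∀ f m, (c.shared.mem n).ptr (Side.fld f) = some m →
    ∀ w g, TreeEdge c w g m → (w = n ∨ w = s) ∧ g = f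

/-- `removeFromTree(n)` before `n` is replaced by `v`. -/
structure Replacing (c : Config K) (t : Thread) (n : Node) (v : Option Node) : Prop where
  own : Own c t n
  -- The last conjunct serves a node `n` that is its own child: then the link to be overwritten is
  -- one of its own.
  target : ∀ m, v = some m → InTree c m ∧ Seen c m ∧ NotNew c m ∧ OwnPar c t m ∧
    (∀ w f, TreeEdge c w f m → w = n) ∧ (m = n → Par c t n n)
  child : ∀ f m, (c.shared.mem n).ptr (Side.fld f) = some m →
    OwnPar c t m ∧ SettledExcept c n m ∧ SrcOwned c t m

/-- `removeFromTree(n)` before `s` is unlinked from its old place and replaced by `v`. -/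
structure Unlinking (c : Config K) (t : Thread) (n s : Node) (v : Option Node) : Prop where
  own_n : Own c t n
  own_s : Own c t s
  succ : (c.shared.mem n).ptr .succ = some s
  right : (c.shared.mem s).ptr .right = v

/-- `removeFromTree(n)` after `s` has been replaced by `v` as a child of `q`. -/
structure Unlinked (c : Config K) (t : Thread) (n s : Node) (v : Option Node) (q : Node) :
    Prop where
  own_n : Own c t n
  own_s : Own c t s
  own_q : Own c t q
  succ : (c.shared.mem n).ptr .succ = some s
  par_s : OwnPar c t s
  in_s : ∀ w f, TreeEdge c w f s → w = s
  target : ∀ m, v = some m → NotNew c m ∧ Par c t m s ∧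
    ∃ d, ∀ w f, TreeEdge c w f m → w = s ∨ (w = q ∧ f = d)
  child : ∀ f m, (c.shared.mem s).ptr (Side.fld f) = some m → v ≠ some m →
    Par c t m s ∧ ∀ w g, TreeEdge c w g m → w = s

/-- `removeFromTree(n)` after `n` has been replaced by `v` as a child of `q`. -/
structure Replaced (c : Config K) (t : Thread) (n : Node) (v : Option Node) (q : Node) :
    Prop where
  own_q : Own c t q
  keep : KeepChildren c t n
  target : ∀ m, v = some m → NotNew c m ∧ OwnPar c t m ∧
    ∃ d, ∀ w f, TreeEdge c w f m → w = q ∧ f = d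

/-- What thread `t` knows about the tree at program point `q` of `removeFromTree(n)`. -/
def RmThread (c : Config K) (t : Thread) (n : Node) : RmPoint → Prop
  | .lockNode => True
  | .testLeft => Own c t n
  | .testRight => Own c t n
  | .oneChild _ => Own c t n
  | .readSucc => Own c t n
  | .lockSucc s => Own c t n ∧ (c.shared.mem n).ptr .succ = some s
  | .unlinkSucc s => Own c t n ∧ (c.shared.mem n).ptr .succ = some s ∧ Own c t s
  | .copyRead s .left => Copying c t n s
  | .copyWrite s .left v => Copying c t n s ∧ (c.shared.mem n).ptr .left = v
  | .copyRead s .right => Copying c t n s ∧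
      (c.shared.mem s).ptr .left = (c.shared.mem n).ptr .left
  | .copyWrite s .right v => Copying c t n s ∧
      (c.shared.mem s).ptr .left = (c.shared.mem n).ptr .left ∧ (c.shared.mem n).ptr .right = v
  | .adoptRead s .left => Adopting c t n s n n
  | .adoptWrite s .left v => Adopting c t n s n n ∧ (c.shared.mem n).ptr .left = v
  | .adoptRead s .right => Adopting c t n s s n
  | .adoptWrite s .right v => Adopting c t n s s n ∧ (c.shared.mem n).ptr .right = v
  | .uc m v (some s) (.setParent q) => m = s ∧ Unlinked c t n s v q
  | .uc m v (some s) q => m = s ∧ Unlinking c t n s v ∧ UCThread c t s q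
  | .uc m v none (.setParent q) => m = n ∧ Replaced c t n v q
  | .uc m v none q => m = n ∧ Replacing c t n v ∧ UCThread c t n q

/-- What thread `t` knows about the tree at program point `q`. -/
def TreeThread (c : Config K) (t : Thread) : PC K → Prop
  | .rot d e q => RotThread c t d e q
  | .delTree _ _ n q => RmThread c t n q
  | .delRead _ _ n => KeepChildren c t n
  | .delPred _ _ n _ => KeepChildren c t n
  | .delSucc _ _ n _ => KeepChildren c t n
  | .insNewSucc _ _ _ n => (c.shared.mem n).ptr .parent = none
  | .insNewPred _ _ _ n => (c.shared.mem n).ptr .parent = none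
  | .insSucc _ _ _ n => (c.shared.mem n).ptr .parent = none
  | .insPred _ _ _ n => (c.shared.mem n).ptr .parent = none
  | .insChoose _ _ _ n => (c.shared.mem n).ptr .parent = none
  | .insParent _ n _ => (c.shared.mem n).ptr .parent = none
  | .insLock _ n z => (c.shared.mem n).ptr .parent = some z
  | .insChild _ n z => (c.shared.mem n).ptr .parent = some z ∧ Own c t z
  | _ => True

/-- The nodes whose incoming links are being rearranged by a thread. -/
def Transit (c : Config K) (m : Node) : PC K → Prop
  | .rot _ _ (.parentX _ y x) => m = x ∨ m = y
  | .rot _ _ (.readC y x) => m = x ∨ m = y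
  | .rot _ _ (.linkC y x _) => m = x ∨ m = y
  | .rot _ _ (.parentC y _ v) => m = y ∨ v = some m
  | .rot _ e (.linkY y x) => m = y ∨ (c.shared.mem x).ptr e.opp.fld = some m
  | .rot _ _ (.parentY y _) => m = y
  | .delTree _ _ _ (.copyRead s _) => m = s ∨ ∃ f : Side, (c.shared.mem s).ptr f.fld = some m
  | .delTree _ _ _ (.copyWrite s _ _) => m = s ∨ ∃ f : Side, (c.shared.mem s).ptr f.fld = some m
  | .delTree _ _ n (.adoptRead s _) => m = s ∨ ∃ f : Side, (c.shared.mem n).ptr f.fld = some m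
  | .delTree _ _ n (.adoptWrite s _ _) => m = s ∨ ∃ f : Side, (c.shared.mem n).ptr f.fld = some m
  | .delTree _ _ _ (.uc _ v (some s) (.setParent _)) => m = s ∨ v = some m
  | .delTree _ _ _ (.uc _ _ (some _) _) => False
  | .delTree _ _ _ (.uc _ v none (.setParent _)) => v = some m
  | .delTree _ _ n (.uc _ v none _) =>
      v = some m ∨ ∃ f : Side, (c.shared.mem n).ptr f.fld = some m
  | _ => False

/-- No shape of a tree is asserted. The clause `edge` concerns links of all nodes, also of removed
ones, on which searches may stand; `edge_inTree` and `settled` concern only links from nodes of the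
tree. -/
structure TreeInv (c : Config K) : Prop where
  lock_lt : ∀ w t, c.shared.treeLock w = some t → w < c.shared.next
  parent_lt : ∀ w v, (c.shared.mem w).ptr .parent = some v → v < c.shared.next
  edge : ∀ w d m, (c.shared.mem w).ptr (Side.fld d) = some m → Seen c m ∧ NotNew c m
  edge_inTree : ∀ w d m, TreeEdge c w d m → InTree c m
  settled : ∀ m, Settled c m ∨ ∃ t, Transit c m (c.pc t)
  thread : ∀ t, TreeThread c t (c.pc t)

/-! ### Guarantees -/

/-- What thread `t` guarantees to the other threads when it makes a step. -/
structure TreeGuar (c c' : Config K) (t : Thread) : Prop where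
  pc : ∀ t', t' ≠ t → c'.pc t' = c.pc t'
  next_le : c.shared.next ≤ c'.shared.next
  seen : ∀ x, Seen c x → Seen c' x
  notNew : ∀ x, x < c.shared.next → NotNew c x → NotNew c' x
  lock : ∀ w t', t' ≠ t → c.shared.treeLock w = some t' → c'.shared.treeLock w = some t'
  fld : ∀ w d, w < c.shared.next →
    (c'.shared.mem w).ptr (Side.fld d) ≠ (c.shared.mem w).ptr d.fld →
    c.shared.treeLock w = some t
  -- Ownership of the present parent of `m` is the right to change that parent, to create a link to
  -- `m`, and, together with ownership of `m`, to take `m` out of the tree. A node whose parent is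
  -- still null receives its first one without a lock.
  par : ∀ m, m < c.shared.next → (c'.shared.mem m).ptr .parent ≠ (c.shared.mem m).ptr .parent →
    ((c.shared.mem m).ptr .parent = none ∨ OwnPar c t m) ∧
      ∀ t', t' ≠ t → (c.pc t').newNode ≠ some m
  edge : ∀ w d m, TreeEdge c' w d m → TreeEdge c w d m ∨ OwnPar c t m
  inTree : ∀ x, x < c.shared.next → InTree c x → ¬ InTree c' x → Own c t x ∧ OwnPar c t x

section Stability

variable {c c' : Config K} {t t' : Thread}

theorem Own.eq {w : Node} (h : Own c t w) (h' : Own c t' w) : t = t' :=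
  Option.some.inj (h.1.symm.trans h'.1)

/-- A node has one parent and a lock has one holder, so at most one thread has the right to
rearrange the links to a node. -/
theorem OwnPar.eq {w : Node} (h : OwnPar c t w) (h' : OwnPar c t' w) : t = t' := by
  obtain ⟨v, h⟩ := h
  obtain ⟨v', h'⟩ := h'
  obtain rfl := Option.some.inj (h.ptr.symm.trans h'.ptr)
  exact h.own.eq h'.own

/-- What a step does not change for a thread `t`: the nodes that it owns and the nodes whose
parents it owns. -/
structure Keep (c c' : Config K) (t : Thread) : Prop where
  next_le : c.shared.next ≤ c'.shared.next
  seen : ∀ x, Seen c x → Seen c' x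
  notNew : ∀ x, x < c.shared.next → NotNew c x → NotNew c' x
  own_lt : ∀ w, Own c t w → w < c.shared.next
  own : ∀ w, Own c t w → Own c' t w
  fld : ∀ w, Own c t w → ∀ d : Side, (c'.shared.mem w).ptr d.fld = (c.shared.mem w).ptr d.fld
  par : ∀ m v, Par c t m v → Par c' t m v
  edge : ∀ w d m, OwnPar c t m → TreeEdge c' w d m → TreeEdge c w d m
  inTree : ∀ x, InTree c x → Own c t x ∨ OwnPar c t x → InTree c' x

/-- If a clause failed, the guarantee of `t'` would make it hold a lock that `t` holds, or own the
parent of a node whose parent `t` owns. -/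
theorem TreeGuar.keep (g : TreeGuar c c' t') (ht : t ≠ t') (hT : TreeInv c) : Keep c c' t where
  next_le := g.next_le
  seen := g.seen
  notNew := g.notNew
  own_lt w h := hT.lock_lt _ _ h.1
  own w h := ⟨g.lock _ _ ht h.1, by rw [g.pc _ ht]; exact h.2⟩
  fld w h d := by
    by_contra hne
    have := g.fld w d (hT.lock_lt _ _ h.1) hne
    exact ht (Option.some.inj (h.1.symm.trans this))
  par m v h := by
    refine ⟨h.lt.trans_le g.next_le, ?_,
      ⟨g.lock _ _ ht h.own.1, by rw [g.pc _ ht]; exact h.own.2⟩⟩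
    by_contra hne
    rcases (g.par m h.lt (fun he => hne (he.trans h.ptr))).1 with h1 | h1
    · rw [h.ptr] at h1; cases h1
    · exact ht (OwnPar.eq ⟨v, h⟩ h1)
  edge w d m h he := by
    rcases g.edge w d m he with h1 | h1
    · exact h1
    · exact absurd (h.eq h1) ht
  inTree x h ho := by
    by_contra hn
    rcases ho with ho | ⟨v, ho⟩
    · exact ht (ho.eq (g.inTree x (hT.lock_lt _ _ ho.1) h hn).1)
    · exact ht (OwnPar.eq ⟨v, ho⟩ (g.inTree x ho.lt h hn).2)

theorem Own.rely (g : Keep c c' t) {w : Node} (h : Own c t w) : Own c' t w := g.own w h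

theorem Par.rely (g : Keep c c' t) {m v : Node} (h : Par c t m v) : Par c' t m v := g.par m v h

theorem OwnPar.rely (g : Keep c c' t) {m : Node} (h : OwnPar c t m) : OwnPar c' t m :=
  h.imp fun v => g.par m v

theorem TreeEdge.rely (g : Keep c c' t) {m w : Node} {d : Side} (h : OwnPar c t m)
    (he : TreeEdge c' w d m) : TreeEdge c w d m := g.edge w d m h he

theorem SrcOwned.rely (g : Keep c c' t) {m : Node}
    (ho : OwnPar c t m) (h : SrcOwned c t m) : SrcOwned c' t m :=
  fun w d he => (h w d (he.rely g ho)).rely g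

theorem SettledExcept.rely (g : Keep c c' t) {n m : Node}
    (ho : OwnPar c t m) (h : SettledExcept c n m) : SettledExcept c' n m := by
  intro w d he hw
  obtain ⟨h1, h2⟩ := h w d (he.rely g ho) hw
  obtain ⟨v, hv⟩ := ho
  have h3 := (hv.rely g).ptr
  rw [hv.ptr] at h1
  exact ⟨h3.trans h1, fun w' d' he' hw' => h2 w' d' (he'.rely g ⟨v, hv⟩) hw'⟩

theorem RotLinks.rely (g : Keep c c' t) {d e : Side}
    {p y x : Node} (h : RotLinks c t d e p y x) (hx : OwnPar c t x) :
    RotLinks c' t d e p y x where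
  own_p := h.own_p.rely g
  own_y := h.own_y.rely g
  own_x := h.own_x.rely g
  inTree_y := g.inTree _ h.inTree_y (Or.inl h.own_y)
  inTree_x := g.inTree _ h.inTree_x (Or.inl h.own_x)
  seen_y := g.seen _ h.seen_y
  new_y := g.notNew _ (g.own_lt _ h.own_y) h.new_y
  new_x := g.notNew _ (g.own_lt _ h.own_x) h.new_x
  ptr_p := (g.fld _ h.own_p d).trans h.ptr_p
  par_y := h.par_y.rely g
  loop := h.loop
  in_x w f he := h.in_x w f (he.rely g hx)
  in_y w f he := h.in_y w f (he.rely g ⟨_, h.par_y⟩)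

theorem RotUnlinked.rely (g : Keep c c' t)
    {y x : Node} (h : RotUnlinked c t y x) : RotUnlinked c' t y x where
  own_y := h.own_y.rely g
  own_x := h.own_x.rely g
  inTree_y := g.inTree _ h.inTree_y (Or.inl h.own_y)
  inTree_x := g.inTree _ h.inTree_x (Or.inl h.own_x)
  seen_y := g.seen _ h.seen_y
  new_y := g.notNew _ (g.own_lt _ h.own_y) h.new_y
  par_y := h.par_y.rely g

theorem RotThread.rely (g : Keep c c' t) {d e : Side}
    {q : RotPoint} (h : RotThread c t d e q) : RotThread c' t d e q := by
  cases q with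
  | lockP p => exact lt_of_lt_of_le h g.next_le
  | checkP p => exact Own.rely g h
  | readY p => exact ⟨h.1.rely g, g.inTree _ h.2 (Or.inl h.1)⟩
  | lockY p y =>
    exact ⟨h.1.rely g, g.inTree _ h.2.1 (Or.inl h.1), (g.fld _ h.1 d).trans h.2.2⟩
  | readX p y =>
    exact ⟨h.1.rely g, g.inTree _ h.2.1 (Or.inl h.1), (g.fld _ h.1 d).trans h.2.2.1,
      h.2.2.2.rely g⟩
  | lockX p y x =>
    exact ⟨h.1.rely g, g.inTree _ h.2.1 (Or.inl h.1), (g.fld _ h.1 d).trans h.2.2.1,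
      h.2.2.2.1.rely g, (g.fld _ h.2.2.2.1 e).trans h.2.2.2.2⟩
  | linkX p y x =>
    exact ⟨h.1.rely g, g.inTree _ h.2.1 (Or.inl h.1), (g.fld _ h.1 d).trans h.2.2.1,
      h.2.2.2.1.rely g, (g.fld _ h.2.2.2.1 e).trans h.2.2.2.2.1,
      h.2.2.2.2.2.rely g⟩
  | parentX p y x => exact ⟨h.1.rely g ⟨_, h.2⟩, h.2.rely g⟩
  | readC y x =>
    obtain ⟨p, h1, h2⟩ := h
    exact ⟨p, h1.rely g ⟨_, h2⟩, h2.rely g⟩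
  | linkC y x v =>
    obtain ⟨p, h1, h2, h3⟩ := h
    exact ⟨p, h1.rely g ⟨_, h2⟩, h2.rely g, (g.fld _ h1.own_x _).trans h3⟩
  | parentC y x v =>
    obtain ⟨h1, h2, h3, h4⟩ := h
    refine ⟨h1.rely g, fun w f he => h2 w f (he.rely g h1.par_y),
      (g.fld _ h1.own_x _).trans h3, fun m hm => ?_⟩
    obtain ⟨h5, h6, h7⟩ := h4 m hm
    exact ⟨h5.rely g, g.notNew _ h5.lt h6, fun w f he => h7 w f (he.rely g ⟨_, h5⟩)⟩
  | linkY y x =>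
    obtain ⟨h1, h2, h4⟩ := h
    refine ⟨h1.rely g, fun w f he => h2 w f (he.rely g h1.par_y), fun m hm => ?_⟩
    rw [g.fld _ h1.own_x] at hm
    obtain ⟨h5, h7⟩ := h4 m hm
    exact ⟨h5.rely g, fun w f he => h7 w f (he.rely g ⟨_, h5⟩)⟩
  | parentY y x => exact ⟨h.1.rely g, fun w f he => h.2 w f (he.rely g h.1.par_y)⟩
  | unlock => trivial

theorem UCThread.rely (g : Keep c c' t)
    (hl : ∀ w, c.shared.treeLock w = some t → c'.shared.treeLock w = some t) {m : Node}
    {q : UCPoint} (h : UCThread c t m q) : UCThread c' t m q := by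
  cases q with
  | readParent => trivial
  | lockParent p => exact lt_of_lt_of_le h g.next_le
  | validate p b => exact hl p h
  | test p => exact Par.rely g h
  | write p d =>
    have := g.fld _ h.1.own .left
    simp only [Side.fld] at this
    exact ⟨h.1.rely g, by rw [this]; exact h.2.1, by rw [this]; exact h.2.2⟩
  | setParent p => exact h

theorem KeepChildren.rely (g : Keep c c' t) {n : Node}
    (h : KeepChildren c t n) : KeepChildren c' t n where
  own := h.own.rely g
  child f m hm := by
    rw [g.fld _ h.own] at hm
    rcases h.child f m hm with h1 | ⟨h1, h2⟩
    · exact Or.inl h1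
    · exact Or.inr ⟨g.inTree _ h1 (Or.inr h2), h2.rely g⟩

theorem Copying.rely (g : Keep c c' t) {n s : Node}
    (hs : (c'.shared.mem n).ptr .succ = (c.shared.mem n).ptr .succ)
    (h : Copying c t n s) : Copying c' t n s where
  own_n := h.own_n.rely g
  own_s := h.own_s.rely g
  succ := hs.trans h.succ
  par_s := h.par_s.rely g
  in_s w f he := h.in_s w f (he.rely g h.par_s)
  child f m hm := by
    rw [g.fld _ h.own_s] at hm
    obtain ⟨h1, h2, h3⟩ := h.child f m hm
    exact ⟨h1.rely g, h2.rely g h1, h3.rely g h1⟩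

theorem Adopting.rely (g : Keep c c' t) {n s pl pr : Node}
    (hs : (c'.shared.mem n).ptr .succ = (c.shared.mem n).ptr .succ)
    (h : Adopting c t n s pl pr) : Adopting c' t n s pl pr where
  own_n := h.own_n.rely g
  own_s := h.own_s.rely g
  succ := hs.trans h.succ
  par_s := h.par_s.rely g
  in_s w f he := h.in_s w f (he.rely g h.par_s)
  same f := by rw [g.fld _ h.own_s, g.fld _ h.own_n]; exact h.same f
  left m hm := by
    have := g.fld _ h.own_n .left
    exact (h.left m (this.symm.trans hm)).rely g
  right m hm := by
    have := g.fld _ h.own_n .right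
    exact (h.right m (this.symm.trans hm)).rely g
  child f m hm w d he := by
    rw [g.fld _ h.own_n] at hm
    refine h.child f m hm w d (he.rely g ?_)
    cases f
    · exact ⟨_, h.left m hm⟩
    · exact ⟨_, h.right m hm⟩

theorem Replacing.rely (g : Keep c c' t) {n : Node}
    {v : Option Node} (h : Replacing c t n v) : Replacing c' t n v where
  own := h.own.rely g
  target m hm := by
    obtain ⟨h1, h2, h3, h4, h5, h6⟩ := h.target m hm
    exact ⟨g.inTree _ h1 (Or.inr h4), g.seen _ h2, g.notNew _ h2.1.1 h3, h4.rely g,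
      fun w f he => h5 w f (he.rely g h4), fun he => (h6 he).rely g⟩
  child f m hm := by
    rw [g.fld _ h.own] at hm
    obtain ⟨h1, h2, h3⟩ := h.child f m hm
    exact ⟨h1.rely g, h2.rely g h1, h3.rely g h1⟩

theorem Unlinking.rely (g : Keep c c' t) {n s : Node}
    {v : Option Node} (hs : (c'.shared.mem n).ptr .succ = (c.shared.mem n).ptr .succ)
    (h : Unlinking c t n s v) : Unlinking c' t n s v where
  own_n := h.own_n.rely g
  own_s := h.own_s.rely g
  succ := hs.trans h.succ
  right := (g.fld _ h.own_s .right).trans h.right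

theorem Unlinked.rely (g : Keep c c' t) {n s q : Node}
    {v : Option Node} (hs : (c'.shared.mem n).ptr .succ = (c.shared.mem n).ptr .succ)
    (h : Unlinked c t n s v q) : Unlinked c' t n s v q where
  own_n := h.own_n.rely g
  own_s := h.own_s.rely g
  own_q := h.own_q.rely g
  succ := hs.trans h.succ
  par_s := h.par_s.rely g
  in_s w f he := h.in_s w f (he.rely g h.par_s)
  target m hm := by
    obtain ⟨h1, h2, d, h3⟩ := h.target m hm
    exact ⟨g.notNew _ h2.lt h1, h2.rely g, d, fun w f he => h3 w f (he.rely g ⟨_, h2⟩)⟩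
  child f m hm hv := by
    rw [g.fld _ h.own_s] at hm
    obtain ⟨h1, h2⟩ := h.child f m hm hv
    exact ⟨h1.rely g, fun w d he => h2 w d (he.rely g ⟨_, h1⟩)⟩

theorem Replaced.rely (g : Keep c c' t) {n q : Node}
    {v : Option Node} (h : Replaced c t n v q) : Replaced c' t n v q where
  own_q := h.own_q.rely g
  keep := h.keep.rely g
  target m hm := by
    obtain ⟨h1, ⟨u, h2⟩, d, h3⟩ := h.target m hm
    exact ⟨g.notNew _ h2.lt h1, ⟨u, h2.rely g⟩, d,
      fun w f he => h3 w f (he.rely g ⟨_, h2⟩)⟩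

theorem RmThread.rely (g : Keep c c' t)
    (hl : ∀ w, c.shared.treeLock w = some t → c'.shared.treeLock w = some t) {n : Node}
    (hs : (c'.shared.mem n).ptr .succ = (c.shared.mem n).ptr .succ)
    {q : RmPoint} (h : RmThread c t n q) : RmThread c' t n q := by
  cases q with
  | lockNode => trivial
  | testLeft => exact Own.rely g h
  | testRight => exact Own.rely g h
  | oneChild d => exact Own.rely g h
  | readSucc => exact Own.rely g h
  | lockSucc s => exact ⟨h.1.rely g, hs.trans h.2⟩
  | unlinkSucc s => exact ⟨h.1.rely g, hs.trans h.2.1, h.2.2.rely g⟩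
  | copyRead s d =>
    cases d
    · exact Copying.rely g hs h
    · exact ⟨h.1.rely g hs, (g.fld _ h.1.own_s .left).trans
        (h.2.trans (g.fld _ h.1.own_n .left).symm)⟩
  | copyWrite s d v =>
    cases d
    · exact ⟨h.1.rely g hs, (g.fld _ h.1.own_n .left).trans h.2⟩
    · exact ⟨h.1.rely g hs, (g.fld _ h.1.own_s .left).trans
        (h.2.1.trans (g.fld _ h.1.own_n .left).symm),
        (g.fld _ h.1.own_n .right).trans h.2.2⟩
  | adoptRead s d =>
    cases d
    · exact Adopting.rely g hs h
    · exact Adopting.rely g hs h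
  | adoptWrite s d v =>
    cases d
    · exact ⟨h.1.rely g hs, (g.fld _ h.1.own_n .left).trans h.2⟩
    · exact ⟨h.1.rely g hs, (g.fld _ h.1.own_n .right).trans h.2⟩
  | uc m v after q =>
    cases after with
    | none =>
      cases q with
      | setParent q => exact ⟨h.1, h.2.rely g⟩
      | _ => exact ⟨h.1, h.2.1.rely g, h.2.2.rely g hl⟩
    | some s =>
      cases q with
      | setParent q => exact ⟨h.1, h.2.rely g hs⟩
      | _ => exact ⟨h.1, h.2.1.rely g hs, h.2.2.rely g hl⟩

end Stability

/-! ### Stability of the tree knowledge under steps of other threads -/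

section StabilityKeys

variable [LinearOrder K] {c c' : Config K} {t t' : Thread}

theorem TreeThread.rely (g : TreeGuar c c' t') (ht : t ≠ t') (hL : ListInv c) (hT : TreeInv c)
    (r : ListRely c c' t) : TreeThread c' t (c.pc t) := by
  have gk := g.keep ht hT
  have h := hT.thread t
  have hl := hL.thread t
  -- The chosen parent of a new node is recorded before it is locked; it stays valid because no
  -- other thread writes the parent of a new node.
  have hnew : ∀ n, (c.pc t).newNode = some n →
      (c'.shared.mem n).ptr .parent = (c.shared.mem n).ptr .parent := by
    intro n hn
    by_contra hne
    exact (g.par n (hL.newNode_lt hn) hne).2 t ht hn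
  generalize c.pc t = q at h hl hnew
  cases q with
  | rot d e q => exact RotThread.rely gk h
  | delTree k p n q =>
    refine RmThread.rely gk (fun w => g.lock w t ht) ?_ h
    -- The value of `n.succ` is used long after it has been read; it is protected by the list lock
    -- of `n`, which the deleter holds.
    exact r.succ n ⟨hL.reach_lt _ hl.1.reach_succ, Or.inl hl.1.reach_succ⟩ hl.2.2.1
  | delRead k p n => exact KeepChildren.rely gk h
  | delPred k p n => exact KeepChildren.rely gk h
  | delSucc k p n => exact KeepChildren.rely gk h
  | insNewSucc k p s n => exact (hnew n rfl).trans h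
  | insNewPred k p s n => exact (hnew n rfl).trans h
  | insSucc k p s n => exact (hnew n rfl).trans h
  | insPred k p s n => exact (hnew n rfl).trans h
  | insChoose k p s n => exact (hnew n rfl).trans h
  | insParent k n z => exact (hnew n rfl).trans h
  | insLock k n z => exact (hnew n rfl).trans h
  | insChild k n z => exact ⟨(hnew n rfl).trans h.1, h.2.rely gk⟩
  | _ => trivial

/-- The transit of a node does not depend on the steps of other threads. -/
theorem Transit.rely (g : Keep c c' t) (hT : TreeInv c) {m : Node}
    (h : Transit c m (c.pc t)) : Transit c' m (c.pc t) := by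
  have hi := hT.thread t
  generalize c.pc t = q at h hi
  cases q with
  | rot d e q =>
    cases q with
    | linkY y x =>
      simp only [Transit] at h ⊢
      rw [g.fld _ hi.1.own_x]
      exact h
    | _ => exact h
  | delTree k p n q =>
    cases q with
    | copyRead s d =>
      have ho : Own c t s := by cases d; exacts [hi.own_s, hi.1.own_s]
      simp only [Transit, g.fld _ ho] at h ⊢
      exact h
    | copyWrite s d v =>
      have ho : Own c t s := by cases d; exacts [hi.1.own_s, hi.1.own_s]
      simp only [Transit, g.fld _ ho] at h ⊢
      exact h
    | adoptRead s d =>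
      have ho : Own c t n := by cases d; exacts [hi.own_n, hi.own_n]
      simp only [Transit, g.fld _ ho] at h ⊢
      exact h
    | adoptWrite s d v =>
      have ho : Own c t n := by cases d; exacts [hi.1.own_n, hi.1.own_n]
      simp only [Transit, g.fld _ ho] at h ⊢
      exact h
    | uc m' v after q =>
      cases after with
      | none =>
        cases q with
        | setParent q => exact h
        | _ =>
          have ho : Own c t n := hi.2.1.own
          simp only [Transit, g.fld _ ho] at h ⊢
          exact h
      | some s => cases q <;> exact h
    | _ => exact h
  | _ => exact h

/-- Nodes in transit are protected by locks. -/
theorem TreeInv.transit (hT : TreeInv c) {m : Node} (h : Transit c m (c.pc t)) :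
    OwnPar c t m ∧ SrcOwned c t m := by
  have hi := hT.thread t
  generalize c.pc t = q at h hi
  have hrot : ∀ {d e p y x}, RotLinks c t d e p y x → OwnPar c t x → m = x ∨ m = y →
      OwnPar c t m ∧ SrcOwned c t m := by
    rintro d e p y x hr hx (rfl | rfl)
    · refine ⟨hx, fun w f he => ?_⟩
      rcases hr.in_x w f he with h1 | h1
      · rw [h1.1]; exact hr.own_p
      · rw [h1.1]; exact hr.own_y
    · refine ⟨⟨_, hr.par_y⟩, fun w f he => ?_⟩
      rw [(hr.in_y w f he).1]; exact hr.own_p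
  have hcopy : ∀ {n s}, Copying c t n s → m = s ∨ (∃ f : Side, (c.shared.mem s).ptr f.fld = some m) →
      OwnPar c t m ∧ SrcOwned c t m := by
    rintro n s hr (rfl | ⟨f, hf⟩)
    · exact ⟨hr.par_s, fun w f he => by rw [hr.in_s w f he]; exact hr.own_s⟩
    · exact ⟨(hr.child f m hf).1, (hr.child f m hf).2.2⟩
  have hadopt : ∀ {n s pl pr}, Adopting c t n s pl pr →
      m = s ∨ (∃ f : Side, (c.shared.mem n).ptr f.fld = some m) →
      OwnPar c t m ∧ SrcOwned c t m := by
    rintro n s pl pr hr (rfl | ⟨f, hf⟩)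
    · exact ⟨hr.par_s, fun w f he => absurd he (hr.in_s w f)⟩
    · refine ⟨?_, fun w g he => ?_⟩
      · cases f
        · exact ⟨_, hr.left m hf⟩
        · exact ⟨_, hr.right m hf⟩
      · rcases (hr.child f m hf w g he).1 with h1 | h1
        · rw [h1]; exact hr.own_n
        · rw [h1]; exact hr.own_s
  cases q with
  | rot d e q =>
    cases q with
    | parentX p y x => exact hrot hi.1 ⟨_, hi.2⟩ h
    | readC y x =>
      obtain ⟨p, h1, h2⟩ := hi
      exact hrot h1 ⟨_, h2⟩ h
    | linkC y x v =>
      obtain ⟨p, h1, h2, -⟩ := hi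
      exact hrot h1 ⟨_, h2⟩ h
    | parentC y x v =>
      obtain ⟨h1, h2, -, h3⟩ := hi
      rcases h with rfl | h
      · exact ⟨h1.par_y, fun w f he => absurd he (h2 w f)⟩
      · obtain ⟨h4, -, h5⟩ := h3 m h
        refine ⟨⟨_, h4⟩, fun w f he => ?_⟩
        rcases h5 w f he with h6 | h6
        · rw [h6.1]; exact h1.own_x
        · rw [h6.1]; exact h1.own_y
    | linkY y x =>
      obtain ⟨h1, h2, h3⟩ := hi
      rcases h with rfl | h
      · exact ⟨h1.par_y, fun w f he => absurd he (h2 w f)⟩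
      · obtain ⟨h4, h5⟩ := h3 m h
        refine ⟨⟨_, h4⟩, fun w f he => ?_⟩
        rcases h5 w f he with h6 | h6
        · rw [h6.1]; exact h1.own_x
        · rw [h6.1]; exact h1.own_y
    | parentY y x =>
      obtain ⟨h1, h2⟩ := hi
      simp only [Transit] at h
      subst h
      exact ⟨h1.par_y, fun w f he => by rw [(h2 w f he).1]; exact h1.own_x⟩
    | _ => exact h.elim
  | delTree k p n q =>
    cases q with
    | copyRead s d => cases d; exacts [hcopy hi h, hcopy hi.1 h]
    | copyWrite s d v => cases d; exacts [hcopy hi.1 h, hcopy hi.1 h]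
    | adoptRead s d => cases d; exacts [hadopt hi h, hadopt hi h]
    | adoptWrite s d v => cases d; exacts [hadopt hi.1 h, hadopt hi.1 h]
    | uc m' v after q =>
      cases after with
      | none =>
        have hrep : Replacing c t n v → v = some m ∨ (∃ f : Side, (c.shared.mem n).ptr f.fld = some m) →
            OwnPar c t m ∧ SrcOwned c t m := by
          rintro hr (hm | ⟨f, hf⟩)
          · obtain ⟨-, -, -, h4, h5, -⟩ := hr.target m hm
            exact ⟨h4, fun w f he => by rw [h5 w f he]; exact hr.own⟩
          · exact ⟨(hr.child f m hf).1, (hr.child f m hf).2.2⟩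
        cases q with
        | setParent q =>
          obtain ⟨-, h4, d, h5⟩ := hi.2.target m h
          exact ⟨h4, fun w f he => by rw [(h5 w f he).1]; exact hi.2.own_q⟩
        | _ => exact hrep hi.2.1 h
      | some s =>
        cases q with
        | setParent q =>
          rcases h with rfl | h
          · exact ⟨hi.2.par_s, fun w f he => by rw [hi.2.in_s w f he]; exact hi.2.own_s⟩
          · obtain ⟨-, h4, d, h5⟩ := hi.2.target m h
            refine ⟨⟨_, h4⟩, fun w f he => ?_⟩
            rcases h5 w f he with h6 | h6
            · rw [h6]; exact hi.2.own_s
            · rw [h6.1]; exact hi.2.own_q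
        | _ => exact h.elim
    | _ => exact h.elim
  | _ => exact h.elim

/-- A step preserves the invariant of the tree if it keeps its guarantees. -/
theorem TreeInv.step (hL : ListInv c) (hT : TreeInv c) (g : TreeGuar c c' t)
    (r : ∀ t', t' ≠ t → ListRely c c' t') (ho : TreeThread c' t (c'.pc t))
    (hlock : ∀ w, c'.shared.treeLock w = some t → w < c'.shared.next)
    (hlock' : ∀ w t', t' ≠ t → c'.shared.treeLock w = some t' → c.shared.treeLock w = some t')
    (hpar : ∀ w v, (c'.shared.mem w).ptr .parent = some v → v < c'.shared.next)
    (hedge : ∀ w d m, (c'.shared.mem w).ptr (Side.fld d) = some m → Seen c' m ∧ NotNew c' m)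
    (hin : ∀ w d m, TreeEdge c' w d m → InTree c' m)
    (hset : ∀ m, Settled c m ∨ Transit c m (c.pc t) → Settled c' m ∨ Transit c' m (c'.pc t)) :
    TreeInv c' where
  lock_lt w t' hw := by
    by_cases ht : t' = t
    · subst ht; exact hlock w hw
    · exact (hT.lock_lt w t' (hlock' w t' ht hw)).trans_le g.next_le
  parent_lt := hpar
  edge := hedge
  edge_inTree := hin
  settled m := by
    have hset' : Settled c m ∨ Transit c m (c.pc t) →
        Settled c' m ∨ ∃ t, Transit c' m (c'.pc t) := fun h => (hset m h).imp id fun h => ⟨t, h⟩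
    rcases hT.settled m with h | ⟨t', h⟩
    · exact hset' (Or.inl h)
    · by_cases ht : t' = t
      · subst ht; exact hset' (Or.inr h)
      -- A node that another thread has in transit stays in transit, so only settled nodes and the
      -- transit of `t` itself need an argument for each step.
      · exact Or.inr ⟨t', by rw [g.pc t' ht]; exact h.rely (g.keep ht hT) hT⟩
  thread t' := by
    by_cases ht : t' = t
    · subst ht; exact ho
    · rw [g.pc t' ht]; exact TreeThread.rely g ht hL hT (r t' ht)

end StabilityKeys

/-! ### Generic steps -/

section Views

variable {h h' : Shared K} {pc : Thread → PC K} {t : Thread} {q' : PC K}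

local notation "𝒸" => (Config.mk h pc : Config K)
local notation "𝒸₁" => (Config.mk h' (Function.update pc t q') : Config K)

theorem exists_pc_iff {α : Type*} {f : PC K → Option α} {e : α} (hf : f q' = f (pc t)) :
    (∃ t', f (Function.update pc t q' t') = some e) ↔ ∃ t', f (pc t') = some e := by
  refine exists_congr fun t' => ?_
  by_cases ht : t' = t
  · subst ht; simp [hf]
  · rw [Function.update_of_ne ht]

theorem inTree_iff (hr : ∀ x, (h'.mem x).rem = (h.mem x).rem)
    (hf : q'.removing = (pc t).removing) {x : Node} : InTree 𝒸₁ x ↔ InTree 𝒸 x := by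
  unfold InTree
  simp only [hr]
  rw [exists_pc_iff (f := PC.removing) hf]

theorem own_iff (hl : h'.treeLock = h.treeLock) (hf : q'.freshLock = none)
    (hf' : (pc t).freshLock = none) {t' : Thread} {w : Node} : Own 𝒸₁ t' w ↔ Own 𝒸 t' w := by
  unfold Own
  simp only [hl]
  by_cases ht : t' = t
  · subst ht; simp [hf, hf']
  · simp only [Function.update_of_ne ht]

theorem NotNew.step (hn : ∀ n, q'.newNode = some n → (pc t).newNode = some n) {x : Node}
    (hx : NotNew 𝒸 x) : NotNew 𝒸₁ x := by
  intro t' he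
  by_cases ht : t' = t
  · subst ht; exact hx t' (hn x (by simpa using he))
  · exact hx t' (by simpa only [Function.update_of_ne ht] using he)

theorem NotNew.step_lt (hn : ∀ n < h.next, q'.newNode = some n → (pc t).newNode = some n)
    {x : Node} (hlt : x < h.next) (hx : NotNew 𝒸 x) : NotNew 𝒸₁ x := by
  intro t' he
  by_cases ht : t' = t
  · subst ht; exact hx t' (hn x hlt (by simpa using he))
  · exact hx t' (by simpa only [Function.update_of_ne ht] using he)

theorem Side.fld_injective {d d' : Side} (h : d.fld = d'.fld) : d = d' := by
  cases d <;> cases d' <;> first | rfl | cases h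

theorem Side.fld_ne_parent (d : Side) : d.fld ≠ .parent := by cases d <;> decide

theorem Side.opp_ne (d : Side) : d.opp ≠ d := by cases d <;> simp [Side.opp]

theorem treeEdge_link {w : Node} {d : Side} {v : Option Node}
    (hf : q'.removing = (pc t).removing) {w' m : Node} {d' : Side} :
    TreeEdge ⟨setPtr h w d.fld v, Function.update pc t q'⟩ w' d' m ↔
      (w' = w ∧ d' = d ∧ v = some m ∧ InTree 𝒸 w) ∨
      (¬ (w' = w ∧ d' = d) ∧ TreeEdge 𝒸 w' d' m) := by
  have hi : ∀ x, InTree ⟨setPtr h w d.fld v, Function.update pc t q'⟩ x ↔ InTree 𝒸 x :=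
    fun x => inTree_iff (by simp) hf
  constructor
  · rintro ⟨h1, h2⟩
    rw [hi] at h1
    simp only [setPtr_ptr] at h2
    split_ifs at h2 with hc
    · obtain ⟨rfl, hc⟩ := hc
      exact Or.inl ⟨rfl, Side.fld_injective hc, h2, h1⟩
    · exact Or.inr ⟨fun he => hc ⟨he.1, by rw [he.2]⟩, h1, h2⟩
  · rintro (⟨rfl, rfl, h1, h2⟩ | ⟨h1, h2, h3⟩)
    · exact ⟨(hi _).2 h2, by simp [h1]⟩
    · refine ⟨(hi _).2 h2, ?_⟩
      have : ¬ (w' = w ∧ d'.fld = d.fld) := fun he => h1 ⟨he.1, Side.fld_injective he.2⟩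
      simpa [this] using h3

theorem treeEdge_parent {w : Node} {v : Option Node}
    (hf : q'.removing = (pc t).removing) {w' m : Node} {d' : Side} :
    TreeEdge ⟨setPtr h w .parent v, Function.update pc t q'⟩ w' d' m ↔ TreeEdge 𝒸 w' d' m := by
  have hi : ∀ x, InTree ⟨setPtr h w .parent v, Function.update pc t q'⟩ x ↔ InTree 𝒸 x :=
    fun x => inTree_iff (by simp) hf
  constructor
  · rintro ⟨h1, h2⟩
    exact ⟨(hi _).1 h1, by simpa [d'.fld_ne_parent] using h2⟩
  · rintro ⟨h1, h2⟩
    exact ⟨(hi _).2 h1, by simpa [d'.fld_ne_parent] using h2⟩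

theorem Settled.mono {c c' : Config K} {m : Node}
    (hp : (c'.shared.mem m).ptr .parent = (c.shared.mem m).ptr .parent)
    (he : ∀ w d, TreeEdge c' w d m → TreeEdge c w d m) (h : Settled c m) : Settled c' m := by
  intro w d hw
  obtain ⟨h1, h2⟩ := h w d (he w d hw)
  exact ⟨hp.trans h1, fun w' d' hw' => h2 w' d' (he w' d' hw')⟩

end Views

/-! ### Preservation of the tree invariant by generic reads and writes -/

section Generic

variable [LinearOrder K] {h h' : Shared K} {pc : Thread → PC K} {t : Thread} {q q' : PC K}

local notation "𝒸" => (Config.mk h pc : Config K)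
local notation "𝒸₁" => (Config.mk h' (Function.update pc t q') : Config K)

theorem ListAct.seen (hL : ListInv 𝒸) (ha : ListAct t h (pc t) h' q') {x : Node}
    (hx : Seen 𝒸 x) : Seen 𝒸₁ x :=
  -- The rely condition is stated for threads other than the moving one; `t + 1` is such a thread,
  -- and `Seen` does not depend on it.
  (ha.rely hL rfl (Nat.succ_ne_self t)).seen x hx

/-- A step that does not write links or parents. -/
theorem TreeInv.silent (hL : ListInv 𝒸) (hT : TreeInv 𝒸) (ha : ListAct t h (pc t) h' q')
    (hnew : ∀ n < h.next, q'.newNode = some n → (pc t).newNode = some n)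
    (hptr : ∀ x, x < h.next → ∀ d : Side, (h'.mem x).ptr d.fld = (h.mem x).ptr d.fld)
    (hpar : ∀ x, x < h.next → (h'.mem x).ptr .parent = (h.mem x).ptr .parent)
    (hptr' : ∀ x m (d : Side), (h'.mem x).ptr d.fld = some m → (h.mem x).ptr d.fld = some m)
    (hpar' : ∀ x m, (h'.mem x).ptr .parent = some m → (h.mem x).ptr .parent = some m)
    (hlock : ∀ w t', t' ≠ t → (h'.treeLock w = some t' ↔ h.treeLock w = some t'))
    (hlt : ∀ w, h'.treeLock w = some t → w < h'.next)
    (hin : ∀ x, x < h.next → InTree 𝒸 x → InTree 𝒸₁ x)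
    (hedge : ∀ w d m, TreeEdge 𝒸₁ w d m → TreeEdge 𝒸 w d m)
    (ho : TreeThread 𝒸₁ t q')
    (hset : ∀ m, Transit 𝒸 m (pc t) → Settled 𝒸₁ m ∨ Transit 𝒸₁ m q') :
    TreeInv 𝒸₁ := by
  have hh := ha.hist hL rfl
  have hrely : ∀ t', t' ≠ t → ListRely 𝒸 𝒸₁ t' := fun t' ht => ha.rely hL rfl ht
  have hnn : ∀ x, x < h.next → NotNew 𝒸 x → NotNew 𝒸₁ x := fun x hx => NotNew.step_lt hnew hx
  have hseen : ∀ x, Seen 𝒸 x → Seen 𝒸₁ x := fun x hx => ha.seen hL hx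
  have g : TreeGuar 𝒸 𝒸₁ t := {
    pc := fun t' ht => pc_other ht
    next_le := hh.next_le
    seen := hseen
    notNew := hnn
    lock := fun w t' ht hw => (hlock w t' ht).2 hw
    fld := fun w d hw hne => absurd (hptr w hw d) hne
    par := fun m hm hne => absurd (hpar m hm) hne
    edge := fun w d m he => Or.inl (hedge w d m he)
    inTree := fun x hx h1 h2 => absurd (hin x hx h1) h2 }
  refine hT.step hL g hrely (by simpa using ho) hlt (fun w t' ht => (hlock w t' ht).1) ?_ ?_ ?_ ?_
  · exact fun w v hw => (hT.parent_lt w v (hpar' w v hw)).trans_le hh.next_le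
  · intro w d m hw
    obtain ⟨h1, h2⟩ := hT.edge w d m (hptr' w m d hw)
    exact ⟨hseen m h1, hnn m h1.1.1 h2⟩
  · intro w d m he
    have he' := hedge w d m he
    exact hin m (hT.edge w d m he'.ptr).1.1.1 (hT.edge_inTree w d m he')
  · rintro m (hm | hm)
    · left
      intro w d he
      have hlt := (hT.edge w d m (hedge w d m he).ptr).1.1.1
      exact hm.mono (hpar m hlt) (fun w d => hedge w d m) w d he
    · simpa using hset m hm

/-- A step that changes neither links nor parents nor marks. -/
theorem TreeInv.plain (hL : ListInv 𝒸) (hT : TreeInv 𝒸) (ha : ListAct t h (pc t) h' q')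
    (hnew : ∀ n < h.next, q'.newNode = some n → (pc t).newNode = some n)
    (hrem : q'.removing = (pc t).removing)
    (hptr : ∀ x f, f ≠ .succ → f ≠ .pred → (h'.mem x).ptr f = (h.mem x).ptr f)
    (hmark : ∀ x, (h'.mem x).rem = (h.mem x).rem)
    (hlock : ∀ w t', t' ≠ t → (h'.treeLock w = some t' ↔ h.treeLock w = some t'))
    (hlt : ∀ w, h'.treeLock w = some t → w < h'.next)
    (ho : TreeThread 𝒸₁ t q')
    (hset : ∀ m, Transit 𝒸 m (pc t) → Settled 𝒸₁ m ∨ Transit 𝒸₁ m q') :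
    TreeInv 𝒸₁ := by
  have hd : ∀ x (d : Side), (h'.mem x).ptr d.fld = (h.mem x).ptr d.fld :=
    fun x d => hptr x _ d.fld_ne_succ d.fld_ne_pred
  have hp : ∀ x, (h'.mem x).ptr .parent = (h.mem x).ptr .parent :=
    fun x => hptr x _ (by decide) (by decide)
  refine hT.silent hL ha hnew (fun x _ => hd x) (fun x _ => hp x) (fun x m d => by rw [hd]; exact id)
    (fun x m => by rw [hp]; exact id) hlock hlt (fun x _ hx => (inTree_iff hmark hrem).2 hx) ?_ ho hset
  rintro w d m ⟨h1, h2⟩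
  exact ⟨(inTree_iff hmark hrem).1 h1, (hd w d).symm.trans h2⟩

/-- What a thread knows is not changed by its own steps that do not write. -/
theorem Keep.self (hL : ListInv 𝒸) (hT : TreeInv 𝒸) (ha : ListAct t h (pc t) h' q')
    (hnew : ∀ n < h.next, q'.newNode = some n → (pc t).newNode = some n)
    (hrem : q'.removing = (pc t).removing)
    (hptr : ∀ x f, f ≠ .succ → f ≠ .pred → (h'.mem x).ptr f = (h.mem x).ptr f)
    (hmark : ∀ x, (h'.mem x).rem = (h.mem x).rem)
    (hown : ∀ w, Own 𝒸 t w → Own 𝒸₁ t w) : Keep 𝒸 𝒸₁ t where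
  next_le := (ha.hist hL rfl).next_le
  seen x hx := ha.seen hL hx
  notNew x hx := NotNew.step_lt hnew hx
  own_lt w hw := hT.lock_lt _ _ hw.1
  own := hown
  fld w _ d := hptr w _ d.fld_ne_succ d.fld_ne_pred
  par m v hp := ⟨hp.lt.trans_le (ha.hist hL rfl).next_le,
    (hptr m _ (by decide) (by decide)).trans hp.ptr, hown v hp.own⟩
  edge w d m _ he :=
    ⟨(inTree_iff hmark hrem).1 he.inTree, (hptr w _ d.fld_ne_succ d.fld_ne_pred).symm.trans he.ptr⟩
  inTree x hx _ := (inTree_iff hmark hrem).2 hx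

/-- A step that writes the link on side `d` of `w`. -/
theorem TreeInv.write_link (hL : ListInv 𝒸) (hT : TreeInv 𝒸) {w : Node} {d : Side}
    {v : Option Node} (ha : ListAct t h (pc t) (setPtr h w d.fld v) q')
    (hnew : ∀ n, q'.newNode = some n → (pc t).newNode = some n)
    (hrem : q'.removing = (pc t).removing)
    (hw : h.treeLock w = some t)
    (hv : ∀ m, v = some m → Seen 𝒸 m ∧ InTree 𝒸 m ∧
      NotNew ⟨setPtr h w d.fld v, Function.update pc t q'⟩ m ∧ OwnPar 𝒸 t m)
    (ho : TreeThread ⟨setPtr h w d.fld v, Function.update pc t q'⟩ t q')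
    (hset : ∀ m, Transit 𝒸 m (pc t) ∨ v = some m →
      Settled ⟨setPtr h w d.fld v, Function.update pc t q'⟩ m ∨
      Transit ⟨setPtr h w d.fld v, Function.update pc t q'⟩ m q') :
    TreeInv ⟨setPtr h w d.fld v, Function.update pc t q'⟩ := by
  have hrely : ∀ t', t' ≠ t → ListRely 𝒸 ⟨setPtr h w d.fld v, Function.update pc t q'⟩ t' :=
    fun t' ht => ha.rely hL rfl ht
  have hi : ∀ x, InTree ⟨setPtr h w d.fld v, Function.update pc t q'⟩ x ↔ InTree 𝒸 x :=
    fun x => inTree_iff (by simp) hrem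
  have hpar : ∀ x, ((setPtr h w d.fld v).mem x).ptr .parent = (h.mem x).ptr .parent := by
    intro x; simp [d.fld_ne_parent.symm]
  have g : TreeGuar 𝒸 ⟨setPtr h w d.fld v, Function.update pc t q'⟩ t := {
    pc := fun t' ht => pc_other ht
    next_le := le_rfl
    seen := fun x hx => ha.seen hL hx
    notNew := fun x _ => NotNew.step hnew
    lock := fun w t' ht hw => hw
    fld := by
      intro w' d' hw' hne
      by_cases hc : w' = w
      · subst hc; exact hw
      · simp [hc] at hne
    par := fun m hm hne => absurd (hpar m) hne
    edge := by
      intro w' d' m he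
      rcases (treeEdge_link hrem).1 he with ⟨-, -, h1, -⟩ | ⟨-, h1⟩
      · exact Or.inr (hv m h1).2.2.2
      · exact Or.inl h1
    inTree := fun x hx h1 h2 => absurd ((hi x).2 h1) h2 }
  refine hT.step hL g hrely (by simpa using ho) (fun w hw => hT.lock_lt _ _ hw)
    (fun w t' ht => id) ?_ ?_ ?_ ?_
  · exact fun x v hx => hT.parent_lt x v ((hpar x).symm.trans hx)
  · intro w' d' m he
    simp only [setPtr_ptr] at he
    split_ifs at he with hc
    · obtain ⟨h1, -, h2, -⟩ := hv m he
      exact ⟨ha.seen hL h1, h2⟩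
    · obtain ⟨h1, h2⟩ := hT.edge w' d' m he
      exact ⟨ha.seen hL h1, NotNew.step hnew h2⟩
  · intro w' d' m he
    rw [hi]
    rcases (treeEdge_link hrem).1 he with ⟨-, -, h1, -⟩ | ⟨-, h1⟩
    · exact (hv m h1).2.1
    · exact hT.edge_inTree _ _ _ h1
  · intro m hm
    by_cases hvm : v = some m
    · simpa using hset m (Or.inr hvm)
    · rcases hm with hm | hm
      -- If the write does not link to `m`, then `m` can only lose a link, which keeps it settled.
      · left
        refine hm.mono (hpar m) (fun w' d' he => ?_)
        rcases (treeEdge_link hrem).1 he with ⟨-, -, h1, -⟩ | ⟨-, h1⟩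
        · exact absurd h1 hvm
        · exact h1
      · simpa using hset m (Or.inl hm)

/-- A step that writes the parent of `x`. -/
theorem TreeInv.write_parent (hL : ListInv 𝒸) (hT : TreeInv 𝒸) {x v : Node}
    (ha : ListAct t h (pc t) (setPtr h x .parent (some v)) q')
    (hnew : ∀ n, q'.newNode = some n → (pc t).newNode = some n)
    (hrem : q'.removing = (pc t).removing)
    (hx : (h.mem x).ptr .parent = none ∨ OwnPar 𝒸 t x)
    (hx' : ∀ t', t' ≠ t → (pc t').newNode ≠ some x) (hv : v < h.next)
    (ho : TreeThread ⟨setPtr h x .parent (some v), Function.update pc t q'⟩ t q')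
    (hset : ∀ m, Transit 𝒸 m (pc t) ∨ m = x →
      Settled ⟨setPtr h x .parent (some v), Function.update pc t q'⟩ m ∨
      Transit ⟨setPtr h x .parent (some v), Function.update pc t q'⟩ m q') :
    TreeInv ⟨setPtr h x .parent (some v), Function.update pc t q'⟩ := by
  have hrely : ∀ t', t' ≠ t →
      ListRely 𝒸 ⟨setPtr h x .parent (some v), Function.update pc t q'⟩ t' :=
    fun t' ht => ha.rely hL rfl ht
  have hi : ∀ y, InTree ⟨setPtr h x .parent (some v), Function.update pc t q'⟩ y ↔ InTree 𝒸 y :=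
    fun y => inTree_iff (by simp) hrem
  have hptr : ∀ y (d : Side), ((setPtr h x .parent (some v)).mem y).ptr d.fld =
      (h.mem y).ptr d.fld := by
    intro x d; simp [d.fld_ne_parent]
  have g : TreeGuar 𝒸 ⟨setPtr h x .parent (some v), Function.update pc t q'⟩ t := {
    pc := fun t' ht => pc_other ht
    next_le := le_rfl
    seen := fun x hx => ha.seen hL hx
    notNew := fun x _ => NotNew.step hnew
    lock := fun w t' ht hw => hw
    fld := fun w d hw hne => absurd (hptr w d) hne
    par := by
      intro m hm hne
      by_cases hc : m = x
      · subst hc; exact ⟨hx, hx'⟩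
      · simp [hc] at hne
    edge := fun w d m he => Or.inl ((treeEdge_parent hrem).1 he)
    inTree := fun x hx h1 h2 => absurd ((hi x).2 h1) h2 }
  refine hT.step hL g hrely (by simpa using ho) (fun w hw => hT.lock_lt _ _ hw)
    (fun w t' ht => id) ?_ ?_ ?_ ?_
  · intro y u hy
    simp only [setPtr_ptr, and_true] at hy
    split_ifs at hy with hc
    · obtain rfl := Option.some.inj hy; exact hv
    · exact hT.parent_lt y u hy
  · intro w' d' m he
    rw [hptr] at he
    obtain ⟨h1, h2⟩ := hT.edge w' d' m he
    exact ⟨ha.seen hL h1, NotNew.step hnew h2⟩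
  · intro w' d' m he
    rw [hi]
    exact hT.edge_inTree _ _ _ ((treeEdge_parent hrem).1 he)
  · intro m hm
    by_cases hmx : m = x
    · simpa using hset m (Or.inr hmx)
    · rcases hm with hm | hm
      · left
        refine hm.mono (by simp [hmx]) (fun w' d' he => (treeEdge_parent hrem).1 he)
      · simpa using hset m (Or.inl hm)

/-- If a link leads to `m` from a node that `t` owns, or `t` owns the parent of `m`, then only `t`
can rearrange the links to `m`. -/
theorem TreeInv.settled_of_own {c : Config K} (hT : TreeInv c) {m : Node}
    (hm : OwnPar c t m ∨ ∃ w d, TreeEdge c w d m ∧ Own c t w) (ht : ¬ Transit c m (c.pc t)) :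
    Settled c m := by
  rcases hT.settled m with h1 | ⟨t', h1⟩
  · exact h1
  · exfalso
    obtain ⟨h2, h3⟩ := hT.transit h1
    -- The thread that has `m` in transit owns the parent of `m` and the sources of all links to
    -- `m`; either alternative of `hm` makes `t` own one of these.
    have : t' = t := by
      rcases hm with hm | ⟨w, d, hm, hw⟩
      · exact h2.eq hm
      · exact (h3 w d hm).eq hw
    subst this
    exact ht h1

/-- The successor of a node that is being deleted. -/
theorem ListInv.succ_deleted {c : Config K} (hL : ListInv c) {n s : Node}
    (hd : (c.pc t).deleted = some n) (hs : (c.shared.mem n).ptr .succ = some s) :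
    s ≠ n ∧ (c.shared.mem s).rem = false ∧ Seen c s ∧ NotNew c s := by
  obtain ⟨k, p, b, hk, hl, hr⟩ := hL.deleted_base hd
  have hn := b.reach_succ
  have hsr := hn.succ hs
  have hne : s ≠ n := by
    rintro rfl
    exact lt_irrefl _ (hL.sorted _ _ hn hs)
  have hnn : NotNew c s := by
    intro t' he
    have h1 := hL.thread t'
    -- An inserter that has linked `s` to the list still holds the lock of the predecessor of `s`.
    -- This predecessor is `n`, whose lock the deleter holds.
    have hb : ∀ k' p', Base c t' k' p' s → t' = t := by
      intro k' p' b'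
      obtain rfl := hL.sorted.pred_unique b'.reach hn b'.succ hs
      exact Option.some.inj (b'.lock.symm.trans hl)
    have ht : t' ≠ t := by
      rintro rfl
      generalize c.pc t' = q at hd he
      cases q <;> simp [PC.deleted, PC.newNode] at hd he
    generalize c.pc t' = q at h1 he
    cases q <;> simp only [PC.newNode, reduceCtorEq, Option.some.injEq] at he <;> subst he
    · exact h1.2.2.not_reach hsr
    · exact h1.2.2.1.not_reach hsr
    · exact h1.2.2.1.not_reach hsr
    · exact ht (hb _ _ h1.1)
    · exact ht (hb _ _ h1)
    · obtain ⟨-, p', h1⟩ := h1; exact ht (hb _ _ h1)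
    · obtain ⟨-, p', h1⟩ := h1; exact ht (hb _ _ h1)
    · obtain ⟨-, p', h1⟩ := h1; exact ht (hb _ _ h1)
  refine ⟨hne, hL.rem_succ hn hs hl ?_, ⟨⟨hL.reach_lt s hsr, Or.inl hsr⟩, fun t' he => ?_⟩, hnn⟩
  · rw [hd]; simpa using hne.symm
  · exact hnn t' (PC.newNode_of_hidden he)

end Generic

/-! ### Steps that do not write -/

section Reads

variable [LinearOrder K] {h h' : Shared K} {pc : Thread → PC K} {t : Thread} {q q' : PC K}

local notation "𝒸" => (Config.mk h pc : Config K)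

theorem Keep.read (hL : ListInv 𝒸) (hT : TreeInv 𝒸) (ha : ListAct t h (pc t) h q')
    (hnew : ∀ n < h.next, q'.newNode = some n → (pc t).newNode = some n)
    (hrem : q'.removing = (pc t).removing)
    (hf : ∀ w, q'.freshLock = some w → (pc t).freshLock = some w) :
    Keep 𝒸 ⟨h, Function.update pc t q'⟩ t :=
  Keep.self hL hT ha hnew hrem (fun _ _ _ _ => rfl) (fun _ => rfl)
    (fun w hw => ⟨hw.1, by simpa using fun he => hw.2 (hf w he)⟩)

theorem TreeInv.read (hL : ListInv 𝒸) (hT : TreeInv 𝒸) (ha : ListAct t h (pc t) h q')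
    (hnew : ∀ n < h.next, q'.newNode = some n → (pc t).newNode = some n)
    (hrem : q'.removing = (pc t).removing)
    (ho : TreeThread ⟨h, Function.update pc t q'⟩ t q')
    (hset : ∀ m, Transit 𝒸 m (pc t) → Settled ⟨h, Function.update pc t q'⟩ m ∨
      Transit ⟨h, Function.update pc t q'⟩ m q') :
    TreeInv ⟨h, Function.update pc t q'⟩ :=
  hT.plain hL ha hnew hrem (fun _ _ _ _ => rfl) (fun _ => rfl) (fun _ _ _ => Iff.rfl)
    (fun w hw => hT.lock_lt w t hw) ho hset

/-- By `hf`, a lock that becomes tentative was not held before or was tentative already, so no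
ownership is lost. -/
theorem Keep.lock {w : Node} (hL : ListInv 𝒸) (hT : TreeInv 𝒸)
    (ha : ListAct t h (pc t) (lockTreeOf h w t) q')
    (hnew : ∀ n < h.next, q'.newNode = some n → (pc t).newNode = some n)
    (hrem : q'.removing = (pc t).removing)
    (hf : ∀ w, q'.freshLock = some w → h.treeLock w = some t → (pc t).freshLock = some w) :
    Keep 𝒸 ⟨lockTreeOf h w t, Function.update pc t q'⟩ t :=
  Keep.self hL hT ha hnew hrem (fun _ _ _ _ => rfl) (fun _ => rfl)
    (fun w' hw => ⟨by
      have := hw.1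
      dsimp only at this
      simp [this], by simpa using fun he => hw.2 (hf w' he hw.1)⟩)

theorem TreeInv.lock {w : Node} (hL : ListInv 𝒸) (hT : TreeInv 𝒸)
    (ha : ListAct t h (pc t) (lockTreeOf h w t) q')
    (hnew : ∀ n < h.next, q'.newNode = some n → (pc t).newNode = some n)
    (hrem : q'.removing = (pc t).removing)
    (hl : CanLock h.treeLock w t) (hw : w < h.next)
    (ho : TreeThread ⟨lockTreeOf h w t, Function.update pc t q'⟩ t q')
    (hset : ∀ m, Transit 𝒸 m (pc t) → Settled ⟨lockTreeOf h w t, Function.update pc t q'⟩ m ∨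
      Transit ⟨lockTreeOf h w t, Function.update pc t q'⟩ m q') :
    TreeInv ⟨lockTreeOf h w t, Function.update pc t q'⟩ := by
  refine hT.plain hL ha hnew hrem (fun _ _ _ _ => rfl) (fun _ => rfl) (fun w' t' ht => ?_)
    (fun w' hw' => ?_) ho hset
  · by_cases hc : w' = w
    · subst hc
      rcases hl with hl | hl <;> simp [hl, ht.symm]
    · simp [hc]
  · simp only [lockTreeOf_treeLock] at hw'
    split_ifs at hw' with hc
    · subst hc; exact hw
    · exact hT.lock_lt w' t hw'

theorem TreeInv.release (hL : ListInv 𝒸) (hT : TreeInv 𝒸)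
    (ha : ListAct t h (pc t) (releaseAll h t) q')
    (hnew : ∀ n < h.next, q'.newNode = some n → (pc t).newNode = some n)
    (hrem : q'.removing = (pc t).removing)
    (ho : TreeThread ⟨releaseAll h t, Function.update pc t q'⟩ t q')
    (hset : ∀ m, ¬ Transit 𝒸 m (pc t)) :
    TreeInv ⟨releaseAll h t, Function.update pc t q'⟩ := by
  refine hT.plain hL ha hnew hrem (fun _ _ _ _ => rfl) (fun _ => rfl) (fun w' t' ht => ?_)
    (fun w' hw' => ?_) ho (fun m hm => absurd hm (hset m))
  · simp only [releaseAll_treeLock]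
    split_ifs with hc
    · simp [hc, ht.symm]
    · rfl
  · simp only [releaseAll_treeLock] at hw'
    split_ifs at hw' with hc
    exact absurd hw' hc

theorem own_setPtr {o : Node} {f : PtrField} {v : Option Node} (hf : q'.freshLock = none)
    (hf' : (pc t).freshLock = none) {t' : Thread} {w : Node} :
    Own ⟨setPtr h o f v, Function.update pc t q'⟩ t' w ↔ Own 𝒸 t' w :=
  own_iff rfl hf hf'

theorem inTree_setPtr {o : Node} {f : PtrField} {v : Option Node}
    (hf : q'.removing = (pc t).removing) {x : Node} :
    InTree ⟨setPtr h o f v, Function.update pc t q'⟩ x ↔ InTree 𝒸 x :=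
  inTree_iff (by simp) hf

theorem par_link {o : Node} {d : Side} {v : Option Node} (hf : q'.freshLock = none)
    (hf' : (pc t).freshLock = none) {t' : Thread} {m u : Node} :
    Par ⟨setPtr h o d.fld v, Function.update pc t q'⟩ t' m u ↔ Par 𝒸 t' m u := by
  constructor
  · rintro ⟨h1, h2, h3⟩
    exact ⟨h1, by simpa [d.fld_ne_parent.symm] using h2, (own_setPtr hf hf').1 h3⟩
  · rintro ⟨h1, h2, h3⟩
    exact ⟨h1, by simpa [d.fld_ne_parent.symm] using h2, (own_setPtr hf hf').2 h3⟩

theorem ownPar_link {o : Node} {d : Side} {v : Option Node} (hf : q'.freshLock = none)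
    (hf' : (pc t).freshLock = none) {t' : Thread} {m : Node} :
    OwnPar ⟨setPtr h o d.fld v, Function.update pc t q'⟩ t' m ↔ OwnPar 𝒸 t' m :=
  exists_congr fun _ => par_link hf hf'

theorem par_parent {o v : Node} (hf : q'.freshLock = none)
    (hf' : (pc t).freshLock = none) (ho : o < h.next) {t' : Thread} (hv : Own 𝒸 t' v) :
    Par ⟨setPtr h o .parent (some v), Function.update pc t q'⟩ t' o v :=
  ⟨ho, by simp, (own_setPtr hf hf').2 hv⟩

theorem par_parent_of_ne {o v : Node} (hf : q'.freshLock = none)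
    (hf' : (pc t).freshLock = none) {t' : Thread} {m u : Node} (hm : m ≠ o)
    (hp : Par 𝒸 t' m u) :
    Par ⟨setPtr h o .parent (some v), Function.update pc t q'⟩ t' m u :=
  ⟨hp.lt, by simpa [hm] using hp.ptr, (own_setPtr hf hf').2 hp.own⟩

theorem ownPar_parent {o v : Node} (hf : q'.freshLock = none)
    (hf' : (pc t).freshLock = none) {t' : Thread} {m : Node} (hv : Own 𝒸 t' v)
    (hp : OwnPar 𝒸 t' m) :
    OwnPar ⟨setPtr h o .parent (some v), Function.update pc t q'⟩ t' m := by
  obtain ⟨u, hp⟩ := hp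
  by_cases hm : m = o
  · subst hm; exact ⟨v, par_parent hf hf' hp.lt hv⟩
  · exact ⟨u, par_parent_of_ne hf hf' hm hp⟩

end Reads

/-! ### Rotations -/

section Rotation

variable [LinearOrder K] {h h' : Shared K} {pc : Thread → PC K} {t : Thread}

local notation "𝒸" => (Config.mk h pc : Config K)

/-- Before the first write `t` has nothing in transit and owns the sources of the links to `y` and
`x`, so both are settled, with parents `p` and `y`. Afterwards `x` may have the two sources `p` and
`y`, and no link to `y` remains unless `x = y`. -/
theorem RotThread.linkX {d e : Side} {p y x : Node} (hL : ListInv 𝒸) (hT : TreeInv 𝒸)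
    (hpc : pc t = .rot d e (.linkX p y x))
    (ha : ListAct t h (pc t) (setPtr h p d.fld (some x)) (.rot d e (.parentX p y x))) :
    TreeInv ⟨setPtr h p d.fld (some x), Function.update pc t (.rot d e (.parentX p y x))⟩ := by
  have hi := hT.thread t
  dsimp only at hi
  rw [hpc] at hi
  obtain ⟨op, ip, py, oy, yx, ox⟩ := hi
  have hf : (PC.rot (K := K) d e (.parentX p y x)).freshLock = none := rfl
  have hf' : (pc t).freshLock = none := by rw [hpc]; rfl
  have hr : (PC.rot (K := K) d e (.parentX p y x)).removing = (pc t).removing := by rw [hpc]; rfl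
  have hnt : ∀ m, ¬ Transit 𝒸 m (pc t) := by intro m; rw [hpc]; exact id
  have e1 : TreeEdge 𝒸 p d y := ⟨ip, py⟩
  have iy := hT.edge_inTree _ _ _ e1
  have e2 : TreeEdge 𝒸 y e x := ⟨iy, yx⟩
  have ix := hT.edge_inTree _ _ _ e2
  obtain ⟨sy, ny⟩ := hT.edge _ _ _ py
  obtain ⟨sx, nx⟩ := hT.edge _ _ _ yx
  obtain ⟨ppy, uy⟩ := hT.settled_of_own (Or.inr ⟨_, _, e1, op⟩) (hnt y) _ _ e1
  obtain ⟨ppx, ux⟩ := hT.settled_of_own (Or.inr ⟨_, _, e2, oy⟩) (hnt x) _ _ e2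
  have Py : Par 𝒸 t y p := ⟨sy.1.1, ppy, op⟩
  have Px : Par 𝒸 t x y := ⟨sx.1.1, ppx, oy⟩
  have hnew : ∀ n, (PC.rot (K := K) d e (.parentX p y x)).newNode = some n →
      (pc t).newNode = some n := by intro n hn; cases hn
  refine hT.write_link hL ha hnew hr op.1 ?_ ?_ ?_
  · intro m hm
    obtain rfl := Option.some.inj hm
    exact ⟨sx, ix, NotNew.step hnew nx, _, Px⟩
  · refine ⟨⟨(own_setPtr hf hf').2 op, (own_setPtr hf hf').2 oy, (own_setPtr hf hf').2 ox,
      (inTree_setPtr hr).2 iy, (inTree_setPtr hr).2 ix, ha.seen hL sy, NotNew.step hnew ny,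
      NotNew.step hnew nx, by simp, (par_link hf hf').2 Py, ?_, ?_, ?_⟩, (par_link hf hf').2 Px⟩
    -- If `x = y`, the links from `p` and from `y` to `y` coincide, because `y` is settled.
    · rintro rfl
      obtain ⟨h1, h2⟩ := uy _ _ e2
      exact ⟨h1.symm, h2.symm⟩
    · intro w f he
      rcases (treeEdge_link hr).1 he with ⟨h1, h2, -⟩ | ⟨-, he⟩
      · exact Or.inl ⟨h1, h2⟩
      · exact Or.inr (ux _ _ he)
    · intro w f he
      rcases (treeEdge_link hr).1 he with ⟨h1, h2, -⟩ | ⟨-, he⟩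
      · exact ⟨h1, h2⟩
      · exact uy _ _ he
  · rintro m (hm | hm)
    · exact absurd hm (hnt m)
    · exact Or.inr (Or.inl (Option.some.inj hm).symm)

theorem RotThread.parentX {d e : Side} {p y x : Node} (hL : ListInv 𝒸) (hT : TreeInv 𝒸)
    (hpc : pc t = .rot d e (.parentX p y x))
    (ha : ListAct t h (pc t) (setPtr h x .parent (some p)) (.rot d e (.readC y x))) :
    TreeInv ⟨setPtr h x .parent (some p), Function.update pc t (.rot d e (.readC y x))⟩ := by
  have hi := hT.thread t
  dsimp only at hi
  rw [hpc] at hi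
  obtain ⟨r, Px⟩ := hi
  have hf : (PC.rot (K := K) d e (.readC y x)).freshLock = none := rfl
  have hf' : (pc t).freshLock = none := by rw [hpc]; rfl
  have hr : (PC.rot (K := K) d e (.readC y x)).removing = (pc t).removing := by rw [hpc]; rfl
  have hnew : ∀ n, (PC.rot (K := K) d e (.readC y x)).newNode = some n →
      (pc t).newNode = some n := by intro n hn; cases hn
  refine hT.write_parent hL ha hnew hr (Or.inr ⟨_, Px⟩) (fun t' _ => r.new_x t')
    (hT.lock_lt _ _ r.own_p.1) ?_ ?_
  · refine ⟨p, ⟨(own_setPtr hf hf').2 r.own_p, (own_setPtr hf hf').2 r.own_y,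
      (own_setPtr hf hf').2 r.own_x, (inTree_setPtr hr).2 r.inTree_y,
      (inTree_setPtr hr).2 r.inTree_x, ha.seen hL r.seen_y, NotNew.step hnew r.new_y,
      NotNew.step hnew r.new_x, by simpa [d.fld_ne_parent] using r.ptr_p, ?_, r.loop,
      fun w f he => r.in_x w f ((treeEdge_parent hr).1 he),
      fun w f he => r.in_y w f ((treeEdge_parent hr).1 he)⟩, par_parent hf hf' Px.lt r.own_p⟩
    by_cases hxy : y = x
    · subst hxy; exact par_parent hf hf' Px.lt r.own_p
    · exact par_parent_of_ne hf hf' hxy r.par_y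
  · rintro m (hm | hm)
    · rw [hpc] at hm; exact Or.inr hm
    · exact Or.inr (Or.inl hm)

theorem RotThread.linkC {d e : Side} {y x : Node} {v : Option Node} (hL : ListInv 𝒸)
    (hT : TreeInv 𝒸) (hpc : pc t = .rot d e (.linkC y x v))
    (ha : ListAct t h (pc t) (setPtr h y e.fld v) (.rot d e (.parentC y x v))) :
    TreeInv ⟨setPtr h y e.fld v, Function.update pc t (.rot d e (.parentC y x v))⟩ := by
  have hi := hT.thread t
  dsimp only at hi
  rw [hpc] at hi
  obtain ⟨p, r, Px, hv⟩ := hi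
  have hf : (PC.rot (K := K) d e (.parentC y x v)).freshLock = none := rfl
  have hf' : (pc t).freshLock = none := by rw [hpc]; rfl
  have hr : (PC.rot (K := K) d e (.parentC y x v)).removing = (pc t).removing := by rw [hpc]; rfl
  have hnew : ∀ n, (PC.rot (K := K) d e (.parentC y x v)).newNode = some n →
      (pc t).newNode = some n := by intro n hn; cases hn
  have hopp := e.opp_ne
  -- The child that moves from `x` to `y` is hit by a link of `x`, hence settled with parent `x`,
  -- unless it is `x` itself, for which the facts about `x` in the rotation apply.
  have child : ∀ m, v = some m → m ≠ y ∧ Par 𝒸 t m x ∧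
      ∀ w f, TreeEdge 𝒸 w f m → (w = x ∧ f = e.opp) ∨ (w = y ∧ f = e) := by
    intro m hm
    have hem : TreeEdge 𝒸 x e.opp m := ⟨r.inTree_x, hv.trans hm⟩
    have hmy : m ≠ y := by
      -- A link from `x` to `y` on the far side would be the link of `p`, which leads to `x`. Then
      -- `x = y`, and `loop` would identify opposite sides.
      rintro rfl
      obtain ⟨rfl, rfl⟩ := r.in_y _ _ hem
      have : m = x := Option.some.inj (hm.symm.trans (hv.symm.trans r.ptr_p))
      exact hopp (r.loop this.symm).2
    refine ⟨hmy, ?_⟩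
    by_cases hmx : m = x
    · subst hmx
      rcases r.in_x _ _ hem with ⟨rfl, rfl⟩ | ⟨-, h1⟩
      · exact ⟨Px, fun w f he => r.in_x w f he⟩
      · exact absurd h1 hopp
    · have hnt : ¬ Transit 𝒸 m (pc t) := by
        rw [hpc]; rintro (h1 | h1); exacts [hmx h1, hmy h1]
      obtain ⟨h1, h2⟩ := hT.settled_of_own (Or.inr ⟨_, _, hem, r.own_x⟩) hnt _ _ hem
      exact ⟨⟨(hT.edge _ _ _ hem.ptr).1.1.1, h1, r.own_x⟩, fun w f he => Or.inl (h2 w f he)⟩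
  refine hT.write_link hL ha hnew hr r.own_y.1 ?_ ?_ ?_
  · intro m hm
    have hem : TreeEdge 𝒸 x e.opp m := ⟨r.inTree_x, hv.trans hm⟩
    obtain ⟨h1, h2⟩ := hT.edge _ _ _ hem.ptr
    exact ⟨h1, hT.edge_inTree _ _ _ hem, NotNew.step hnew h2, _, (child m hm).2.1⟩
  · refine ⟨⟨(own_setPtr hf hf').2 r.own_y, (own_setPtr hf hf').2 r.own_x,
      (inTree_setPtr hr).2 r.inTree_y, (inTree_setPtr hr).2 r.inTree_x, ha.seen hL r.seen_y,
      NotNew.step hnew r.new_y, _, (par_link hf hf').2 r.par_y⟩, ?_, ?_, ?_⟩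
    · intro w f he
      rcases (treeEdge_link hr).1 he with ⟨-, -, h1, -⟩ | ⟨hne, he⟩
      · exact (child y h1).1 rfl
      · have hp := he.ptr
        obtain ⟨rfl, rfl⟩ := r.in_y _ _ he
        have : x = y := Option.some.inj (r.ptr_p.symm.trans hp)
        exact hne (r.loop this)
    · have : ¬ (x = y ∧ e.opp.fld = e.fld) := fun h1 => hopp (Side.fld_injective h1.2)
      simpa [this] using hv
    · intro m hm
      obtain ⟨h1, h2, h3⟩ := child m hm
      have hem : TreeEdge 𝒸 x e.opp m := ⟨r.inTree_x, hv.trans hm⟩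
      refine ⟨(par_link hf hf').2 h2, NotNew.step hnew (hT.edge _ _ _ hem.ptr).2, ?_⟩
      intro w f he
      rcases (treeEdge_link hr).1 he with ⟨h1, h2, -⟩ | ⟨hne, he⟩
      · exact Or.inr ⟨h1, h2⟩
      · exact h3 w f he
  · intro m hm
    by_cases hvm : v = some m
    · exact Or.inr (Or.inr hvm)
    · rw [hpc] at hm
      rcases hm with (rfl | rfl) | hm
      · left
        -- Here `m` is the node `x`. Its second incoming link, from `y`, has just been overwritten,
        -- so only the link from its new parent `p` remains.
        have hx : ∀ w f, TreeEdge ⟨setPtr h y e.fld v,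
            Function.update pc t (.rot d e (.parentC y m v))⟩ w f m → w = p ∧ f = d := by
          intro w f he
          rcases (treeEdge_link hr).1 he with ⟨-, -, h1, -⟩ | ⟨hne, he⟩
          · exact absurd h1 hvm
          · rcases r.in_x _ _ he with h1 | h1
            · exact h1
            · exact absurd h1 hne
        intro w f he
        obtain ⟨rfl, rfl⟩ := hx w f he
        exact ⟨((par_link hf hf').2 Px).ptr, hx⟩
      · exact Or.inr (Or.inl rfl)
      · exact absurd hm hvm

theorem RotThread.parentC {d e : Side} {y x m : Node} (hL : ListInv 𝒸)
    (hT : TreeInv 𝒸) (hpc : pc t = .rot d e (.parentC y x (some m)))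
    (ha : ListAct t h (pc t) (setPtr h m .parent (some y)) (.rot d e (.linkY y x))) :
    TreeInv ⟨setPtr h m .parent (some y), Function.update pc t (.rot d e (.linkY y x))⟩ := by
  have hi := hT.thread t
  dsimp only at hi
  rw [hpc] at hi
  obtain ⟨r, hy, hv, hm⟩ := hi
  obtain ⟨Pm, nm, hm⟩ := hm m rfl
  have hf : (PC.rot (K := K) d e (.linkY y x)).freshLock = none := rfl
  have hf' : (pc t).freshLock = none := by rw [hpc]; rfl
  have hr : (PC.rot (K := K) d e (.linkY y x)).removing = (pc t).removing := by rw [hpc]; rfl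
  have hnew : ∀ n, (PC.rot (K := K) d e (.linkY y x)).newNode = some n →
      (pc t).newNode = some n := by intro n hn; cases hn
  have hv' : ((setPtr h m .parent (some y)).mem x).ptr e.opp.fld = some m := by
    simpa [e.opp.fld_ne_parent] using hv
  refine hT.write_parent hL ha hnew hr (Or.inr ⟨_, Pm⟩) (fun t' _ => nm t')
    (hT.lock_lt _ _ r.own_y.1) ?_ ?_
  · refine ⟨⟨(own_setPtr hf hf').2 r.own_y, (own_setPtr hf hf').2 r.own_x,
      (inTree_setPtr hr).2 r.inTree_y, (inTree_setPtr hr).2 r.inTree_x, ha.seen hL r.seen_y,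
      NotNew.step hnew r.new_y, ownPar_parent hf hf' r.own_y r.par_y⟩,
      fun w f he => hy w f ((treeEdge_parent hr).1 he), fun m' hm' => ?_⟩
    obtain rfl := Option.some.inj (hv'.symm.trans hm')
    exact ⟨par_parent hf hf' Pm.lt r.own_y, fun w f he => hm w f ((treeEdge_parent hr).1 he)⟩
  · rintro m' (hm' | rfl)
    · rw [hpc] at hm'
      rcases hm' with hm' | hm'
      · exact Or.inr (Or.inl hm')
      · exact Or.inr (Or.inr (hv'.trans hm'))
    · exact Or.inr (Or.inr hv')

theorem RotThread.linkY {d e : Side} {y x : Node} (hL : ListInv 𝒸)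
    (hT : TreeInv 𝒸) (hpc : pc t = .rot d e (.linkY y x))
    (ha : ListAct t h (pc t) (setPtr h x e.opp.fld (some y)) (.rot d e (.parentY y x))) :
    TreeInv ⟨setPtr h x e.opp.fld (some y), Function.update pc t (.rot d e (.parentY y x))⟩ := by
  have hi := hT.thread t
  dsimp only at hi
  rw [hpc] at hi
  obtain ⟨r, hy, hv⟩ := hi
  have hf : (PC.rot (K := K) d e (.parentY y x)).freshLock = none := rfl
  have hf' : (pc t).freshLock = none := by rw [hpc]; rfl
  have hr : (PC.rot (K := K) d e (.parentY y x)).removing = (pc t).removing := by rw [hpc]; rfl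
  have hnew : ∀ n, (PC.rot (K := K) d e (.parentY y x)).newNode = some n →
      (pc t).newNode = some n := by intro n hn; cases hn
  refine hT.write_link hL ha hnew hr r.own_x.1 ?_ ?_ ?_
  · intro m hm
    obtain rfl := Option.some.inj hm
    exact ⟨r.seen_y, r.inTree_y, NotNew.step hnew r.new_y, r.par_y⟩
  · refine ⟨⟨(own_setPtr hf hf').2 r.own_y, (own_setPtr hf hf').2 r.own_x,
      (inTree_setPtr hr).2 r.inTree_y, (inTree_setPtr hr).2 r.inTree_x, ha.seen hL r.seen_y,
      NotNew.step hnew r.new_y, (ownPar_link hf hf').2 r.par_y⟩, ?_⟩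
    intro w f he
    rcases (treeEdge_link hr).1 he with ⟨h1, h2, -⟩ | ⟨hne, he⟩
    · exact ⟨h1, h2⟩
    · exact absurd he (hy w f)
  · intro m hm
    by_cases hmy : m = y
    · exact Or.inr hmy
    · rw [hpc] at hm
      rcases hm with (hm | hm) | hm
      · exact absurd hm hmy
      · left
        obtain ⟨Pm, h1⟩ := hv m hm
        -- The moved child was linked from `x` and possibly from `y`; the link from `x` is
        -- overwritten here, so any remaining link comes from its new parent `y`.
        have hx : ∀ w f, TreeEdge ⟨setPtr h x e.opp.fld (some y),
            Function.update pc t (.rot d e (.parentY y x))⟩ w f m → w = y ∧ f = e := by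
          intro w f he
          rcases (treeEdge_link hr).1 he with ⟨-, -, h2, -⟩ | ⟨hne, he⟩
          · exact absurd (Option.some.inj h2).symm hmy
          · rcases h1 _ _ he with h1 | h1
            · exact absurd h1 hne
            · exact h1
        intro w f he
        obtain ⟨rfl, rfl⟩ := hx w f he
        exact ⟨((par_link hf hf').2 Pm).ptr, hx⟩
      · exact absurd (Option.some.inj hm).symm hmy

theorem RotThread.parentY {d e : Side} {y x : Node} (hL : ListInv 𝒸)
    (hT : TreeInv 𝒸) (hpc : pc t = .rot d e (.parentY y x))
    (ha : ListAct t h (pc t) (setPtr h y .parent (some x)) (.rot d e .unlock)) :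
    TreeInv ⟨setPtr h y .parent (some x), Function.update pc t (.rot d e .unlock)⟩ := by
  have hi := hT.thread t
  dsimp only at hi
  rw [hpc] at hi
  obtain ⟨r, hy⟩ := hi
  have hr : (PC.rot (K := K) d e .unlock).removing = (pc t).removing := by rw [hpc]; rfl
  have hnew : ∀ n, (PC.rot (K := K) d e .unlock).newNode = some n →
      (pc t).newNode = some n := by intro n hn; cases hn
  refine hT.write_parent hL ha hnew hr (Or.inr r.par_y) (fun t' _ => r.new_y t')
    (hT.lock_lt _ _ r.own_x.1) trivial ?_
  intro m hm
  have hm : m = y := by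
    rcases hm with hm | hm
    · rw [hpc] at hm; exact hm
    · exact hm
  subst hm
  left
  intro w f he
  obtain ⟨rfl, rfl⟩ := hy w f ((treeEdge_parent hr).1 he)
  exact ⟨by simp, fun w' f' he' => hy w' f' ((treeEdge_parent hr).1 he')⟩

theorem RotStep.treeInv {d e : Side} {q q' : RotPoint} (hL : ListInv 𝒸) (hT : TreeInv 𝒸)
    (hpc : pc t = .rot d e q) (hst : RotStep t d e h q h' (some q')) :
    TreeInv ⟨h', Function.update pc t (.rot d e q')⟩ := by
  have ha : ListAct t h (pc t) h' (.rot d e q') := by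
    rw [hpc]; exact (TStep.rot h h' d e q q' hst).listAct
  have hi := hT.thread t
  dsimp only at hi
  rw [hpc] at hi
  have hr : ∀ q' : RotPoint, (PC.rot (K := K) d e q').removing = (pc t).removing := by
    intro q'; rw [hpc]; rfl
  have hnew : ∀ q' : RotPoint, ∀ n < h.next, (PC.rot (K := K) d e q').newNode = some n →
      (pc t).newNode = some n := by intro q' n _ hn; cases hn
  have hfr : ∀ q' : RotPoint, ∀ w, (PC.rot (K := K) d e q').freshLock = some w →
      (pc t).freshLock = some w := by intro q' n hn; cases hn
  have read : ∀ q' : RotPoint, ListAct t h (pc t) h (.rot d e q') → RotThread 𝒸 t d e q' →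
      (∀ m, Transit 𝒸 m (.rot d e q) → Transit 𝒸 m (.rot d e q')) →
      TreeInv ⟨h, Function.update pc t (.rot d e q')⟩ := by
    intro q' ha h1 h2
    refine hT.read hL ha (hnew q') (hr q')
      (RotThread.rely (Keep.read hL hT ha (hnew q') (hr q') (hfr q')) h1) (fun m hm => ?_)
    rw [hpc] at hm
    have := h2 m hm
    cases q' <;> exact Or.inr this
  have own : ∀ w (q' : RotPoint),
      Own ⟨lockTreeOf h w t, Function.update pc t (.rot d e q')⟩ t w :=
    fun w q' => ⟨by simp, by simp [PC.freshLock]⟩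
  cases hst with
  | lockP p hl =>
    refine hT.lock hL ha (hnew _) (hr _) hl hi (own p _) (fun m hm => ?_)
    rw [hpc] at hm; exact hm.elim
  | removed p hp => exact read _ ha trivial (fun m => id)
  -- The mark is tested under the lock of `p`. From here on `p` stays in the tree, since taking it
  -- out requires ownership of `p`.
  | present p hp => exact read _ ha ⟨hi, Or.inl hp⟩ (fun m => id)
  | noY p hy => exact read _ ha trivial (fun m => id)
  | readY p y hy => exact read _ ha ⟨hi.1, hi.2, hy⟩ (fun m => id)
  | lockY p y hl =>
    have g := Keep.lock hL hT ha (hnew _) (hr _) (fun w hw _ => hfr _ w hw)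
    refine hT.lock hL ha (hnew _) (hr _) hl (hT.edge _ _ _ hi.2.2).1.1.1
      ⟨hi.1.rely g, g.inTree _ hi.2.1 (Or.inl hi.1), hi.2.2, own y _⟩ (fun m hm => ?_)
    rw [hpc] at hm; exact hm.elim
  | noX p y hx => exact read _ ha trivial (fun m => id)
  | readX p y x hx => exact read _ ha ⟨hi.1, hi.2.1, hi.2.2.1, hi.2.2.2, hx⟩ (fun m => id)
  | lockX p y x hl =>
    have g := Keep.lock hL hT ha (hnew _) (hr _) (fun w hw _ => hfr _ w hw)
    refine hT.lock hL ha (hnew _) (hr _) hl (hT.edge _ _ _ hi.2.2.2.2).1.1.1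
      ⟨hi.1.rely g, g.inTree _ hi.2.1 (Or.inl hi.1), hi.2.2.1, hi.2.2.2.1.rely g, hi.2.2.2.2,
        own x _⟩ (fun m hm => ?_)
    rw [hpc] at hm; exact hm.elim
  | linkX p y x => exact RotThread.linkX hL hT hpc ha
  | parentX p y x => exact RotThread.parentX hL hT hpc ha
  | readC y x =>
    obtain ⟨p, h1, h2⟩ := hi
    exact read _ ha ⟨p, h1, h2, rfl⟩ (fun m => id)
  | linkC y x v => exact RotThread.linkC hL hT hpc ha
  | parentC y x v =>
    cases v with
    | none =>
      refine read _ ha ⟨hi.1, hi.2.1, fun m hm => ?_⟩ (fun m hm => ?_)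
      · rw [hi.2.2.1] at hm; cases hm
      · rcases hm with hm | hm
        · exact Or.inl hm
        · cases hm
    | some m => exact RotThread.parentC hL hT hpc ha
  | linkY y x => exact RotThread.linkY hL hT hpc ha
  | parentY y x => exact RotThread.parentY hL hT hpc ha

end Rotation

/-! ### Removal of nodes from the tree -/

theorem PC.deleted_of_removing {q : PC K} {n : Node} (h : q.removing = some n) :
    q.deleted = some n := by
  unfold PC.removing at h
  split at h
  · cases h
  · exact h
  · cases h

/-- After all links from nodes other than `n` to `m` are known to be settled, a new link from `n`
does not matter. -/
theorem Settled.except {c : Config K} {n m : Node} (h : Settled c m) : SettledExcept c n m :=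
  fun w d he _ => ⟨(h w d he).1, fun w' d' he' _ => (h w d he).2 w' d' he'⟩

section Removal

variable [LinearOrder K] {h h' : Shared K} {pc : Thread → PC K} {t : Thread} {k : K}
  {p n : Node}

local notation "𝒸" => (Config.mk h pc : Config K)

/-- A child of a node that `t` owns. -/
theorem TreeInv.par_child (hT : TreeInv 𝒸) {w m : Node} {d : Side} (he : TreeEdge 𝒸 w d m)
    (hw : Own 𝒸 t w) (hm : ¬ Transit 𝒸 m (pc t)) :
    Par 𝒸 t m w ∧ ∀ w' d', TreeEdge 𝒸 w' d' m → w' = w ∧ d' = d := by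
  obtain ⟨h1, h2⟩ := hT.settled_of_own (Or.inr ⟨_, _, he, hw⟩) hm _ _ he
  exact ⟨⟨(hT.edge _ _ _ he.ptr).1.1.1, h1, hw⟩, h2⟩

/-- The start of `updateChild` when a single child takes the place of `n`. As nothing is in transit,
every child of `n` is settled under `n`, which `t` owns. -/
theorem TreeInv.replacing (hT : TreeInv 𝒸) (hr : (pc t).removing = some n)
    (hnt : ∀ m, ¬ Transit 𝒸 m (pc t)) (ho : Own 𝒸 t n) (d : Side) :
    Replacing 𝒸 t n ((h.mem n).ptr d.fld) := by
  have hin : InTree 𝒸 n := Or.inr ⟨t, hr⟩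
  refine ⟨ho, fun m hm => ?_, fun f m hm => ?_⟩
  · have he : TreeEdge 𝒸 n d m := ⟨hin, hm⟩
    obtain ⟨h1, h2⟩ := hT.par_child he ho (hnt m)
    obtain ⟨h3, h4⟩ := hT.edge _ _ _ hm
    exact ⟨hT.edge_inTree _ _ _ he, h3, h4, ⟨_, h1⟩, fun w f he => (h2 w f he).1,
      fun he => by subst he; exact h1⟩
  · have he : TreeEdge 𝒸 n f m := ⟨hin, hm⟩
    obtain ⟨h1, h2⟩ := hT.par_child he ho (hnt m)
    exact ⟨⟨_, h1⟩, fun w f he hw => absurd (h2 w f he).1 hw,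
      fun w f he => by rw [(h2 w f he).1]; exact ho⟩

/-- Once the parents of both children are `s`, only the links from `n` disagree with the parents.
These stop counting when `n` leaves the tree, hence `SettledExcept` with exception `n`. -/
theorem Adopting.replacing {c : Config K} {s : Node} (hA : Adopting c t n s s s)
    (hs : InTree c s) (hseen : Seen c s) (hnew : NotNew c s) (hne : s ≠ n) :
    Replacing c t n (some s) where
  own := hA.own_n
  target m hm := by
    obtain rfl := Option.some.inj hm
    exact ⟨hs, hseen, hnew, hA.par_s, fun w f he => absurd he (hA.in_s w f),
      fun he => absurd he hne⟩
  child f m hm := by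
    have hp : Par c t m s := by
      cases f
      · exact hA.left m hm
      · exact hA.right m hm
    have hc := hA.child f m hm
    refine ⟨⟨_, hp⟩, fun w g he hw => ?_, fun w g he => ?_⟩
    · obtain ⟨h1, rfl⟩ := hc w g he
      obtain rfl := h1.resolve_left hw
      refine ⟨hp.ptr, fun w' g' he' hw' => ?_⟩
      obtain ⟨h1, rfl⟩ := hc w' g' he'
      exact ⟨h1.resolve_left hw', rfl⟩
    · rcases (hc w g he).1 with h1 | h1
      · rw [h1]; exact hA.own_n
      · rw [h1]; exact hA.own_s

/-- The facts about a child of `n` or `s` while children are copied. -/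
theorem Copying.facts {s m : Node} (hT : TreeInv 𝒸)
    (hC : Copying 𝒸 t n s)
    (htr : ∀ m, Transit 𝒸 m (pc t) → m = s ∨ ∃ f : Side, (h.mem s).ptr f.fld = some m)
    (hm : (∃ f, TreeEdge 𝒸 n f m) ∨ ∃ f : Side, (h.mem s).ptr f.fld = some m) :
    OwnPar 𝒸 t m ∧ SettledExcept 𝒸 s m ∧ SrcOwned 𝒸 t m := by
  rcases hm with ⟨f, he⟩ | ⟨f, hm⟩
  · by_cases ht : Transit 𝒸 m (pc t)
    · obtain ⟨h1, h2⟩ := hT.transit ht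
      refine ⟨h1, ?_, h2⟩
      rcases htr m ht with rfl | ⟨g, hg⟩
      · exact fun w d he hw => absurd (hC.in_s w d he) hw
      · exact (hC.child g m hg).2.1
    · obtain ⟨h1, h2⟩ := hT.par_child he hC.own_n ht
      refine ⟨⟨_, h1⟩, ?_, fun w d he' => by rw [(h2 w d he').1]; exact hC.own_n⟩
      exact (hT.settled_of_own (Or.inl ⟨_, h1⟩) ht).except
  · exact hC.child f m hm

/-- `SettledExcept` ignores links from `s`, and `t` owns `s`, so a write to a link of `s` cannot
disturb these facts. -/
theorem Copying.link {s : Node} {d : Side} {v : Option Node} {q' : PC K}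
    (hf : q'.freshLock = none) (hf' : (pc t).freshLock = none)
    (hr : q'.removing = (pc t).removing) (hs : Own 𝒸 t s) {m : Node}
    (hm : OwnPar 𝒸 t m ∧ SettledExcept 𝒸 s m ∧ SrcOwned 𝒸 t m) :
    OwnPar ⟨setPtr h s d.fld v, Function.update pc t q'⟩ t m ∧
    SettledExcept ⟨setPtr h s d.fld v, Function.update pc t q'⟩ s m ∧
    SrcOwned ⟨setPtr h s d.fld v, Function.update pc t q'⟩ t m := by
  have hold : ∀ w f, TreeEdge ⟨setPtr h s d.fld v, Function.update pc t q'⟩ w f m → w ≠ s →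
      TreeEdge 𝒸 w f m := by
    intro w f he hw
    rcases (treeEdge_link hr).1 he with ⟨h1, -⟩ | ⟨-, he⟩
    · exact absurd h1 hw
    · exact he
  refine ⟨(ownPar_link hf hf').2 hm.1, fun w f he hw => ?_, fun w f he => ?_⟩
  · obtain ⟨h1, h2⟩ := hm.2.1 w f (hold w f he hw) hw
    exact ⟨by simpa [d.fld_ne_parent.symm] using h1,
      fun w' f' he' hw' => h2 w' f' (hold w' f' he' hw') hw'⟩
  · by_cases hw : w = s
    · subst hw; exact (own_setPtr hf hf').2 hs
    · exact (own_setPtr hf hf').2 (hm.2.2 w f (hold w f he hw))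

theorem SettledExcept.settled {c : Config K} {s m : Node} (hm : SettledExcept c s m)
    (hs : ¬ ∃ f : Side, (c.shared.mem s).ptr f.fld = some m) : Settled c m := by
  have hne : ∀ w f, TreeEdge c w f m → w ≠ s := by
    rintro w f he rfl
    exact hs ⟨f, he.ptr⟩
  intro w f he
  obtain ⟨h1, h2⟩ := hm w f he (hne w f he)
  exact ⟨h1, fun w' f' he' => h2 w' f' he' (hne w' f' he')⟩

theorem RmThread.copyLeft {s : Node} {v : Option Node} (hL : ListInv 𝒸) (hT : TreeInv 𝒸)
    (hpc : pc t = .delTree k p n (.copyWrite s .left v))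
    (ha : ListAct t h (pc t) (setPtr h s .left v) (.delTree k p n (.copyRead s .right))) :
    TreeInv ⟨setPtr h s .left v, Function.update pc t (.delTree k p n (.copyRead s .right))⟩ := by
  have hi := hT.thread t
  dsimp only at hi
  rw [hpc] at hi
  obtain ⟨hC, hv⟩ := hi
  dsimp only at hv
  have hf : (PC.delTree k p n (.copyRead s .right)).freshLock = none := rfl
  have hf' : (pc t).freshLock = none := by rw [hpc]; rfl
  have hr : (PC.delTree k p n (.copyRead s .right)).removing = (pc t).removing := by rw [hpc]; rfl
  have hin : InTree 𝒸 n := Or.inr ⟨t, by dsimp only; rw [hpc]; rfl⟩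
  have hnew : ∀ m, (PC.delTree k p n (.copyRead s .right)).newNode = some m →
      (pc t).newNode = some m := by intro n hn; cases hn
  have hne : s ≠ n := (hL.succ_deleted (t := t) (by dsimp only; rw [hpc]; rfl) hC.succ).1
  have htr : ∀ m, Transit 𝒸 m (pc t) → m = s ∨ ∃ f : Side, (h.mem s).ptr f.fld = some m := by
    rw [hpc]; exact fun m hm => hm
  have hedge : ∀ m, v = some m → TreeEdge 𝒸 n .left m := fun m hm => ⟨hin, hv.trans hm⟩
  have facts : ∀ m, v = some m ∨ (∃ f : Side, (h.mem s).ptr f.fld = some m) → _ := fun m hm =>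
    Copying.link (d := .left) (v := v) hf hf' hr hC.own_s
      (hC.facts hT htr (hm.imp_left fun hm => ⟨_, hedge m hm⟩))
  refine hT.write_link (d := .left) hL ha hnew hr hC.own_s.1 ?_ ?_ ?_
  · intro m hm
    obtain ⟨h1, h2⟩ := hT.edge _ _ _ (hedge m hm).ptr
    exact ⟨h1, hT.edge_inTree _ _ _ (hedge m hm), NotNew.step hnew h2,
      (hC.facts hT htr (Or.inl ⟨_, hedge m hm⟩)).1⟩
  · refine ⟨⟨(own_setPtr hf hf').2 hC.own_n, (own_setPtr hf hf').2 hC.own_s, ?_,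
      (ownPar_link (d := .left) hf hf').2 hC.par_s, ?_, ?_⟩, ?_⟩
    · simpa [Side.fld] using hC.succ
    · intro w f he
      rcases (treeEdge_link (d := .left) hr).1 he with ⟨h1, -⟩ | ⟨-, he⟩
      · exact h1
      · exact hC.in_s w f he
    · intro f m hm
      refine facts m ?_
      simp only [setPtr_ptr, true_and] at hm
      split_ifs at hm with hc
      · exact Or.inl hm
      · exact Or.inr ⟨f, hm⟩
    · simp [Side.fld, hne.symm, hv]
  · intro m hm
    -- A former child that `s` no longer links to has only links that `SettledExcept` controls, so
    -- it leaves the transit as a settled node.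
    by_cases hs : ∃ f : Side, ((setPtr h s .left v).mem s).ptr f.fld = some m
    · exact Or.inr (Or.inr hs)
    · rcases hm with hm | hm
      · rcases htr m hm with h1 | h1
        · exact Or.inr (Or.inl h1)
        · exact Or.inl ((facts m (Or.inr h1)).2.1.settled hs)
      · exact Or.inl ((facts m (Or.inl hm)).2.1.settled hs)

theorem RmThread.copyRight {s : Node} {v : Option Node} (hL : ListInv 𝒸) (hT : TreeInv 𝒸)
    (hpc : pc t = .delTree k p n (.copyWrite s .right v))
    (ha : ListAct t h (pc t) (setPtr h s .right v) (.delTree k p n (.adoptRead s .left))) :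
    TreeInv ⟨setPtr h s .right v, Function.update pc t (.delTree k p n (.adoptRead s .left))⟩ := by
  have hi := hT.thread t
  dsimp only at hi
  rw [hpc] at hi
  obtain ⟨hC, hsl, hv⟩ := hi
  dsimp only at hv hsl
  have hf : (PC.delTree k p n (.adoptRead s .left)).freshLock = none := rfl
  have hf' : (pc t).freshLock = none := by rw [hpc]; rfl
  have hr : (PC.delTree k p n (.adoptRead s .left)).removing = (pc t).removing := by rw [hpc]; rfl
  have hin : InTree 𝒸 n := Or.inr ⟨t, by dsimp only; rw [hpc]; rfl⟩
  have hnew : ∀ m, (PC.delTree k p n (.adoptRead s .left)).newNode = some m →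
      (pc t).newNode = some m := by intro n hn; cases hn
  have hne : s ≠ n := (hL.succ_deleted (t := t) (by dsimp only; rw [hpc]; rfl) hC.succ).1
  have htr : ∀ m, Transit 𝒸 m (pc t) → m = s ∨ ∃ f : Side, (h.mem s).ptr f.fld = some m := by
    rw [hpc]; exact fun m hm => hm
  have hedge : ∀ m, v = some m → TreeEdge 𝒸 n .right m := fun m hm => ⟨hin, hv.trans hm⟩
  have facts : ∀ m, v = some m ∨ (∃ f : Side, (h.mem s).ptr f.fld = some m) → _ := fun m hm =>
    Copying.link (d := .right) (v := v) hf hf' hr hC.own_s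
      (hC.facts hT htr (hm.imp_left fun hm => ⟨_, hedge m hm⟩))
  have hsame : ∀ f : Side, ((setPtr h s .right v).mem s).ptr f.fld =
      ((setPtr h s .right v).mem n).ptr f.fld := by
    rintro (_ | _)
    · simpa [Side.fld] using hsl
    · simp [Side.fld, hne.symm, hv]
  have hnptr : ∀ f : Side, ((setPtr h s .right v).mem n).ptr f.fld = (h.mem n).ptr f.fld := by
    intro f; simp [hne.symm]
  -- The children of `n` still have parent `n`, and besides the copies in `s` they have no other
  -- incoming link. In particular no node is a child of `n` on both sides.
  have factsn : ∀ f m, (h.mem n).ptr (Side.fld f) = some m →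
      (h.mem m).ptr .parent = some n ∧ ∀ w' d', TreeEdge 𝒸 w' d' m → w' ≠ s → w' = n ∧ d' = f :=
    fun f m hm => (hC.facts hT htr (Or.inl ⟨f, hin, hm⟩)).2.1 n f ⟨hin, hm⟩ hne.symm
  have hlt : ∀ f m, (h.mem n).ptr (Side.fld f) = some m → m < h.next :=
    fun f m hm => (hT.edge n f m hm).1.1.1
  refine hT.write_link (d := .right) hL ha hnew hr hC.own_s.1 ?_ ?_ ?_
  · intro m hm
    obtain ⟨h1, h2⟩ := hT.edge _ _ _ (hedge m hm).ptr
    exact ⟨h1, hT.edge_inTree _ _ _ (hedge m hm), NotNew.step hnew h2,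
      (hC.facts hT htr (Or.inl ⟨_, hedge m hm⟩)).1⟩
  · refine ⟨(own_setPtr hf hf').2 hC.own_n, (own_setPtr hf hf').2 hC.own_s, ?_,
      (ownPar_link (d := .right) hf hf').2 hC.par_s, ?_, hsame, ?_, ?_, ?_⟩
    · simpa [Side.fld] using hC.succ
    -- Links to `s` came from `s` only. Both links of `s` are now copies of links of `n`, and no
    -- link of `n` leads to `s`, so none is left.
    · intro w f he
      rcases (treeEdge_link (d := .right) hr).1 he with ⟨-, -, h1, -⟩ | ⟨hx, he⟩
      · exact hne (hC.in_s _ _ (hedge s h1)).symm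
      · obtain rfl := hC.in_s w f he
        cases f
        · exact hne (hC.in_s n .left ⟨hin, hsl.symm.trans he.ptr⟩).symm
        · exact hx ⟨rfl, rfl⟩
    · intro m hm
      have hm : (h.mem n).ptr .left = some m := (hnptr .left).symm.trans hm
      exact (par_link (d := .right) hf hf').2 ⟨hlt .left m hm, (factsn .left m hm).1, hC.own_n⟩
    · intro m hm
      have hm : (h.mem n).ptr .right = some m := (hnptr .right).symm.trans hm
      exact (par_link (d := .right) hf hf').2 ⟨hlt .right m hm, (factsn .right m hm).1, hC.own_n⟩
    · intro f m hm w g he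
      have hm : (h.mem n).ptr f.fld = some m := (hnptr f).symm.trans hm
      have hfm := (factsn f m hm).2
      rcases (treeEdge_link (d := .right) hr).1 he with ⟨h1, h2, h3, -⟩ | ⟨hx, he0⟩
      · exact ⟨Or.inr h1, h2.trans (hfm _ _ (hedge m h3) hne.symm).2⟩
      · by_cases hw : w = s
        · subst hw
          refine ⟨Or.inr rfl, ?_⟩
          cases g
          · exact (hfm n .left ⟨hin, hsl.symm.trans he0.ptr⟩ hne.symm).2
          · exact absurd ⟨rfl, rfl⟩ hx
        · obtain ⟨h1, h2⟩ := hfm w g he0 hw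
          exact ⟨Or.inl h1, h2⟩
  · intro m hm
    by_cases hs : ∃ f : Side, ((setPtr h s .right v).mem s).ptr f.fld = some m
    · refine Or.inr (Or.inr ?_)
      obtain ⟨f, hs⟩ := hs
      exact ⟨f, (hsame f).symm.trans hs⟩
    · rcases hm with hm | hm
      · rcases htr m hm with h1 | h1
        · exact Or.inr (Or.inl h1)
        · exact Or.inl ((facts m (Or.inr h1)).2.1.settled hs)
      · exact Or.inl ((facts m (Or.inl hm)).2.1.settled hs)

/-- The parent of a child of `n` is set to `s`. -/
theorem Adopting.parent {s m : Node} {f : Side} {q' : PC K} (hT : TreeInv 𝒸)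
    (hf : q'.freshLock = none) (hf' : (pc t).freshLock = none)
    (hr : q'.removing = (pc t).removing) {pl pr : Node} (hA : Adopting 𝒸 t n s pl pr)
    (hin : InTree 𝒸 n) (hm : (h.mem n).ptr f.fld = some m) :
    Adopting ⟨setPtr h m .parent (some s), Function.update pc t q'⟩ t n s
      (match f with | .left => s | .right => pl) (match f with | .left => pr | .right => s) := by
  have hptr : ∀ y (d : Side), ((setPtr h m .parent (some s)).mem y).ptr d.fld =
      (h.mem y).ptr d.fld := by
    intro x d; simp [d.fld_ne_parent]
  have hlt : m < h.next := (hT.edge n f m hm).1.1.1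
  -- The node `m` is a child of `n` on one side only, so the parent of the child on the other side
  -- is not affected by the write.
  have other : ∀ g, (h.mem n).ptr (Side.fld g) = some m → g = f := fun g hg =>
    (hA.child f m hm n g ⟨hin, hg⟩).2
  refine ⟨(own_setPtr hf hf').2 hA.own_n, (own_setPtr hf hf').2 hA.own_s, ?_,
    ownPar_parent hf hf' hA.own_s hA.par_s, fun w f he => hA.in_s w f ((treeEdge_parent hr).1 he),
    fun g => by rw [hptr, hptr]; exact hA.same g, ?_, ?_, ?_⟩
  · simpa using hA.succ
  · intro x hx
    replace hx : (h.mem n).ptr .left = some x := (hptr n .left).symm.trans hx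
    cases f
    · obtain rfl := Option.some.inj (hx.symm.trans hm)
      exact par_parent hf hf' hlt hA.own_s
    · refine par_parent_of_ne hf hf' ?_ (hA.left x hx)
      rintro rfl
      cases other .left hx
  · intro x hx
    replace hx : (h.mem n).ptr .right = some x := (hptr n .right).symm.trans hx
    cases f
    · refine par_parent_of_ne hf hf' ?_ (hA.right x hx)
      rintro rfl
      cases other .right hx
    · obtain rfl := Option.some.inj (hx.symm.trans hm)
      exact par_parent hf hf' hlt hA.own_s
  · intro g x hx w e he
    dsimp only at hx
    rw [hptr] at hx
    exact hA.child g x hx w e ((treeEdge_parent hr).1 he)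

theorem RmThread.adopt {s m : Node} {f : Side} {at_ : RmPoint} (hL : ListInv 𝒸) (hT : TreeInv 𝒸)
    (hpc : pc t = .delTree k p n (.adoptWrite s f (some m)))
    {pl pr : Node} (hA : Adopting 𝒸 t n s pl pr) (hm : (h.mem n).ptr f.fld = some m)
    (ha : ListAct t h (pc t) (setPtr h m .parent (some s)) (.delTree k p n at_))
    (hr : (PC.delTree k p n at_).removing = some n)
    (ho : TreeThread ⟨setPtr h m .parent (some s), Function.update pc t (.delTree k p n at_)⟩ t
      (.delTree k p n at_))
    (htr : ∀ c : Config K, ∀ m, (m = s ∨ ∃ f : Side, (c.shared.mem n).ptr f.fld = some m) →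
      Transit c m (.delTree k p n at_)) :
    TreeInv ⟨setPtr h m .parent (some s), Function.update pc t (.delTree k p n at_)⟩ := by
  have hptr : ∀ y (d : Side), ((setPtr h m .parent (some s)).mem y).ptr d.fld =
      (h.mem y).ptr d.fld := by
    intro x d; simp [d.fld_ne_parent]
  have hedge := hT.edge n f m hm
  have hr' : (PC.delTree k p n at_).removing = (pc t).removing := by rw [hr, hpc]; rfl
  have hlt : m < h.next := hedge.1.1.1
  refine hT.write_parent hL ha (fun m hm => by cases hm) hr' (Or.inr ?_)
    (fun t' _ => hedge.2 t') (hT.lock_lt _ _ hA.own_s.1) ho ?_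
  · cases f
    · exact ⟨_, hA.left m hm⟩
    · exact ⟨_, hA.right m hm⟩
  · rintro x (hx | rfl)
    · rw [hpc] at hx
      refine Or.inr (htr _ _ ?_)
      simp only [hptr]
      exact hx
    · exact Or.inr (htr _ _ (Or.inr ⟨f, by rw [hptr]; exact hm⟩))

/-- The successor `s` is unmarked, because the deleter holds the lock of its predecessor, and it is
settled under the locked parent `q`. Overwriting the tested link leaves no link to `s`, except
possibly one from `s` to itself. -/
theorem RmThread.ucWriteSucc {m s q : Node} {v : Option Node} {d : Side} (hL : ListInv 𝒸)
    (hT : TreeInv 𝒸) (hpc : pc t = .delTree k p n (.uc m v (some s) (.write q d)))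
    (ha : ListAct t h (pc t) (setPtr h q d.fld v)
      (.delTree k p n (.uc m v (some s) (.setParent q)))) :
    TreeInv ⟨setPtr h q d.fld v,
      Function.update pc t (.delTree k p n (.uc m v (some s) (.setParent q)))⟩ := by
  have hi := hT.thread t
  dsimp only at hi
  rw [hpc] at hi
  obtain ⟨rfl, hU, Ps, hl, hrt⟩ := hi
  dsimp only at hl hrt
  set q' : PC K := .delTree k p n (.uc m v (some m) (.setParent q)) with hq'
  have hf : q'.freshLock = none := rfl
  have hf' : (pc t).freshLock = none := by rw [hpc]; rfl
  have hr : q'.removing = (pc t).removing := by rw [hpc]; rfl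
  have hnew : ∀ m, q'.newNode = some m → (pc t).newNode = some m := by intro n hn; cases hn
  obtain ⟨hne, hrem, hseen, hnn⟩ :=
    hL.succ_deleted (t := t) (by dsimp only; rw [hpc]; rfl) hU.succ
  have hin : InTree 𝒸 m := Or.inl hrem
  have hnt : ∀ x, ¬ Transit 𝒸 x (pc t) := by intro x; rw [hpc]; exact id
  have hset := hT.settled_of_own (Or.inl ⟨_, Ps⟩) (hnt m)
  have hedge : ∀ x, v = some x → TreeEdge 𝒸 m .right x := fun x hx => ⟨hin, hU.right.trans hx⟩
  refine hT.write_link hL ha hnew hr Ps.own.1 ?_ ?_ ?_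
  · intro x hx
    obtain ⟨h1, h2⟩ := hT.edge _ _ _ (hedge x hx).ptr
    exact ⟨h1, hT.edge_inTree _ _ _ (hedge x hx), NotNew.step hnew h2,
      _, (hT.par_child (hedge x hx) hU.own_s (hnt x)).1⟩
  · refine ⟨rfl, (own_setPtr hf hf').2 hU.own_n, (own_setPtr hf hf').2 hU.own_s,
      (own_setPtr hf hf').2 Ps.own, ?_, ⟨_, (par_link hf hf').2 Ps⟩, ?_, ?_, ?_⟩
    · have := hU.succ
      simpa [d.fld_ne_succ.symm] using this
    · intro w f he
      rcases (treeEdge_link hr).1 he with ⟨rfl, -, h1, -⟩ | ⟨hx, he0⟩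
      -- If the right child of `s` is `s` itself, then its parent `q` is `s` as well.
      · have := (hT.par_child (hedge m h1) hU.own_s (hnt m)).1.ptr
        exact Option.some.inj (Ps.ptr.symm.trans this)
      · exfalso
        obtain ⟨h1, h2⟩ := hset w f he0
        obtain rfl := Option.some.inj (h1.symm.trans Ps.ptr)
        refine hx ⟨rfl, ?_⟩
        -- The link from `q` is unique, and the test of `q.left` decides its side: if `q.left` is
        -- not `s`, only the right link can be.
        cases d
        · exact ((h2 w .left ⟨he0.inTree, hl rfl⟩).2).symm
        · cases f
          · exact absurd he0.ptr (hrt rfl)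
          · rfl
    · intro x hx
      obtain ⟨h1, h2⟩ := hT.par_child (hedge x hx) hU.own_s (hnt x)
      refine ⟨NotNew.step hnew (hT.edge _ _ _ (hedge x hx).ptr).2, (par_link hf hf').2 h1, d, ?_⟩
      intro w f he
      rcases (treeEdge_link hr).1 he with ⟨h3, h4, -⟩ | ⟨-, he⟩
      · exact Or.inr ⟨h3, h4⟩
      · exact Or.inl (h2 w f he).1
    · intro f x hx hvx
      have hx' : TreeEdge 𝒸 m f x := by
        refine ⟨hin, ?_⟩
        simp only [setPtr_ptr] at hx
        split_ifs at hx with hc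
        · exact absurd hx hvx
        · exact hx
      obtain ⟨h1, h2⟩ := hT.par_child hx' hU.own_s (hnt x)
      refine ⟨(par_link hf hf').2 h1, fun w g he => ?_⟩
      rcases (treeEdge_link hr).1 he with ⟨-, -, h3, -⟩ | ⟨-, he⟩
      · exact absurd h3 hvx
      · exact (h2 w g he).1
  · rintro x (hx | hx)
    · exact absurd hx (hnt x)
    · exact Or.inr (Or.inr hx)

theorem RmThread.ucParentSucc {m s q x : Node} (hL : ListInv 𝒸)
    (hT : TreeInv 𝒸) (hpc : pc t = .delTree k p n (.uc m (some x) (some s) (.setParent q)))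
    (ha : ListAct t h (pc t) (setPtr h x .parent (some q))
      (.delTree k p n (.copyRead s .left))) :
    TreeInv ⟨setPtr h x .parent (some q),
      Function.update pc t (.delTree k p n (.copyRead s .left))⟩ := by
  have hi := hT.thread t
  dsimp only at hi
  rw [hpc] at hi
  obtain ⟨rfl, hU⟩ := hi
  set q' : PC K := .delTree k p n (.copyRead m .left) with hq'
  have hf : q'.freshLock = none := rfl
  have hf' : (pc t).freshLock = none := by rw [hpc]; rfl
  have hr : q'.removing = (pc t).removing := by rw [hpc]; rfl
  have hnew : ∀ m, q'.newNode = some m → (pc t).newNode = some m := by intro n hn; cases hn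
  have hptr : ∀ y (d : Side), ((setPtr h x .parent (some q)).mem y).ptr d.fld =
      (h.mem y).ptr d.fld := by
    intro x d; simp [d.fld_ne_parent]
  obtain ⟨nx, Px, d, hx⟩ := hU.target x rfl
  have hP := par_parent (q' := q') hf hf' Px.lt hU.own_q
  -- Apart from the link in `s`, which copying will overwrite, `x` now hangs at its new parent `q`
  -- only.
  have hse : SettledExcept ⟨setPtr h x .parent (some q), Function.update pc t q'⟩ m x := by
    intro w g he hw
    obtain ⟨rfl, rfl⟩ := (hx w g ((treeEdge_parent hr).1 he)).resolve_left hw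
    exact ⟨hP.ptr, fun w' g' he' hw' =>
      (hx w' g' ((treeEdge_parent hr).1 he')).resolve_left hw'⟩
  refine hT.write_parent hL ha hnew hr (Or.inr ⟨_, Px⟩) (fun t' _ => nx t')
    (hT.lock_lt _ _ hU.own_q.1) ?_ ?_
  · refine ⟨(own_setPtr hf hf').2 hU.own_n, (own_setPtr hf hf').2 hU.own_s, ?_,
      ownPar_parent hf hf' hU.own_q hU.par_s,
      fun w f he => hU.in_s w f ((treeEdge_parent hr).1 he), fun f y hy => ?_⟩
    · simpa using hU.succ
    · dsimp only at hy
      rw [hptr] at hy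
      by_cases hyx : y = x
      · subst hyx
        refine ⟨⟨_, hP⟩, hse, fun w g he => ?_⟩
        rcases hx w g ((treeEdge_parent hr).1 he) with h1 | h1
        · rw [h1]; exact (own_setPtr hf hf').2 hU.own_s
        · rw [h1.1]; exact (own_setPtr hf hf').2 hU.own_q
      · obtain ⟨h1, h2⟩ := hU.child f y hy (fun he => hyx (Option.some.inj he).symm)
        exact ⟨⟨_, par_parent_of_ne hf hf' hyx h1⟩,
          fun w g he hw => absurd (h2 w g ((treeEdge_parent hr).1 he)) hw,
          fun w g he => by
            rw [h2 w g ((treeEdge_parent hr).1 he)]; exact (own_setPtr hf hf').2 hU.own_s⟩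
  · intro y hy
    have hy : y = m ∨ y = x := by
      rcases hy with hy | hy
      · rw [hpc] at hy
        exact hy.imp id fun hy => (Option.some.inj hy).symm
      · exact Or.inr hy
    rcases hy with rfl | rfl
    · exact Or.inr (Or.inl rfl)
    · by_cases hs : ∃ f : Side, ((setPtr h y .parent (some q)).mem m).ptr f.fld = some y
      · exact Or.inr (Or.inr hs)
      · exact Or.inl (hse.settled hs)

theorem RmThread.ucParent {m q x : Node} (hL : ListInv 𝒸)
    (hT : TreeInv 𝒸) (hpc : pc t = .delTree k p n (.uc m (some x) none (.setParent q)))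
    (ha : ListAct t h (pc t) (setPtr h x .parent (some q)) (.delRead k p n)) :
    TreeInv ⟨setPtr h x .parent (some q), Function.update pc t (.delRead k p n)⟩ := by
  have hi := hT.thread t
  dsimp only at hi
  rw [hpc] at hi
  obtain ⟨rfl, hU⟩ := hi
  set q' : PC K := .delRead k p m with hq'
  have hf : q'.freshLock = none := rfl
  have hf' : (pc t).freshLock = none := by rw [hpc]; rfl
  have hr : q'.removing = (pc t).removing := by rw [hpc]; rfl
  have hnew : ∀ m, q'.newNode = some m → (pc t).newNode = some m := by intro n hn; cases hn
  obtain ⟨nx, Px, d, hx⟩ := hU.target x rfl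
  refine hT.write_parent hL ha hnew hr (Or.inr Px) (fun t' _ => nx t')
    (hT.lock_lt _ _ hU.own_q.1) ?_ ?_
  · refine ⟨(own_setPtr hf hf').2 hU.keep.own, fun f y hy => ?_⟩
    have hy' : (h.mem m).ptr f.fld = some y := by simpa [f.fld_ne_parent] using hy
    refine (hU.keep.child f y hy').imp id fun hy => ?_
    exact ⟨(inTree_setPtr hr).2 hy.1, ownPar_parent hf hf' hU.own_q hy.2⟩
  · intro y hy
    obtain rfl : y = x := by
      rcases hy with hy | hy
      · rw [hpc] at hy; exact (Option.some.inj hy).symm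
      · exact hy
    left
    intro w g he
    obtain ⟨rfl, rfl⟩ := hx w g ((treeEdge_parent hr).1 he)
    exact ⟨by simp, fun w' g' he' => hx w' g' ((treeEdge_parent hr).1 he')⟩

/-- The step that unlinks the removed node `n` from the tree. -/
theorem RmThread.ucWrite {m q : Node} {v : Option Node} {d : Side} (hL : ListInv 𝒸)
    (hT : TreeInv 𝒸) (hpc : pc t = .delTree k p n (.uc m v none (.write q d)))
    (ha : ListAct t h (pc t) (setPtr h q d.fld v)
      (.delTree k p n (.uc m v none (.setParent q)))) :
    TreeInv ⟨setPtr h q d.fld v,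
      Function.update pc t (.delTree k p n (.uc m v none (.setParent q)))⟩ := by
  have hi := hT.thread t
  dsimp only at hi
  rw [hpc] at hi
  obtain ⟨rfl, hR, Pn, hl, hrt⟩ := hi
  dsimp only at hl hrt
  set q' : PC K := .delTree k p m (.uc m v none (.setParent q)) with hq'
  have hf : q'.freshLock = none := rfl
  have hf' : (pc t).freshLock = none := by rw [hpc]; rfl
  have hnew : ∀ m, q'.newNode = some m → (pc t).newNode = some m := by intro n hn; cases hn
  have hremov : (pc t).removing = some m := by rw [hpc]; rfl
  obtain ⟨-, -, -, -, hlk, hrm⟩ := hL.deleted_base (PC.deleted_of_removing hremov)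
  dsimp only at hlk hrm
  have hin : InTree 𝒸 m := Or.inr ⟨t, hremov⟩
  -- The removed node is marked, and after this step no thread has it in `removing`: its deleter
  -- moves on, and there is only one. So exactly this node leaves the tree.
  have hi : ∀ x, InTree ⟨setPtr h q d.fld v, Function.update pc t q'⟩ x ↔
      InTree 𝒸 x ∧ x ≠ m := by
    intro x
    constructor
    · rintro (hx | ⟨t', hx⟩)
      · replace hx : (h.mem x).rem = false := by simpa using hx
        refine ⟨Or.inl hx, ?_⟩
        rintro rfl
        rw [hrm] at hx; cases hx
      · dsimp only at hx
        by_cases ht : t' = t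
        · subst ht; simp [hq', PC.removing] at hx
        · rw [pc_other ht] at hx
          refine ⟨Or.inr ⟨t', hx⟩, ?_⟩
          rintro rfl
          obtain ⟨-, -, -, -, hlk', -⟩ := hL.deleted_base (PC.deleted_of_removing hx)
          exact ht (Option.some.inj (hlk'.symm.trans hlk))
    · rintro ⟨hx | ⟨t', hx⟩, hne⟩
      · exact Or.inl (by simpa using hx)
      · dsimp only at hx
        have ht : t' ≠ t := by
          rintro rfl
          exact hne (Option.some.inj (hx.symm.trans hremov))
        exact Or.inr ⟨t', by dsimp only; rw [pc_other ht]; exact hx⟩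
  have hE : ∀ w f x, TreeEdge ⟨setPtr h q d.fld v, Function.update pc t q'⟩ w f x →
      w ≠ m ∧ ((w = q ∧ f = d ∧ v = some x) ∨ (¬ (w = q ∧ f = d) ∧ TreeEdge 𝒸 w f x)) := by
    rintro w f x ⟨h1, h2⟩
    rw [hi] at h1
    refine ⟨h1.2, ?_⟩
    simp only [setPtr_ptr] at h2
    split_ifs at h2 with hc
    · exact Or.inl ⟨hc.1, Side.fld_injective hc.2, h2⟩
    · exact Or.inr ⟨fun he => hc ⟨he.1, by rw [he.2]⟩, h1.1, h2⟩
  have hpar : ∀ x, ((setPtr h q d.fld v).mem x).ptr .parent = (h.mem x).ptr .parent := by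
    intro x; simp [d.fld_ne_parent.symm]
  have hnt : ∀ x, Transit 𝒸 x (pc t) →
      v = some x ∨ ∃ f : Side, (h.mem m).ptr f.fld = some x := by rw [hpc]; exact fun x => id
  -- Links from the removed node to itself need no control, since they stop counting in this step.
  have hse : SettledExcept 𝒸 m m := by
    by_cases ht : Transit 𝒸 m (pc t)
    · rcases hnt m ht with h1 | ⟨f, h1⟩
      · exact fun w f he hw => absurd ((hR.target m h1).2.2.2.2.1 w f he) hw
      · exact (hR.child f m h1).2.1
    · exact (hT.settled_of_own (Or.inl ⟨_, Pn⟩) ht).except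
  -- The decisive fact: no node of the tree links to the removed node any more. A link from another
  -- node comes from the validated, locked parent `q`, on the side selected by the test, and is the
  -- one overwritten.
  have hnone : ∀ w f, ¬ TreeEdge ⟨setPtr h q d.fld v, Function.update pc t q'⟩ w f m := by
    intro w f he
    obtain ⟨hw, ⟨rfl, rfl, h1⟩ | ⟨hx, he0⟩⟩ := hE w f m he
    -- If the replacement is the removed node itself, then `q` is that node too, and it no longer
    -- counts as a source.
    · have := ((hR.target m h1).2.2.2.2.2 rfl).ptr
      exact hw (Option.some.inj (Pn.ptr.symm.trans this))
    · obtain ⟨h1, h2⟩ := hse w f he0 hw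
      obtain rfl := Option.some.inj (h1.symm.trans Pn.ptr)
      refine hx ⟨rfl, ?_⟩
      cases d
      · exact ((h2 w .left ⟨he0.inTree, hl rfl⟩ hw).2).symm
      · cases f
        · exact absurd he0.ptr (hrt rfl)
        · rfl
  have hin' : ∀ w f x, TreeEdge ⟨setPtr h q d.fld v, Function.update pc t q'⟩ w f x →
      InTree ⟨setPtr h q d.fld v, Function.update pc t q'⟩ x := by
    intro w f x he
    rw [hi]
    refine ⟨?_, ?_⟩
    · obtain ⟨-, ⟨-, -, h1⟩ | ⟨-, he⟩⟩ := hE w f x he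
      · exact (hR.target x h1).1
      · exact hT.edge_inTree _ _ _ he
    · rintro rfl
      exact hnone _ _ he
  have hrely : ∀ t', t' ≠ t → ListRely 𝒸 ⟨setPtr h q d.fld v, Function.update pc t q'⟩ t' :=
    fun t' ht => ha.rely hL rfl ht
  have g : TreeGuar 𝒸 ⟨setPtr h q d.fld v, Function.update pc t q'⟩ t := {
    pc := fun t' ht => pc_other ht
    next_le := le_rfl
    seen := fun x hx => ha.seen hL hx
    notNew := fun x _ => NotNew.step hnew
    lock := fun w t' ht hw => hw
    fld := by
      intro w' d' hw' hne
      by_cases hc : w' = q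
      · subst hc; exact Pn.own.1
      · simp [hc] at hne
    par := fun m hm hne => absurd (hpar m) hne
    edge := by
      intro w' d' x he
      obtain ⟨-, ⟨-, -, h1⟩ | ⟨-, he⟩⟩ := hE w' d' x he
      · exact Or.inr (hR.target x h1).2.2.2.1
      · exact Or.inl he
    inTree := by
      intro x hx h1 h2
      obtain rfl : x = m := by
        by_contra hne
        exact h2 ((hi x).2 ⟨h1, hne⟩)
      exact ⟨hR.own, _, Pn⟩ }
  refine hT.step hL g hrely ?_ (fun w hw => hT.lock_lt _ _ hw) (fun w t' ht => id) ?_ ?_ hin' ?_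
  · dsimp only
    rw [show Function.update pc t q' t = q' from Function.update_self _ _ _]
    refine ⟨rfl, (own_setPtr hf hf').2 Pn.own, ⟨(own_setPtr hf hf').2 hR.own, ?_⟩, ?_⟩
    · intro f x hx
      -- A self-link is allowed; every other child is in the tree, and ownership of its parent keeps
      -- it there until the node leaves the list.
      by_cases hxm : x = m
      · exact Or.inl hxm
      · refine Or.inr ?_
        rw [hi]
        simp only [setPtr_ptr] at hx
        split_ifs at hx with hc
        · obtain ⟨h1, -, -, h4, -⟩ := hR.target x hx
          exact ⟨⟨h1, hxm⟩, (ownPar_link hf hf').2 h4⟩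
        · exact ⟨⟨hT.edge_inTree _ _ _ ⟨hin, hx⟩, hxm⟩,
            (ownPar_link hf hf').2 (hR.child f x hx).1⟩
    · intro x hx
      obtain ⟨h1, -, h3, h4, h5, -⟩ := hR.target x hx
      refine ⟨NotNew.step hnew h3, (ownPar_link hf hf').2 h4, d, fun w f he => ?_⟩
      obtain ⟨hw, ⟨h6, h7, -⟩ | ⟨-, he⟩⟩ := hE w f x he
      · exact ⟨h6, h7⟩
      · exact absurd (h5 w f he) hw
  · exact fun x v hx => hT.parent_lt x v ((hpar x).symm.trans hx)
  · intro w' d' x he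
    simp only [setPtr_ptr] at he
    split_ifs at he with hc
    · obtain ⟨-, h2, h3, -⟩ := hR.target x he
      exact ⟨ha.seen hL h2, NotNew.step hnew h3⟩
    · obtain ⟨h1, h2⟩ := hT.edge w' d' x he
      exact ⟨ha.seen hL h1, NotNew.step hnew h2⟩
  · intro x hx
    by_cases hvx : v = some x
    · right
      dsimp only
      rw [show Function.update pc t q' t = q' from Function.update_self _ _ _]
      exact hvx
    · left
      have hold : ∀ w f, TreeEdge ⟨setPtr h q d.fld v, Function.update pc t q'⟩ w f x →
          w ≠ m ∧ TreeEdge 𝒸 w f x := by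
        intro w f he
        obtain ⟨hw, ⟨-, -, h1⟩ | ⟨-, he⟩⟩ := hE w f x he
        · exact absurd h1 hvx
        · exact ⟨hw, he⟩
      -- Links from the removed node have ceased to count, so settled up to links from it now means
      -- settled.
      have : SettledExcept 𝒸 m x := by
        rcases hx with hx | hx
        · exact hx.except
        · obtain ⟨f, hx⟩ := (hnt x hx).resolve_left hvx
          exact (hR.child f x hx).2.1
      intro w f he
      obtain ⟨h1, h2⟩ := this w f (hold w f he).2 (hold w f he).1
      exact ⟨(hpar x).trans h1, fun w' f' he' => h2 w' f' (hold w' f' he').2 (hold w' f' he').1⟩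

end Removal

/-! ### All steps of `updateChild` and `removeFromTree` -/

section TreeSteps

variable [LinearOrder K] {h h' : Shared K} {pc : Thread → PC K} {t : Thread} {q q' : PC K}

local notation "𝒸" => (Config.mk h pc : Config K)

theorem TreeInv.read_at (hL : ListInv 𝒸) (hT : TreeInv 𝒸) (hpc : pc t = q)
    (ha : ListAct t h q h q') (hnew : ∀ n, q'.newNode = some n → q.newNode = some n)
    (hrem : q'.removing = q.removing)
    (ho : Keep 𝒸 ⟨h, Function.update pc t q'⟩ t → TreeThread ⟨h, Function.update pc t q'⟩ t q')
    (hfr : ∀ w, q'.freshLock = some w → q.freshLock = some w)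
    (hset : ∀ m, Transit 𝒸 m q → Transit ⟨h, Function.update pc t q'⟩ m q') :
    TreeInv ⟨h, Function.update pc t q'⟩ := by
  subst hpc
  exact hT.read hL ha (fun n _ => hnew n) hrem
    (ho (Keep.read hL hT ha (fun n _ => hnew n) hrem hfr)) (fun m hm => Or.inr (hset m hm))

theorem UCStep.treeInv {k : K} {p n m : Node} {v after : Option Node} {u u' : UCPoint}
    (hL : ListInv 𝒸) (hT : TreeInv 𝒸) (hpc : pc t = .delTree k p n (.uc m v after u))
    (hst : UCStep t m v h u h' (some u')) :
    TreeInv ⟨h', Function.update pc t (.delTree k p n (.uc m v after u'))⟩ := by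
  have ha : ListAct t h (pc t) h' (.delTree k p n (.uc m v after u')) := by
    rw [hpc]
    exact (TStep.delTree h h' k p n _ _ (.ucStep h h' m v after u u' hst)).listAct
  have hi := hT.thread t
  dsimp only at hi
  rw [hpc] at hi
  have hnew : ∀ u' : UCPoint, ∀ x < h.next,
      (PC.delTree k p n (.uc m v after u')).newNode = some x → (pc t).newNode = some x := by
    intro u' x _ hx; cases hx
  have hlt : Own 𝒸 t m → m < h.next := fun ho => hT.lock_lt _ _ ho.1
  have hrem : ∀ u', (∀ q, u ≠ .setParent q) → (∀ q, u' ≠ .setParent q) →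
      (PC.delTree k p n (.uc m v after u')).removing = (pc t).removing := by
    intro u' h1 h2
    rw [hpc]
    cases after <;> cases u <;> cases u' <;>
      first | rfl | exact absurd rfl (h1 _) | exact absurd rfl (h2 _)
  have thread : (∀ q, u ≠ .setParent q) → (∀ q, u' ≠ .setParent q) →
      Keep 𝒸 ⟨h', Function.update pc t (.delTree k p n (.uc m v after u'))⟩ t →
      (∀ x, (h'.mem x).ptr .succ = (h.mem x).ptr .succ) →
      (Own 𝒸 t m → UCThread 𝒸 t m u →
        UCThread ⟨h', Function.update pc t (.delTree k p n (.uc m v after u'))⟩ t m u') →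
      TreeThread ⟨h', Function.update pc t (.delTree k p n (.uc m v after u'))⟩ t
        (.delTree k p n (.uc m v after u')) := by
    intro h1 h2 g hs h3
    cases after with
    | none =>
      cases u <;> cases u' <;>
        first
        | exact absurd rfl (h1 _)
        | exact absurd rfl (h2 _)
        | (obtain ⟨rfl, hR, hu⟩ := hi
           exact ⟨rfl, hR.rely g, h3 hR.own hu⟩)
    | some s =>
      cases u <;> cases u' <;>
        first
        | exact absurd rfl (h1 _)
        | exact absurd rfl (h2 _)
        | (obtain ⟨rfl, hR, hu⟩ := hi
           exact ⟨rfl, hR.rely g (hs n), h3 hR.own_s hu⟩)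
  have hset : (∀ q, u ≠ .setParent q) → (∀ q, u' ≠ .setParent q) →
      (∀ x (d : Side), (h'.mem x).ptr d.fld = (h.mem x).ptr d.fld) →
      ∀ x, Transit 𝒸 x (pc t) →
      Transit ⟨h', Function.update pc t (.delTree k p n (.uc m v after u'))⟩ x
        (.delTree k p n (.uc m v after u')) := by
    intro h1 h2 h3 x hx
    rw [hpc] at hx
    cases after <;> cases u <;> cases u' <;>
      first
      | exact absurd rfl (h1 _)
      | exact absurd rfl (h2 _)
      | exact hx
      | (simp only [Transit, h3] at hx ⊢
         exact hx)
  have htread : (∀ q, u ≠ .setParent q) → UCThread 𝒸 t m u := by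
    intro h1
    cases after <;> cases u <;>
      first
      | exact absurd rfl (h1 _)
      | (obtain ⟨rfl, -, hu⟩ := hi
         exact hu)
  have read : ∀ u' : UCPoint, ListAct t h (pc t) h (.delTree k p n (.uc m v after u')) →
      (PC.delTree k p n (.uc m v after u')).removing = (pc t).removing →
      (∀ w, (PC.delTree k p n (.uc m v after u')).freshLock = some w →
        (pc t).freshLock = some w) →
      (Keep 𝒸 ⟨h, Function.update pc t (.delTree k p n (.uc m v after u'))⟩ t →
        TreeThread ⟨h, Function.update pc t (.delTree k p n (.uc m v after u'))⟩ t
          (.delTree k p n (.uc m v after u'))) →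
      (∀ x, Transit 𝒸 x (pc t) →
        Transit ⟨h, Function.update pc t (.delTree k p n (.uc m v after u'))⟩ x
        (.delTree k p n (.uc m v after u'))) →
      TreeInv ⟨h, Function.update pc t (.delTree k p n (.uc m v after u'))⟩ :=
    fun u' ha h1 h2 h3 h4 => hT.read hL ha (hnew u') h1 (h3 (Keep.read hL hT ha (hnew u') h1 h2))
      (fun x hx => Or.inr (h4 x hx))
  cases hst with
  | readParent r hp =>
    exact read _ ha (hrem _ (by simp) (by simp)) (fun w hw => by cases hw)
      (fun g => thread (by simp) (by simp) g (fun _ => rfl) (fun _ _ => hT.parent_lt _ _ hp))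
      (hset (by simp) (by simp) (fun _ _ => rfl))
  | lockFresh r hl =>
    refine hT.lock hL ha (hnew _) (hrem _ (by simp) (by simp)) (Or.inl hl) (htread (by simp))
      (thread (by simp) (by simp) (Keep.lock hL hT ha (hnew _) (hrem _ (by simp) (by simp))
        (fun w hw hw' => ?_)) (fun _ => rfl) (fun _ _ => by simp [UCThread])) (fun x hx => Or.inr
          (hset (by simp) (by simp) (fun _ _ => rfl) x hx))
    obtain rfl : r = w := Option.some.inj hw
    rw [hl] at hw'; cases hw'
  | lockHeld r hl =>
    exact read _ ha (hrem _ (by simp) (by simp)) (fun w hw => by cases hw)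
      (fun g => thread (by simp) (by simp) g (fun _ => rfl) (fun _ _ => hl))
      (hset (by simp) (by simp) (fun _ _ => rfl))
  | valid r b hp =>
    -- Successful validation turns the tentative lock into an owned one, and the parent has been
    -- read under this lock.
    exact read _ ha (hrem _ (by simp) (by simp)) (fun w hw => by cases hw)
      (fun g => thread (by simp) (by simp) g (fun _ => rfl) (fun ho hu =>
        ⟨hlt ho, hp, hu, by simp [PC.freshLock]⟩))
      (hset (by simp) (by simp) (fun _ _ => rfl))
  | invalid r b hp =>
    have hr : h.treeLock r = some t := htread (by simp)
    cases b with
    | false =>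
      exact read _ ha (hrem _ (by simp) (by simp)) (fun w hw => by cases hw)
        (fun g => thread (by simp) (by simp) g (fun _ => rfl) (fun _ _ => trivial))
        (hset (by simp) (by simp) (fun _ _ => rfl))
    | true =>
      have g : Keep 𝒸 ⟨unlockTreeOf h r,
          Function.update pc t (.delTree k p n (.uc m v after .readParent))⟩ t := by
        refine Keep.self hL hT ha (hnew _) (hrem _ (by simp) (by simp)) (fun _ _ _ _ => rfl)
          (fun _ => rfl) (fun w hw => ⟨?_, by simp [PC.freshLock]⟩)
        -- The released lock was tentative, hence not owned, so nothing that `t` knows depends on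
        -- it.
        have hne : w ≠ r := by
          rintro rfl
          apply hw.2
          dsimp only
          rw [hpc]; rfl
        have := hw.1
        dsimp only at this
        simpa [hne] using this
      refine hT.plain hL ha (hnew _) (hrem _ (by simp) (by simp)) (fun _ _ _ _ => rfl)
        (fun _ => rfl) (fun w t' ht => ?_) (fun w hw => ?_)
        (thread (by simp) (by simp) g (fun _ => rfl) (fun _ _ => trivial))
        (fun x hx => Or.inr (hset (by simp) (by simp) (fun _ _ => rfl) x hx))
      · by_cases hw : w = r
        · subst hw; simp [hr, ht.symm]
        · simp [hw]
      · by_cases hwr : w = r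
        · subst hwr; simp at hw
        · exact hT.lock_lt w t (by simpa [hwr] using hw)
  | testLeft r hp =>
    exact read _ ha (hrem _ (by simp) (by simp)) (fun w hw => by cases hw)
      (fun g => thread (by simp) (by simp) g (fun _ => rfl) (fun ho hu =>
        ⟨Par.rely g hu, fun _ => hp, fun he => by cases he⟩))
      (hset (by simp) (by simp) (fun _ _ => rfl))
  | testRight r hp =>
    exact read _ ha (hrem _ (by simp) (by simp)) (fun w hw => by cases hw)
      (fun g => thread (by simp) (by simp) g (fun _ => rfl) (fun ho hu =>
        ⟨Par.rely g hu, fun he => by (cases he), fun _ => hp⟩))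
      (hset (by simp) (by simp) (fun _ _ => rfl))
  | write r d =>
    cases after with
    | none => exact RmThread.ucWrite hL hT hpc ha
    | some s => exact RmThread.ucWriteSucc hL hT hpc ha

theorem RmStep.treeInv {k : K} {p n : Node} {r r' : RmPoint}
    (hL : ListInv 𝒸) (hT : TreeInv 𝒸) (hpc : pc t = .delTree k p n r)
    (hst : RmStep t n h r h' (some r')) :
    TreeInv ⟨h', Function.update pc t (.delTree k p n r')⟩ := by
  have ha : ListAct t h (pc t) h' (.delTree k p n r') := by
    rw [hpc]
    exact (TStep.delTree h h' k p n _ _ hst).listAct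
  have hi := hT.thread t
  dsimp only at hi
  rw [hpc] at hi
  have hnew : ∀ r' : RmPoint, ∀ x < h.next,
      (PC.delTree k p n r').newNode = some x → (pc t).newNode = some x := by
    intro u' x _ hx; cases hx
  have hdel : ((𝒸 : Config K).pc t).deleted = some n := by dsimp only; rw [hpc]; rfl
  obtain ⟨k', p', hB, -⟩ := hL.deleted_base hdel
  have read : ∀ r', ListAct t h (pc t) h (.delTree k p n r') →
      (PC.delTree k p n r').removing = (pc t).removing →
      (PC.delTree k p n r').freshLock = none →
      (Keep 𝒸 ⟨h, Function.update pc t (.delTree k p n r')⟩ t →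
        TreeThread ⟨h, Function.update pc t (.delTree k p n r')⟩ t (.delTree k p n r')) →
      (∀ x, Transit 𝒸 x (.delTree k p n r) →
        Transit ⟨h, Function.update pc t (.delTree k p n r')⟩ x (.delTree k p n r')) →
      TreeInv ⟨h, Function.update pc t (.delTree k p n r')⟩ :=
    fun u' ha h1 h2 h3 h4 => hT.read hL ha (hnew u') h1
      (h3 (Keep.read hL hT ha (hnew u') h1 (fun w hw => by rw [h2] at hw; cases hw)))
      (fun x hx => Or.inr (h4 x (by rw [← hpc]; exact hx)))
  generalize hr' : some r' = o at hst
  cases hst with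
  | lockNode hl =>
    obtain rfl := Option.some.inj hr'
    refine hT.lock hL ha (hnew _) (by rw [hpc]; rfl) hl (hL.reach_lt _ hB.reach_succ)
      ⟨by simp, by simp [PC.freshLock]⟩ (fun m hm => ?_)
    rw [hpc] at hm; exact hm.elim
  | leftNull hc =>
    obtain rfl := Option.some.inj hr'
    exact read _ ha (by rw [hpc]; rfl) rfl (fun g => Own.rely g hi) (fun _ hx => hx.elim)
  | leftSome hc =>
    obtain rfl := Option.some.inj hr'
    exact read _ ha (by rw [hpc]; rfl) rfl (fun g => Own.rely g hi) (fun _ hx => hx.elim)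
  | rightNull hc =>
    obtain rfl := Option.some.inj hr'
    exact read _ ha (by rw [hpc]; rfl) rfl (fun g => Own.rely g hi) (fun _ hx => hx.elim)
  | rightSome hc =>
    obtain rfl := Option.some.inj hr'
    exact read _ ha (by rw [hpc]; rfl) rfl (fun g => Own.rely g hi) (fun _ hx => hx.elim)
  | oneChild d =>
    obtain rfl := Option.some.inj hr'
    refine read _ ha (by rw [hpc]; rfl) rfl (fun g => ⟨rfl, Replacing.rely g ?_, trivial⟩)
      (fun _ hx => hx.elim)
    exact hT.replacing (by rw [hpc]; rfl) (by intro m; rw [hpc]; exact id) hi d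
  | readSucc s hs =>
    obtain rfl := Option.some.inj hr'
    exact read _ ha (by rw [hpc]; rfl) rfl (fun g => ⟨Own.rely g hi, hs⟩) (fun _ hx => hx.elim)
  | lockSucc s hl =>
    obtain rfl := Option.some.inj hr'
    have hr : (PC.delTree k p n (.unlinkSucc s)).removing = (pc t).removing := by rw [hpc]; rfl
    have g := Keep.lock hL hT ha (hnew _) hr (fun w hw => by cases hw)
    refine hT.lock hL ha (hnew _) hr hl (hL.succ_deleted hdel hi.2).2.2.1.1.1
      ⟨hi.1.rely g, hi.2, by simp, by simp [PC.freshLock]⟩ (fun m hm => ?_)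
    rw [hpc] at hm; exact hm.elim
  | unlinkSucc s =>
    obtain rfl := Option.some.inj hr'
    exact read _ ha (by rw [hpc]; rfl) rfl
      (fun g => ⟨rfl, Unlinking.rely g rfl ⟨hi.1, hi.2.2, hi.2.1, rfl⟩, trivial⟩)
      (fun _ hx => hx.elim)
  | copyRead s d =>
    obtain rfl := Option.some.inj hr'
    refine read _ ha (by rw [hpc]; rfl) rfl (fun g => ?_) (fun _ hx => hx)
    cases d
    · exact ⟨Copying.rely g rfl hi, rfl⟩
    · exact ⟨hi.1.rely g rfl, hi.2, rfl⟩
  | copyLeft s v =>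
    obtain rfl := Option.some.inj hr'
    exact RmThread.copyLeft hL hT hpc ha
  | copyRight s v =>
    obtain rfl := Option.some.inj hr'
    exact RmThread.copyRight hL hT hpc ha
  | adoptRead s d =>
    obtain rfl := Option.some.inj hr'
    refine read _ ha (by rw [hpc]; rfl) rfl (fun g => ?_) (fun _ hx => hx)
    cases d
    · exact ⟨Adopting.rely g rfl hi, rfl⟩
    · exact ⟨Adopting.rely g rfl hi, rfl⟩
  | adoptLeft s v =>
    obtain rfl := Option.some.inj hr'
    obtain ⟨hA, hv⟩ := hi
    have hr : (PC.delTree k p n (.adoptRead s .right)).removing = (pc t).removing := by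
      rw [hpc]; rfl
    cases v with
    | none =>
      refine read _ ha hr rfl (fun g => Adopting.rely g rfl { hA with left := fun m hm => ?_ })
        (fun _ hx => hx)
      rw [hv] at hm; cases hm
    | some m =>
      exact RmThread.adopt hL hT hpc hA hv ha rfl
        (hA.parent (f := .left) hT rfl (by rw [hpc]; rfl) hr
          (Or.inr ⟨t, by dsimp only; rw [hpc]; rfl⟩) hv) (fun _ _ => id)
  | adoptRight s v =>
    obtain rfl := Option.some.inj hr'
    obtain ⟨hA, hv⟩ := hi
    have hr : (PC.delTree k p n (.uc n (some s) none .readParent)).removing =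
      (pc t).removing := by rw [hpc]; rfl
    obtain ⟨h1, h2, h3, h4⟩ := hL.succ_deleted hdel hA.succ
    have hset : ∀ c : Config K, ∀ m, (m = s ∨ ∃ f : Side, (c.shared.mem n).ptr f.fld = some m) →
        Transit c m (.delTree k p n (.uc n (some s) none .readParent)) :=
      fun c m hm => hm.imp (fun hm => by rw [hm]) id
    cases v with
    | none =>
      refine read _ ha hr rfl (fun g => ⟨rfl, Replacing.rely g (Adopting.replacing
        { hA with right := fun m hm => ?_ } (Or.inl h2) h3 h4 h1), trivial⟩) (fun m hx => hset 𝒸 m hx)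
      rw [hv] at hm; cases hm
    | some m =>
      have hA' := hA.parent (f := .right) hT
        (q' := .delTree k p n (.uc n (some s) none .readParent)) rfl (by rw [hpc]; rfl) hr
          (Or.inr ⟨t, by dsimp only; rw [hpc]; rfl⟩) hv
      refine RmThread.adopt hL hT hpc hA hv ha rfl ⟨rfl, hA'.replacing ?_ (ha.seen hL h3)
        (NotNew.step (fun x hx => by cases hx) h4) h1, trivial⟩ hset
      exact Or.inl (by simpa using h2)
  | ucStep _ m v after u u' hq =>
    obtain rfl := Option.some.inj hr'
    exact UCStep.treeInv hL hT hpc hq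
  | ucReturn _ m v after u hq =>
    cases after with
    | none => cases hr'
    | some s =>
      obtain rfl := Option.some.inj hr'
      cases hq with
      | setParent q =>
        cases v with
        | none =>
          obtain ⟨rfl, hU⟩ := hi
          refine read _ ha (by rw [hpc]; rfl) rfl (fun g => Copying.rely g rfl
            ⟨hU.own_n, hU.own_s, hU.succ, hU.par_s, hU.in_s, fun f x hx => ?_⟩) (fun x hx => ?_)
          · obtain ⟨h1, h2⟩ := hU.child f x hx (by simp)
            exact ⟨⟨_, h1⟩, fun w g he hw => absurd (h2 w g he) hw,
              fun w g he => by rw [h2 w g he]; exact hU.own_s⟩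
          · rcases hx with hx | hx
            · exact Or.inl hx
            · cases hx
        | some x => exact RmThread.ucParentSucc hL hT hpc ha

theorem RmStep.treeInv_return {k : K} {p n : Node} {r : RmPoint}
    (hL : ListInv 𝒸) (hT : TreeInv 𝒸) (hpc : pc t = .delTree k p n r)
    (hst : RmStep t n h r h' none) :
    TreeInv ⟨h', Function.update pc t (.delRead k p n)⟩ := by
  have ha : ListAct t h (pc t) h' (.delRead k p n) := by
    rw [hpc]
    exact (TStep.delTreeReturn h h' k p n r hst).listAct
  have hi := hT.thread t
  dsimp only at hi
  rw [hpc] at hi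
  generalize hr' : none = o at hst
  cases hst with
  | ucReturn _ m v after u hq =>
    cases after with
    | some s => cases hr'
    | none =>
      cases hq with
      | setParent q =>
        cases v with
        | none =>
          rw [hpc] at ha
          obtain ⟨rfl, hU⟩ := hi
          refine hT.read_at hL hpc ha (fun x hx => by cases hx) rfl
            (fun g => KeepChildren.rely g hU.keep) (fun x hx => by cases hx) (fun x hx => ?_)
          cases hx
        | some x => exact RmThread.ucParent hL hT hpc ha
  | _ => cases hr'

end TreeSteps

/-! ### Insertions, the marking step, and all steps together -/

section Inserts

variable [LinearOrder K] {h h' : Shared K} {pc : Thread → PC K} {t : Thread} {q q' : PC K}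
  {k : K} {p s n z : Node}

local notation "𝒸" => (Config.mk h pc : Config K)

/-- No link leads to the new node of an insertion. -/
theorem TreeInv.new_not_edge (hT : TreeInv 𝒸) (hn : (pc t).newNode = some n) (w : Node) (d : Side) :
    (h.mem w).ptr d.fld ≠ some n := fun he => (hT.edge w d n he).2 t hn

theorem insNew_treeInv (hL : ListInv 𝒸) (hT : TreeInv 𝒸) (hpc : pc t = .insNew k p s)
    (ha : ListAct t h (pc t) (alloc h (toKey k)) (.insNewSucc k p s h.next)) :
    TreeInv ⟨alloc h (toKey k), Function.update pc t (.insNewSucc k p s h.next)⟩ := by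
  have hr : (PC.insNewSucc k p s h.next).removing = (pc t).removing := by rw [hpc]; rfl
  have hold : ∀ x, x ≠ h.next → (alloc h (toKey k)).mem x = h.mem x := by
    intro x hx; rw [alloc_mem, if_neg hx]
  have hnull : ∀ f, ((alloc h (toKey k)).mem h.next).ptr f = none := by
    intro f; rw [alloc_mem, if_pos rfl]; rfl
  have hrem : ∀ x, (∃ t', ((Function.update pc t (.insNewSucc k p s h.next)) t').removing = some x)
      ↔ ∃ t', (pc t').removing = some x := fun x => exists_pc_iff (f := PC.removing) hr
  refine hT.silent hL ha ?_ ?_ ?_ ?_ ?_ (fun _ _ _ => Iff.rfl) ?_ ?_ ?_ (hnull _) ?_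
  · intro x hx hx'
    exact absurd (Option.some.inj hx') hx.ne'
  · intro x hx d; rw [hold x hx.ne]
  · intro x hx; rw [hold x hx.ne]
  · intro x m d hx
    by_cases hc : x = h.next
    · subst hc; rw [hnull] at hx; cases hx
    · rwa [hold x hc] at hx
  · intro x m hx
    by_cases hc : x = h.next
    · subst hc; rw [hnull] at hx; cases hx
    · rwa [hold x hc] at hx
  · intro w hw
    exact (hT.lock_lt w t hw).trans (Nat.lt_succ_self _)
  · intro x hx hi
    refine hi.imp (fun hi => ?_) (hrem x).2
    dsimp only
    rw [hold x hx.ne]; exact hi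
  · rintro w d m ⟨h1, h2⟩
    dsimp only at h2
    have hc : w ≠ h.next := by
      rintro rfl
      rw [hnull] at h2; cases h2
    rw [hold w hc] at h2
    refine ⟨h1.imp (fun h1 => ?_) (hrem w).1, h2⟩
    dsimp only at h1
    rwa [hold w hc] at h1
  · intro m hm
    rw [hpc] at hm; exact hm.elim

/-- Marking does not change the set of tree nodes: `s` was unmarked, and it now counts as being
removed by its deleter. -/
theorem delMark_treeInv (hL : ListInv 𝒸) (hT : TreeInv 𝒸) (hpc : pc t = .delMark k p s)
    (ha : ListAct t h (pc t) (setRem h s true) (.delTree k p s .lockNode)) :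
    TreeInv ⟨setRem h s true, Function.update pc t (.delTree k p s .lockNode)⟩ := by
  have hi := hL.thread t
  dsimp only at hi
  rw [hpc] at hi
  have hrs : (h.mem s).rem = false := by
    refine hL.rem_succ hi.1.reach hi.1.succ hi.1.lock ?_
    dsimp only
    rw [hpc]; simp [PC.deleted]
  refine hT.silent hL ha (fun x _ hx => by cases hx) (fun x _ d => by simp) (fun x _ => by simp)
    (fun x m d hx => by simpa using hx) (fun x m hx => by simpa using hx) (fun _ _ _ => Iff.rfl)
    (fun w hw => hT.lock_lt w t hw) ?_ ?_ trivial (fun m hm => by rw [hpc] at hm; exact hm.elim)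
  · rintro x hx (hi | ⟨t', ht'⟩)
    · by_cases hxs : x = s
      · subst hxs; exact Or.inr ⟨t, by simp [PC.removing]⟩
      · exact Or.inl (by simpa [hxs] using hi)
    · have ht : t' ≠ t := by
        rintro rfl
        dsimp only at ht'
        rw [hpc] at ht'; cases ht'
      exact Or.inr ⟨t', by simpa [pc_other ht] using ht'⟩
  · rintro w d m ⟨h1, h2⟩
    refine ⟨?_, by simpa using h2⟩
    rcases h1 with h1 | ⟨t', h1⟩
    · simp only [setRem_rem] at h1
      split_ifs at h1 with hc
      exact Or.inl h1
    · by_cases ht : t' = t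
      · subst ht
        simp only [Function.update_self, PC.removing, Option.some.injEq] at h1
        subst h1; exact Or.inl hrs
      · exact Or.inr ⟨t', by simpa [pc_other ht] using h1⟩

/-- No lock is needed: the parent of `n` is still null, `n` is the new node of `t` alone, and no
link leads to `n`, which makes it settled with any parent. -/
theorem insParent_treeInv (hL : ListInv 𝒸) (hT : TreeInv 𝒸) (hpc : pc t = .insParent k n z)
    (ha : ListAct t h (pc t) (setPtr h n .parent (some z)) (.insLock k n z)) :
    TreeInv ⟨setPtr h n .parent (some z), Function.update pc t (.insLock k n z)⟩ := by
  have hi := hT.thread t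
  have hl := hL.thread t
  dsimp only at hi hl
  rw [hpc] at hi hl
  have hn : (pc t).newNode = some n := by rw [hpc]; rfl
  have hr : (PC.insLock k n z).removing = (pc t).removing := by rw [hpc]; rfl
  refine hT.write_parent hL ha (fun x hx => by rw [hn]; exact hx) hr
    (Or.inl hi) (fun t' ht he => ht (hL.new_inj t' t n he hn)) hl.1 ?_ ?_
  · simp [TreeThread]
  · rintro m (hm | rfl)
    · rw [hpc] at hm; exact hm.elim
    · exact Or.inl (fun w d he => absurd ((treeEdge_parent hr).1 he).ptr (hT.new_not_edge hn w d))

/-- The new node is unmarked, since the inserter still holds the lock of its list predecessor; so it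
is in the tree whether or not `z` is. A child displaced by the write only loses a link. -/
theorem insChild_treeInv {d : Side} (hL : ListInv 𝒸) (hT : TreeInv 𝒸) (hpc : pc t = .insChild k n z)
    (ha : ListAct t h (pc t) (setPtr h z d.fld (some n)) (.unlock true)) :
    TreeInv ⟨setPtr h z d.fld (some n), Function.update pc t (.unlock true)⟩ := by
  have hi := hT.thread t
  have hl := hL.thread t
  dsimp only at hi hl
  rw [hpc] at hi hl
  obtain ⟨hp, hz⟩ := hi
  obtain ⟨-, p, hB⟩ := hl
  have hn : (pc t).newNode = some n := by rw [hpc]; rfl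
  have hr : (PC.unlock (K := K) true).removing = (pc t).removing := by rw [hpc]; rfl
  have hnew : ∀ x, (PC.unlock (K := K) true).newNode = some x → (pc t).newNode = some x :=
    fun x hx => by cases hx
  have hother : ∀ t', t' ≠ t → (pc t').newNode ≠ some n :=
    fun t' ht he => ht (hL.new_inj t' t n he hn)
  have hlt := hL.reach_lt _ hB.reach_succ
  refine hT.write_link hL ha hnew hr hz.1 ?_ trivial ?_
  · intro m hm
    obtain rfl := Option.some.inj hm
    refine ⟨⟨⟨hlt, Or.inl hB.reach_succ⟩, fun t' he => ?_⟩,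
      Or.inl (hL.rem_succ hB.reach hB.succ hB.lock ?_), fun t' he => ?_, z, hlt, hp, hz⟩
    · by_cases ht : t' = t
      · subst ht; dsimp only at he; rw [hpc] at he; cases he
      · exact hother t' ht (PC.newNode_of_hidden he)
    · dsimp only; rw [hpc]; simp [PC.deleted]
    · by_cases ht : t' = t
      · subst ht; simp [PC.newNode] at he
      · exact hother t' ht (by simpa [pc_other ht] using he)
  · rintro m (hm | hm)
    · rw [hpc] at hm; exact hm.elim
    · obtain rfl := Option.some.inj hm
      left
      have hx : ∀ w f, TreeEdge ⟨setPtr h z d.fld (some n), Function.update pc t (.unlock true)⟩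
          w f n → w = z ∧ f = d := by
        intro w f he
        rcases (treeEdge_link hr).1 he with ⟨h1, h2, -⟩ | ⟨-, he⟩
        · exact ⟨h1, h2⟩
        · exact absurd he.ptr (hT.new_not_edge hn w f)
      intro w f he
      obtain ⟨rfl, rfl⟩ := hx w f he
      exact ⟨by simpa [f.fld_ne_parent.symm] using hp, hx⟩

theorem TreeInv.list_at {o : Node} {f : PtrField} {v : Option Node} (hL : ListInv 𝒸)
    (hT : TreeInv 𝒸) (hpc : pc t = q) (hf : f = .succ ∨ f = .pred)
    (ha : ListAct t h q (setPtr h o f v) q')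
    (hnew : ∀ n, q'.newNode = some n → q.newNode = some n)
    (hrem : q'.removing = q.removing)
    (ho : Keep 𝒸 ⟨setPtr h o f v, Function.update pc t q'⟩ t →
      TreeThread ⟨setPtr h o f v, Function.update pc t q'⟩ t q')
    (hfr : ∀ w, q'.freshLock = some w → q.freshLock = some w)
    (hset : ∀ m, ¬ Transit 𝒸 m q) :
    TreeInv ⟨setPtr h o f v, Function.update pc t q'⟩ := by
  subst hpc
  have hptr : ∀ x g, g ≠ .succ → g ≠ .pred →
      ((setPtr h o f v).mem x).ptr g = (h.mem x).ptr g := by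
    intro x g h1 h2
    have : g ≠ f := by rcases hf with rfl | rfl; exacts [h1, h2]
    simp [this]
  refine hT.plain hL ha (fun n _ => hnew n) hrem hptr (fun _ => by simp) (fun _ _ _ => Iff.rfl)
    (fun w hw => hT.lock_lt w t hw) (ho ?_) (fun m hm => absurd hm (hset m))
  exact Keep.self hL hT ha (fun n _ => hnew n) hrem hptr (fun _ => by simp)
    (fun w hw => ⟨hw.1, by simpa using fun he => hw.2 (hfr w he)⟩)

/-- The invariant of the tree is preserved. -/
theorem TStep.treeInv {l : Label K} (hL : ListInv 𝒸) (hT : TreeInv 𝒸) (hpc : pc t = q)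
    (hst : TStep t h q l h' q') : TreeInv ⟨h', Function.update pc t q'⟩ := by
  have ha := hst.listAct
  have ha' := ha
  rw [← hpc] at ha'
  have hi := hT.thread t
  have hl := hL.thread t
  dsimp only at hi hl
  rw [hpc] at hi hl
  have silent : ∀ q', ListAct t h q h q' → (∀ n, q'.newNode = some n → q.newNode = some n) →
      q'.removing = q.removing → TreeThread ⟨h, Function.update pc t q'⟩ t q' →
      (∀ w, q'.freshLock ≠ some w) → (∀ m, ¬ Transit 𝒸 m q) →
      TreeInv ⟨h, Function.update pc t q'⟩ :=
    fun q' ha h1 h2 h3 h4 h5 => hT.read_at hL hpc ha h1 h2 (fun _ => h3)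
      (fun w hw => absurd hw (h4 w)) (fun m hm => absurd hm (h5 m))
  have locate : ∀ g x y, q = .locate g x y → ∀ z, Seen 𝒸 z → ListAct t h q h (afterLocate z g) →
      TreeInv ⟨h, Function.update pc t (afterLocate z g)⟩ := by
    rintro g x y rfl z hz ha
    rcases g with (k | ⟨u, k⟩) | ⟨κ, d, e⟩
    · exact silent _ ha (by simp [afterLocate, PC.newNode]) rfl trivial
        (by simp [afterLocate, PC.freshLock]) (fun _ => id)
    · exact silent _ ha (by simp [afterLocate, PC.newNode]) rfl trivial
        (by simp [afterLocate, PC.freshLock]) (fun _ => id)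
    · exact silent _ ha (by simp [afterLocate, PC.newNode]) rfl hz.1.1
        (by simp [afterLocate, PC.freshLock]) (fun _ => id)
  cases hst with
  | locateNull g x => exact locate _ _ _ rfl _ hl.1 ha
  | locateFound g x y => exact locate _ _ _ rfl _ (hl.2 y rfl) ha
  | lockPred u k p hlk =>
    exact hT.plain hL ha' (fun x _ hx => by cases hx) (by rw [hpc]; rfl) (fun _ _ _ _ => rfl)
      (fun _ => rfl) (fun _ _ _ => Iff.rfl) (fun w hw => hT.lock_lt w t hw) trivial
      (fun m hm => by rw [hpc] at hm; exact hm.elim)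
  | delLock k p s hlk =>
    exact hT.plain hL ha' (fun x _ hx => by cases hx) (by rw [hpc]; rfl) (fun _ _ _ _ => rfl)
      (fun _ => rfl) (fun _ _ _ => Iff.rfl) (fun w hw => hT.lock_lt w t hw) trivial
      (fun m hm => by rw [hpc] at hm; exact hm.elim)
  | restart u k =>
    exact hT.release hL ha' (fun x _ hx => by cases hx) (by rw [hpc]; rfl) trivial
      (fun m hm => by rw [hpc] at hm; exact hm.elim)
  | unlock b =>
    exact hT.release hL ha' (fun x _ hx => by cases hx) (by rw [hpc]; rfl) trivial
      (fun m hm => by rw [hpc] at hm; exact hm.elim)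
  | delMark k p s => exact delMark_treeInv hL hT hpc ha'
  | delTree _ k p s r r' hq => exact hq.treeInv hL hT hpc
  | delTreeReturn _ k p s r hq => exact hq.treeInv_return hL hT hpc
  | delRead k p s y hy =>
    exact hT.read_at hL hpc ha (fun x hx => by cases hx) rfl (fun g => KeepChildren.rely g hi)
      (fun w hw => by cases hw) (fun m hm => hm)
  | delPred k p s y =>
    exact hT.list_at hL hpc (Or.inr rfl) ha (fun x hx => by cases hx) rfl
      (fun g => KeepChildren.rely g hi) (fun w hw => by cases hw) (fun m hm => hm)
  | delSucc k p s y =>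
    exact hT.list_at hL hpc (Or.inl rfl) ha (fun x hx => by cases hx) rfl
      (fun g => trivial) (fun w hw => by cases hw) (fun m hm => hm)
  | insNew k p s => exact insNew_treeInv hL hT hpc ha'
  | insNewSucc k p s n =>
    exact hT.list_at hL hpc (Or.inl rfl) ha (fun x hx => hx) rfl
      (fun g => by simpa [TreeThread] using hi) (fun w hw => by cases hw) (fun m hm => hm)
  | insNewPred k p s n =>
    exact hT.list_at hL hpc (Or.inr rfl) ha (fun x hx => hx) rfl
      (fun g => by simpa [TreeThread] using hi) (fun w hw => by cases hw) (fun m hm => hm)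
  | insSucc k p s n =>
    exact hT.list_at hL hpc (Or.inl rfl) ha (fun x hx => hx) rfl
      (fun g => by simpa [TreeThread] using hi) (fun w hw => by cases hw) (fun m hm => hm)
  | insPred k p s n =>
    exact hT.list_at hL hpc (Or.inr rfl) ha (fun x hx => hx) rfl
      (fun g => by simpa [TreeThread] using hi) (fun w hw => by cases hw) (fun m hm => hm)
  | insChoose k p s n z hz =>
    exact hT.read_at hL hpc ha (fun x hx => hx) rfl (fun _ => hi) (fun w hw => by cases hw)
      (fun m hm => hm)
  | insParent k n z => exact insParent_treeInv hL hT hpc ha'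
  | insLock k n z hlk =>
    exact hT.lock hL ha' (fun x _ hx => by rw [hpc]; exact hx) (by rw [hpc]; rfl) hlk hl.1
      ⟨hi, by simp, by simp [PC.freshLock]⟩ (fun m hm => by rw [hpc] at hm; exact hm.elim)
  | insChild k n z => exact insChild_treeInv hL hT hpc ha'
  | rot _ d e r r' hq => exact hq.treeInv hL hT hpc
  | rotReturn _ d e r hq =>
    generalize hr' : none = o at hq
    cases hq with
    | unlock =>
      exact hT.release hL ha' (fun x _ hx => by cases hx) (by rw [hpc]; rfl) trivial
        (fun m hm => by rw [hpc] at hm; exact hm.elim)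
    | _ => cases hr'
  | _ =>
    exact silent _ ha (by simp [PC.newNode]) rfl trivial (by simp [PC.freshLock]) (fun _ => id)

end Inserts

/-! ## Runs -/

section Init

variable [LinearOrder K]

theorem reach_init {x : Node} (hx : Reach (initMem K) x) : x = minNode ∨ x = maxNode := by
  induction hx with
  | refl => exact Or.inl rfl
  | @tail b c _ hbc ih =>
    have hbc : (initMem K b).ptr .succ = some c := hbc
    rcases ih with rfl | rfl
    · simp only [initMem, if_true, Option.some.injEq] at hbc
      exact Or.inr hbc.symm
    · simp [initMem, minNode, maxNode] at hbc

theorem reach_init_max : Reach (initMem K) maxNode :=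
  (reach_min _).succ (by simp [initMem])

theorem ListInv.init : ListInv (initConfig K) where
  key_min := by simp [initConfig, initMem, blankNode]
  key_max := by simp [initConfig, initMem, blankNode, minNode, maxNode]
  reach_lt x hx := by
    rcases reach_init hx with rfl | rfl <;> simp [initConfig, minNode, maxNode]
  sorted x y hx hy := by
    rcases reach_init hx with rfl | rfl
    · simp only [initConfig, initMem, if_true, Option.some.injEq] at hy
      subst hy
      simp [initConfig, initMem, blankNode, minNode, maxNode]
    · simp [initConfig, initMem, minNode, maxNode] at hy
  reach_max := reach_init_max
  pred_min := by simp [initConfig, initMem]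
  pred_eq x y hx hy := by
    rcases reach_init hx with rfl | rfl
    · simp only [initConfig, initMem, if_true, Option.some.injEq] at hy
      subst hy
      left
      simp [initConfig, initMem, minNode, maxNode]
    · simp [initConfig, initMem, minNode, maxNode] at hy
  marked x _ hr := by
    exfalso
    simp only [initConfig, initMem] at hr
    split_ifs at hr <;> simp [blankNode] at hr
  pred_seen x y hy := by
    simp only [initConfig, initMem] at hy
    split_ifs at hy
    · simp at hy
    · simp only [if_true, Option.some.injEq] at hy
      subst hy
      exact ⟨⟨by simp [initConfig, minNode], Or.inl (reach_min _)⟩,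
        fun t => by simp [initConfig, PC.hidden]⟩
    · simp [blankNode] at hy
  new_inj t t' n hn := by simp [initConfig, PC.newNode] at hn
  thread t := trivial

theorem initMem_ptr {x : Node} {f : PtrField} (hf : f ≠ .succ) (hf' : f ≠ .pred) :
    (initMem K x).ptr f = none := by
  simp only [initMem]
  split_ifs <;> simp [blankNode, hf, hf']

theorem TreeInv.init : TreeInv (initConfig K) where
  lock_lt w t hw := by simp [initConfig] at hw
  parent_lt w v hw := by
    rw [show ((initConfig K).shared.mem w).ptr .parent = none from
      initMem_ptr (by decide) (by decide)] at hw
    cases hw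
  edge w d m hw := by
    rw [show ((initConfig K).shared.mem w).ptr d.fld = none from
      initMem_ptr d.fld_ne_succ d.fld_ne_pred] at hw
    cases hw
  edge_inTree w d m hw := by
    have := hw.ptr
    rw [show ((initConfig K).shared.mem w).ptr d.fld = none from
      initMem_ptr d.fld_ne_succ d.fld_ne_pred] at this
    cases this
  settled m := by
    left
    intro w d hw
    have := hw.ptr
    rw [show ((initConfig K).shared.mem w).ptr d.fld = none from
      initMem_ptr d.fld_ne_succ d.fld_ne_pred] at this
    cases this
  thread t := trivial

end Init

/-! ### Links of list nodes, and newly written links, lead to list nodes -/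

section Links

variable [LinearOrder K]

/-- A known unmarked node is in the list. A marked node of the tree has a deleter, which unlinks it
from the tree before it unlinks it from the list. -/
theorem InTree.reach {c : Config K} (hL : ListInv c) {x : Node} (hx : InTree c x)
    (hk : Known c x) : Reach c.shared.mem x := by
  rcases hx with hx | ⟨t, hx⟩
  · rcases hk.2 with h1 | h1
    · exact h1
    · rw [hx] at h1; cases h1
  · obtain ⟨k, p, hB, -⟩ := hL.deleted_base (PC.deleted_of_removing hx)
    exact hB.reach_succ

theorem TreeInv.reach_of_edge {c : Config K} (hL : ListInv c) (hT : TreeInv c) {w m : Node}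
    {d : Side} (he : TreeEdge c w d m) : Reach c.shared.mem m :=
  (hT.edge_inTree _ _ _ he).reach hL (hT.edge _ _ _ he.ptr).1.1

/-- Tree links and predecessor links of nodes of the list lead to nodes of the list. -/
theorem TreeInv.reach_link {c : Config K} (hL : ListInv c) (hT : TreeInv c) {x y : Node}
    {f : PtrField} (hf : IsTreePredField f) (hx : Reach c.shared.mem x)
    (hy : (c.shared.mem x).ptr f = some y) : Reach c.shared.mem y := by
  have tree : ∀ d : Side, (c.shared.mem x).ptr d.fld = some y → Reach c.shared.mem y := by
    intro d hy
    by_cases hi : InTree c x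
    · exact hT.reach_of_edge hL ⟨hi, hy⟩
    · have hr : (c.shared.mem x).rem = true := by
        by_contra hr
        exact hi (Or.inl (by simpa using hr))
      obtain ⟨t, ht⟩ := hL.marked x hx hr
      have hrm : (c.pc t).removing ≠ some x := fun he => hi (Or.inr ⟨t, he⟩)
      -- Here `x` has left the tree but not yet the list: its deleter is between the last write of
      -- `updateChild` and the write of `p.succ`.
      have hk : KeepChildren c t x := by
        have h1 := hT.thread t
        generalize c.pc t = q at ht hrm h1
        cases q with
        | delTree k p s r =>
          obtain rfl := Option.some.inj ht
          cases r with
          | uc m v after u =>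
            cases after with
            | none =>
              cases u with
              | setParent q => exact h1.2.keep
              | _ => exact absurd rfl hrm
            | some s => exact absurd rfl hrm
          | _ => exact absurd rfl hrm
        | delRead k p s => obtain rfl := Option.some.inj ht; exact h1
        | delPred k p s y => obtain rfl := Option.some.inj ht; exact h1
        | delSucc k p s y => obtain rfl := Option.some.inj ht; exact h1
        | _ => cases ht
      rcases hk.child d y hy with rfl | ⟨h1, -⟩
      · exact hx
      · exact h1.reach hL (hT.edge _ _ _ hy).1.1
  rcases hf with rfl | rfl | rfl
  · exact tree .left hy
  · exact tree .right hy
  · rcases Relation.ReflTransGen.cases_tail hx with h1 | ⟨w, hw, hwx⟩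
    · subst h1
      rw [hL.pred_min] at hy; cases hy
    · rcases hL.pred_eq w x hw hwx with h1 | ⟨t, ht⟩
      · obtain rfl := Option.some.inj (h1.symm.trans hy)
        exact hw
      -- An out-of-date predecessor link skips one node and leads to `p`, which is in the list and
      -- locked.
      · have h1 := hL.thread t
        generalize c.pc t = q at ht h1
        cases q <;> simp only [PC.predGap, reduceCtorEq, Option.some.injEq, Prod.mk.injEq] at ht
          <;> obtain ⟨rfl, rfl⟩ := ht
        · obtain ⟨hB, -, -, -, -, h2⟩ := h1
          obtain rfl := Option.some.inj (h2.symm.trans hy)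
          exact hB.reach
        · obtain ⟨hB, -, h2⟩ := h1
          obtain rfl := Option.some.inj (h2.symm.trans hy)
          exact hB.reach

variable {h h' : Shared K} {pc : Thread → PC K} {t : Thread} {q q' : PC K}

local notation "𝒸" => (Config.mk h pc : Config K)

theorem setPtr_ptr_some {o x m : Node} {f g : PtrField} {v : Option Node}
    (hx : ((setPtr h o f v).mem x).ptr g = some m) : (h.mem x).ptr g = some m ∨ v = some m := by
  simp only [setPtr_ptr] at hx
  split_ifs at hx
  · exact Or.inr hx
  · exact Or.inl hx

/-- A rotation writes only targets that it has reached along links of nodes which it owns and which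
are still in the tree. -/
theorem RotStep.link_reach {d e : Side} {r : RotPoint} {r' : Option RotPoint} (hL : ListInv 𝒸)
    (hT : TreeInv 𝒸) (hpc : pc t = .rot d e r) (hst : RotStep t d e h r h' r') {x m : Node}
    {g : Side} (hx : (h'.mem x).ptr g.fld = some m) :
    (h.mem x).ptr g.fld = some m ∨ Reach h.mem m := by
  have hi := hT.thread t
  dsimp only at hi
  rw [hpc] at hi
  cases hst with
  | linkX p y x =>
    refine (setPtr_ptr_some hx).imp id fun hm => ?_
    obtain rfl := Option.some.inj hm
    obtain ⟨-, ip, py, -, yx, -⟩ := hi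
    exact hT.reach_of_edge hL (w := y) (d := e) ⟨hT.edge_inTree _ _ _ ⟨ip, py⟩, yx⟩
  | linkC y x v =>
    refine (setPtr_ptr_some hx).imp id fun hm => ?_
    obtain ⟨p, hr, -, hv⟩ := hi
    exact hT.reach_of_edge hL (w := x) (d := e.opp) ⟨hr.inTree_x, hv.trans hm⟩
  | linkY y x =>
    refine (setPtr_ptr_some hx).imp id fun hm => ?_
    obtain rfl := Option.some.inj hm
    exact hi.1.inTree_y.reach hL hi.1.seen_y.1
  | parentX p y x => left; simpa [g.fld_ne_parent] using hx
  | parentC y x v =>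
    left
    cases v with
    | none => exact hx
    | some z => simpa [setPtrIf, g.fld_ne_parent] using hx
  | parentY y x => left; simpa [g.fld_ne_parent] using hx
  | _ => exact Or.inl hx

theorem RmStep.link_reach {k : K} {p n : Node} {r : RmPoint} {r' : Option RmPoint}
    (hL : ListInv 𝒸) (hT : TreeInv 𝒸) (hpc : pc t = .delTree k p n r)
    (hst : RmStep t n h r h' r') {x m : Node}
    {g : Side} (hx : (h'.mem x).ptr g.fld = some m) :
    (h.mem x).ptr g.fld = some m ∨ Reach h.mem m := by
  have hi := hT.thread t
  dsimp only at hi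
  rw [hpc] at hi
  have hdel : ((𝒸 : Config K).pc t).deleted = some n := by dsimp only; rw [hpc]; rfl
  have setParent : ∀ (v : Option Node) (s : Node),
      ((setPtrIf h v .parent (some s)).mem x).ptr g.fld = some m →
      (h.mem x).ptr g.fld = some m ∨ Reach h.mem m := by
    intro v s hx
    left
    cases v with
    | none => exact hx
    | some z => simpa [setPtrIf, g.fld_ne_parent] using hx
  cases hst with
  | copyLeft s v =>
    refine (setPtr_ptr_some hx).imp id fun hm => ?_
    exact hT.reach_of_edge hL (w := n) (d := .left)
      ⟨Or.inr ⟨t, by dsimp only; rw [hpc]; rfl⟩, hi.2.trans hm⟩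
  | copyRight s v =>
    refine (setPtr_ptr_some hx).imp id fun hm => ?_
    exact hT.reach_of_edge hL (w := n) (d := .right)
      ⟨Or.inr ⟨t, by dsimp only; rw [hpc]; rfl⟩, hi.2.2.trans hm⟩
  | adoptLeft s v => exact setParent v s hx
  | adoptRight s v => exact setParent v s hx
  | ucStep _ z v after u u' hq =>
    generalize hu : some u' = o at hq
    cases hq with
    | write q d =>
      refine (setPtr_ptr_some hx).imp id fun hm => ?_
      cases after with
      | none =>
        obtain ⟨h1, h2, -⟩ := hi.2.1.target m hm
        exact h1.reach hL h2.1
      | some s =>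
        obtain ⟨-, h2, -, -⟩ := hL.succ_deleted hdel hi.2.1.succ
        exact hT.reach_of_edge hL (w := s) (d := .right) ⟨Or.inl h2, hi.2.1.right.trans hm⟩
    | setParent q => cases hu
    | invalid r b hp => cases b <;> exact Or.inl hx
    | _ => exact Or.inl hx
  | ucReturn _ z v after u hq =>
    generalize hu : none = o at hq
    cases hq with
    | setParent q => exact setParent v q hx
    | _ => cases hu
  | _ => exact Or.inl hx

/-- New tree links lead to nodes of the list. -/
theorem TStep.link_reach {l : Label K} (hL : ListInv 𝒸) (hT : TreeInv 𝒸) (hpc : pc t = q)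
    (hst : TStep t h q l h' q') {x m : Node} {g : Side} (hx : (h'.mem x).ptr g.fld = some m) :
    (h.mem x).ptr g.fld = some m ∨ Reach h.mem m := by
  have hl := hL.thread t
  dsimp only at hl
  rw [hpc] at hl
  have list : ∀ (o : Node) (f : PtrField) (v : Option Node), g.fld ≠ f →
      ((setPtr h o f v).mem x).ptr g.fld = some m →
      (h.mem x).ptr g.fld = some m ∨ Reach h.mem m := by
    intro o f v hf hx
    left
    simpa [hf] using hx
  cases hst with
  | delTree _ k p s r r' hq => exact hq.link_reach hL hT hpc hx
  | delTreeReturn _ k p s r hq => exact hq.link_reach hL hT hpc hx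
  | rot _ d e r r' hq => exact hq.link_reach hL hT hpc hx
  | rotReturn _ d e r hq => exact hq.link_reach hL hT hpc hx
  | delMark k p s => left; simpa using hx
  | delPred => exact list _ _ _ g.fld_ne_pred hx
  | delSucc => exact list _ _ _ g.fld_ne_succ hx
  | insNew k p s =>
    left
    rw [alloc_mem] at hx
    split_ifs at hx with hc
    · cases hx
    · exact hx
  | insNewSucc => exact list _ _ _ g.fld_ne_succ hx
  | insNewPred => exact list _ _ _ g.fld_ne_pred hx
  | insSucc => exact list _ _ _ g.fld_ne_succ hx
  | insPred => exact list _ _ _ g.fld_ne_pred hx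
  | insParent => exact list _ _ _ g.fld_ne_parent hx
  | insChild k n z =>
    refine (setPtr_ptr_some hx).imp id fun hm => ?_
    obtain rfl := Option.some.inj hm
    obtain ⟨-, p, hB⟩ := hl
    exact hB.reach_succ
  | _ => exact Or.inl hx

end Links

/-! ### Invariants and histories of runs -/

section Run

variable [LinearOrder K]

/-- What is known about a step from a state in which the invariants hold. -/
theorem Step.spec {c c' : Config K} {l : Label K} (hst : Step c l c') (hL : ListInv c)
    (hT : TreeInv c) : ListInv c' ∧ TreeInv c' ∧ ListHist c c' ∧
      ∀ x m (g : Side), (c'.shared.mem x).ptr g.fld = some m →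
        (c.shared.mem x).ptr g.fld = some m ∨ Reach c.shared.mem m := by
  obtain ⟨t, q', hst, hpc⟩ := hst
  obtain ⟨h, pc⟩ := c
  obtain ⟨h', pc'⟩ := c'
  dsimp only at hpc hst
  subst hpc
  exact ⟨hst.listInv hL (fun x d y hy => (hT.edge x d y hy).1) rfl, hst.treeInv hL hT rfl,
    hst.listAct.hist hL rfl, fun x m g hx => hst.link_reach hL hT rfl hx⟩

variable {st : ℕ → Config K} {lab : ℕ → Label K} {N : ℕ}

/-- The invariants are proved together: the list needs tree links to lead to `Seen` nodes, and the
tree needs the list locks and the marks. -/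
theorem IsRun.inv (hr : IsRun st lab N) {i : ℕ} (hi : i ≤ N) :
    ListInv (st i) ∧ TreeInv (st i) := by
  induction i with
  | zero => rw [hr.1]; exact ⟨ListInv.init, TreeInv.init⟩
  | succ i ih =>
    obtain ⟨h1, h2⟩ := ih (by omega)
    obtain ⟨h3, h4, -⟩ := (hr.2 i hi).spec h1 h2
    exact ⟨h3, h4⟩

theorem IsRun.sorted (hr : IsRun st lab N) {i : ℕ} (hi : i ≤ N) :
    SortedList (st i).shared.mem := (hr.inv hi).1.sorted

theorem IsRun.hist (hr : IsRun st lab N) {i : ℕ} (hi : i < N) : ListHist (st i) (st (i + 1)) :=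
  ((hr.2 i hi).spec (hr.inv hi.le).1 (hr.inv hi.le).2).2.2.1

theorem IsRun.known (hr : IsRun st lab N) {i j : ℕ} (hij : i ≤ j) (hj : j ≤ N) {x : Node}
    (hx : Known (st i) x) : Known (st j) x := by
  induction j, hij using Nat.le_induction with
  | base => exact hx
  | succ j hij ih => exact (hr.hist hj).known (ih (by omega))

theorem IsRun.known_of_reach (hr : IsRun st lab N) {i j : ℕ} (hij : i ≤ j) (hj : j ≤ N) {x : Node}
    (hx : Reach (st i).shared.mem x) : Known (st j) x :=
  hr.known hij hj ⟨(hr.inv (hij.trans hj)).1.reach_lt x hx, Or.inl hx⟩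

theorem IsRun.key (hr : IsRun st lab N) {i j : ℕ} (hij : i ≤ j) (hj : j ≤ N) {x : Node}
    (hx : Reach (st i).shared.mem x) : ((st j).shared.mem x).key = ((st i).shared.mem x).key := by
  induction j, hij using Nat.le_induction with
  | base => rfl
  | succ j hij ih =>
    rw [(hr.hist hj).key x (hr.known_of_reach hij (by omega) hx).1, ih (by omega)]

/-- Nodes are marked before they are unlinked. -/
theorem IsRun.reach_of_not_rem (hr : IsRun st lab N) {i j : ℕ} (hij : i ≤ j) (hj : j ≤ N)
    {x : Node} (hx : Reach (st i).shared.mem x) (hm : ((st j).shared.mem x).rem = false) :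
    Reach (st j).shared.mem x := by
  rcases (hr.known_of_reach hij hj hx).2 with h1 | h1
  · exact h1
  · rw [hm] at h1; cases h1

variable {σ : ℕ → Mem K}

/-- Following a tree link or a predecessor link of a node that was reachable. -/
theorem IsRun.past_link (hr : IsRun st lab N) (hσ : ∀ i, σ i = (st i).shared.mem) {i j : ℕ}
    (hij : i ≤ j) (hj : j ≤ N) {x y : Node} {f : PtrField} (hf : IsTreePredField f)
    (hx : Reach (σ i) x) (hy : (σ j x).ptr f = some y) :
    Past σ i j (fun s => Reach s y) := by
  simp only [Past, hσ] at *
  induction j, hij using Nat.le_induction with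
  | base => exact ⟨i, le_rfl, le_rfl, (hr.inv hj).2.reach_link (hr.inv hj).1 hf hx hy⟩
  | succ j hij ih =>
    have hj' : j < N := hj
    -- Either the last step did not write this value, or it did and the target was in the list just
    -- before. The node `x` itself may have been removed long ago.
    have hnew : ((st j).shared.mem x).ptr f = some y ∨ Reach (st j).shared.mem y := by
      have hl := ((hr.2 j hj').spec (hr.inv hj'.le).1 (hr.inv hj'.le).2).2.2.2
      rcases hf with rfl | rfl | rfl
      · exact hl x y .left hy
      · exact hl x y .right hy
      · by_cases hc : ((st j).shared.mem x).ptr .pred = some y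
        · exact Or.inl hc
        · obtain ⟨m, h1, h2⟩ := (hr.hist hj').pred x (hr.known_of_reach hij hj'.le hx)
            (fun he => hc (he.symm.trans hy))
          obtain rfl := Option.some.inj (h1.symm.trans hy)
          exact Or.inr h2
    rcases hnew with h1 | h1
    · obtain ⟨u, h2, h3, h4⟩ := ih hj'.le h1
      exact ⟨u, h2, by omega, h4⟩
    · exact ⟨j, hij, by omega, h1⟩

/-- Following the successor link of a node that was `k`-reachable. -/
theorem IsRun.past_succ (hr : IsRun st lab N) (hσ : ∀ i, σ i = (st i).shared.mem) {i j : ℕ}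
    (hij : i ≤ j) (hj : j ≤ N) {k : K} {x y : Node} (hx : KReach (σ i) k x)
    (hk : (σ i x).key < toKey k) (hy : (σ j x).ptr .succ = some y) :
    Past σ i j (fun s => KReach s k y) := by
  simp only [Past, hσ] at *
  induction j, hij using Nat.le_induction with
  | base => exact ⟨i, le_rfl, le_rfl, hx.succ hk hy⟩
  | succ j hij ih =>
    have hj' : j < N := hj
    by_cases hc : ((st j).shared.mem x).ptr .succ = some y
    · obtain ⟨u, h2, h3, h4⟩ := ih hj'.le hc
      exact ⟨u, h2, by omega, h4⟩
    · have h1 := (hr.hist hj').succ x (hr.known_of_reach hij hj'.le hx.reach)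
        (fun he => hc (he.symm.trans hy))
      have hkey : ((st (j + 1)).shared.mem x).key < toKey k := by
        rw [hr.key (by omega) hj hx.reach]; exact hk
      exact ⟨j + 1, by omega, le_rfl, ((hr.sorted hj).kReach h1 hkey.le).succ hkey hy⟩

/-- A single edge suffices. The time at which the previous location was reachable may precede its
read by any amount; monotonicity of `τ` keeps it before the next read. -/
theorem TraversalCorrect.of_step {E : Extend K} {R : ReachPred K} {σ : ℕ → Mem K} {tb n : ℕ}
    {ℓ : ℕ → Loc} {τ : ℕ → ℕ} (ht : IsTraversal σ E n ℓ τ)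
    (hτ : ∀ i, i < n → tb ≤ τ i) (h0 : R (σ tb) (ℓ 0))
    (hs : ∀ i, i < n → ∀ u, tb ≤ u → u ≤ τ i → R (σ u) (ℓ i) →
      Past σ tb (τ i) (fun s => R s (ℓ (i + 1)))) :
    TraversalCorrect σ R tb n ℓ τ := by
  refine ⟨h0, fun i => ?_⟩
  induction i with
  | zero => exact fun hi => hs 0 hi tb le_rfl (hτ 0 hi) h0
  | succ i ih =>
    intro hi
    obtain ⟨u, h1, h2, h3⟩ := ih (by omega)
    exact hs (i + 1) hi u h1 (h2.trans (ht.1 i hi)) h3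

theorem IsRun.tree_traversals (hr : IsRun st lab N) (hσ : ∀ i, σ i = (st i).shared.mem) :
    TraversalsCorrect σ TreePredExt SReachLoc N := by
  intro tb n ℓ τ _ ht hτ h0
  refine .of_step ht (fun i hi => (hτ i hi).1) h0 fun i hi u hu hu' hR => ?_
  have he := ht.2 i hi
  simp only [SReachLoc] at hR ⊢
  generalize ℓ i = a at hR he
  generalize ℓ (i + 1) = b at he
  generalize hv : readLoc (σ (τ i)) a = v at he
  cases he with
  | field o _ f hf => exact ⟨u, hu, hu', hR⟩
  | follow o o' f hf =>
    simp only [readLoc, Val.ptr.injEq] at hv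
    obtain ⟨w, h1, h2, h3⟩ := hr.past_link hσ hu' (hτ i hi).2 hf (sReach_iff_reach.1 hR) hv
    exact ⟨w, hu.trans h1, h2, sReach_iff_reach.2 h3⟩

theorem IsRun.succ_traversals (hr : IsRun st lab N) (hσ : ∀ i, σ i = (st i).shared.mem) (k : K) :
    TraversalsCorrect σ (SuccExt k) (KReachLoc k) N := by
  intro tb n ℓ τ _ ht hτ h0
  refine .of_step ht (fun i hi => (hτ i hi).1) h0 fun i hi u hu hu' hR => ?_
  have he := ht.2 i hi
  generalize ℓ i = a at hR he
  generalize ℓ (i + 1) = b at he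
  generalize hv : readLoc (σ (τ i)) a = v at he
  cases he with
  | field o m hm =>
    simp only [readLoc, Val.key.injEq] at hv
    have hR : KReach (σ u) k o := hR
    refine ⟨u, hu, hu', kReachLoc_succ_iff.2 ⟨hR, ?_⟩⟩
    have := hR.reach
    rw [hσ] at this hv ⊢
    rw [← hr.key hu' (hτ i hi).2 this, hv]
    exact hm
  | follow o o' =>
    simp only [readLoc, Val.ptr.injEq] at hv
    obtain ⟨h1, h2⟩ := kReachLoc_succ_iff.1 hR
    obtain ⟨w, h1, h2, h3⟩ := hr.past_succ hσ hu' (hτ i hi).2 h1 h2 hv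
    exact ⟨w, hu.trans h1, h2, h3⟩

/-- Past reachability together with a later value of the mark. -/
theorem IsRun.past_rem (hr : IsRun st lab N) (hσ : ∀ i, σ i = (st i).shared.mem) {i j : ℕ}
    (hij : i ≤ j) (hj : j ≤ N) {k : K} {x : Node} (hx : KReach (σ i) k x)
    (hk : (σ j x).key = toKey k) :
    Past σ i j (fun s => KReach s k x ∧ (s x).rem = (σ j x).rem) := by
  simp only [Past, hσ] at *
  induction j, hij using Nat.le_induction with
  | base => exact ⟨i, le_rfl, le_rfl, hx, rfl⟩
  | succ j hij ih =>
    have hj' : j < N := hj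
    have hkn := hr.known_of_reach hij hj'.le hx.reach
    have hkj : ((st j).shared.mem x).key = toKey k := by
      rw [← (hr.hist hj').key x hkn.1]; exact hk
    by_cases hc : ((st (j + 1)).shared.mem x).rem = ((st j).shared.mem x).rem
    · obtain ⟨u, h2, h3, h4, h5⟩ := ih hj'.le hkj
      exact ⟨u, h2, by omega, h4, h5.trans hc.symm⟩
    · have h1 : ((st j).shared.mem x).rem = false := by
        by_contra h1
        have h1 : ((st j).shared.mem x).rem = true := by simpa using h1
        exact hc (((hr.hist hj').rem x hkn.1 h1).trans h1.symm)
      have h2 : ((st (j + 1)).shared.mem x).rem = true := by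
        rw [h1] at hc; simpa using hc
      -- The mark was set in this step, so `x` was in the list before it; being unmarked then, it
      -- did not leave the list in the same step.
      have h3 := (hr.hist hj').mark x hkn.1 h1 h2
      rcases (hr.hist hj').reach x h3 with h4 | h4
      · exact ⟨j + 1, by omega, le_rfl, (hr.sorted hj).kReach h4 hk.le, rfl⟩
      · rw [h1] at h4; cases h4

end Run

/-! ## The assertions -/

section Assertions

variable [LinearOrder K]

/-- The assertions about the past, with the conditions on immutable keys moved to the past. -/
def PastAssertion (past : (Mem K → Prop) → Prop) : PC K → Prop
  | .locate _ x y =>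
      past (fun s => SReach s x) ∧ ∀ y', y = some y' → past (fun s => SReach s y')
  | .walkPred _ x => past (fun s => SReach s x)
  | .walkSucc k x => past (fun s => KReach s k x)
  | .missing k x => past (fun s => KReach s k x ∧ toKey k < (s x).key)
  | .readRem k x => past (fun s => KReach s k x ∧ (s x).key = toKey k)
  | .gotRem k x b => past (fun s => KReach s k x ∧ (s x).key = toKey k ∧ (s x).rem = b)
  | _ => True

theorem Past.mono {σ : ℕ → Mem K} {a a' b b' : ℕ} {P Q : Mem K → Prop} (h : Past σ a b P)
    (ha : a' ≤ a) (hb : b ≤ b') (hPQ : ∀ s, P s → Q s) : Past σ a' b' Q := by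
  obtain ⟨u, h1, h2, h3⟩ := h
  exact ⟨u, ha.trans h1, h2.trans hb, hPQ _ h3⟩

theorem PastAssertion.mono {past past' : (Mem K → Prop) → Prop}
    (h : ∀ P, past P → past' P) {q : PC K} (hq : PastAssertion past q) :
    PastAssertion past' q := by
  cases q with
  | locate g x y => exact ⟨h _ hq.1, fun y' hy => h _ (hq.2 y' hy)⟩
  | walkPred k x => exact h _ hq
  | walkSucc k x => exact h _ hq
  | missing k x => exact h _ hq
  | readRem k x => exact h _ hq
  | gotRem k x b => exact h _ hq
  | _ => trivial

variable {st : ℕ → Config K} {lab : ℕ → Label K} {N : ℕ} {σ : ℕ → Mem K}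

theorem pastAssertion_locate (hr : IsRun st lab N) (hσ : ∀ i, σ i = (st i).shared.mem) {a i : ℕ}
    (ha : a ≤ i) (hi : i ≤ N) (g : Goal K) :
    PastAssertion (Past σ a i) (.locate g maxNode (some maxNode)) := by
  have : Past σ a i (fun s => SReach s maxNode) :=
    ⟨i, ha, le_rfl, sReach_iff_reach.2 (by rw [hσ]; exact (hr.inv hi).1.reach_max)⟩
  exact ⟨this, fun y hy => by obtain rfl := Option.some.inj hy; exact this⟩

theorem PastAssertion.afterLocate {past : (Mem K → Prop) → Prop} {x : Node}
    (hx : past (fun s => SReach s x)) (g : Goal K) :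
    PastAssertion past (afterLocate x g) := by
  rcases g with (k | ⟨u, k⟩) | ⟨κ, d, e⟩
  · exact hx
  · trivial
  · trivial

/-- The assertions about the past are preserved. -/
theorem PastAssertion.step (hr : IsRun st lab N) (hσ : ∀ i, σ i = (st i).shared.mem) {a i : ℕ}
    (ha : a ≤ i) (hi : i < N) {t : Thread} {q q' : PC K} {l : Label K} {h' : Shared K}
    (hst : TStep t (st i).shared q l h' q') (hq : PastAssertion (Past σ a i) q) :
    PastAssertion (Past σ a (i + 1)) q' := by
  have hloc : ∀ g, PastAssertion (Past σ a (i + 1)) (.locate g maxNode (some maxNode)) :=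
    fun g => pastAssertion_locate hr hσ (by omega) hi g
  have mono : ∀ {q' : PC K}, PastAssertion (Past σ a i) q' → PastAssertion (Past σ a (i + 1)) q' :=
    fun h => h.mono (fun P hP => hP.mono le_rfl (Nat.le_succ i) (fun _ => id))
  have link : ∀ {x y : Node} {f : PtrField}, IsTreePredField f → Past σ a i (fun s => SReach s x) →
      ((st i).shared.mem x).ptr f = some y → Past σ a i (fun s => SReach s y) := by
    rintro x y f hf ⟨u, h1, h2, h3⟩ hy
    exact (hr.past_link hσ h2 hi.le hf (sReach_iff_reach.1 h3) (by rw [hσ]; exact hy)).mono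
      h1 le_rfl (fun _ => sReach_iff_reach.2)
  have key : ∀ {u : ℕ} {x : Node}, u ≤ i → Reach (σ u) x →
      ((st i).shared.mem x).key = (σ u x).key := by
    intro u x hu hx
    rw [hσ] at hx ⊢
    exact hr.key hu hi.le hx
  cases hst with
  | call => exact hloc _
  | startRotate => exact hloc _
  | restart => exact hloc _
  | locateNull g x => exact mono (PastAssertion.afterLocate hq.1 g)
  | locateFound g x y hk => exact mono (PastAssertion.afterLocate (hq.2 y rfl) g)
  | locateRight g x y hk =>
    exact mono ⟨hq.2 y rfl, fun z hz => link (Or.inr (Or.inl rfl)) (hq.2 y rfl) hz⟩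
  | locateLeft g x y hk =>
    exact mono ⟨hq.2 y rfl, fun z hz => link (Or.inl rfl) (hq.2 y rfl) hz⟩
  | walkPred k x x' hk hx =>
    exact mono (q' := .walkPred k x') (link (Or.inr (Or.inr rfl)) hq hx)
  | walkPredEnd k x hk =>
    obtain ⟨u, h1, h2, h3⟩ := hq
    have h3 := sReach_iff_reach.1 h3
    rw [key h2 h3] at hk
    -- The change of predicate between the two loops: at the past time `u`, a reachable node with
    -- key at most `k` was `k`-reachable.
    refine ⟨u, h1, by omega, SortedList.kReach ?_ h3 hk⟩
    rw [hσ]; exact hr.sorted (h2.trans hi.le)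
  | walkSucc k x x' hk hx =>
    obtain ⟨u, h1, h2, h3⟩ := hq
    rw [key h2 h3.reach] at hk
    exact (hr.past_succ hσ h2 hi.le h3 hk (by rw [hσ]; exact hx)).mono h1 (Nat.le_succ i)
      (fun _ => id)
  | walkSuccMiss k x hk =>
    obtain ⟨u, h1, h2, h3⟩ := hq
    rw [key h2 h3.reach] at hk
    exact ⟨u, h1, by omega, h3, hk⟩
  | walkSuccHit k x hk =>
    obtain ⟨u, h1, h2, h3⟩ := hq
    rw [key h2 h3.reach] at hk
    exact ⟨u, h1, by omega, h3, hk⟩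
  | readRem k x =>
    obtain ⟨u, h1, h2, h3, h4⟩ := hq
    have hk := h4
    rw [← key h2 h3.reach] at hk
    obtain ⟨w, h5, h6, h7, h8⟩ := hr.past_rem hσ h2 hi.le h3 (by rw [hσ]; exact hk)
    refine ⟨w, h1.trans h5, by omega, h7, ?_, by rw [h8, hσ]⟩
    rw [← key h6 h7.reach, hk]
  | _ => trivial

/-- The assertions follow from the assertions about the past and the invariant of the list. -/
theorem PastAssertion.assertion (hr : IsRun st lab N) (hσ : ∀ i, σ i = (st i).shared.mem)
    {a i : ℕ} (hi : i ≤ N) {t : Thread} {q : PC K} (hpc : (st i).pc t = q)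
    (hq : PastAssertion (Past σ a i) q) :
    Assertion (st i).shared.mem (Past σ a i) q := by
  have hL := (hr.inv hi).1
  have hl := hL.thread t
  rw [hpc] at hl
  have key : ∀ {u : ℕ} {x : Node}, u ≤ i → Reach (σ u) x →
      ((st i).shared.mem x).key = (σ u x).key := by
    intro u x hu hx
    rw [hσ] at hx ⊢
    exact hr.key hu hi hx
  have base : ∀ {k p s}, Base (st i) t k p s → KReach (st i).shared.mem k p :=
    fun b => hL.sorted.kReach b.reach b.key_lt.le
  have rem : ∀ {k p s}, Base (st i) t k p s → ((st i).pc t).deleted = none →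
      ((st i).shared.mem s).rem = false :=
    fun b hd => hL.rem_succ b.reach b.succ b.lock (by rw [hd]; simp)
  cases q with
  | locate g x y => exact hq
  | walkPred k x => exact hq
  | walkSucc k x => exact hq
  | missing k x =>
    obtain ⟨u, h1, h2, h3, h4⟩ := hq
    exact ⟨⟨u, h1, h2, h3⟩, by rw [key h2 h3.reach]; exact h4⟩
  | readRem k x =>
    obtain ⟨u, h1, h2, h3, h4⟩ := hq
    exact ⟨⟨u, h1, h2, h3⟩, by rw [key h2 h3.reach]; exact h4⟩
  | gotRem k x b =>
    obtain ⟨u, h1, h2, h3, h4, h5⟩ := hq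
    exact ⟨⟨u, h1, h2, h3, h5⟩, by rw [key h2 h3.reach]; exact h4⟩
  | inRange u k p s => exact ⟨base hl, hl.key_lt, hl.le_key, hl.rem, hl.succ⟩
  | failed u k p s =>
    obtain ⟨hB, hk⟩ := hl
    have h1 := (base hB).succ hB.key_lt hB.succ
    cases u with
    | insert => exact ⟨h1, hk, rem hB (by rw [hpc]; rfl)⟩
    | delete => exact ⟨h1, hk⟩
  | delMark k p s =>
    obtain ⟨hB, hk, -⟩ := hl
    exact ⟨(base hB).succ hB.key_lt hB.succ, hk, rem hB (by rw [hpc]; rfl)⟩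
  | delSucc k p s y =>
    obtain ⟨hB, hk, -, h1, h2, -⟩ := hl
    exact ⟨base hB, hB.succ, h2, hk, hB.key_lt, by
      rw [← hk]; exact hL.sorted _ _ hB.reach_succ h2, hB.rem, h1⟩
  | insSucc k p s n =>
    obtain ⟨hB, hk, hF, h1, -⟩ := hl
    exact ⟨base hB, hB.rem, hB.succ, hB.key_lt, hk, hF.key, hF.rem, h1⟩
  | _ => trivial

theorem TStep.label_call {t t' : Thread} {h h' : Shared K} {q q' : PC K} {o : SetOp K}
    (hst : TStep t h q (.call t' o) h' q') :
    t' = t ∧ q = .idle ∧ q' = .locate (.op o) maxNode (some maxNode) := by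
  cases hst
  exact ⟨rfl, rfl, rfl⟩

/-- The window starts at `i + 1`, the state right after the call, and only grows, so statements
about the past survive steps of other threads without any rely condition. -/
theorem IsRun.pastAssertion (hr : IsRun st lab N) (hσ : ∀ i, σ i = (st i).shared.mem)
    {t : Thread} {o : SetOp K} {i m : ℕ} (hl : lab i = .call t o) (him : i < m) (hm : m ≤ N) :
    PastAssertion (Past σ (i + 1) m) ((st m).pc t) := by
  induction m, Nat.succ_le_of_lt him using Nat.le_induction with
  | base =>
    obtain ⟨t', q', hst, hpc⟩ := hr.2 i hm
    rw [hl] at hst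
    obtain ⟨rfl, -, rfl⟩ := hst.label_call
    rw [hpc, Function.update_self]
    exact pastAssertion_locate hr hσ le_rfl hm _
  | succ m hi ih =>
    have ih := ih hi (by omega)
    obtain ⟨t', q', hst, hpc⟩ := hr.2 m hm
    rw [hpc]
    by_cases ht : t = t'
    · subst ht
      rw [Function.update_self]
      exact PastAssertion.step hr hσ hi hm hst ih
    · rw [Function.update_of_ne ht]
      exact ih.mono (fun P hP => hP.mono le_rfl (Nat.le_succ m) (fun _ => id))

theorem IsRun.assertionsHold (hr : IsRun st lab N) : AssertionsHold st lab N := by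
  intro t o i m hl him hm _
  exact (hr.pastAssertion (σ := fun r => (st r).shared.mem) (fun _ => rfl) hl him hm).assertion hr
    (fun _ => rfl) hm rfl

end Assertions

/-! ## The abstract set -/

/-- The update that the next step of a thread applies to the abstract set. -/
def PC.effect : PC K → Option (Upd × K)
  | .delMark k _ _ => some (.delete, k)
  | .insSucc k _ _ _ => some (.insert, k)
  | _ => none

theorem toKey_injective : Function.Injective (toKey : K → Key K) :=
  fun _ _ h => WithTop.coe_injective (WithBot.coe_injective h)

section AbsSet

variable [LinearOrder K]

/-- Only reachable nodes that are unmarked count, so unlinking a marked node is invisible. -/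
theorem absSet_congr {σ σ' : Mem K} (hs : SortedList σ) (hs' : SortedList σ')
    (hr : ∀ x, Reach σ' x ∧ (σ' x).rem = false ↔ Reach σ x ∧ (σ x).rem = false)
    (hk : ∀ x, Reach σ x → (σ' x).key = (σ x).key) : absSet σ' = absSet σ := by
  ext k
  rw [hs.mem_absSet, hs'.mem_absSet]
  refine exists_congr fun x => ?_
  constructor
  · rintro ⟨h1, h2, h3⟩
    have h4 := (hr x).1 ⟨h1, h3⟩
    exact ⟨h4.1, by rw [← hk x h4.1]; exact h2, h4.2⟩
  · rintro ⟨h1, h2, h3⟩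
    have h4 := (hr x).2 ⟨h1, h3⟩
    exact ⟨h4.1, by rw [hk x h1]; exact h2, h4.2⟩

variable {h h' : Shared K} {pc : Thread → PC K} {t : Thread} {q q' : PC K}

local notation "𝒸" => (Config.mk h pc : Config K)

theorem ListAct.absSet_eq (hi : ListInv 𝒸) (hq : pc t = q) (ha : ListAct t h q h' q')
    (hs' : SortedList h'.mem) (he : q.effect = none) : absSet h'.mem = absSet h.mem := by
  have ho := hi.thread t
  dsimp only at ho
  rw [hq] at ho
  cases ha with
  | silent _ _ _ hs hqq =>
    exact absSet_congr hi.sorted hs' (fun x => by rw [hs.reach, hs.rem]) (fun x _ => hs.key x)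
  | insNew k p s =>
    refine absSet_congr hi.sorted hs' (fun x => ?_) (fun x hx => ?_)
    · rw [insNew_reach hi]
      refine and_congr_right fun hx => ?_
      simp [alloc_mem, (hi.reach_lt x hx).ne]
    · simp [alloc_mem, (hi.reach_lt x hx).ne]
  | insNewSucc k p s n =>
    exact absSet_congr hi.sorted hs' (fun x => by rw [setNew_reach ho.2.2.not_reach]; simp)
      (fun x _ => by simp)
  | insNewPred k p s n =>
    exact absSet_congr hi.sorted hs' (fun x => by rw [setNew_reach ho.2.2.1.not_reach]; simp)
      (fun x _ => by simp)
  | insSucc => cases he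
  | insPred k p s n =>
    exact absSet_congr hi.sorted hs' (fun x => by rw [setPred_reach]; simp) (fun x _ => by simp)
  | delMark => cases he
  | delPred k p s y =>
    exact absSet_congr hi.sorted hs' (fun x => by rw [setPred_reach]; simp) (fun x _ => by simp)
  | delSucc k p s y =>
    refine absSet_congr hi.sorted hs' (fun x => ?_) (fun x _ => by simp)
    rw [delSucc_reach hi hq, setPtr_rem]
    refine ⟨fun hx => ⟨hx.1.1, hx.2⟩, fun hx => ⟨⟨hx.1, ?_⟩, hx.2⟩⟩
    rintro rfl
    have h1 := ho.2.2.2.1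
    rw [hx.2] at h1
    cases h1

/-- Insertion: `k` lies strictly between the keys of neighbours, so no node of the list has this key
and the set really grows. Deletion: `s` is the only node of the list with its key and is unmarked
until now, so the set really shrinks. -/
theorem TStep.absSet_effect {l : Label K} (hi : ListInv 𝒸) (hq : pc t = q)
    (hst : TStep t h q l h' q') (hs' : SortedList h'.mem) {u : Upd} {k : K}
    (he : q.effect = some (u, k)) :
    absSet h'.mem = u.apply k (absSet h.mem) ∧ absSet h.mem ≠ absSet h'.mem := by
  have ho := hi.thread t
  dsimp only at ho
  rw [hq] at ho
  cases hst with
  | insSucc k₀ p s n =>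
    obtain ⟨rfl, rfl⟩ := Prod.mk.inj (Option.some.inj he)
    obtain ⟨b, hs, hf, -, -⟩ := ho
    have hmem : ∀ k, k ∈ absSet (setPtr h p .succ (some n)).mem ↔ k ∈ absSet h.mem ∨ k = k₀ := by
      intro k
      rw [hi.sorted.mem_absSet, hs'.mem_absSet]
      simp only [insSucc_reach hi hq, setPtr_key, setPtr_rem]
      constructor
      · rintro ⟨x, hx | rfl, h1, h2⟩
        · exact Or.inl ⟨x, hx, h1, h2⟩
        · exact Or.inr (toKey_injective (h1.symm.trans hf.key))
      · rintro (⟨x, hx, h1⟩ | rfl)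
        · exact ⟨x, Or.inl hx, h1⟩
        · exact ⟨n, Or.inr rfl, hf.key, hf.rem⟩
    have hnot : k₀ ∉ absSet h.mem := by
      rintro ⟨x, hx, h1, -⟩
      have h2 := hi.sorted.path_of_key_lt b.reach hx.reach (by rw [h1]; exact b.key_lt)
      rcases Relation.ReflTransGen.cases_head h2 with h3 | ⟨z, hz, h3⟩
      · subst h3; exact b.key_lt.ne h1
      · obtain rfl : s = z := Option.some.inj (b.succ.symm.trans hz)
        have h4 := hi.sorted.key_le_of_path b.reach_succ h3
        exact absurd (hs.trans_le h4) (by rw [h1]; exact lt_irrefl _)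
    refine ⟨Set.ext hmem, fun h1 => hnot ?_⟩
    have := (hmem k₀).2 (Or.inr rfl)
    rwa [← h1] at this
  | delMark k₀ p s =>
    obtain ⟨rfl, rfl⟩ := Prod.mk.inj (Option.some.inj he)
    obtain ⟨b, hk, -⟩ := ho
    have hmem : ∀ k, k ∈ absSet (setRem h s true).mem ↔ k ∈ absSet h.mem ∧ k ≠ k₀ := by
      intro k
      rw [hi.sorted.mem_absSet, hs'.mem_absSet]
      simp only [delMark_reach, setRem_key, setRem_rem]
      constructor
      · rintro ⟨x, hx, h1, h2⟩
        split_ifs at h2 with h3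
        refine ⟨⟨x, hx, h1, h2⟩, ?_⟩
        rintro rfl
        exact h3 (hi.sorted.eq_of_key_eq hx b.reach_succ (h1.trans hk.symm))
      · rintro ⟨⟨x, hx, h1, h2⟩, hne⟩
        refine ⟨x, hx, h1, ?_⟩
        rw [if_neg, h2]
        rintro rfl
        exact hne (toKey_injective (h1.symm.trans hk))
    have hin : k₀ ∈ absSet h.mem := hi.sorted.mem_absSet.2 ⟨s, b.reach_succ, hk,
      hi.rem_succ b.reach b.succ b.lock (t := t) (by dsimp only; rw [hq]; simp [PC.deleted])⟩
    refine ⟨Set.ext hmem, fun h1 => ?_⟩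
    rw [h1] at hin
    exact ((hmem k₀).1 hin).2 rfl
  | _ => cases he

end AbsSet

/-! ## Effects of operations -/

/-- The operation that a thread executes, until it is about to return the result of an update. -/
def PC.op : PC K → Option (SetOp K)
  | .locate (.op o) _ _ => some o
  | .walkPred k _ | .walkSucc k _ | .missing k _ | .readRem k _ | .gotRem k _ _ =>
      some (.contains k)
  | .choosePred u k _ | .lockPred u k _ | .readSucc u k _ | .check u k _ _ | .restart u k
  | .inRange u k _ _ | .failed u k _ _ => some (.update u k)
  | .delLock k _ _ | .delMark k _ _ | .delTree k _ _ _ | .delRead k _ _ | .delPred k _ _ _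
  | .delSucc k _ _ _ => some (.update .delete k)
  | .insNew k _ _ | .insNewSucc k _ _ _ | .insNewPred k _ _ _ | .insSucc k _ _ _
  | .insPred k _ _ _ | .insChoose k _ _ _ | .insParent k _ _ | .insLock k _ _
  | .insChild k _ _ => some (.update .insert k)
  | _ => none

/-- The update has taken effect. -/
def PC.after : PC K → Bool
  | .delTree _ _ _ _ | .delRead _ _ _ | .delPred _ _ _ _ | .delSucc _ _ _ _
  | .insPred _ _ _ _ | .insChoose _ _ _ _ | .insParent _ _ _ | .insLock _ _ _
  | .insChild _ _ _ => true
  | _ => false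

/-- The thread executes an operation of the set. -/
def PC.Busy (q : PC K) : Prop := q.op ≠ none ∨ ∃ b, q = .unlock b ∨ q = .done b

theorem PC.op_of_effect {q : PC K} {u : Upd} {k : K} (h : q.effect = some (u, k)) :
    q.op = some (.update u k) ∧ q.after = false := by
  cases q <;> simp only [PC.effect, reduceCtorEq, Option.some.injEq, Prod.mk.injEq] at h <;>
    obtain ⟨rfl, rfl⟩ := h <;> exact ⟨rfl, rfl⟩

theorem afterLocate_op (x : Node) (o : SetOp K) :
    (afterLocate x (.op o)).op = some o ∧ (afterLocate x (.op o)).after = false := by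
  rcases o with k | ⟨u, k⟩ <;> exact ⟨rfl, rfl⟩

section Effects

variable [LinearOrder K]

theorem TStep.label_ret {t t' : Thread} {h h' : Shared K} {q q' : PC K} {b : Bool}
    (hst : TStep t h q (.ret t' b) h' q') : t' = t := by
  cases hst <;> rfl

/-- The three alternatives: the operation goes on, an update finishes its work and is about to
release its locks, or `contains` returns. In the first, `after` is switched on exactly by a decisive
step. -/
theorem TStep.op_step {t : Thread} {h h' : Shared K} {q q' : PC K} {l : Label K} {o : SetOp K}
    (hst : TStep t h q l h' q') (ho : q.op = some o) :
    (l = .internal ∧ q'.op = some o ∧ (q'.after = true ↔ q.after = true ∨ q.effect ≠ none)) ∨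
    (l = .internal ∧ q.effect = none ∧ ∃ u k, o = .update u k ∧
      ((q.after = true ∧ q' = .unlock true) ∨
        (q.after = false ∧ q' = .unlock false ∧ ∃ p s, q = .failed u k p s))) ∨
    ∃ k, o = .contains k ∧ ((∃ x, q = .missing k x ∧ l = .ret t false) ∨
      ∃ x b, q = .gotRem k x b ∧ l = .ret t (!b)) := by
  cases hst with
  | locateNull g x =>
    cases g with
    | op o' =>
      obtain rfl := Option.some.inj ho
      refine Or.inl ⟨rfl, (afterLocate_op _ _).1, ?_⟩
      rw [(afterLocate_op x o').2]; simp [PC.after, PC.effect]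
    | rotate => cases ho
  | locateFound g x y =>
    cases g with
    | op o' =>
      obtain rfl := Option.some.inj ho
      refine Or.inl ⟨rfl, (afterLocate_op _ _).1, ?_⟩
      rw [(afterLocate_op y o').2]; simp [PC.after, PC.effect]
    | rotate => cases ho
  | locateRight g x y =>
    cases g with
    | op o' => exact Or.inl ⟨rfl, ho, by simp [PC.after, PC.effect]⟩
    | rotate => cases ho
  | locateLeft g x y =>
    cases g with
    | op o' => exact Or.inl ⟨rfl, ho, by simp [PC.after, PC.effect]⟩
    | rotate => cases ho
  | call => cases ho
  | startRotate => cases ho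
  | unlock => cases ho
  | done => cases ho
  | rot => cases ho
  | rotReturn => cases ho
  | missing k x =>
    obtain rfl := Option.some.inj ho
    exact Or.inr (Or.inr ⟨_, rfl, Or.inl ⟨_, rfl, rfl⟩⟩)
  | gotRem k x b =>
    obtain rfl := Option.some.inj ho
    exact Or.inr (Or.inr ⟨_, rfl, Or.inr ⟨_, _, rfl, rfl⟩⟩)
  | failed u k p s =>
    obtain rfl := Option.some.inj ho
    exact Or.inr (Or.inl ⟨rfl, rfl, u, k, rfl, Or.inr ⟨rfl, rfl, p, s, rfl⟩⟩)
  | delSucc k =>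
    obtain rfl := Option.some.inj ho
    exact Or.inr (Or.inl ⟨rfl, rfl, _, k, rfl, Or.inl ⟨rfl, rfl⟩⟩)
  | insChild k =>
    obtain rfl := Option.some.inj ho
    exact Or.inr (Or.inl ⟨rfl, rfl, _, k, rfl, Or.inl ⟨rfl, rfl⟩⟩)
  | _ => exact Or.inl ⟨rfl, ho, by simp [PC.after, PC.effect]⟩

theorem TStep.busy {t : Thread} {h h' : Shared K} {q q' : PC K} {l : Label K}
    (hst : TStep t h q l h' q') (hb : q'.Busy) :
    (∃ o, l = .call t o) ∨ (l = .internal ∧ q.Busy) := by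
  have no : ∀ q : PC K, q.op = none → (∀ b, q ≠ .unlock b ∧ q ≠ .done b) → ¬ q.Busy := by
    rintro q h1 h2 (h3 | ⟨b, h3 | h3⟩)
    · exact h3 h1
    · exact (h2 b).1 h3
    · exact (h2 b).2 h3
  cases hst with
  | call o => exact Or.inl ⟨_, rfl⟩
  | startRotate => exact absurd hb (no _ rfl (by simp))
  | locateNull g x =>
    cases g with
    | op o' => exact Or.inr ⟨rfl, Or.inl (by simp [PC.op])⟩
    | rotate => exact absurd hb (no _ rfl (by simp [afterLocate]))
  | locateFound g x y =>
    cases g with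
    | op o' => exact Or.inr ⟨rfl, Or.inl (by simp [PC.op])⟩
    | rotate => exact absurd hb (no _ rfl (by simp [afterLocate]))
  | locateRight g x y =>
    cases g with
    | op o' => exact Or.inr ⟨rfl, Or.inl (by simp [PC.op])⟩
    | rotate => exact absurd hb (no _ rfl (by simp))
  | locateLeft g x y =>
    cases g with
    | op o' => exact Or.inr ⟨rfl, Or.inl (by simp [PC.op])⟩
    | rotate => exact absurd hb (no _ rfl (by simp))
  | missing => exact absurd hb (no _ rfl (by simp))
  | gotRem => exact absurd hb (no _ rfl (by simp))
  | done => exact absurd hb (no _ rfl (by simp))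
  | rot => exact absurd hb (no _ rfl (by simp))
  | rotReturn => exact absurd hb (no _ rfl (by simp))
  | unlock b => exact Or.inr ⟨rfl, Or.inr ⟨b, Or.inl rfl⟩⟩
  | _ => exact Or.inr ⟨rfl, Or.inl (by simp [PC.op])⟩

/-- The step from time `m` to time `m+1` is a step of thread `t`. -/
structure Acts (st : ℕ → Config K) (lab : ℕ → Label K) (m : ℕ) (t : Thread) : Prop where
  step : TStep t (st m).shared ((st m).pc t) (lab m) (st (m + 1)).shared ((st (m + 1)).pc t)
  other : ∀ t', t' ≠ t → (st (m + 1)).pc t' = (st m).pc t'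

/-- The operation invoked by thread `t` at step `i` is pending at time `m`. -/
structure Pending (lab : ℕ → Label K) (t : Thread) (o : SetOp K) (i m : ℕ) : Prop where
  call : lab i = .call t o
  lt : i < m
  ret : ∀ j, i < j → j < m → ∀ b, lab j ≠ .ret t b

/-- Between times `i` and `m`, thread `t` has made a step that changes the abstract set. -/
def Effected (st : ℕ → Config K) (act : ℕ → Thread) (t : Thread) (i m : ℕ) : Prop :=
  ∃ m', i < m' ∧ m' < m ∧ act m' = t ∧ ((st m').pc t).effect ≠ none

/-- The precondition of an update that fails. -/
def FailSet (u : Upd) (k : K) (S : Set K) : Prop :=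
  match u with
  | .insert => k ∈ S
  | .delete => k ∉ S

/-- The state of a pending operation, where `E` says that it has taken effect. -/
def OpState (past : (Mem K → Prop) → Prop) (E : Prop) (o : SetOp K) (q : PC K) : Prop :=
  (q.op = some o ∧ (q.after = true ↔ E)) ∨
  ∃ b u k, (q = .unlock b ∨ q = .done b) ∧ o = .update u k ∧ (b = true ↔ E) ∧
    (b = false → past (fun s => FailSet u k (absSet s)))

variable {st : ℕ → Config K} {lab : ℕ → Label K} {N : ℕ} {σ : ℕ → Mem K} {act : ℕ → Thread}

theorem IsRun.exists_acts (hr : IsRun st lab N) :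
    ∃ act : ℕ → Thread, ∀ m, m < N → Acts st lab m (act m) := by
  have : ∀ m, ∃ t, m < N → Acts st lab m t := by
    intro m
    by_cases hm : m < N
    · obtain ⟨t, q, hst, hpc⟩ := hr.2 m hm
      refine ⟨t, fun _ => ⟨?_, fun t' ht' => ?_⟩⟩
      · rw [hpc, Function.update_self]; exact hst
      · rw [hpc, Function.update_of_ne ht']
    · exact ⟨0, fun h => absurd h hm⟩
  exact ⟨fun m => (this m).choose, fun m => (this m).choose_spec⟩

/-- A node of the list whose key is greater than `k` and that is `k`-reachable shows that `k` is
not in the set. -/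
theorem SortedList.not_mem_absSet {s : Mem K} (hs : SortedList s) {k : K} {x : Node}
    (hx : KReach s k x) (hk : toKey k < (s x).key) : k ∉ absSet s := by
  rintro ⟨y, hy, h1, -⟩
  exact absurd (hs.key_le_of_kReach hx hy.reach h1.ge) (by rw [h1]; exact not_le.2 hk)

theorem IsRun.effected_succ (i m : ℕ) (t : Thread) (him : i < m) :
    Effected st act t i (m + 1) ↔
      Effected st act t i m ∨ (act m = t ∧ ((st m).pc t).effect ≠ none) := by
  constructor
  · rintro ⟨m', h1, h2, h3⟩
    rcases Nat.lt_succ_iff_lt_or_eq.1 h2 with h4 | rfl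
    · exact Or.inl ⟨m', h1, h4, h3⟩
    · exact Or.inr h3
  · rintro (⟨m', h1, h2, h3⟩ | h3)
    · exact ⟨m', h1, h2.trans (Nat.lt_succ_self m), h3⟩
    · exact ⟨m, him, Nat.lt_succ_self m, h3⟩

/-- This ties program points to history: an update about to return `true` has executed a decisive
step since its call, and one about to return `false` has not, but has passed a state that justifies
its failure. -/
theorem IsRun.opState (hr : IsRun st lab N) (hσ : ∀ i, σ i = (st i).shared.mem)
    (hact : ∀ m, m < N → Acts st lab m (act m)) {t : Thread} {o : SetOp K} {i m : ℕ}
    (hp : Pending lab t o i m) (hm : m ≤ N) :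
    OpState (Past σ (i + 1) m) (Effected st act t i m) o ((st m).pc t) := by
  obtain ⟨hl, him, hret⟩ := hp
  induction m, Nat.succ_le_of_lt him using Nat.le_induction with
  | base =>
    have hst := (hact i hm).step
    rw [hl] at hst
    obtain ⟨h1, -, h2⟩ := hst.label_call
    rw [← h1] at h2
    refine Or.inl ⟨by rw [h2]; rfl, ?_⟩
    rw [h2]
    constructor
    · intro h3; cases h3
    · rintro ⟨m', h3, h4, -⟩; exact absurd h3 (by omega)
  | succ m hi ih =>
    have ih := ih (by omega) hi (fun j h1 h2 => hret j h1 (by omega))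
    have hpast : ∀ P, Past σ (i + 1) m P → Past σ (i + 1) (m + 1) P :=
      fun P hP => hP.mono le_rfl (Nat.le_succ m) (fun _ => id)
    have hE := IsRun.effected_succ (st := st) (act := act) i m t hi
    by_cases ht : t = act m
    · subst ht
      have hst := (hact m hm).step
      rcases ih with ⟨h1, h2⟩ | ⟨b, u, k, h1, h2, h3, h4⟩
      · rcases hst.op_step h1 with ⟨-, h3, h4⟩ | ⟨-, h3, u, k, rfl, h4⟩ | ⟨k, rfl, h3⟩
        · refine Or.inl ⟨h3, ?_⟩
          rw [h4, h2, hE]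
          simp
        · refine Or.inr ?_
          rcases h4 with ⟨h4, h5⟩ | ⟨h4, h5, p, s, h6⟩
          · refine ⟨true, u, k, Or.inl h5, rfl, ?_, by simp⟩
            rw [hE, ← h2, h4]; simp
          · refine ⟨false, u, k, Or.inl h5, rfl, ?_, fun _ => hpast _ ?_⟩
            · rw [hE, ← h2, h4, h3]; simp
            -- The witness for the failure is the present state, by the assertion at `failed`.
            · refine ⟨m, hi, le_rfl, ?_⟩
              have h7 := (hr.pastAssertion hσ hl (by omega) (Nat.le_of_lt hm)).assertion hr hσ
                (Nat.le_of_lt hm) rfl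
              have hs := hr.sorted (Nat.le_of_lt hm)
              rw [h6] at h7
              rw [hσ]
              cases u with
              | insert => exact ⟨s, h7⟩
              | delete => exact hs.not_mem_absSet h7.1 h7.2
        · exfalso
          rcases h3 with ⟨x, -, h3⟩ | ⟨x, b, -, h3⟩
          · exact hret m (by omega) (Nat.lt_succ_self m) _ h3
          · exact hret m (by omega) (Nat.lt_succ_self m) _ h3
      · have he : ((st m).pc (act m)).effect = none := by
          rcases h1 with h1 | h1 <;> rw [h1] <;> rfl
        refine Or.inr ⟨b, u, k, ?_, h2, ?_, fun h => hpast _ (h4 h)⟩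
        · rcases h1 with h1 | h1
          · rw [h1] at hst
            generalize (st (m + 1)).pc (act m) = q' at hst
            generalize (st (m + 1)).shared = h' at hst
            generalize lab m = l at hst
            cases hst
            exact Or.inr rfl
          · exfalso
            rw [h1] at hst
            generalize (st (m + 1)).pc (act m) = q' at hst
            generalize (st (m + 1)).shared = h' at hst
            generalize hl' : lab m = l at hst
            cases hst
            exact hret m (by omega) (Nat.lt_succ_self m) _ hl'
        · rw [h3, hE, he]; simp
    · rw [(hact m hm).other t ht]
      have : Effected st act t i (m + 1) ↔ Effected st act t i m := by
        rw [hE]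
        exact or_iff_left fun h => ht h.1.symm
      rcases ih with ⟨h1, h2⟩ | ⟨b, u, k, h1, h2, h3, h4⟩
      · exact Or.inl ⟨h1, h2.trans this.symm⟩
      · exact Or.inr ⟨b, u, k, h1, h2, h3.trans this.symm, fun h => hpast _ (h4 h)⟩

/-- A thread that executes an operation has invoked it. -/
theorem IsRun.exists_pending (hr : IsRun st lab N)
    (hact : ∀ m, m < N → Acts st lab m (act m)) {t : Thread} {m : ℕ} (hm : m ≤ N)
    (hb : ((st m).pc t).Busy) : ∃ o i, Pending lab t o i m := by
  induction m with
  | zero =>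
    rw [hr.1] at hb
    rcases hb with h | ⟨b, h | h⟩
    · exact absurd rfl h
    · cases h
    · cases h
  | succ m ih =>
    have next : ((st m).pc t).Busy → (∀ b, lab m ≠ .ret t b) →
        ∃ o i, Pending lab t o i (m + 1) := by
      intro h1 h2
      obtain ⟨o, i, h3, h4, h5⟩ := ih (by omega) h1
      refine ⟨o, i, h3, by omega, fun j h6 h7 b => ?_⟩
      rcases Nat.lt_succ_iff_lt_or_eq.1 h7 with h8 | rfl
      · exact h5 j h6 h8 b
      · exact h2 b
    by_cases ht : t = act m
    · have hst := (hact m hm).step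
      rw [← ht] at hst
      rcases hst.busy hb with ⟨o, h1⟩ | ⟨h1, h2⟩
      · exact ⟨o, m, h1, Nat.lt_succ_self m, fun j h2 h3 => absurd h2 (by omega)⟩
      · exact next h2 (by simp [h1])
    · rw [(hact m hm).other t ht] at hb
      refine next hb fun b h1 => ht ?_
      have hst := (hact m hm).step
      rw [h1] at hst
      exact hst.label_ret

theorem OpState.ne_idle {past : (Mem K → Prop) → Prop} {E : Prop} {o : SetOp K} {q : PC K}
    (h : OpState past E o q) : q ≠ .idle := by
  rintro rfl
  rcases h with h | ⟨b, u, k, h | h, -⟩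
  · cases h.1
  · cases h
  · cases h

theorem IsRun.act_of_call (hact : ∀ m, m < N → Acts st lab m (act m)) {t : Thread}
    {o : SetOp K} {m : ℕ} (hm : m < N) (hl : lab m = .call t o) :
    t = act m ∧ (st m).pc t = .idle := by
  have hst := (hact m hm).step
  rw [hl] at hst
  obtain ⟨rfl, h1, -⟩ := hst.label_call
  exact ⟨rfl, h1⟩

theorem IsRun.act_of_ret (hact : ∀ m, m < N → Acts st lab m (act m)) {t : Thread}
    {b : Bool} {m : ℕ} (hm : m < N) (hl : lab m = .ret t b) : t = act m := by
  have hst := (hact m hm).step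
  rw [hl] at hst
  exact hst.label_ret

/-- A call is made by an idle thread, and a thread with a pending operation is not idle. -/
theorem IsRun.pending_unique (hr : IsRun st lab N)
    (hact : ∀ m, m < N → Acts st lab m (act m)) {t : Thread} {o o' : SetOp K} {i i' m : ℕ}
    (hm : m ≤ N) (hp : Pending lab t o i m) (hp' : Pending lab t o' i' m) : i = i' := by
  have aux : ∀ {o o' : SetOp K} {i i' : ℕ}, Pending lab t o i m → Pending lab t o' i' m →
      i < i' → False := by
    intro o o' i i' hp hp' hlt
    have h1 : Pending lab t o i i' := ⟨hp.call, hlt, fun j h1 h2 => hp.ret j h1 (h2.trans hp'.lt)⟩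
    have hi' : i' < N := hp'.lt.trans_le hm
    exact (hr.opState (σ := fun i => (st i).shared.mem) (fun _ => rfl) hact h1 hi'.le).ne_idle
      (IsRun.act_of_call hact hi' hp'.call).2
  rcases lt_trichotomy i i' with h | h | h
  · exact (aux hp hp' h).elim
  · exact h
  · exact (aux hp' hp h).elim

theorem Returns.pending {i j : ℕ} {b : Bool} {t : Thread} {o : SetOp K}
    (h : Returns lab i j b) (hl : lab i = .call t o) :
    Pending lab t o i j ∧ lab j = .ret t b := by
  obtain ⟨t', o', h1, h2, h3, h4⟩ := h
  rw [hl] at h1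
  obtain ⟨rfl, rfl⟩ := Label.call.inj h1
  exact ⟨⟨hl, h2, h4⟩, h3⟩

/-- The result of an update tells whether it has taken effect. -/
theorem IsRun.returns_update (hr : IsRun st lab N) (hσ : ∀ i, σ i = (st i).shared.mem)
    (hact : ∀ m, m < N → Acts st lab m (act m)) {t : Thread} {u : Upd} {k : K} {i j : ℕ}
    {b : Bool} (hj : j < N) (hl : lab i = .call t (.update u k)) (h : Returns lab i j b) :
    (b = true ↔ Effected st act t i j) ∧
      (b = false → Past σ (i + 1) j (fun s => FailSet u k (absSet s))) := by
  obtain ⟨hp, hlj⟩ := h.pending hl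
  have hst := (hact j hj).step
  rw [← IsRun.act_of_ret hact hj hlj, hlj] at hst
  rcases hr.opState hσ hact hp hj.le with h1 | ⟨b', u', k', h1, h2, h3, h4⟩
  · rcases hst.op_step h1.1 with h2 | h2 | ⟨k', h2, -⟩
    · cases h2.1
    · cases h2.1
    · cases h2
  · obtain ⟨rfl, rfl⟩ := SetOp.update.inj h2
    have : b = b' := by
      generalize (st (j + 1)).pc t = q' at hst
      generalize (st (j + 1)).shared = h' at hst
      rcases h1 with h1 | h1
      · rw [h1] at hst; cases hst
      · rw [h1] at hst; cases hst; rfl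
    subst this
    exact ⟨h3, h4⟩

/-- The result of `contains` was correct at some time. -/
theorem IsRun.returns_contains (hr : IsRun st lab N) (hσ : ∀ i, σ i = (st i).shared.mem)
    (hact : ∀ m, m < N → Acts st lab m (act m)) {t : Thread} {k : K} {i j : ℕ}
    {b : Bool} (hj : j < N) (hl : lab i = .call t (.contains k)) (h : Returns lab i j b) :
    Past σ (i + 1) j (fun s => b = true ↔ k ∈ absSet s) := by
  obtain ⟨hp, hlj⟩ := h.pending hl
  have hst := (hact j hj).step
  rw [← IsRun.act_of_ret hact hj hlj, hlj] at hst
  have hpa := hr.pastAssertion hσ hl hp.lt hj.le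
  have hs : ∀ u, u ≤ j → SortedList (σ u) := fun u hu => by
    rw [hσ]; exact hr.sorted (hu.trans hj.le)
  rcases hr.opState hσ hact hp hj.le with h1 | ⟨b', u', k', h1, h2, h3, h4⟩
  · rcases hst.op_step h1.1 with h2 | h2 | ⟨k', h2, h3⟩
    · cases h2.1
    · cases h2.1
    · obtain rfl := SetOp.contains.inj h2
      rcases h3 with ⟨x, h3, h4⟩ | ⟨x, b', h3, h4⟩
      · obtain rfl := (Label.ret.inj h4).2
        rw [h3] at hpa
        obtain ⟨u, h5, h6, h7, h8⟩ := hpa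
        exact ⟨u, h5, h6, by simpa using (hs u h6).not_mem_absSet h7 h8⟩
      · obtain rfl := (Label.ret.inj h4).2
        rw [h3] at hpa
        obtain ⟨u, h5, h6, h7, h8, h9⟩ := hpa
        refine ⟨u, h5, h6, ?_⟩
        simp only [Bool.not_eq_true', ← h9]
        constructor
        · exact fun h10 => ⟨x, h7, h8, h10⟩
        · rintro ⟨y, h10, h11, h12⟩
          rwa [(hs u h6).eq_of_key_eq h7.reach h10.reach (h8.trans h11.symm)]
  · cases h2

theorem IsRun.absSet_step (hr : IsRun st lab N) (hσ : ∀ i, σ i = (st i).shared.mem)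
    {m : ℕ} (hm : m < N) {t : Thread} (ha : Acts st lab m t) :
    (((st m).pc t).effect = none → absSet (σ (m + 1)) = absSet (σ m)) ∧
    ∀ u k, ((st m).pc t).effect = some (u, k) →
      absSet (σ (m + 1)) = u.apply k (absSet (σ m)) ∧ Changes σ m := by
  have hi := (hr.inv hm.le).1
  have hs := hr.sorted (Nat.succ_le_of_lt hm)
  simp only [Changes, hσ]
  exact ⟨fun he => ListAct.absSet_eq (h := (st m).shared) (pc := (st m).pc) hi rfl
    ha.step.listAct hs he,
    fun u k he => TStep.absSet_effect (h := (st m).shared) (pc := (st m).pc) hi rfl ha.step hs he⟩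

/-- A step that changes the abstract set belongs to a pending update that has not taken effect
before. -/
theorem IsRun.changes (hr : IsRun st lab N) (hσ : ∀ i, σ i = (st i).shared.mem)
    (hact : ∀ m, m < N → Acts st lab m (act m)) {m : ℕ} (hm : m < N) (hc : Changes σ m) :
    ∃ u k i, ((st m).pc (act m)).effect = some (u, k) ∧
      Pending lab (act m) (.update u k) i m ∧ ¬ Effected st act (act m) i m ∧
      absSet (σ (m + 1)) = u.apply k (absSet (σ m)) := by
  have h1 := hr.absSet_step hσ hm (hact m hm)
  cases he : ((st m).pc (act m)).effect with
  | none => exact absurd (h1.1 he).symm hc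
  | some e =>
    obtain ⟨u, k⟩ := e
    obtain ⟨h2, h3⟩ := PC.op_of_effect he
    obtain ⟨o, i, hp⟩ := hr.exists_pending hact hm.le (Or.inl (by rw [h2]; simp))
    rcases hr.opState hσ hact hp hm.le with ⟨h4, h5⟩ | ⟨b, u', k', h4, -⟩
    · obtain rfl := Option.some.inj (h2.symm.trans h4)
      refine ⟨u, k, i, rfl, hp, fun h6 => ?_, (h1.2 u k he).1⟩
      rw [h5.2 h6] at h3
      cases h3
    · rcases h4 with h4 | h4 <;> rw [h4] at he <;> cases he

theorem IsRun.takesEffect (hr : IsRun st lab N) (hσ : ∀ i, σ i = (st i).shared.mem) :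
    TakesEffect σ lab N := by
  obtain ⟨act, hact⟩ := hr.exists_acts
  refine ⟨fun i j t k b hj hl h => ?_, fun i j t k hj hl h => ?_, fun i j t k hj hl h => ?_, ?_⟩
  · exact hr.returns_contains hσ hact hj hl h
  · exact (hr.returns_update hσ hact hj hl h).2 rfl
  · exact (hr.returns_update hσ hact hj hl h).2 rfl
  have hD : ∀ m, ∃ i, m < N → Changes σ m → ∃ u k, ((st m).pc (act m)).effect = some (u, k) ∧
      Pending lab (act m) (.update u k) i m ∧ ¬ Effected st act (act m) i m ∧
      absSet (σ (m + 1)) = u.apply k (absSet (σ m)) := by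
    intro m
    by_cases h : m < N ∧ Changes σ m
    · obtain ⟨u, k, i, h1⟩ := hr.changes hσ hact h.1 h.2
      exact ⟨i, fun _ _ => ⟨u, k, h1⟩⟩
    -- A default value; `D` matters only at steps that change the set.
    · exact ⟨0, fun h1 h2 => absurd ⟨h1, h2⟩ h⟩
  choose D hD using hD
  refine ⟨D, fun m hm hc => ?_, fun m m' hm hm' hc hc' he => ?_, fun i j t u k hj hl h => ?_⟩
  · obtain ⟨u, k, h1, h2, -, h4⟩ := hD m hm hc
    refine ⟨act m, u, k, h2.call, h2.lt, fun j b hj h => ?_, h4, hc⟩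
    obtain ⟨h5, h6⟩ := h.pending h2.call
    have hmj : m < j := by
      rcases lt_trichotomy m j with h7 | rfl | h7
      · exact h7
      -- A decisive step is internal, so it is not the return itself.
      · exfalso
        rcases (hact m hm).step.op_step (PC.op_of_effect h1).1 with h7 | h7 | ⟨k', h7, -⟩
        · rw [h7.1] at h6; cases h6
        · rw [h7.1] at h6; cases h6
        · cases h7
      · exact absurd h6 (h2.ret j h5.lt h7 b)
    exact ⟨hmj, (hr.returns_update hσ hact hj h2.call h).1.2
      ⟨m, h2.lt, hmj, rfl, by rw [h1]; simp⟩⟩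
  -- For the later of two changes assigned to one operation, the earlier one would already have been
  -- its effect.
  · have aux : ∀ m m', m < N → m' < N → Changes σ m → Changes σ m' → D m = D m' →
        ¬ m < m' := by
      intro m m' hm hm' hc hc' he hlt
      obtain ⟨u, k, h1, h2, -⟩ := hD m hm hc
      obtain ⟨u', k', h3, h4, h5, -⟩ := hD m' hm' hc'
      have h6 := h4.call
      rw [← he, h2.call] at h6
      have h7 : act m = act m' := (Label.call.inj h6).1
      exact h5 ⟨m, by rw [← he]; exact h2.lt, hlt, h7, by rw [← h7, h1]; simp⟩
    exact le_antisymm (not_lt.1 (aux m' m hm' hm hc' hc he.symm))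
      (not_lt.1 (aux m m' hm hm' hc hc' he))
  · obtain ⟨m, h1, h2, rfl, h4⟩ := (hr.returns_update hσ hact hj hl h).1.1 rfl
    have hm : m < N := h2.trans hj
    obtain ⟨⟨u', k'⟩, he⟩ := Option.ne_none_iff_exists'.1 h4
    have hc := ((hr.absSet_step hσ hm (hact m hm)).2 u' k' he).2
    refine ⟨m, hm, hc, ?_⟩
    obtain ⟨u'', k'', -, h5, -⟩ := hD m hm hc
    have hp := (h.pending hl).1
    exact hr.pending_unique hact hm.le h5
      ⟨hl, h1, fun j' h6 h7 => hp.ret j' h6 (h7.trans h2)⟩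

end Effects

/-! ## Linearizability -/

theorem Returns.unique {lab : ℕ → Label K} {i j j' : ℕ} {b b' : Bool} (h : Returns lab i j b)
    (h' : Returns lab i j' b') : j = j' ∧ b = b' := by
  obtain ⟨t, o, h1, h2, h3, h4⟩ := h
  obtain ⟨t', o', h1', h2', h3', h4'⟩ := h'
  rw [h1] at h1'
  obtain ⟨rfl, rfl⟩ := Label.call.inj h1'
  have hj : j = j' := by
    rcases lt_trichotomy j j' with h | h | h
    · exact absurd h3 (h4' j h2 h b)
    · exact h
    · exact absurd h3' (h4 j' h2' h b')
  subst hj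
  rw [h3] at h3'
  exact ⟨rfl, (Label.ret.inj h3').2⟩

/-- The sequence `L` of operations is legal from `S` and leads to `S'`. -/
def SeqTo (lab : ℕ → Label K) (S : Set K) (L : List (ℕ × Bool)) (S' : Set K) : Prop :=
  ∀ L', SeqLegal lab S' L' → SeqLegal lab S (L ++ L')

theorem SeqTo.append {lab : ℕ → Label K} {S S' S'' : Set K} {L L' : List (ℕ × Bool)}
    (h : SeqTo lab S L S') (h' : SeqTo lab S' L' S'') : SeqTo lab S (L ++ L') S'' := by
  intro L'' hL
  rw [List.append_assoc]
  exact h _ (h' _ hL)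

theorem seqTo_nil (lab : ℕ → Label K) (S : Set K) : SeqTo lab S [] S := fun _ h => h

/-- Operations that leave `S` unchanged can be executed at `S` one after another in any order. -/
theorem seqTo_of_forall {lab : ℕ → Label K} {S : Set K} {L : List (ℕ × Bool)}
    (h : ∀ a ∈ L, ∃ t o, lab a.1 = .call t o ∧ SeqSpec S o a.2 S) : SeqTo lab S L S := by
  induction L with
  | nil => exact seqTo_nil lab S
  | cons a L ih =>
    intro L' hL
    obtain ⟨t, o, h1, h2⟩ := h a (by simp)
    exact ⟨t, o, S, h1, h2, ih (fun a' ha' => h a' (by simp [ha'])) L' hL⟩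

/-- An update that changes the set was applicable to it, so its specified result is `true`. This
also supplies results for pending updates. -/
theorem Upd.seqSpec {u : Upd} {k : K} {S : Set K} (h : S ≠ u.apply k S) :
    SeqSpec S (.update u k) true (u.apply k S) := by
  cases u with
  | insert =>
    refine ⟨iff_of_true rfl fun hk => h ?_, rfl⟩
    exact (Set.union_eq_left.2 (Set.singleton_subset_iff.2 hk)).symm
  | delete =>
    refine ⟨iff_of_true rfl ?_, rfl⟩
    by_contra hk
    exact h (Set.sdiff_singleton_eq_self hk).symm

theorem seqTo_flatMap_range {lab : ℕ → Label K} {S : ℕ → Set K} {f : ℕ → List (ℕ × Bool)} {N : ℕ}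
    (h : ∀ m, m < N → SeqTo lab (S m) (f m) (S (m + 1))) :
    SeqTo lab (S 0) ((List.range N).flatMap f) (S N) := by
  induction N with
  | zero => exact seqTo_nil lab _
  | succ N ih =>
    rw [List.range_succ, List.flatMap_append, List.flatMap_singleton]
    exact (ih fun m hm => h m (by omega)).append (h N (Nat.lt_succ_self N))

/-! ### From effects on the abstract set to a linearization -/

section

variable [LinearOrder K] {σ : ℕ → Mem K} {lab : ℕ → Label K} {N : ℕ}

/-- The operation invoked at step `i` returns before step `N`, and it is not a successful
update. -/
def IsQuery (lab : ℕ → Label K) (N i : ℕ) : Prop :=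
  ∃ j b, j < N ∧ Returns lab i j b ∧ ((∃ t k, lab i = .call t (.contains k)) ∨ b = false)

/-- A failed update behaves like a query: in the state that justifies its failure, its effect on the
set is trivial. -/
theorem TakesEffect.query (h : TakesEffect σ lab N) {i : ℕ} (hi : IsQuery lab N i) :
    ∃ (m : ℕ) (b : Bool), i < m ∧ m < N ∧
      (∀ j b', Returns lab i j b' → m ≤ j ∧ b' = b) ∧
      ∃ t o, lab i = .call t o ∧ SeqSpec (absSet (σ m)) o b (absSet (σ m)) := by
  obtain ⟨h1, h2, h3, -⟩ := h
  obtain ⟨j, b, hj, hr, hq⟩ := hi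
  have key : ∀ (m : ℕ) (t : Thread) (o : SetOp K), i < m → m ≤ j → lab i = .call t o →
      SeqSpec (absSet (σ m)) o b (absSet (σ m)) → ∃ (m : ℕ) (b : Bool), i < m ∧ m < N ∧
      (∀ j b', Returns lab i j b' → m ≤ j ∧ b' = b) ∧
      ∃ t o, lab i = .call t o ∧ SeqSpec (absSet (σ m)) o b (absSet (σ m)) := by
    intro m t o him hmj hl hs
    refine ⟨m, b, him, by omega, fun j' b' hr' => ?_, t, o, hl, hs⟩
    obtain ⟨rfl, rfl⟩ := hr.unique hr'
    exact ⟨hmj, rfl⟩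
  obtain ⟨t, o, hl, -⟩ := id hr
  rcases o with k | ⟨u, k⟩
  · obtain ⟨m, h4, h5, h6⟩ := h1 i j t k b hj hl hr
    exact key m t _ h4 h5 hl ⟨h6, rfl⟩
  · have hb : b = false := by
      rcases hq with ⟨t', k', hl'⟩ | hb
      · rw [hl] at hl'
        cases (Label.call.inj hl').2
      · exact hb
    subst hb
    cases u with
    | insert =>
      obtain ⟨m, h4, h5, h6⟩ := h2 i j t k hj hl hr
      refine key m t _ h4 h5 hl ⟨by simpa using h6, ?_⟩
      exact (Set.union_eq_left.2 (Set.singleton_subset_iff.2 h6)).symm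
    | delete =>
      obtain ⟨m, h4, h5, h6⟩ := h3 i j t k hj hl hr
      exact key m t _ h4 h5 hl ⟨by simpa using h6, (Set.sdiff_singleton_eq_self h6).symm⟩

open Classical in
-- Each query gets a time `m` at which its result is correct for `σ m`, and each change of the set
-- is charged to its update. Block `m` lists the queries with time `m`, then the update that turns
-- `σ m` into `σ (m + 1)`, if there is one. The concatenation of the blocks is legal because the set
-- is constant along the queries of a block. It respects real time because each chosen time lies
-- between invocation and return.
theorem TakesEffect.linearizable (h : TakesEffect σ lab N) (h0 : absSet (σ 0) = ∅) :
    Linearizable lab N := by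
  have hquery : ∀ i, ∃ (m : ℕ) (b : Bool), IsQuery lab N i → i < m ∧ m < N ∧
      (∀ j b', Returns lab i j b' → m ≤ j ∧ b' = b) ∧
      ∃ t o, lab i = .call t o ∧ SeqSpec (absSet (σ m)) o b (absSet (σ m)) := by
    intro i
    by_cases hi : IsQuery lab N i
    · obtain ⟨m, b, hm⟩ := h.query hi
      exact ⟨m, b, fun _ => hm⟩
    -- Default values for steps that do not invoke a query.
    · exact ⟨0, false, fun h => absurd h hi⟩
  choose pt res hQ using hquery
  obtain ⟨-, -, -, D, hD, hinj, hsurj⟩ := h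
  let block : ℕ → List (ℕ × Bool) := fun m =>
    ((List.range N).filter fun i => IsQuery lab N i ∧ pt i = m).map (fun i => (i, res i)) ++
      if Changes σ m then [(D m, true)] else []
  have hmem : ∀ m a, a ∈ block m ↔ (a.1 < N ∧ IsQuery lab N a.1 ∧ pt a.1 = m ∧ res a.1 = a.2) ∨
      (Changes σ m ∧ a = (D m, true)) := by
    rintro m ⟨i, b⟩
    by_cases hc : Changes σ m
    · simp only [block, hc]; simp; grind
    · simp only [block, hc]; simp; grind
  have hspec : ∀ m, m < N → ∀ a ∈ block m, a.1 < m ∧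
      ∀ j b, j < N → Returns lab a.1 j b → m ≤ j := by
    intro m hm a ha
    rcases (hmem m a).1 ha with ⟨-, h1, rfl, -⟩ | ⟨hc, rfl⟩
    · obtain ⟨h2, -, h3, -⟩ := hQ _ h1
      exact ⟨h2, fun j b _ hr => (h3 j b hr).1⟩
    · obtain ⟨t, u, k, -, h2, h3, -⟩ := hD m hm hc
      exact ⟨h2, fun j b hj hr => (h3 j b hj hr).1.le⟩
  -- An update that changes the set never returns `false`, so no operation is listed both as a query
  -- and as a change.
  have hdis : ∀ m, m < N → Changes σ m → ¬ IsQuery lab N (D m) := by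
    rintro m hm hc ⟨j, b, hj, hr, hq⟩
    obtain ⟨t, u, k, h1, h2, h3, -⟩ := hD m hm hc
    rcases hq with ⟨t', k', hl⟩ | rfl
    · rw [h1] at hl
      cases (Label.call.inj hl).2
    · cases (h3 j _ hj hr).2
  have hne : ∀ m m', m < N → m' < N → m ≠ m' → ∀ a ∈ block m, ∀ a' ∈ block m', a.1 ≠ a'.1 := by
    intro m m' hm hm' hmm a ha a' ha' he
    rcases (hmem m a).1 ha with ⟨-, h1, h2, -⟩ | ⟨hc, rfl⟩ <;>
      rcases (hmem m' a').1 ha' with ⟨-, h1', h2', -⟩ | ⟨hc', rfl⟩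
    · rw [he] at h2; exact hmm (h2.symm.trans h2')
    · rw [he] at h1; exact hdis m' hm' hc' h1
    · rw [← he] at h1'; exact hdis m hm hc h1'
    · exact hmm (hinj m m' hm hm' hc hc' he)
  have hpair : ((List.range N).flatMap block).Pairwise fun a a' =>
      a.1 ≠ a'.1 ∧ ¬ ∃ j b, Returns lab a'.1 j b ∧ j < a.1 := by
    -- The case `m = m'` is included: operations of one block were all invoked before time `m` and
    -- have not returned before it, so they overlap and may be listed in any order.
    have haft : ∀ m m', m ≤ m' → m' < N → ∀ a ∈ block m, ∀ a' ∈ block m',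
        ¬ ∃ j b, Returns lab a'.1 j b ∧ j < a.1 := by
      rintro m m' hmm hm' a ha a' ha' ⟨j, b, hr, hj⟩
      have h1 := (hspec m (by omega) a ha).1
      have h2 := (hspec m' hm' a' ha').2 j b (by omega) hr
      omega
    rw [List.pairwise_flatMap]
    constructor
    · intro m hm
      have hm := List.mem_range.1 hm
      have h1 : (block m).Pairwise fun a a' => a.1 ≠ a'.1 := by
        refine List.pairwise_append.2 ⟨?_, ?_, ?_⟩
        · rw [List.pairwise_map]
          exact List.nodup_range.filter _
        · split_ifs <;> simp
        · intro a ha a' ha' he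
          split_ifs at ha' with hc
          · obtain rfl := List.mem_singleton.1 ha'
            obtain ⟨i, hi, rfl⟩ := List.mem_map.1 ha
            have hi := (List.mem_filter.1 hi).2
            simp only [decide_eq_true_eq] at hi
            simp only at he
            rw [he] at hi
            exact hdis m hm hc hi.1
          · cases ha'
      exact h1.imp_of_mem fun ha ha' h => ⟨h, haft m m le_rfl hm _ ha _ ha'⟩
    · refine List.pairwise_lt_range.imp_of_mem fun {m m'} hm hm' hlt a ha a' ha' => ?_
      have hm := List.mem_range.1 hm
      have hm' := List.mem_range.1 hm'
      exact ⟨hne m m' hm hm' hlt.ne a ha a' ha', haft m m' hlt.le hm' a ha a' ha'⟩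
  refine ⟨(List.range N).flatMap block, ?_, ?_, ?_, hpair.imp And.right, ?_⟩
  · rw [List.Nodup, List.pairwise_map]
    exact hpair.imp And.left
  · intro a ha
    obtain ⟨m, hm, ha⟩ := List.mem_flatMap.1 ha
    have hm := List.mem_range.1 hm
    exact (hspec m hm a ha).1.trans hm
  · intro i j b hj hr
    rw [List.mem_flatMap]
    have query : ((∃ t k, lab i = .call t (.contains k)) ∨ b = false) →
        ∃ m ∈ List.range N, (i, b) ∈ block m := by
      intro hq
      have hi : IsQuery lab N i := ⟨j, b, hj, hr, hq⟩
      obtain ⟨h1, h2, h3, -⟩ := hQ i hi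
      exact ⟨pt i, List.mem_range.2 h2,
        (hmem _ _).2 (Or.inl ⟨h1.trans h2, hi, rfl, (h3 j b hr).2.symm⟩)⟩
    obtain ⟨t, o, hl, -⟩ := id hr
    rcases o with k | ⟨u, k⟩
    · exact query (Or.inl ⟨t, k, hl⟩)
    · cases b with
      | false => exact query (Or.inr rfl)
      | true =>
        obtain ⟨m, hm, hc, rfl⟩ := hsurj i j t u k hj hl hr
        exact ⟨m, List.mem_range.2 hm, (hmem _ _).2 (Or.inr ⟨hc, rfl⟩)⟩
  · have hseq : SeqTo lab (absSet (σ 0)) ((List.range N).flatMap block) (absSet (σ N)) := by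
      refine seqTo_flatMap_range (S := fun m => absSet (σ m)) fun m hm => ?_
      refine (seqTo_of_forall ?_).append (S' := absSet (σ m)) ?_
      · intro a ha
        obtain ⟨i, hi, rfl⟩ := List.mem_map.1 ha
        have hi := (List.mem_filter.1 hi).2
        simp only [decide_eq_true_eq] at hi
        obtain ⟨h1, rfl⟩ := hi
        exact (hQ i h1).2.2.2
      · split_ifs with hc
        · obtain ⟨t, u, k, h1, -, -, h2, -⟩ := hD m hm hc
          intro L' hL
          refine ⟨t, _, absSet (σ (m + 1)), h1, ?_, hL⟩
          rw [h2]
          exact Upd.seqSpec (by rw [← h2]; exact hc)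
        · rw [← not_not.1 hc]
          exact seqTo_nil _ _
    have := hseq [] trivial
    rwa [List.append_nil, h0] at this

theorem absSet_init : absSet (initMem K) = ∅ := by
  refine Set.eq_empty_of_forall_notMem ?_
  rintro k ⟨x, hx, hk, -⟩
  rcases reach_init hx.reach with rfl | rfl
  · simp [initMem, blankNode, toKey] at hk
  · simp [initMem, minNode, maxNode, blankNode, toKey] at hk

end

end LOTree

theorem mainTheorem3 {K : Type*} [LinearOrder K] (st : ℕ → LOTree.Config K)
    (lab : ℕ → LOTree.Label K) (N : ℕ) (hrun : LOTree.IsRun st lab N)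
    (σ : ℕ → LOTree.Mem K) (hσ : ∀ i, σ i = (st i).shared.mem) :
    -- traversals over tree and predecessor links, with respect to plain reachability
    LOTree.TraversalsCorrect σ LOTree.TreePredExt LOTree.SReachLoc N ∧
    -- traversals over successor links, with respect to `k`-reachability
    (∀ k : K, LOTree.TraversalsCorrect σ (LOTree.SuccExt k) (LOTree.KReachLoc k) N) ∧
    -- `k`-reachability in the past together with the value of `rem`
    (∀ (k : K) (x : LOTree.Node) (t t' : ℕ), t ≤ t' → t' ≤ N → LOTree.KReach (σ t) k x →
      (σ t' x).key = LOTree.toKey k →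
      LOTree.Past σ t t' (fun s => LOTree.KReach s k x ∧ (s x).rem = (σ t' x).rem)) ∧
    -- the successor list is sorted
    (∀ (t : ℕ) (x y : LOTree.Node), t ≤ N → LOTree.SReach (σ t) x →
      (σ t x).ptr .succ = some y → (σ t x).key < (σ t y).key) ∧
    -- nodes are marked before they are unlinked
    (∀ (x : LOTree.Node) (t t' : ℕ), t ≤ t' → t' ≤ N → LOTree.SReach (σ t) x →
      (σ t' x).rem = false → LOTree.SReach (σ t') x) ∧
    -- the assertions in the code
    LOTree.AssertionsHold st lab N ∧
    -- linearizability
    LOTree.TakesEffect σ lab N ∧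
    LOTree.Linearizable lab N := by
  refine ⟨hrun.tree_traversals hσ, hrun.succ_traversals hσ,
    fun k x t t' htt ht hx hk => hrun.past_rem hσ htt ht hx hk, fun t x y ht hx hy => ?_,
    fun x t t' htt ht hx hr => ?_, hrun.assertionsHold, hrun.takesEffect hσ,
    (hrun.takesEffect hσ).linearizable ?_⟩
  · rw [hσ] at hx hy ⊢
    exact hrun.sorted ht x y (LOTree.sReach_iff_reach.1 hx) hy
  · rw [hσ] at hx hr ⊢
    exact LOTree.sReach_iff_reach.2
      (hrun.reach_of_not_rem htt ht (LOTree.sReach_iff_reach.1 hx) hr)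
  · rw [hσ, hrun.1]
    exact LOTree.absSet_init
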